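/- \textsc{MinPAC} is the following problem. Input: a strongly connected finite directed graph $G$ (without parallel arcs) with arc set $A(G)$, and weights $w\colon A(G)\to\mathbb{N}=\{0,1,2,\dots\}$. Task: find a strongly connected spanning subgraph $H$ of $G$ that minimizes $$\sum_{v\in V(G)}\ \max_{vu\in A(H)} w(vu),$$ where the maximum over the empty set is $0$. Let $n$ be the number of vertices of $G$, $m$ its number of arcs, $W$ its largest arc weight ($0$ if there are no arcs), and let the feedback edge number $g$ of $G$ be the minimum number of edges that have to be removed from the underlying undirected simple graph of $G$ (in which distinct $u,v$ are adjacent iff $uv\in A(G)$ or $vu\in A(G)$) in order to make it a forest. \textbf{Corollary.} \textsc{MinPAC} can be solved in $O(2^{O(g)}+n+m)$ time. That is, there are a single program for the random access machine and a constant $c$ such that, given any instance as $n$, $m$ and a list of the $m$ arcs in arbitrary order (each arc once, as tail, head and weight, with vertices named $0,\dots,n-1$), the program halts after at most $c\,(2^{c g}+n+m)$ steps and has marked in the list exactly the arcs of an optimal solution $H$. Here a random access machine has finitely many registers and a memory addressed by natural numbers; one step is loading a constant, copying a register, an addition or truncated subtraction of two registers, an indirect memory read or write, or a comparison of two registers,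 with structured control flow (sequencing, if, while). All numbers that occur during the run are at most $c\,(n+m+W+1)^c$, i.e. fit into words of $O(\log(n+m+W+2))$ bits. -/

import Mathlib

namespace MinPAC

/-! ### The optimization problem -/

/-- Every vertex reaches every vertex along a directed path. -/
def StronglyConnected {V : Type*} (G : Digraph V) : Prop :=
  ∀ u v : V, Relation.ReflTransGen G.Adj u v

open Classical in
/-- `∑ v, max {w v u | v u an arc of H}`; the maximum over the empty set is `0` (this matters only
for a graph on one vertex). -/
noncomputable def cost {V : Type*} [Fintype V] (H : Digraph V) (w : V → V → ℕ) : ℕ :=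
  ∑ v : V, (Finset.univ.filter fun u => H.Adj v u).sup fun u => w v u

/-- `H` is a solution of the instance `G`: a strongly connected spanning subgraph of `G`. -/
def IsSolution {V : Type*} (G H : Digraph V) : Prop :=
  H ≤ G ∧ StronglyConnected H

/-- `H` is a solution of minimum cost of the instance `(G, w)`. -/
def IsOptimalSolution {V : Type*} [Fintype V] (G : Digraph V) (w : V → V → ℕ)
    (H : Digraph V) : Prop :=
  IsSolution G H ∧ ∀ H' : Digraph V, IsSolution G H' → cost H w ≤ cost H' w

/-- The minimum number of edges whose removal turns an undirected graph into a forest. -/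
noncomputable def undirectedFeedbackEdgeNumber {V : Type*} (G : SimpleGraph V) : ℕ :=
  sInf {k | ∃ F : Finset (Sym2 V), (F : Set (Sym2 V)) ⊆ G.edgeSet ∧ F.card = k ∧
    (G.deleteEdges (F : Set (Sym2 V))).IsAcyclic}

/-- The feedback edge number of a digraph is that of its underlying undirected simple graph. -/
noncomputable def feedbackEdgeNumber {V : Type*} (G : Digraph V) : ℕ :=
  undirectedFeedbackEdgeNumber G.toSimpleGraphInclusive

/-! ### The machine model: a random access machine with words of bounded size

A program uses registers (named by fixed numbers) and a random access memory. The operations are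
loading a constant, copying, addition, truncated subtraction, and indirect reads and writes;
control flow is structured, with comparisons of two registers as tests. Each operation and
each evaluation of a test takes one step. -/

structure State where
  reg : ℕ → ℕ
  mem : ℕ → ℕ

inductive Instr where
  /-- `reg x := k` -/
  | const (x k : ℕ)
  /-- `reg x := reg y` -/
  | copy (x y : ℕ)
  /-- `reg x := reg y + reg z` -/
  | add (x y z : ℕ)
  /-- `reg x := max 0 (reg y - reg z)` -/
  | sub (x y z : ℕ)
  /-- `reg x := mem (reg y)` -/
  | load (x y : ℕ)
  /-- `mem (reg x) := reg y` -/
  | store (x y : ℕ)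

/-- The effect of one instruction. -/
def Instr.run : Instr → State → State
  | .const x k, s => { s with reg := Function.update s.reg x k }
  | .copy x y, s => { s with reg := Function.update s.reg x (s.reg y) }
  | .add x y z, s => { s with reg := Function.update s.reg x (s.reg y + s.reg z) }
  | .sub x y z, s => { s with reg := Function.update s.reg x (s.reg y - s.reg z) }
  | .load x y, s => { s with reg := Function.update s.reg x (s.mem (s.reg y)) }
  | .store x y, s => { s with mem := Function.update s.mem (s.reg x) (s.reg y) }

inductive Prog where
  | instr (i : Instr)
  | seq (p q : Prog)
  /-- if `reg x < reg y` then `p` else `q` -/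
  | ite (x y : ℕ) (p q : Prog)
  /-- while `reg x < reg y` do `p` -/
  | while (x y : ℕ) (p : Prog)

/-- All registers and memory cells hold numbers of size at most `B`. -/
def State.Fits (B : ℕ) (s : State) : Prop :=
  (∀ x, s.reg x ≤ B) ∧ ∀ a, s.mem a ≤ B

/-- `Exec B p s t s'`: started in state `s`, the program `p` halts in state `s'` after exactly `t`
steps, and no instruction of the run produces a number larger than `B`. -/
inductive Exec (B : ℕ) : Prog → State → ℕ → State → Prop where
  | instr (i : Instr) (s : State) (h : (i.run s).Fits B) : Exec B (.instr i) s 1 (i.run s)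
  | seq {p q : Prog} {s s' s'' : State} {t t' : ℕ} (h : Exec B p s t s')
      (h' : Exec B q s' t' s'') : Exec B (.seq p q) s (t + t') s''
  | ite_true {x y : ℕ} {p q : Prog} {s s' : State} {t : ℕ} (hlt : s.reg x < s.reg y)
      (h : Exec B p s t s') : Exec B (.ite x y p q) s (t + 1) s'
  | ite_false {x y : ℕ} {p q : Prog} {s s' : State} {t : ℕ} (hlt : ¬ s.reg x < s.reg y)
      (h : Exec B q s t s') : Exec B (.ite x y p q) s (t + 1) s'
  | while_true {x y : ℕ} {p : Prog} {s s' s'' : State} {t t' : ℕ} (hlt : s.reg x < s.reg y)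
      (h : Exec B p s t s') (h' : Exec B (.while x y p) s' t' s'') :
      Exec B (.while x y p) s (t + t' + 1) s''
  | while_false {x y : ℕ} {p : Prog} {s : State} (hlt : ¬ s.reg x < s.reg y) :
      Exec B (.while x y p) s 1 s

/-! ### Input and output -/

/-- `L` lists every arc of `G` exactly once. -/
def IsArcList {V : Type*} (G : Digraph V) (L : List (V × V)) : Prop :=
  L.Nodup ∧ ∀ a : V × V, a ∈ L ↔ G.Adj a.1 a.2

/-- The initial state: the memory holds the number of vertices, the number of arcs, and then
tail, head and weight of each arc; everything else is zero. -/
def inputState {n : ℕ} (w : Fin n → Fin n → ℕ) (L : List (Fin n × Fin n)) : State where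
  reg := fun _ => 0
  mem := fun a =>
    (n :: L.length :: L.flatMap fun e => [(e.1 : ℕ), (e.2 : ℕ), w e.1 e.2]).getD a 0

/-- The largest weight of a listed arc. -/
def maxWeight {n : ℕ} (w : Fin n → Fin n → ℕ) (L : List (Fin n × Fin n)) : ℕ :=
  L.toFinset.sup fun e => w e.1 e.2

/-- The subgraph returned in a final state: it consists of the `i`-th listed arcs such that memory
cell `i` holds `1`. -/
def outputGraph {n : ℕ} (L : List (Fin n × Fin n)) (s : State) : Digraph (Fin n) where
  Adj u v := ∃ i : ℕ, L[i]? = some (u, v) ∧ s.mem i = 1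

end MinPAC

namespace MinPAC

/-! ### A small language with arrays on top of the random access machine -/

/-! Root a spanning tree of `G` at vertex `0` by breadth-first search, so that every downward tree
arc exists. Loops are useless. The arcs that are neither loops nor run along tree edges are the
further arcs. Deleting a minimum feedback edge set leaves at most `n - 1` edges, so at most `g`
edges lie outside the tree and there are at most `2 g` further arcs (`card_nontree_le`).

A vertex is active if it is the root or its subtree contains an end of a further arc. It is a branch
vertex if it is the root, an end of a further arc, or has two active children. The inactive parts
hang on bridges, and every solution contains both arcs of a bridge (`Lay.Good.inactive`). The active
part decomposes into chains between branch vertices, one for each branch vertex other than the root,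
which is its lower end. Counting children gives at most four times as many chains as further arcs
(`Lay.Pre.card_br_le`).

If a strongly connected selection lacks both an upward and a downward arc of a chain, these belong
to the same edge and nothing else of the chain is missing: otherwise the segment between the two
edges could not be entered, or could not be left (`Lay.Good.missing_eq`). So six options per chain
suffice: upward arcs only (`0`), downward arcs only (`1`), both (`2`), or one edge broken in both
directions, namely the lowest (`3`), the highest (`4`) or one with two inner ends (`5`). In the last
case only the powers of the two ends change, so a best edge can be computed in advance for every
chain (`Lay.Good.ic_add_sav`). Strong connectivity is then decided on the branch vertices alone,
with the arcs given by unbroken chains and by the selected further arcs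
(`Lay.Good.strong_of_bstrong`, `Lay.Good.bstrong`). Altogether some choice of options is as good as
any given solution (`Lay.Good.exists_options`).

The program tries all choices. With chains and further arcs together there are at most `10 g` slots
of six values each. The cost of a choice is the sum of the powers of the branch vertices and of
tabulated chain costs, up to a constant (`Lay.Good.sum_pw`), so one choice takes time quadratic in
the number of slots. The search therefore takes `2 ^ O(g)` steps, and all preprocessing is linear.

A missing upward arc gets a weight above the total weight, so an optimum never uses it. The output
consists of all arcs that the optimal powers pay for: it contains the selected arcs and costs no
more (`Desc.isOptimal`).

The program is written in a small language with arrays that compiles to the machine with constant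
overhead (`Run.comp`); step bounds and correctness are proved together by the triples `Tr`. -/

/-- Expressions: constants, variables, sums, truncated differences and array reads. -/
inductive Ex where
  | lit (k : ℕ)
  | var (x : ℕ)
  | plus (a b : Ex)
  | minus (a b : Ex)
  | get (j : ℕ) (e : Ex)

/-- Commands. -/
inductive Cm where
  | skip
  | set (x : ℕ) (e : Ex)
  | put (j : ℕ) (i e : Ex)
  | seq (c d : Cm)
  | ite (a b : Ex) (c d : Cm)
  | while (a b : Ex) (c : Cm)

/-- The state: variables and arrays. Array `0` is the low part of the memory. -/
structure St where
  v : ℕ → ℕ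
  a : ℕ → ℕ → ℕ

def St.set (s : St) (x k : ℕ) : St := ⟨Function.update s.v x k, s.a⟩

def St.put (s : St) (j i k : ℕ) : St :=
  ⟨s.v, Function.update s.a j (Function.update (s.a j) i k)⟩

@[simp] theorem St.set_v (s : St) (x k y : ℕ) : (s.set x k).v y = if y = x then k else s.v y := by
  simp [St.set, Function.update_apply]

@[simp] theorem St.set_a (s : St) (x k j : ℕ) : (s.set x k).a j = s.a j := rfl

@[simp] theorem St.put_v (s : St) (j i k y : ℕ) : (s.put j i k).v y = s.v y := rfl

@[simp] theorem St.put_a (s : St) (j i k l : ℕ) :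
    (s.put j i k).a l = if l = j then Function.update (s.a j) i k else s.a l := by
  by_cases h : l = j
  · subst h; simp [St.put]
  · simp [St.put, h]

@[simp] def Ex.eval : Ex → St → ℕ
  | .lit k, _ => k
  | .var x, s => s.v x
  | .plus a b, s => a.eval s + b.eval s
  | .minus a b, s => a.eval s - b.eval s
  | .get j e, s => s.a j (e.eval s)

/-- No number above `B` occurs, and the low part of the memory is accessed below `b`. -/
@[simp] def Ex.ok (B b : ℕ) : Ex → St → Prop
  | .lit k, _ => k ≤ B
  | .var _, _ => True
  | .plus x y, s => x.ok B b s ∧ y.ok B b s ∧ x.eval s + y.eval s ≤ B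
  | .minus x y, s => x.ok B b s ∧ y.ok B b s
  | .get j e, s => e.ok B b s ∧ (j = 0 → e.eval s < b)

/-- An elementary command or a test counts as one step whatever the size of its expressions; `Cm.wt`
pays for the difference to machine steps. -/
inductive Run (B b : ℕ) : Cm → St → ℕ → St → Prop where
  | skip (s : St) : Run B b .skip s 1 s
  | set (x : ℕ) (e : Ex) (s : St) (h : e.ok B b s) : Run B b (.set x e) s 1 (s.set x (e.eval s))
  | put (j : ℕ) (i e : Ex) (s : St) (hi : i.ok B b s) (he : e.ok B b s)
      (hj : j = 0 → i.eval s < b) : Run B b (.put j i e) s 1 (s.put j (i.eval s) (e.eval s))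
  | seq {c d : Cm} {s s' s'' : St} {t t' : ℕ} (h : Run B b c s t s') (h' : Run B b d s' t' s'') :
      Run B b (.seq c d) s (t + t') s''
  | ite_true {x y : Ex} {c d : Cm} {s s' : St} {t : ℕ} (hx : x.ok B b s) (hy : y.ok B b s)
      (hlt : x.eval s < y.eval s) (h : Run B b c s t s') : Run B b (.ite x y c d) s (t + 1) s'
  | ite_false {x y : Ex} {c d : Cm} {s s' : St} {t : ℕ} (hx : x.ok B b s) (hy : y.ok B b s)
      (hlt : ¬ x.eval s < y.eval s) (h : Run B b d s t s') : Run B b (.ite x y c d) s (t + 1) s'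
  | while_true {x y : Ex} {c : Cm} {s s' s'' : St} {t t' : ℕ} (hx : x.ok B b s) (hy : y.ok B b s)
      (hlt : x.eval s < y.eval s) (h : Run B b c s t s') (h' : Run B b (.while x y c) s' t' s'') :
      Run B b (.while x y c) s (t + t' + 1) s''
  | while_false {x y : Ex} {c : Cm} {s : St} (hx : x.ok B b s) (hy : y.ok B b s)
      (hlt : ¬ x.eval s < y.eval s) : Run B b (.while x y c) s 1 s

/-- The number of arrays. -/
abbrev stride : ℕ := 64

@[simp] def Ex.wf : Ex → Bool
  | .lit _ => true
  | .var _ => true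
  | .plus a b => a.wf && b.wf
  | .minus a b => a.wf && b.wf
  | .get j e => decide (j < stride) && e.wf

@[simp] def Cm.wf : Cm → Bool
  | .skip => true
  | .set _ e => e.wf
  | .put j i e => decide (j < stride) && (i.wf && e.wf)
  | .seq c d => c.wf && d.wf
  | .ite a b c d => a.wf && (b.wf && (c.wf && d.wf))
  | .while a b c => a.wf && (b.wf && c.wf)

/-! ### Compilation -/

/-- Turns the array index in register `2 * d` into an address. -/
def compAddr (d j : ℕ) : Prog :=
  if j = 0 then .instr (.const (2 * d + 2) 0) else
    .seq (.instr (.add (2 * d) (2 * d) (2 * d))) <| .seq (.instr (.add (2 * d) (2 * d) (2 * d))) <|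
    .seq (.instr (.add (2 * d) (2 * d) (2 * d))) <| .seq (.instr (.add (2 * d) (2 * d) (2 * d))) <|
    .seq (.instr (.add (2 * d) (2 * d) (2 * d))) <| .seq (.instr (.add (2 * d) (2 * d) (2 * d))) <|
    .seq (.instr (.const (2 * d + 2) j)) <| .seq (.instr (.add (2 * d) (2 * d) (2 * d + 2))) <|
    .instr (.add (2 * d) (2 * d) 0)

/-- Evaluates an expression into register `2 * d`. -/
def Ex.comp (d : ℕ) : Ex → Prog
  | .lit k => .instr (.const (2 * d) k)
  | .var x => .instr (.copy (2 * d) (2 * x + 1))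
  | .plus a b => .seq (a.comp d) (.seq (b.comp (d + 1)) (.instr (.add (2 * d) (2 * d) (2 * d + 2))))
  | .minus a b => .seq (a.comp d) (.seq (b.comp (d + 1)) (.instr (.sub (2 * d) (2 * d) (2 * d + 2))))
  | .get j e => .seq (e.comp d) (.seq (compAddr d j) (.instr (.load (2 * d) (2 * d))))

/-- Register `0` keeps the base address, the odd register `2 * x + 1` holds variable `x`, and the
even registers from `2` on serve as evaluation stack. A loop evaluates its test once before it
starts and again at the end of each round. -/
def Cm.comp : Cm → Prog
  | .skip => .instr (.const 2 0)
  | .set x e => .seq (e.comp 1) (.instr (.copy (2 * x + 1) 2))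
  | .put j i e => .seq (i.comp 1) (.seq (compAddr 1 j) (.seq (e.comp 2) (.instr (.store 2 4))))
  | .seq c d => .seq c.comp d.comp
  | .ite a b c d => .seq (.seq (a.comp 1) (b.comp 2)) (.ite 2 4 c.comp d.comp)
  | .while a b c => .seq (.seq (a.comp 1) (b.comp 2))
      (.while 2 4 (.seq c.comp (.seq (a.comp 1) (b.comp 2))))

def Ex.wt : Ex → ℕ
  | .lit _ => 1
  | .var _ => 1
  | .plus a b => a.wt + b.wt + 1
  | .minus a b => a.wt + b.wt + 1
  | .get _ e => e.wt + 10

def Cm.wt : Cm → ℕ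
  | .skip => 1
  | .set _ e => e.wt + 1
  | .put _ i e => i.wt + e.wt + 10
  | .seq c d => c.wt + d.wt
  | .ite a b c d => a.wt + b.wt + c.wt + d.wt + 1
  | .while a b c => a.wt + b.wt + c.wt + 1

/-- The address of entry `i` of array `j`. -/
def addr (b j i : ℕ) : ℕ := if j = 0 then i else b + stride * i + j

/-- Array `0` lives below `b`; beyond `b` the arrays are interleaved, and the distance from `b`
modulo `stride` tells the array. -/
theorem addr_inj {b j i j' i' : ℕ} (hj : j < stride) (hj' : j' < stride) (h : j = 0 → i < b)
    (h' : j' = 0 → i' < b) (he : addr b j i = addr b j' i') : j = j' ∧ i = i' := by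
  unfold addr stride at *
  split_ifs at he <;> simp_all <;> omega

/-- The machine state `σ` represents `s`. -/
structure Rep (B b : ℕ) (s : St) (σ : State) : Prop where
  base : σ.reg 0 = b
  var : ∀ x, σ.reg (2 * x + 1) = s.v x
  arr : ∀ j i, j < stride → (j = 0 → i < b) → σ.mem (addr b j i) = s.a j i
  fits : σ.Fits (b + stride * B + stride)

def St.Fits (B : ℕ) (s : St) : Prop := (∀ x, s.v x ≤ B) ∧ ∀ j i, s.a j i ≤ B

/-- `σ'` arises from `σ` by changing scratch registers only. -/
def Scratch (d : ℕ) (σ σ' : State) : Prop :=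
  σ'.mem = σ.mem ∧ (∀ r, r < 2 * d → σ'.reg r = σ.reg r) ∧ ∀ x, σ'.reg (2 * x + 1) = σ.reg (2 * x + 1)

theorem Scratch.mono {d e : ℕ} {σ σ' : State} (h : Scratch e σ σ') (hde : d ≤ e) :
    Scratch d σ σ' := ⟨h.1, fun r hr => h.2.1 r (by omega), h.2.2⟩

theorem Scratch.trans {d : ℕ} {σ σ' σ'' : State} (h : Scratch d σ σ') (h' : Scratch d σ' σ'') :
    Scratch d σ σ'' :=
  ⟨h'.1.trans h.1, fun r hr => (h'.2.1 r hr).trans (h.2.1 r hr), fun x => (h'.2.2 x).trans (h.2.2 x)⟩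

theorem Scratch.rep {B b d : ℕ} {s : St} {σ σ' : State} (h : Scratch d σ σ') (hd : 1 ≤ d)
    (hr : Rep B b s σ) (hf : σ'.Fits (b + stride * B + stride)) : Rep B b s σ' :=
  ⟨(h.2.1 0 (by omega)).trans hr.base, fun x => (h.2.2 x).trans (hr.var x),
    fun j i hj hi => by rw [h.1]; exact hr.arr j i hj hi, hf⟩

theorem fits_update_reg {N : ℕ} {σ : State} (h : σ.Fits N) (x k : ℕ) (hk : k ≤ N) :
    State.Fits N { σ with reg := Function.update σ.reg x k } :=
  ⟨fun y => by
    by_cases hy : y = x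
    · subst hy; simpa using hk
    · simpa [Function.update_apply, hy] using h.1 y, h.2⟩

/-- One instruction that writes `k` to the scratch register `2 * d`. -/
theorem Scratch.update (d e : ℕ) (σ : State) (k : ℕ) (h : d ≤ e) :
    Scratch d σ { σ with reg := Function.update σ.reg (2 * e) k } :=
  ⟨rfl, fun r hr => Function.update_of_ne (by omega) _ _,
    fun x => Function.update_of_ne (by omega) _ _⟩

theorem exec_const {N : ℕ} {σ : State} (h : σ.Fits N) (x k : ℕ) (hk : k ≤ N) :
    Exec N (.instr (.const x k)) σ 1 { σ with reg := Function.update σ.reg x k } :=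
  Exec.instr (.const x k) σ (fits_update_reg h x k hk)

theorem exec_add {N : ℕ} {σ : State} (h : σ.Fits N) (x y z : ℕ) (hk : σ.reg y + σ.reg z ≤ N) :
    Exec N (.instr (.add x y z)) σ 1
      { σ with reg := Function.update σ.reg x (σ.reg y + σ.reg z) } :=
  Exec.instr (.add x y z) σ (fits_update_reg h x _ hk)

theorem exec_dbl {N d v : ℕ} {σ : State} (h : σ.Fits N) (hv : σ.reg (2 * d) = v)
    (hk : v + v ≤ N) : ∃ σ', Exec N (.instr (.add (2 * d) (2 * d) (2 * d))) σ 1 σ' ∧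
      Scratch d σ σ' ∧ σ'.reg (2 * d) = v + v ∧ σ'.Fits N :=
  ⟨_, exec_add h _ _ _ (by omega), Scratch.update d d σ _ le_rfl, by simp [hv],
    fits_update_reg h _ _ (by omega)⟩

theorem compAddr_spec {B b d j i : ℕ} {σ : State} (hd : 1 ≤ d) (hj : j < stride) (hi : i ≤ B)
    (hf : σ.Fits (b + stride * B + stride)) (h0 : σ.reg 0 = b) (hr : σ.reg (2 * d) = i) :
    ∃ t σ', Exec (b + stride * B + stride) (compAddr d j) σ t σ' ∧ t ≤ 9 ∧ Scratch d σ σ' ∧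
      σ'.reg (2 * d) = addr b j i ∧ σ'.Fits (b + stride * B + stride) := by
  unfold compAddr addr
  split_ifs with hj0
  · exact ⟨_, _, exec_const hf _ _ (by omega), by omega, Scratch.update d (d + 1) σ _ (by omega),
      by simp [hr], fits_update_reg hf _ _ (by omega)⟩
  · unfold stride at *
    -- Six doublings multiply the index by `stride = 64`.
    obtain ⟨σ1, e1, c1, r1, f1⟩ := exec_dbl (d := d) hf hr (by omega)
    obtain ⟨σ2, e2, c2, r2, f2⟩ := exec_dbl f1 r1 (by omega)
    obtain ⟨σ3, e3, c3, r3, f3⟩ := exec_dbl f2 r2 (by omega)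
    obtain ⟨σ4, e4, c4, r4, f4⟩ := exec_dbl f3 r3 (by omega)
    obtain ⟨σ5, e5, c5, r5, f5⟩ := exec_dbl f4 r4 (by omega)
    obtain ⟨σ6, e6, c6, r6, f6⟩ := exec_dbl f5 r5 (by omega)
    have e7 := exec_const f6 (2 * d + 2) j (by omega)
    have f7 := fits_update_reg f6 (2 * d + 2) j (by omega)
    have c7 : Scratch d σ6 _ := Scratch.update d (d + 1) σ6 j (by omega)
    have cc := ((((((c1.trans c2).trans c3).trans c4).trans c5).trans c6).trans c7)
    generalize hσ7 : ({ σ6 with reg := Function.update σ6.reg (2 * d + 2) j } : State) = σ7 at *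
    have q1 : σ7.reg (2 * d) = 64 * i := by
      subst hσ7; simp only; rw [Function.update_of_ne (by omega), r6]; omega
    have q2 : σ7.reg (2 * d + 2) = j := by subst hσ7; simp
    have e8 := exec_add f7 (2 * d) (2 * d) (2 * d + 2) (by omega)
    have f8 := fits_update_reg f7 (2 * d) (σ7.reg (2 * d) + σ7.reg (2 * d + 2)) (by omega)
    have c8 := Scratch.update d d σ7 (σ7.reg (2 * d) + σ7.reg (2 * d + 2)) le_rfl
    generalize hσ8 : ({ σ7 with reg := Function.update σ7.reg (2 * d) (σ7.reg (2 * d) + σ7.reg (2 * d + 2)) } : State) = σ8 at *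
    have q3 : σ8.reg (2 * d) = 64 * i + j := by subst hσ8; simp [q1, q2]
    have cc' := cc.trans c8
    have q4 : σ8.reg 0 = b := by rw [cc'.2.1 0 (by omega), h0]
    have e9 := exec_add f8 (2 * d) (2 * d) 0 (by omega)
    refine ⟨_, _, .seq e1 (.seq e2 (.seq e3 (.seq e4 (.seq e5 (.seq e6 (.seq e7 (.seq e8 e9)))))))
      , by omega, cc'.trans (Scratch.update d d σ8 _ le_rfl), ?_, fits_update_reg f8 _ _ (by omega)⟩
    simp [q3, q4]; omega

theorem Ex.eval_le {B b : ℕ} {s : St} (hs : s.Fits B) : ∀ e : Ex, e.ok B b s → e.eval s ≤ B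
  | .lit _, h => h
  | .var x, _ => hs.1 x
  | .plus _ _, h => h.2.2
  | .minus x _, h => (Nat.sub_le _ _).trans (Ex.eval_le hs x h.1)
  | .get j _, _ => hs.2 j _

theorem Ex.comp_spec {B b : ℕ} {s : St} (hs : s.Fits B) : ∀ (e : Ex) (d : ℕ) (σ : State), 1 ≤ d →
    e.wf = true → e.ok B b s → Rep B b s σ →
    ∃ t σ', Exec (b + stride * B + stride) (e.comp d) σ t σ' ∧ t ≤ e.wt ∧ Scratch d σ σ' ∧
      σ'.reg (2 * d) = e.eval s ∧ Rep B b s σ' := by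
  intro e
  induction e with
  | lit k =>
    intro d σ hd _ hok hr
    have hk : k ≤ B := hok
    have hN : k ≤ b + stride * B + stride := by unfold stride; omega
    have hc := Scratch.update d d σ k le_rfl
    exact ⟨1, _, exec_const hr.fits _ _ hN, le_rfl, hc, by simp,
      hc.rep hd hr (fits_update_reg hr.fits _ _ hN)⟩
  | var x =>
    intro d σ hd _ hok hr
    have hN : σ.reg (2 * x + 1) ≤ b + stride * B + stride := hr.fits.1 _
    have hc := Scratch.update d d σ (σ.reg (2 * x + 1)) le_rfl
    exact ⟨1, _, Exec.instr (.copy (2 * d) (2 * x + 1)) σ (fits_update_reg hr.fits _ _ hN), le_rfl,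
      hc, by simp [Instr.run, hr.var], hc.rep hd hr (fits_update_reg hr.fits _ _ hN)⟩
  | plus x y ihx ihy =>
    intro d σ hd hw hok hr
    simp only [Ex.wf, Bool.and_eq_true] at hw
    obtain ⟨t1, σ1, e1, l1, c1, v1, r1⟩ := ihx d σ hd hw.1 hok.1 hr
    obtain ⟨t2, σ2, e2, l2, c2, v2, r2⟩ := ihy (d + 1) σ1 (by omega) hw.2 hok.2.1 r1
    have hle : x.eval s + y.eval s ≤ B := hok.2.2
    have hx : σ2.reg (2 * d) = x.eval s := by rw [c2.2.1 _ (by omega), v1]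
    have hy : σ2.reg (2 * d + 2) = y.eval s := v2
    have hN : σ2.reg (2 * d) + σ2.reg (2 * d + 2) ≤ b + stride * B + stride := by
      unfold stride; omega
    have hc := Scratch.update d d σ2 (σ2.reg (2 * d) + σ2.reg (2 * d + 2)) le_rfl
    exact ⟨_, _, .seq e1 (.seq e2 (exec_add r2.fits _ _ _ hN)), by simp only [Ex.wt]; omega,
      (c1.trans (c2.mono (by omega))).trans hc, by simp [hx, hy],
      hc.rep hd r2 (fits_update_reg r2.fits _ _ hN)⟩
  | minus x y ihx ihy =>
    intro d σ hd hw hok hr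
    simp only [Ex.wf, Bool.and_eq_true] at hw
    obtain ⟨t1, σ1, e1, l1, c1, v1, r1⟩ := ihx d σ hd hw.1 hok.1 hr
    obtain ⟨t2, σ2, e2, l2, c2, v2, r2⟩ := ihy (d + 1) σ1 (by omega) hw.2 hok.2 r1
    have hx : σ2.reg (2 * d) = x.eval s := by rw [c2.2.1 _ (by omega), v1]
    have hy : σ2.reg (2 * d + 2) = y.eval s := v2
    have hN : σ2.reg (2 * d) - σ2.reg (2 * d + 2) ≤ b + stride * B + stride :=
      (Nat.sub_le _ _).trans (r2.fits.1 _)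
    have hc := Scratch.update d d σ2 (σ2.reg (2 * d) - σ2.reg (2 * d + 2)) le_rfl
    exact ⟨_, _, .seq e1 (.seq e2 (Exec.instr (.sub (2 * d) (2 * d) (2 * d + 2)) σ2
        (fits_update_reg r2.fits _ _ hN))), by simp only [Ex.wt]; omega,
      (c1.trans (c2.mono (by omega))).trans hc, by simp [Instr.run, hx, hy],
      hc.rep hd r2 (fits_update_reg r2.fits _ _ hN)⟩
  | get j e ih =>
    intro d σ hd hw hok hr
    simp only [Ex.wf, Bool.and_eq_true, decide_eq_true_eq] at hw
    obtain ⟨t1, σ1, e1, l1, c1, v1, r1⟩ := ih d σ hd hw.2 hok.1 hr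
    obtain ⟨t2, σ2, e2, l2, c2, v2, f2⟩ :=
      compAddr_spec hd hw.1 (Ex.eval_le hs e hok.1) r1.fits r1.base v1
    have r2 := c2.rep hd r1 f2
    have hv : σ2.mem (σ2.reg (2 * d)) = s.a j (e.eval s) := by
      rw [v2]; exact r2.arr _ _ hw.1 hok.2
    have hN := r2.fits.2 (σ2.reg (2 * d))
    have hc := Scratch.update d d σ2 (σ2.mem (σ2.reg (2 * d))) le_rfl
    exact ⟨_, _, .seq e1 (.seq e2 (Exec.instr (.load (2 * d) (2 * d)) σ2
        (fits_update_reg r2.fits _ _ hN))), by simp only [Ex.wt]; omega,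
      (c1.trans c2).trans hc, by simp [Instr.run, hv], hc.rep hd r2 (fits_update_reg r2.fits _ _ hN)⟩

/-- The code that evaluates the two sides of a comparison. -/
theorem test_spec {B b : ℕ} {s : St} (hs : s.Fits B) {x y : Ex} (hx : x.ok B b s)
    (hy : y.ok B b s) (wx : x.wf = true) (wy : y.wf = true) {σ : State} (hr : Rep B b s σ) :
    ∃ t σ', Exec (b + stride * B + stride) (.seq (x.comp 1) (y.comp 2)) σ t σ' ∧
      t ≤ x.wt + y.wt ∧ σ'.reg 2 = x.eval s ∧ σ'.reg 4 = y.eval s ∧ Rep B b s σ' := by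
  obtain ⟨t1, σ1, e1, l1, c1, v1, r1⟩ := x.comp_spec hs 1 σ le_rfl wx hx hr
  obtain ⟨t2, σ2, e2, l2, c2, v2, r2⟩ := y.comp_spec hs 2 σ1 (by omega) wy hy r1
  exact ⟨_, _, .seq e1 e2, by omega, (c2.2.1 2 (by omega)).trans v1, v2, r2⟩

theorem St.Fits.set {B : ℕ} {s : St} (hs : s.Fits B) (x k : ℕ) (hk : k ≤ B) :
    (s.set x k).Fits B := by
  refine ⟨fun y => ?_, hs.2⟩
  rw [St.set_v]; split_ifs
  exacts [hk, hs.1 y]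

theorem St.Fits.put {B : ℕ} {s : St} (hs : s.Fits B) (j i k : ℕ) (hk : k ≤ B) :
    (s.put j i k).Fits B := by
  refine ⟨hs.1, fun l y => ?_⟩
  rw [St.put_a]; split_ifs
  · rw [Function.update_apply]; split_ifs
    exacts [hk, hs.2 _ _]
  · exact hs.2 _ _

theorem Run.fits {B b : ℕ} {c : Cm} {s s' : St} {t : ℕ} (h : Run B b c s t s') (hs : s.Fits B) :
    s'.Fits B := by
  induction h with
  | skip => exact hs
  | set x e s h => exact hs.set _ _ (e.eval_le hs h)
  | put j i e s hi he hj => exact hs.put _ _ _ (e.eval_le hs he)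
  | seq _ _ ih ih' => exact ih' (ih hs)
  | ite_true _ _ _ _ ih => exact ih hs
  | ite_false _ _ _ _ ih => exact ih hs
  | while_true _ _ _ _ _ ih ih' => exact ih' (ih hs)
  | while_false => exact hs

/-- The weight `c.wt` counts the whole text of `c`, hence bounds the machine cost of each single
step of its run; loops need no larger factor, because the steps themselves are counted in `t`. -/
theorem Run.comp {B b : ℕ} {c : Cm} {s s' : St} {t : ℕ} (h : Run B b c s t s') :
    s.Fits B → c.wf = true → ∀ σ, Rep B b s σ →
    ∃ t' σ', Exec (b + stride * B + stride) c.comp σ t' σ' ∧ t' ≤ c.wt * t ∧ Rep B b s' σ' := by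
  induction h with
  | skip s =>
    intro hs _ σ hr
    have hc := Scratch.update 1 1 σ 0 le_rfl
    exact ⟨_, _, exec_const hr.fits 2 0 (Nat.zero_le _), by simp [Cm.wt],
      hc.rep le_rfl hr (fits_update_reg hr.fits _ _ (Nat.zero_le _))⟩
  | set x e s h =>
    intro hs hw σ hr
    obtain ⟨t1, σ1, e1, l1, c1, v1, r1⟩ := e.comp_spec hs 1 σ le_rfl hw h hr
    have v1' : σ1.reg 2 = e.eval s := v1
    have f := fits_update_reg r1.fits (2 * x + 1) (σ1.reg 2) (r1.fits.1 _)
    refine ⟨_, _, .seq e1 (Exec.instr (.copy (2 * x + 1) 2) σ1 f), ?_, ?_, fun y => ?_, r1.arr, f⟩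
    · simp only [Cm.wt]; omega
    · have h0 : (0 : ℕ) ≠ 2 * x + 1 := by omega
      simpa [Instr.run, h0] using r1.base
    · simp only [Instr.run, St.set_v, Function.update_apply, v1', r1.var]
      by_cases hy : y = x <;> simp [hy]
  | put j i e s hi he hj =>
    intro hs hw σ hr
    simp only [Cm.wf, Bool.and_eq_true, decide_eq_true_eq] at hw
    obtain ⟨t1, σ1, e1, l1, c1, v1, r1⟩ := i.comp_spec hs 1 σ le_rfl hw.2.1 hi hr
    obtain ⟨t2, σ2, e2, l2, c2, v2, f2⟩ :=
      compAddr_spec le_rfl hw.1 (Ex.eval_le hs i hi) r1.fits r1.base v1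
    have r2 := c2.rep le_rfl r1 f2
    obtain ⟨t3, σ3, e3, l3, c3, v3, r3⟩ := e.comp_spec hs 2 σ2 (by omega) hw.2.2 he r2
    have w1 : σ3.reg 2 = addr b j (i.eval s) := (c3.2.1 2 (by omega)).trans v2
    have w2 : σ3.reg 4 = e.eval s := v3
    have f : State.Fits (b + stride * B + stride)
        { σ3 with mem := Function.update σ3.mem (σ3.reg 2) (σ3.reg 4) } := by
      refine ⟨r3.fits.1, fun y => ?_⟩
      simp only [Function.update_apply]
      split_ifs
      exacts [r3.fits.1 _, r3.fits.2 _]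
    refine ⟨_, _, .seq e1 (.seq e2 (.seq e3 (Exec.instr (.store 2 4) σ3 f))),
      by simp only [Cm.wt]; omega, r3.base, r3.var, fun j' i' hj' hi' => ?_, f⟩
    simp only [Instr.run, w1, w2, St.put_a, Function.update_apply]
    by_cases hc : addr b j' i' = addr b j (i.eval s)
    · obtain ⟨rfl, rfl⟩ := addr_inj hj' hw.1 hi' hj hc
      simp
    · rw [if_neg hc, r3.arr j' i' hj' hi']
      by_cases hjj : j' = j
      · subst hjj
        have : i' ≠ i.eval s := by rintro rfl; exact hc rfl
        simp [this]
      · simp [hjj]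
  | @seq c d s s' s'' t t' h h' ih ih' =>
    intro hs hw σ hr
    simp only [Cm.wf, Bool.and_eq_true] at hw
    obtain ⟨t1, σ1, e1, l1, r1⟩ := ih hs hw.1 σ hr
    obtain ⟨t2, σ2, e2, l2, r2⟩ := ih' (h.fits hs) hw.2 σ1 r1
    exact ⟨_, _, .seq e1 e2, by simp only [Cm.wt]; nlinarith, r2⟩
  | @ite_true x y c d s s' t hx hy hlt h ih =>
    intro hs hw σ hr
    simp only [Cm.wf, Bool.and_eq_true] at hw
    obtain ⟨t1, σ1, e1, l1, v1, v2, r1⟩ := test_spec hs hx hy hw.1 hw.2.1 hr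
    obtain ⟨t2, σ2, e2, l2, r2⟩ := ih hs hw.2.2.1 σ1 r1
    refine ⟨_, _, .seq e1 (.ite_true (by rwa [v1, v2]) e2), ?_, r2⟩
    simp only [Cm.wt]; nlinarith
  | @ite_false x y c d s s' t hx hy hlt h ih =>
    intro hs hw σ hr
    simp only [Cm.wf, Bool.and_eq_true] at hw
    obtain ⟨t1, σ1, e1, l1, v1, v2, r1⟩ := test_spec hs hx hy hw.1 hw.2.1 hr
    obtain ⟨t2, σ2, e2, l2, r2⟩ := ih hs hw.2.2.2 σ1 r1
    refine ⟨_, _, .seq e1 (.ite_false (by rwa [v1, v2]) e2), ?_, r2⟩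
    simp only [Cm.wt]; nlinarith
  | @while_true x y c s s' s'' t t' hx hy hlt h h' ih ih' =>
    intro hs hw σ hr
    have hw' := hw
    simp only [Cm.wf, Bool.and_eq_true] at hw
    obtain ⟨t1, σ1, e1, l1, v1, v2, r1⟩ := test_spec hs hx hy hw.1 hw.2.1 hr
    obtain ⟨t2, σ2, e2, l2, r2⟩ := ih hs hw.2.2 σ1 r1
    obtain ⟨t3, σ3, e3, l3, r3⟩ := ih' (h.fits hs) hw' σ2 r2
    -- The induction hypothesis starts the remaining rounds with an evaluation of the test; in the
    -- compiled loop this evaluation is the end of the current round.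
    cases e3 with
    | @seq _ _ _ σ4 _ t4 t5 e4 e5 =>
      refine ⟨_, _, .seq e1 (.while_true (by rwa [v1, v2]) (.seq e2 e4) e5), ?_, r3⟩
      simp only [Cm.wt] at *; nlinarith
  | @while_false x y c s hx hy hlt =>
    intro hs hw σ hr
    simp only [Cm.wf, Bool.and_eq_true] at hw
    obtain ⟨t1, σ1, e1, l1, v1, v2, r1⟩ := test_spec hs hx hy hw.1 hw.2.1 hr
    exact ⟨_, _, .seq e1 (.while_false (by rwa [v1, v2])), by simp only [Cm.wt]; omega, r1⟩

/-! ### Reasoning about commands -/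

/-- Does the command write to variable `x`? -/
def Cm.wv : Cm → ℕ → Bool
  | .skip, _ => false
  | .set y _, x => Nat.beq x y
  | .put _ _ _, _ => false
  | .seq c d, x => c.wv x || d.wv x
  | .ite _ _ c d, x => c.wv x || d.wv x
  | .while _ _ c, x => c.wv x

/-- Does the command write to array `j`? -/
def Cm.wa : Cm → ℕ → Bool
  | .skip, _ => false
  | .set _ _, _ => false
  | .put l _ _, j => Nat.beq j l
  | .seq c d, j => c.wa j || d.wa j
  | .ite _ _ c d, j => c.wa j || d.wa j
  | .while _ _ c, j => c.wa j

/-- `s'` differs from `s` only where `c` writes, and it holds no number above `B` if `s` does not. -/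
structure Frame (B : ℕ) (c : Cm) (s s' : St) : Prop where
  vars : ∀ x, c.wv x = false → s'.v x = s.v x
  arrs : ∀ j, c.wa j = false → s'.a j = s.a j
  fits : s.Fits B → s'.Fits B

variable {B : ℕ}

theorem Frame.refl (c : Cm) (s : St) : Frame B c s s := ⟨fun _ _ => rfl, fun _ _ => rfl, id⟩

theorem Frame.trans {c : Cm} {s s' s'' : St} (h : Frame B c s s') (h' : Frame B c s' s'') :
    Frame B c s s'' :=
  ⟨fun x hx => (h'.1 x hx).trans (h.1 x hx), fun j hj => (h'.2 j hj).trans (h.2 j hj),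
    fun hs => h'.3 (h.3 hs)⟩

theorem Frame.of_le {c d : Cm} {s s' : St} (h : Frame B c s s')
    (hv : ∀ x, d.wv x = false → c.wv x = false) (ha : ∀ j, d.wa j = false → c.wa j = false) :
    Frame B d s s' :=
  ⟨fun x hx => h.1 x (hv x hx), fun j hj => h.2 j (ha j hj), h.3⟩

theorem Run.frame {b : ℕ} {c : Cm} {s s' : St} {t : ℕ} (h : Run B b c s t s') :
    Frame B c s s' := by
  induction h with
  | skip => exact Frame.refl _ _
  | set x e s h =>
    refine ⟨fun y hy => ?_, fun _ _ => rfl, (Run.set (b := b) x e s h).fits⟩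
    have : y ≠ x := by rintro rfl; simp [Cm.wv] at hy
    simp [this]
  | put j i e s hi he hj =>
    refine ⟨fun _ _ => rfl, fun l hl => ?_, (Run.put j i e s hi he hj).fits⟩
    have : l ≠ j := by rintro rfl; simp [Cm.wa] at hl
    simp [this]
  | seq _ _ ih ih' =>
    exact (ih.of_le (by simp +contextual [Cm.wv]) (by simp +contextual [Cm.wa])).trans
      (ih'.of_le (by simp +contextual [Cm.wv]) (by simp +contextual [Cm.wa]))
  | ite_true _ _ _ _ ih => exact ih.of_le (by simp +contextual [Cm.wv]) (by simp +contextual [Cm.wa])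
  | ite_false _ _ _ _ ih => exact ih.of_le (by simp +contextual [Cm.wv]) (by simp +contextual [Cm.wa])
  | while_true _ _ _ _ _ ih ih' =>
    exact (ih.of_le (by simp [Cm.wv]) (by simp [Cm.wa])).trans ih'
  | while_false => exact Frame.refl _ _

/-- From `s`, the command halts within `T` steps in a state that satisfies `Q`. -/
def Tr (B b : ℕ) (c : Cm) (s : St) (T : ℕ) (Q : St → Prop) : Prop :=
  ∃ t s', Run B b c s t s' ∧ t ≤ T ∧ Q s'

theorem Tr.mono {B b : ℕ} {c : Cm} {s : St} {T T' : ℕ} {Q Q' : St → Prop} (h : Tr B b c s T Q)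
    (hT : T ≤ T') (hQ : ∀ s', Frame B c s s' → Q s' → Q' s') : Tr B b c s T' Q' :=
  let ⟨t, s', hr, ht, hq⟩ := h
  ⟨t, s', hr, ht.trans hT, hQ s' hr.frame hq⟩

theorem Tr.seq {B b : ℕ} {c d : Cm} {s : St} {T T' : ℕ} {Q Q' : St → Prop} (h : Tr B b c s T Q)
    (h' : ∀ s', Frame B c s s' → Q s' → Tr B b d s' T' Q') : Tr B b (.seq c d) s (T + T') Q' := by
  obtain ⟨t, s', hr, ht, hq⟩ := h
  obtain ⟨t', s'', hr', ht', hq'⟩ := h' s' hr.frame hq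
  exact ⟨_, _, .seq hr hr', by omega, hq'⟩

theorem Tr.ite {B b : ℕ} {x y : Ex} {c d : Cm} {s : St} {T : ℕ} {Q : St → Prop}
    (hx : x.ok B b s) (hy : y.ok B b s) (h : x.eval s < y.eval s → Tr B b c s T Q)
    (h' : ¬ x.eval s < y.eval s → Tr B b d s T Q) : Tr B b (.ite x y c d) s (T + 1) Q := by
  by_cases hlt : x.eval s < y.eval s
  · obtain ⟨t, s', hr, ht, hq⟩ := h hlt
    exact ⟨_, _, .ite_true hx hy hlt hr, by omega, hq⟩
  · obtain ⟨t, s', hr, ht, hq⟩ := h' hlt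
    exact ⟨_, _, .ite_false hx hy hlt hr, by omega, hq⟩

/-- The potential `Φ` falls in every round and so bounds their number; a round costs the body and
one test. -/
theorem Tr.while {B b : ℕ} {x y : Ex} {c : Cm} {s : St} {T : ℕ} {Q : St → Prop}
    (I : St → Prop) (Φ : St → ℕ) (h0 : I s)
    (hok : ∀ s', Frame B c s s' → I s' → x.ok B b s' ∧ y.ok B b s')
    (hstep : ∀ s', Frame B c s s' → I s' → x.eval s' < y.eval s' →
      Tr B b c s' T fun s'' => I s'' ∧ Φ s'' < Φ s')
    (hend : ∀ s', Frame B c s s' → I s' → ¬ x.eval s' < y.eval s' → Q s') :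
    Tr B b (.while x y c) s (Φ s * (T + 1) + 1) Q := by
  have key : ∀ N s', Φ s' ≤ N → Frame B c s s' → I s' →
      Tr B b (.while x y c) s' (N * (T + 1) + 1) Q := by
    intro N
    induction N with
    | zero =>
      intro s' hN hf hi
      obtain ⟨hx, hy⟩ := hok s' hf hi
      have hlt : ¬ x.eval s' < y.eval s' := fun hlt => by
        obtain ⟨t, s'', hr, ht, hq⟩ := hstep s' hf hi hlt
        omega
      exact ⟨_, _, .while_false hx hy hlt, by omega, hend s' hf hi hlt⟩
    | succ N ih =>
      intro s' hN hf hi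
      obtain ⟨hx, hy⟩ := hok s' hf hi
      by_cases hlt : x.eval s' < y.eval s'
      · obtain ⟨t, s'', hr, ht, hq⟩ := hstep s' hf hi hlt
        obtain ⟨t', s3, hr', ht', hq'⟩ := ih s'' (by omega) (hf.trans hr.frame) hq.1
        exact ⟨_, _, .while_true hx hy hlt hr hr', by rw [Nat.succ_mul]; omega, hq'⟩
      · exact ⟨_, _, .while_false hx hy hlt, by omega, hend s' hf hi hlt⟩
  exact key _ s le_rfl (Frame.refl _ _) h0

/-- `for i from st to y - 1 do c`. -/
def Cm.for (i st y : ℕ) (c : Cm) : Cm :=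
  .seq (.set i (.lit st))
    (.while (.var i) (.var y) (.seq c (.set i (.plus (.var i) (.lit 1)))))

/-- The invariant `I k` is asked of states whose counter already holds `k`, hence the `set i` in the
premises. -/
theorem Tr.for {B b i st y : ℕ} {c : Cm} {s : St} {T : ℕ} {Q : St → Prop} (I : ℕ → St → Prop)
    (N : ℕ) (hi : c.wv i = false) (hy : c.wv y = false) (hiy : Nat.beq y i = false)
    (hN : s.v y = N) (hB : N ≤ B) (hst : st ≤ N) (hB1 : 1 ≤ B) (h0 : I st (s.set i st))
    (hstep : ∀ k s', st ≤ k → k < N → Frame B (.for i st y c) s s' → s'.v i = k → I k s' →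
      Tr B b c s' T fun s'' => I (k + 1) (s''.set i (k + 1)))
    (hend : ∀ s', Frame B (.for i st y c) s s' → I N s' → Q s') :
    Tr B b (.for i st y c) s (N * (T + 2) + 2) Q := by
  have hne : y ≠ i := by rintro rfl; simp at hiy
  have hst' : (Ex.lit st).ok B b s := hst.trans hB
  obtain ⟨t, s', hr, ht, hf, hq⟩ :
      Tr B b (.while (.var i) (.var y) (.seq c (.set i (.plus (.var i) (.lit 1))))) (s.set i st)
      ((N - (s.set i st).v i) * (T + 1 + 1) + 1) fun s' => Frame B (.for i st y c) s s' ∧ I N s' := by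
    refine Tr.while (I := fun s' => Frame B (.for i st y c) s s' ∧ s'.v y = N ∧ st ≤ s'.v i ∧
      s'.v i ≤ N ∧ I (s'.v i) s') (fun s' => N - s'.v i) ?_ ?_ ?_ ?_
    · refine ⟨?_, by simp [hne, hN], by simp, by simpa using hst, by simpa using h0⟩
      exact (Run.set (B := B) (b := b) i (.lit st) s hst').frame.of_le
        (by simp +contextual [Cm.for, Cm.wv]) (by simp +contextual [Cm.for, Cm.wa])
    · exact fun _ _ _ => ⟨trivial, trivial⟩
    · rintro s1 - ⟨hf1, hy1, hs1, hN1, hI⟩ hlt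
      simp only [Ex.eval, hy1] at hlt
      obtain ⟨t, s2, hr, ht, hq⟩ := hstep _ s1 hs1 hlt hf1 rfl hI
      have hf2 := hr.frame
      have hi2 : s2.v i = s1.v i := hf2.1 i hi
      have hok : (Ex.plus (.var i) (.lit 1)).ok B b s2 := by
        simp only [Ex.ok, Ex.eval, true_and]; omega
      have hr' := Run.seq hr (Run.set i (.plus (.var i) (.lit 1)) s2 hok)
      refine ⟨_, _, hr', by omega, ⟨hf1.trans ?_, ?_, ?_, ?_, ?_⟩, ?_⟩
      · exact hr'.frame.of_le (by simp +contextual [Cm.for, Cm.wv]) (by simp +contextual [Cm.for, Cm.wa])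
      · simp [hne, hf2.1 y hy, hy1]
      · simp [hi2]; omega
      · simp [hi2]; omega
      · simpa [hi2] using hq
      · simp [hi2]; omega
    · rintro s1 - ⟨hf1, hy1, hs1, hN1, hI⟩ hlt
      simp only [Ex.eval, hy1] at hlt
      have : s1.v i = N := by omega
      exact ⟨hf1, this ▸ hI⟩
  refine ⟨_, _, .seq (.set i (.lit st) s hst') hr, ?_, hend s' hf hq⟩
  simp only [St.set_v, if_true] at ht
  have := Nat.mul_le_mul_right (T + 1 + 1) (Nat.sub_le N st)
  have e : N * (T + 1 + 1) = N * (T + 2) := rfl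
  omega

/-- The weakest precondition of a loop-free command. -/
@[simp] def wp (B b : ℕ) : Cm → (St → Prop) → St → Prop
  | .skip, Q, s => Q s
  | .set x e, Q, s => e.ok B b s ∧ Q (s.set x (e.eval s))
  | .put j i e, Q, s => i.ok B b s ∧ e.ok B b s ∧ (j = 0 → i.eval s < b) ∧
      Q (s.put j (i.eval s) (e.eval s))
  | .seq c d, Q, s => wp B b c (wp B b d Q) s
  | .ite x y c d, Q, s => x.ok B b s ∧ y.ok B b s ∧ (x.eval s < y.eval s → wp B b c Q s) ∧
      (¬ x.eval s < y.eval s → wp B b d Q s)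
  | .while _ _ _, _, _ => False

/-- The number of steps of a loop-free command. -/
def Cm.sz : Cm → ℕ
  | .skip => 1
  | .set _ _ => 1
  | .put _ _ _ => 1
  | .seq c d => c.sz + d.sz
  | .ite _ _ c d => c.sz + d.sz + 1
  | .while _ _ _ => 0

theorem Tr.wp {B b : ℕ} {c : Cm} {s : St} {Q : St → Prop} (h : wp B b c Q s) :
    Tr B b c s c.sz Q := by
  induction c generalizing s Q with
  | skip => exact ⟨_, _, .skip s, le_rfl, h⟩
  | set x e => exact ⟨_, _, .set x e s h.1, le_rfl, h.2⟩
  | put j i e => exact ⟨_, _, .put j i e s h.1 h.2.1 h.2.2.1, le_rfl, h.2.2.2⟩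
  | seq c d ihc ihd => exact (ihc h).seq fun s' _ hq => ihd hq
  | ite x y c d ihc ihd =>
    exact Tr.ite h.1 h.2.1 (fun hlt => (ihc (h.2.2.1 hlt)).mono (by omega) fun _ _ => id)
      fun hlt => (ihd (h.2.2.2 hlt)).mono (by omega) fun _ _ => id
  | _ => exact h.elim

theorem Tr.seq_wp {B b : ℕ} {c d : Cm} {s : St} {T U : ℕ} {Q Q' : St → Prop} (h : Tr B b c s T Q)
    (h' : ∀ s', Frame B c s s' → Q s' → MinPAC.wp B b d Q' s') (hT : T + d.sz ≤ U) :
    Tr B b (.seq c d) s U Q' :=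
  (h.seq fun s' hf hq => Tr.wp (h' s' hf hq)).mono hT fun _ _ => id

theorem wp_mono {b : ℕ} {c : Cm} {s : St} {R Q : St → Prop} (h : MinPAC.wp B b c R s)
    (hQ : ∀ s', Frame B c s s' → R s' → Q s') : MinPAC.wp B b c Q s := by
  induction c generalizing s R Q with
  | skip => exact hQ s (Frame.refl _ _) h
  | set x e => exact ⟨h.1, hQ _ (Run.set x e s h.1 : Run B b _ _ _ _).frame h.2⟩
  | put j i e => exact ⟨h.1, h.2.1, h.2.2.1, hQ _ (Run.put j i e s h.1 h.2.1 h.2.2.1).frame h.2.2.2⟩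
  | seq c d ihc ihd =>
    refine ihc h fun s1 hf1 h1 => ihd h1 fun s2 hf2 h2 => hQ s2 ?_ h2
    exact (hf1.of_le (by simp +contextual [Cm.wv]) (by simp +contextual [Cm.wa])).trans
      (hf2.of_le (by simp +contextual [Cm.wv]) (by simp +contextual [Cm.wa]))
  | ite x y c d ihc ihd =>
    refine ⟨h.1, h.2.1, fun hlt => ihc (h.2.2.1 hlt) fun s' hf hR => hQ s' ?_ hR,
      fun hlt => ihd (h.2.2.2 hlt) fun s' hf hR => hQ s' ?_ hR⟩
    all_goals exact hf.of_le (by simp +contextual [Cm.wv]) (by simp +contextual [Cm.wa])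
  | _ => exact h.elim

theorem wp_seq_of {b : ℕ} {c d : Cm} {s : St} {R Q : St → Prop} (h : MinPAC.wp B b c R s)
    (h' : ∀ s', Frame B c s s' → R s' → MinPAC.wp B b d Q s') : MinPAC.wp B b (.seq c d) Q s :=
  wp_mono (Q := MinPAC.wp B b d Q) h h'

theorem Tr.wp_seq {B b : ℕ} {c d : Cm} {s : St} {T U : ℕ} {Q : St → Prop}
    (h : MinPAC.wp B b c (fun s' => Tr B b d s' T Q) s) (hT : c.sz + T ≤ U) :
    Tr B b (.seq c d) s U Q :=
  ((Tr.wp h).seq fun _ _ hq => hq).mono hT fun _ _ => id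

theorem Tr.for_wp {B b i st y : ℕ} {c : Cm} {s : St} {Q : St → Prop} (I : ℕ → St → Prop)
    (N : ℕ) (hi : c.wv i = false) (hy : c.wv y = false) (hiy : Nat.beq y i = false)
    (hN : s.v y = N) (hB : N ≤ B) (hst : st ≤ N) (hB1 : 1 ≤ B) (h0 : I st (s.set i st))
    (hstep : ∀ k s', st ≤ k → k < N → Frame B (.for i st y c) s s' → s'.v i = k → I k s' →
      MinPAC.wp B b c (fun s'' => I (k + 1) (s''.set i (k + 1))) s')
    (hend : ∀ s', Frame B (.for i st y c) s s' → I N s' → Q s') :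
    Tr B b (.for i st y c) s (N * (c.sz + 2) + 2) Q :=
  Tr.for I N hi hy hiy hN hB hst hB1 h0 (fun k s' h1 h2 h3 h4 h5 => Tr.wp (hstep k s' h1 h2 h3 h4 h5))
    hend

/-! ### Notation -/

infixl:65 " +. " => Ex.plus
infixl:65 " -. " => Ex.minus
infixr:40 " ;; " => Cm.seq

/-- `array j [i] := max (array j [i]) e` -/
def Cm.bump (j : ℕ) (i e : Ex) : Cm := .ite (.get j i) e (.put j i e) .skip

/-- `|x - y|` -/
def Ex.dist (x y : Ex) : Ex := (x -. y) +. (y -. x)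

/-- `if x = y then c else d` -/
def Cm.ifEq (x y : Ex) (c d : Cm) : Cm := .ite (.dist x y) (.lit 1) c d

/-- Raises the value at `i` to at least `k`. -/
def bumpAt (f : ℕ → ℕ) (i k : ℕ) : ℕ → ℕ := Function.update f i (max (f i) k)

theorem bumpAt_apply (f : ℕ → ℕ) (i k x : ℕ) :
    bumpAt f i k x = if x = i then max (f i) k else f x := by
  simp [bumpAt, Function.update_apply]

/-- Raises `array j [i]` to at least `k`. -/
def St.bump (s : St) (j i k : ℕ) : St := ⟨s.v, Function.update s.a j (bumpAt (s.a j) i k)⟩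

@[simp] theorem St.bump_v (s : St) (j i k : ℕ) : (s.bump j i k).v = s.v := rfl

@[simp] theorem St.bump_a (s : St) (j i k l : ℕ) :
    (s.bump j i k).a l = if l = j then bumpAt (s.a j) i k else s.a l := by
  simp [St.bump, Function.update_apply]

@[simp] theorem wp_bump {b j : ℕ} {i e : Ex} {Q : St → Prop} {s : St} (hj : j ≠ 0) :
    wp B b (.bump j i e) Q s ↔ i.ok B b s ∧ e.ok B b s ∧ Q (s.bump j (i.eval s) (e.eval s)) := by
  simp only [Cm.bump, wp, Ex.ok, Ex.eval, hj, false_implies, and_true, true_and, St.put, St.bump, bumpAt]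
  refine and_congr_right fun _ => and_congr_right fun _ => ?_
  by_cases h : s.a j (i.eval s) < e.eval s
  · simp_all [max_eq_right h.le]
  · have h' := not_lt.mp h
    simp [h, max_eq_left h']

theorem wp_ifEq {B b : ℕ} {x y : Ex} {c d : Cm} {Q : St → Prop} {s : St} (hB : 1 ≤ B)
    (hx : x.ok B b s) (hy : y.ok B b s) (hx' : x.eval s ≤ B) (hy' : y.eval s ≤ B) :
    wp B b (.ifEq x y c d) Q s ↔ (x.eval s = y.eval s → wp B b c Q s) ∧
      (x.eval s ≠ y.eval s → wp B b d Q s) := by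
  have h1 : x.eval s - y.eval s + (y.eval s - x.eval s) ≤ B := by omega
  have h2 : x.eval s - y.eval s + (y.eval s - x.eval s) < 1 ↔ x.eval s = y.eval s := by omega
  simp [Cm.ifEq, Ex.dist, hx, hy, h1, h2, hB]

/-! ### Chains of a rooted tree with extra arcs -/

/-- A rooted tree on the vertices below `n` with root `0`, together with `na` further arcs from
`tt j` to `hh j` of weight `ww j`. The arc from `v` to its parent has weight `wu v`, the opposite
arc has weight `wd v`. The active vertices form a subtree; each active vertex that is not a branch
vertex has exactly one active child, so that it lies on the chain from a branch vertex `bot v` up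
to `topv (bot v)`, whose parent is again a branch vertex. -/
structure Lay where
  n : ℕ
  par : ℕ → ℕ
  rk : ℕ → ℕ
  act : ℕ → ℕ
  br : ℕ → ℕ
  bot : ℕ → ℕ
  topv : ℕ → ℕ
  wd : ℕ → ℕ
  wu : ℕ → ℕ
  na : ℕ
  tt : ℕ → ℕ
  hh : ℕ → ℕ
  ww : ℕ → ℕ

namespace Lay

/-- The conditions on a layout that do not involve `topv`. -/
structure Pre (L : Lay) : Prop where
  n_pos : 0 < L.n
  par_lt : ∀ v, 0 < v → v < L.n → L.par v < L.n
  rk_par : ∀ v, 0 < v → v < L.n → L.rk (L.par v) < L.rk v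
  rk_lt : ∀ v, v < L.n → L.rk v < L.n
  rk_inj : ∀ u v, u < L.n → v < L.n → L.rk u = L.rk v → u = v
  act_par : ∀ v, 0 < v → v < L.n → L.act v = 1 → L.act (L.par v) = 1
  br_zero : L.br 0 = 1
  br_act : ∀ v, v < L.n → L.br v = 1 → L.act v = 1
  child : ∀ v, v < L.n → L.act v = 1 → L.br v ≠ 1 → ∃ c, 0 < c ∧ c < L.n ∧ L.par c = v ∧
    L.act c = 1 ∧ L.bot v = L.bot c ∧
    ∀ c', 0 < c' → c' < L.n → L.par c' = v → L.act c' = 1 → c' = c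
  bot_br : ∀ v, 0 < v → v < L.n → L.br v = 1 → L.bot v = v
  arc_br : ∀ j, j < L.na → L.tt j < L.n ∧ L.br (L.tt j) = 1 ∧ L.hh j < L.n ∧ L.br (L.hh j) = 1
  br_cause : ∀ v, 0 < v → v < L.n → L.br v = 1 → (∃ j, j < L.na ∧ (L.tt j = v ∨ L.hh j = v)) ∨
    ∃ c c', c ≠ c' ∧ (0 < c ∧ c < L.n ∧ L.act c = 1 ∧ L.par c = v) ∧
      (0 < c' ∧ c' < L.n ∧ L.act c' = 1 ∧ L.par c' = v)

/-- Separated from `Pre` because the upper ends of the chains are stored by a later pass of the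
program. -/
structure Good (L : Lay) : Prop extends Pre L where
  topv_eq : ∀ v, 0 < v → v < L.n → L.act v = 1 → L.br (L.par v) = 1 → L.topv (L.bot v) = v

variable {L : Lay}

/-- `v` lies on a chain. -/
def Ch (L : Lay) (v : ℕ) : Prop := 0 < v ∧ v < L.n ∧ L.act v = 1

theorem Pre.child_ch (h : L.Pre) {v : ℕ} (hv : L.Ch v) (hb : L.br v ≠ 1) :
    ∃ c, L.Ch c ∧ L.par c = v ∧ L.bot v = L.bot c ∧ L.rk v < L.rk c ∧
      ∀ c', L.Ch c' → L.par c' = v → c' = c := by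
  obtain ⟨c, h0, hn, hp, ha, hbt, hu⟩ := h.child v hv.2.1 hv.2.2 hb
  exact ⟨c, ⟨h0, hn, ha⟩, hp, hbt, hp ▸ h.rk_par c h0 hn, fun c' hc' hp' => hu c' hc'.1 hc'.2.1 hp' hc'.2.2⟩

/-- Induction along a chain, from its branch vertex upwards. -/
theorem Pre.up_induction (h : L.Pre) {P : ℕ → Prop}
    (base : ∀ v, L.Ch v → L.br v = 1 → P v)
    (step : ∀ v c, L.Ch v → L.br v ≠ 1 → L.Ch c → L.par c = v → L.bot v = L.bot c → P c → P v)
    (v : ℕ) (hv : L.Ch v) : P v := by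
  induction hk : L.n - L.rk v using Nat.strong_induction_on generalizing v with
  | _ k ih =>
    by_cases hb : L.br v = 1
    · exact base v hv hb
    · obtain ⟨c, hc, hp, hbt, hr, -⟩ := h.child_ch hv hb
      have := h.rk_lt c hc.2.1
      exact step v c hv hb hc hp hbt (ih _ (by omega) c hc rfl)

theorem Pre.par_ch (h : L.Pre) {v : ℕ} (hv : L.Ch v) (hb : L.br (L.par v) ≠ 1) :
    L.Ch (L.par v) := by
  refine ⟨Nat.pos_of_ne_zero fun h0 => hb (h0 ▸ h.br_zero), h.par_lt v hv.1 hv.2.1,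
    h.act_par v hv.1 hv.2.1 hv.2.2⟩

theorem Pre.bot_par (h : L.Pre) {v : ℕ} (hv : L.Ch v) (hb : L.br (L.par v) ≠ 1) :
    L.bot (L.par v) = L.bot v := by
  obtain ⟨c, hc, hp, hbt, -, hu⟩ := h.child_ch (h.par_ch hv hb) hb
  rw [hbt, hu v hv rfl]

/-- Induction along a chain, from the top downwards. -/
theorem Pre.down_induction (h : L.Pre) {P : ℕ → Prop}
    (base : ∀ v, L.Ch v → L.br (L.par v) = 1 → P v)
    (step : ∀ v, L.Ch v → L.br (L.par v) ≠ 1 → L.Ch (L.par v) → L.bot (L.par v) = L.bot v →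
      P (L.par v) → P v)
    (v : ℕ) (hv : L.Ch v) : P v := by
  induction hk : L.rk v using Nat.strong_induction_on generalizing v with
  | _ k ih =>
    by_cases hb : L.br (L.par v) = 1
    · exact base v hv hb
    · have := h.rk_par v hv.1 hv.2.1
      exact step v hv hb (h.par_ch hv hb) (h.bot_par hv hb) (ih _ (by omega) _ (h.par_ch hv hb) rfl)

theorem Pre.bot_spec (h : L.Pre) (v : ℕ) (hv : L.Ch v) :
    L.Ch (L.bot v) ∧ L.br (L.bot v) = 1 ∧ L.rk v ≤ L.rk (L.bot v) ∧ L.bot (L.bot v) = L.bot v := by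
  refine h.up_induction (P := fun v => L.Ch (L.bot v) ∧ L.br (L.bot v) = 1 ∧
    L.rk v ≤ L.rk (L.bot v) ∧ L.bot (L.bot v) = L.bot v) (fun v hv hb => ?_)
    (fun v c hv hb hc hp hbt ih => ?_) v hv
  · have e := h.bot_br v hv.1 hv.2.1 hb
    simp only [e]
    exact ⟨hv, hb, le_rfl, trivial⟩
  · rw [hbt]
    have := h.rk_par c hc.1 hc.2.1
    rw [hp] at this
    exact ⟨ih.1, ih.2.1, by omega, ih.2.2.2⟩

theorem Good.topv_spec (h : L.Good) (v : ℕ) (hv : L.Ch v) :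
    L.Ch (L.topv (L.bot v)) ∧ L.br (L.par (L.topv (L.bot v))) = 1 ∧
      L.bot (L.topv (L.bot v)) = L.bot v := by
  refine h.down_induction (P := fun v => L.Ch (L.topv (L.bot v)) ∧
    L.br (L.par (L.topv (L.bot v))) = 1 ∧ L.bot (L.topv (L.bot v)) = L.bot v)
    (fun v hv hb => ?_) (fun v hv hb hp hbt ih => ?_) v hv
  · rw [h.topv_eq v hv.1 hv.2.1 hv.2.2 hb]; exact ⟨hv, hb, rfl⟩
  · rwa [hbt] at ih

/-- The order on a chain. -/
theorem Pre.order (h : L.Pre) {u v : ℕ} (hu : L.Ch u) (hv : L.Ch v) (hb : L.bot u = L.bot v)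
    (hr : L.rk u < L.rk v) : L.br (L.par v) ≠ 1 ∧ L.rk u ≤ L.rk (L.par v) := by
  induction hk : L.n - L.rk u using Nat.strong_induction_on generalizing u v with
  | _ k ih =>
    by_cases hbu : L.br u = 1
    · have := (h.bot_spec v hv).2.2.1
      rw [← hb, h.bot_br u hu.1 hu.2.1 hbu] at this
      omega
    · obtain ⟨c, hc, hp, hbt, hrc, -⟩ := h.child_ch hu hbu
      have := h.rk_lt c hc.2.1
      have := h.rk_lt v hv.2.1
      rcases lt_trichotomy (L.rk c) (L.rk v) with hlt | heq | hgt
      · obtain ⟨h1, h2⟩ := ih _ (by omega) hc hv (by rw [← hbt, hb]) hlt rfl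
        exact ⟨h1, by omega⟩
      · obtain rfl := h.rk_inj c v hc.2.1 hv.2.1 heq
        rw [hp]
        exact ⟨hbu, le_rfl⟩
      · obtain ⟨h1, h2⟩ := ih _ (by omega) hv hc (by rw [← hbt, hb]) hgt rfl
        rw [hp] at h2
        omega

/-- By `Pre.order`, the lower of two vertices on a chain has a non-branch parent. Consequently the
pass that fills `topv` never stores two different vertices for one chain. -/
theorem Pre.top_unique (h : L.Pre) {u v : ℕ} (hu : L.Ch u) (hv : L.Ch v) (hb : L.bot u = L.bot v)
    (hu' : L.br (L.par u) = 1) (hv' : L.br (L.par v) = 1) : u = v := by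
  rcases lt_trichotomy (L.rk u) (L.rk v) with hlt | heq | hgt
  · exact absurd hv' (h.order hu hv hb hlt).1
  · exact h.rk_inj _ _ hu.2.1 hv.2.1 heq
  · exact absurd hu' (h.order hv hu hb.symm hgt).1

/-! #### Selections of arcs -/

/-- The arcs selected by `SU` (up), `SD` (down) and `SN` (further arcs). -/
def Arc (L : Lay) (SU SD SN : ℕ → Prop) (u v : ℕ) : Prop :=
  (0 < u ∧ u < L.n ∧ SU u ∧ v = L.par u) ∨ (0 < v ∧ v < L.n ∧ SD v ∧ u = L.par v) ∨
    ∃ j, j < L.na ∧ SN j ∧ u = L.tt j ∧ v = L.hh j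

def Strong (L : Lay) (SU SD SN : ℕ → Prop) : Prop :=
  ∀ v, v < L.n → Relation.ReflTransGen (L.Arc SU SD SN) 0 v ∧
    Relation.ReflTransGen (L.Arc SU SD SN) v 0

/-- The tree edge that option `o` breaks on the chain of `x`. -/
def bk (L : Lay) (mid : ℕ → ℕ) (o x : ℕ) : ℕ :=
  -- An edge is named by its lower end. Since `L.n` is not a vertex, options `0`, `1` and `2` break
  -- nothing.
  if o = 3 then x else if o = 4 then L.topv x else if o = 5 then mid x else L.n

/-- The upward arcs selected by the options `c`. -/
def selU (L : Lay) (mid c : ℕ → ℕ) (v : ℕ) : Prop :=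
  L.act v ≠ 1 ∨ (c (L.bot v) ≠ 1 ∧ L.bk mid (c (L.bot v)) (L.bot v) ≠ v)

/-- The downward arcs selected by the options `c`. -/
def selD (L : Lay) (mid c : ℕ → ℕ) (v : ℕ) : Prop :=
  L.act v ≠ 1 ∨ (c (L.bot v) ≠ 0 ∧ L.bk mid (c (L.bot v)) (L.bot v) ≠ v)

/-- The arcs between branch vertices that the options `c` provide. -/
def BArc (L : Lay) (c : ℕ → ℕ) (SN : ℕ → Prop) (x y : ℕ) : Prop :=
  (0 < x ∧ x < L.n ∧ L.br x = 1 ∧ (c x = 0 ∨ c x = 2) ∧ y = L.par (L.topv x)) ∨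
  (0 < y ∧ y < L.n ∧ L.br y = 1 ∧ (c y = 1 ∨ c y = 2) ∧ x = L.par (L.topv y)) ∨
    ∃ j, j < L.na ∧ SN j ∧ x = L.tt j ∧ y = L.hh j

def BStrong (L : Lay) (c : ℕ → ℕ) (SN : ℕ → Prop) : Prop :=
  ∀ v, v < L.n → L.br v = 1 → Relation.ReflTransGen (L.BArc c SN) 0 v ∧
    Relation.ReflTransGen (L.BArc c SN) v 0

theorem bk_ne {mid : ℕ → ℕ} {o x v : ℕ} (ho : o = 0 ∨ o = 1 ∨ o = 2)
    (hv : L.Ch v) : L.bk mid o x ≠ v := by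
  have : L.bk mid o x = L.n := by rcases ho with rfl | rfl | rfl <;> rfl
  have := hv.2.1
  omega

-- Under options `0` and `1` a chain is a directed path between its two ends. Under the others at
-- most one edge is broken, and each remaining piece is joined in both directions to one end.
-- Inactive vertices hang on by both arcs. Nothing is required of `mid`: a wrong value breaks one
-- edge or none.
open Relation in
theorem Good.strong_of_bstrong (h : L.Good) {mid c : ℕ → ℕ} {SN : ℕ → Prop}
    (hs : L.BStrong c SN) : L.Strong (L.selU mid c) (L.selD mid c) SN := by
  set A := L.Arc (L.selU mid c) (L.selD mid c) SN with hA
  have up : ∀ v, L.Ch v → L.selU mid c v → A v (L.par v) := fun v hv hsel =>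
    Or.inl ⟨hv.1, hv.2.1, hsel, rfl⟩
  have down : ∀ v, L.Ch v → L.selD mid c v → A (L.par v) v := fun v hv hsel =>
    Or.inr (Or.inl ⟨hv.1, hv.2.1, hsel, rfl⟩)
  have su : ∀ v, L.Ch v → c (L.bot v) = 0 ∨ c (L.bot v) = 2 → L.selU mid c v := fun v hv ho =>
    Or.inr ⟨by omega, bk_ne (by tauto) hv⟩
  have sd : ∀ v, L.Ch v → c (L.bot v) = 1 ∨ c (L.bot v) = 2 → L.selD mid c v := fun v hv ho =>
    Or.inr ⟨by omega, bk_ne (by tauto) hv⟩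
  have toTop : ∀ v, L.Ch v → c (L.bot v) = 0 ∨ c (L.bot v) = 2 →
      ReflTransGen A v (L.par (L.topv (L.bot v))) := by
    refine h.down_induction (fun v hv hb ho => ?_) fun v hv hb hp hbt ih ho => ?_
    · rw [h.topv_eq v hv.1 hv.2.1 hv.2.2 hb]
      exact .single (up v hv (su v hv ho))
    · rw [hbt] at ih
      exact .head (up v hv (su v hv ho)) (ih ho)
  have fromTop : ∀ v, L.Ch v → c (L.bot v) = 1 ∨ c (L.bot v) = 2 →
      ReflTransGen A (L.par (L.topv (L.bot v))) v := by
    refine h.down_induction (fun v hv hb ho => ?_) fun v hv hb hp hbt ih ho => ?_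
    · rw [h.topv_eq v hv.1 hv.2.1 hv.2.2 hb]
      exact .single (down v hv (sd v hv ho))
    · rw [hbt] at ih
      exact .tail (ih ho) (down v hv (sd v hv ho))
  have lift : ∀ x y, L.BArc c SN x y → ReflTransGen A x y := by
    rintro x y (⟨h0, hn, hb, ho, rfl⟩ | ⟨h0, hn, hb, ho, rfl⟩ | hj)
    · have := toTop x ⟨h0, hn, h.br_act x hn hb⟩
      rw [h.bot_br x h0 hn hb] at this
      exact this ho
    · have := fromTop y ⟨h0, hn, h.br_act y hn hb⟩
      rw [h.bot_br y h0 hn hb] at this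
      exact this ho
    · exact .single (Or.inr (Or.inr hj))
  have lift' : ∀ x y, ReflTransGen (L.BArc c SN) x y → ReflTransGen A x y := fun x y hxy => by
    induction hxy with
    | refl => exact .refl
    | tail _ hb ih => exact ih.trans (lift _ _ hb)
  have good_br : ∀ v, v < L.n → L.br v = 1 → ReflTransGen A 0 v ∧ ReflTransGen A v 0 :=
    fun v hv hb => ⟨lift' _ _ (hs v hv hb).1, lift' _ _ (hs v hv hb).2⟩
  have fromBot : ∀ v, L.Ch v → c (L.bot v) = 0 ∨ c (L.bot v) = 2 →
      ReflTransGen A (L.bot v) v := by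
    refine h.up_induction (fun v hv hb ho => ?_) fun v d hv hb hd hp hbt ih ho => ?_
    · rw [h.bot_br v hv.1 hv.2.1 hb]
    · rw [hbt] at ho ⊢
      exact .tail (ih ho) (hp ▸ up d hd (su d hd ho))
  have toBot : ∀ v, L.Ch v → c (L.bot v) = 1 ∨ c (L.bot v) = 2 →
      ReflTransGen A v (L.bot v) := by
    refine h.up_induction (fun v hv hb ho => ?_) fun v d hv hb hd hp hbt ih ho => ?_
    · rw [h.bot_br v hv.1 hv.2.1 hb]
    · rw [hbt] at ho ⊢
      exact .head (hp ▸ down d hd (sd d hd ho)) (ih ho)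
  have good_ch : ∀ v, L.Ch v → ReflTransGen A 0 v ∧ ReflTransGen A v 0 := by
    intro v hv
    obtain ⟨hx, hxb, -, hbb⟩ := h.bot_spec v hv
    obtain ⟨ht, htb, -⟩ := h.topv_spec v hv
    obtain ⟨gx1, gx2⟩ := good_br _ hx.2.1 hxb
    obtain ⟨gt1, gt2⟩ := good_br _ (h.par_lt _ ht.1 ht.2.1) htb
    by_cases h0 : c (L.bot v) = 0
    · exact ⟨gx1.trans (fromBot v hv (.inl h0)), (toTop v hv (.inl h0)).trans gt2⟩
    by_cases h1 : c (L.bot v) = 1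
    · exact ⟨gt1.trans (fromTop v hv (.inl h1)), (toBot v hv (.inl h1)).trans gx2⟩
    have key : ∀ u, L.Ch u → L.bot u = L.bot v → L.bk mid (c (L.bot v)) (L.bot v) ≠ u →
        A u (L.par u) ∧ A (L.par u) u := fun u hu hb hne =>
      ⟨up u hu (Or.inr ⟨by rwa [hb], by rwa [hb]⟩), down u hu (Or.inr ⟨by rwa [hb], by rwa [hb]⟩)⟩
    generalize hx : L.bot v = x at key
    set k := L.bk mid (c x) x
    -- If the broken edge lies above `v` on its chain, then `v` is joined to the lower end;
    -- otherwise it is joined to the branch vertex at the top.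
    by_cases hk : L.Ch k ∧ L.bot k = x ∧ L.rk k ≤ L.rk v
    · refine h.up_induction (P := fun u => L.bot u = x → L.rk k ≤ L.rk u →
        ReflTransGen A 0 u ∧ ReflTransGen A u 0) (fun u hu hb _ _ => good_br u hu.2.1 hb)
        (fun u d hu hb hd hp hbt ih hux hru => ?_) v hv hx hk.2.2
      have hr := h.rk_par d hd.1 hd.2.1
      rw [hp] at hr
      obtain ⟨i1, i2⟩ := ih (hbt ▸ hux) (by omega)
      obtain ⟨k1, k2⟩ := key d hd (hbt ▸ hux) (by rintro rfl; omega)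
      rw [hp] at k1 k2
      exact ⟨i1.tail k1, i2.head k2⟩
    · refine h.down_induction (P := fun u => L.bot u = x → ¬ (L.Ch k ∧ L.bot k = x ∧ L.rk k ≤ L.rk u) →
        ReflTransGen A 0 u ∧ ReflTransGen A u 0) (fun u hu hb hux hru => ?_)
        (fun u hu hb hp hbt ih hux hru => ?_) v hv hx hk
      · obtain ⟨k1, k2⟩ := key u hu hux (by rintro rfl; exact hru ⟨hu, hux, le_rfl⟩)
        obtain ⟨i1, i2⟩ := good_br _ (h.par_lt u hu.1 hu.2.1) hb
        exact ⟨i1.tail k2, i2.head k1⟩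
      · obtain ⟨k1, k2⟩ := key u hu hux (by rintro rfl; exact hru ⟨hu, hux, le_rfl⟩)
        have := h.rk_par u hu.1 hu.2.1
        obtain ⟨i1, i2⟩ := ih (hbt ▸ hux) fun ⟨a1, a2, a3⟩ => hru ⟨a1, a2, by omega⟩
        exact ⟨i1.tail k2, i2.head k1⟩
  intro v hv
  induction hk : L.rk v using Nat.strong_induction_on generalizing v with
  | _ k ih =>
    rcases Nat.eq_zero_or_pos v with rfl | h0
    · exact ⟨.refl, .refl⟩
    by_cases ha : L.act v = 1
    · exact good_ch v ⟨h0, hv, ha⟩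
    · have := h.rk_par v h0 hv
      obtain ⟨i1, i2⟩ := ih _ (by omega) _ (h.par_lt v h0 hv) rfl
      exact ⟨i1.tail (Or.inr (Or.inl ⟨h0, hv, Or.inl ha, rfl⟩)),
        i2.head (Or.inl ⟨h0, hv, Or.inl ha, rfl⟩)⟩

/-! #### The structure of strongly connected selections -/

/-- `att v` is the nearest active ancestor of `v`, which contracts the inactive subtrees. Climbing
`n` times suffices, since each climb lowers the rank and ranks are below `n`. -/
theorem Good.exists_att (h : L.Good) : ∃ att : ℕ → ℕ, (∀ v, L.act v = 1 → att v = v) ∧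
    ∀ v, 0 < v → v < L.n → L.act v ≠ 1 → att v = att (L.par v) := by
  let f : ℕ → ℕ := fun v => if L.act v = 1 then v else L.par v
  have hf : ∀ v, L.act v = 1 → f v = v := fun v hv => if_pos hv
  have hk : ∀ k v, v < L.n → L.rk v ≤ k → L.act (f^[k] v) = 1 := by
    intro k
    induction k with
    | zero =>
      intro v hv hr
      rcases Nat.eq_zero_or_pos v with rfl | h0
      · exact h.br_act 0 hv h.br_zero
      · have := h.rk_par v h0 hv
        omega
    | succ k ih =>
      intro v hv hr
      by_cases ha : L.act v = 1
      · rw [Function.iterate_fixed (hf v ha)]; exact ha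
      · have h0 : 0 < v := Nat.pos_of_ne_zero fun h0 => ha (by
          subst h0; exact h.br_act 0 hv h.br_zero)
        have := h.rk_par v h0 hv
        rw [Function.iterate_succ_apply]
        have e : f v = L.par v := if_neg ha
        rw [e]
        exact ih _ (h.par_lt v h0 hv) (by omega)
  refine ⟨f^[L.n], fun v hv => Function.iterate_fixed (hf v hv) _, fun v h0 hv ha => ?_⟩
  have e : f v = L.par v := if_neg ha
  rw [← e, ← Function.iterate_succ_apply, Function.iterate_succ_apply',
    hf _ (hk _ v hv (h.rk_lt v hv).le)]

/-- A set of active vertices that no selected arc leaves contains all or none of them. -/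
theorem Good.cut (h : L.Good) {SU SD SN : ℕ → Prop} (hs : L.Strong SU SD SN) (P : ℕ → Prop)
    (hU : ∀ v, L.Ch v → SU v → P v → P (L.par v)) (hD : ∀ v, L.Ch v → SD v → P (L.par v) → P v)
    (hN : ∀ j, j < L.na → SN j → P (L.tt j) → P (L.hh j)) {a b : ℕ} (ha : a < L.n) (ha' : L.act a = 1)
    (hb : b < L.n) (hb' : L.act b = 1) (hP : P a) : P b := by
  obtain ⟨att, h1, h2⟩ := h.exists_att
  have hab := (hs a ha).2.trans (hs b hb).1
  rw [← h1 b hb']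
  rw [← h1 a ha'] at hP
  clear hb hb' ha ha'
  -- Along the walk `P` is tracked at the active vertex to which the current vertex is attached.
  induction hab with
  | refl => exact hP
  | @tail u w _ hc ih =>
    rcases hc with ⟨h0, hn, hsel, rfl⟩ | ⟨h0, hn, hsel, rfl⟩ | ⟨j, hj, hsel, rfl, rfl⟩
    · by_cases hau : L.act u = 1
      · rw [h1 u hau] at ih
        rw [h1 _ (h.act_par u h0 hn hau)]
        exact hU u ⟨h0, hn, hau⟩ hsel ih
      · rwa [h2 u h0 hn hau] at ih
    · by_cases hau : L.act w = 1
      · rw [h1 _ (h.act_par w h0 hn hau)] at ih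
        rw [h1 w hau]
        exact hD w ⟨h0, hn, hau⟩ hsel ih
      · rwa [h2 w h0 hn hau]
    · obtain ⟨t1, t2, t3, t4⟩ := h.arc_br j hj
      rw [h1 _ (h.br_act _ t1 t2)] at ih
      rw [h1 _ (h.br_act _ t3 t4)]
      exact hN j hj hsel ih

/-- Both tree arcs at an inactive vertex are selected. -/
theorem Good.inactive (h : L.Good) {SU SD SN : ℕ → Prop} (hs : L.Strong SU SD SN) {v : ℕ}
    (h0 : 0 < v) (hv : v < L.n) (ha : L.act v ≠ 1) : SU v ∧ SD v := by
  -- `D` is the subtree below `v`. It contains no branch vertex, hence no end of a further arc, so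
  -- the two tree arcs at `v` are the only way out and in.
  let D : ℕ → Prop := fun u => Relation.ReflTransGen (fun a b => 0 < a ∧ a < L.n ∧ b = L.par a) u v
  have hD : ∀ u, D u → u = v ∨ D (L.par u) := fun u hu => by
    rcases hu.cases_head with rfl | ⟨c, ⟨_, _, rfl⟩, hc⟩
    exacts [.inl rfl, .inr hc]
  have hD0 : ¬ D 0 := fun hu => by
    rcases hu.cases_head with rfl | ⟨c, ⟨h', _, rfl⟩, hc⟩
    all_goals omega
  have hDp : ∀ u, 0 < u → u < L.n → D (L.par u) → D u := fun u h1 h2 hu => .head ⟨h1, h2, rfl⟩ hu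
  have hDa : ∀ u, D u → L.act u ≠ 1 := fun u hu => by
    induction hu using Relation.ReflTransGen.head_induction_on with
    | refl => exact ha
    | head hab _ ih =>
      obtain ⟨h1, h2, rfl⟩ := hab
      exact fun h3 => ih (h.act_par _ h1 h2 h3)
  constructor
  · by_contra hsu
    have : ∀ w, Relation.ReflTransGen (L.Arc SU SD SN) v w → D w := fun w hw => by
      induction hw with
      | refl => exact .refl
      | tail _ hbc ih =>
        rcases hbc with ⟨h1, h2, hsel, rfl⟩ | ⟨h1, h2, hsel, rfl⟩ | ⟨j, hj, -, rfl, rfl⟩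
        · rcases hD _ ih with rfl | hd
          exacts [absurd hsel hsu, hd]
        · exact hDp _ h1 h2 ih
        · exact absurd (h.br_act _ (h.arc_br j hj).1 (h.arc_br j hj).2.1) (hDa _ ih)
    exact hD0 (this 0 (hs v hv).2)
  · by_contra hsd
    have : ∀ w, Relation.ReflTransGen (L.Arc SU SD SN) 0 w → ¬ D w := fun w hw => by
      induction hw with
      | refl => exact hD0
      | tail _ hbc ih =>
        rcases hbc with ⟨h1, h2, hsel, rfl⟩ | ⟨h1, h2, hsel, rfl⟩ | ⟨j, hj, -, rfl, rfl⟩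
        · exact fun hd => ih (hDp _ h1 h2 hd)
        · exact fun hd => (hD _ hd).elim (fun e => hsd (e ▸ hsel)) ih
        · exact fun hd => hDa _ hd (h.br_act _ (h.arc_br j hj).2.2.1 (h.arc_br j hj).2.2.2)
    exact this v (hs v hv).1 .refl

/-- A chain that lacks arcs in both directions lacks one edge and nothing else. -/
theorem Good.missing_eq (h : L.Good) {SU SD SN : ℕ → Prop} (hs : L.Strong SU SD SN) {i j : ℕ}
    (hi : L.Ch i) (hj : L.Ch j) (hb : L.bot i = L.bot j) (hsi : ¬ SU i) (hsj : ¬ SD j) : i = j := by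
  have hz : L.act 0 = 1 := h.br_act 0 h.n_pos h.br_zero
  rcases lt_trichotomy (L.rk j) (L.rk i) with hlt | heq | hgt
  · exfalso
    have hbr : ∀ v, L.Ch v → L.bot v = L.bot i → L.br v = 1 → L.rk i ≤ L.rk v := fun v hv hvb hbv => by
      rw [← h.bot_br v hv.1 hv.2.1 hbv, hvb]; exact (h.bot_spec i hi).2.2.1
    -- Here the edge above `j` is the higher one. The segment `S` between the two edges could be
    -- entered only by the downward arc to `j` or the upward arc from `i`, and both are missing.
    let S : ℕ → Prop := fun v => L.Ch v ∧ L.br v ≠ 1 ∧ L.bot v = L.bot i ∧ L.rk j ≤ L.rk v ∧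
      L.rk v < L.rk i
    have := h.cut hs (fun v => ¬ S v) ?_ ?_ ?_ h.n_pos hz hj.2.1 hj.2.2 fun hc => by
      have := hc.1.1; omega
    · refine this ⟨hj, fun hbj => ?_, hb.symm, le_rfl, hlt⟩
      have := hbr j hj hb.symm hbj
      omega
    · rintro v hv hsel hn ⟨h1, h2, h3, h4, h5⟩
      have hvb := (h.bot_par hv h2).symm.trans h3
      have hr := h.rk_par v hv.1 hv.2.1
      have hri : L.rk i ≤ L.rk v := by
        by_contra hlt'
        exact hn ⟨hv, fun hbv => hlt' (hbr v hv hvb hbv), hvb, by omega, by omega⟩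
      rcases hri.eq_or_lt with he | hl
      · obtain rfl := h.rk_inj _ _ hi.2.1 hv.2.1 he
        exact hsi hsel
      · have := (h.order hi hv hvb.symm hl).2
        omega
    · rintro v hv hsel hn ⟨h1, h2, h3, h4, h5⟩
      rcases h4.eq_or_lt with he | hl
      · obtain rfl := h.rk_inj _ _ hj.2.1 hv.2.1 he
        exact hsj hsel
      · obtain ⟨o1, o2⟩ := h.order hj hv (hb.symm.trans h3.symm) hl
        have := h.rk_par v hv.1 hv.2.1
        exact hn ⟨h.par_ch hv o1, o1, (h.bot_par hv o1).trans h3, o2, by omega⟩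
    · exact fun k hk _ _ hc => hc.2.1 (h.arc_br k hk).2.2.2
  · exact (h.rk_inj _ _ hj.2.1 hi.2.1 heq).symm
  · exfalso
    have hbr : ∀ v, L.Ch v → L.bot v = L.bot i → L.br v = 1 → L.rk j ≤ L.rk v := fun v hv hvb hbv => by
      rw [← h.bot_br v hv.1 hv.2.1 hbv, hvb, hb]; exact (h.bot_spec j hj).2.2.1
    -- In the opposite order the two missing arcs are the only ones that could leave the segment.
    let S : ℕ → Prop := fun v => L.Ch v ∧ L.br v ≠ 1 ∧ L.bot v = L.bot i ∧ L.rk i ≤ L.rk v ∧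
      L.rk v < L.rk j
    have := h.cut hs S ?_ ?_ ?_ hi.2.1 hi.2.2 h.n_pos hz
      ⟨hi, fun hbi => by have := hbr i hi rfl hbi; omega, rfl, le_rfl, hgt⟩
    · have := this.1.1; omega
    · rintro v hv hsel ⟨h1, h2, h3, h4, h5⟩
      rcases h4.eq_or_lt with he | hl
      · obtain rfl := h.rk_inj _ _ hi.2.1 hv.2.1 he
        exact absurd hsel hsi
      · obtain ⟨o1, o2⟩ := h.order hi hv h3.symm hl
        have := h.rk_par v hv.1 hv.2.1
        exact ⟨h.par_ch hv o1, o1, (h.bot_par hv o1).trans h3, o2, by omega⟩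
    · rintro v hv hsel ⟨h1, h2, h3, h4, h5⟩
      have hvb := (h.bot_par hv h2).symm.trans h3
      have hr := h.rk_par v hv.1 hv.2.1
      have hlt : L.rk v < L.rk j := by
        by_contra hge
        rcases (not_lt.mp hge).eq_or_lt with he | hl
        · obtain rfl := h.rk_inj _ _ hj.2.1 hv.2.1 he
          exact hsj hsel
        · have := (h.order hj hv (hb.symm.trans hvb.symm) hl).2
          omega
      exact ⟨hv, fun hbv => absurd (hbr v hv hvb hbv) (by omega), hvb, by omega, hlt⟩
    · exact fun k hk _ hc => absurd (h.arc_br k hk).2.1 hc.2.1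

/-- The chains of a strongly connected selection connect the branch vertices strongly. -/
theorem Good.bstrong (h : L.Good) {SU SD SN : ℕ → Prop} (hs : L.Strong SU SD SN) {c : ℕ → ℕ}
    (hcU : ∀ x, 0 < x → x < L.n → L.br x = 1 → (∀ v, L.Ch v → L.bot v = x → SU v) →
      c x = 0 ∨ c x = 2)
    (hcD : ∀ x, 0 < x → x < L.n → L.br x = 1 → (∀ v, L.Ch v → L.bot v = x → SD v) →
      c x = 1 ∨ c x = 2) : L.BStrong c SN := by
  have key : ∀ a b, a < L.n → L.br a = 1 → b < L.n → L.br b = 1 →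
      Relation.ReflTransGen (L.BArc c SN) a b := by
    intro a b ha hab hb hbb
    let Z : ℕ → Prop := fun z => Relation.ReflTransGen (L.BArc c SN) a z
    -- `F` extends the set `Z` of branch vertices reached from `a` to the chains so that no selected
    -- arc leaves it. With the lower end in `Z`, it takes the whole chain if the upper end is in `Z`
    -- too, and otherwise the part below the highest missing upward arc. With only the upper end in
    -- `Z`, it takes the part above all missing downward arcs.
    let F : ℕ → Prop := fun v => (Z (L.bot v) ∧ (Z (L.par (L.topv (L.bot v))) ∨
        ∃ i, L.Ch i ∧ L.bot i = L.bot v ∧ ¬ SU i ∧ L.rk i ≤ L.rk v)) ∨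
      (¬ Z (L.bot v) ∧ Z (L.par (L.topv (L.bot v))) ∧
        ∀ j, L.Ch j → L.bot j = L.bot v → ¬ SD j → L.rk v < L.rk j)
    have hF : ∀ v, L.Ch v → L.br v = 1 → (F v ↔ Z v) := by
      intro v hv hbv
      have e := h.bot_br v hv.1 hv.2.1 hbv
      have hle : ∀ i, L.Ch i → L.bot i = v → L.rk i ≤ L.rk v := fun i hi hib => by
        rw [← hib]; exact (h.bot_spec i hi).2.2.1
      simp only [F, e]
      constructor
      · rintro (⟨h1, -⟩ | ⟨h1, h2, h3⟩)
        · exact h1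
        · have := hcD v hv.1 hv.2.1 hbv fun j hj hjb => by
            by_contra hsel
            have := h3 j hj hjb hsel
            have := hle j hj hjb
            omega
          exact h2.tail (Or.inr (Or.inl ⟨hv.1, hv.2.1, hbv, this, rfl⟩))
      · intro hz
        refine Or.inl ⟨hz, ?_⟩
        by_cases hall : ∀ v', L.Ch v' → L.bot v' = v → SU v'
        · exact Or.inl (hz.tail (Or.inl ⟨hv.1, hv.2.1, hbv, hcU v hv.1 hv.2.1 hbv hall, rfl⟩))
        · push Not at hall
          obtain ⟨i, hi, hib, hsel⟩ := hall
          exact Or.inr ⟨i, hi, hib, hsel, hle i hi hib⟩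
    let P : ℕ → Prop := fun v => if L.br v = 1 then Z v else F v
    have hPF : ∀ v, L.Ch v → (P v ↔ F v) := fun v hv => by
      by_cases hbv : L.br v = 1
      · simp only [P, if_pos hbv, hF v hv hbv]
      · simp only [P, if_neg hbv]
    have hP := h.cut hs P ?_ ?_ ?_ ha (h.br_act a ha hab) hb (h.br_act b hb hbb)
      (by simp only [P, if_pos hab]; exact .refl)
    · simpa only [P, if_pos hbb] using hP
    · intro v hv hsel hp
      rw [hPF v hv] at hp
      have hr := h.rk_par v hv.1 hv.2.1
      by_cases hb' : L.br (L.par v) = 1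
      · simp only [P, if_pos hb']
        have e := h.topv_eq v hv.1 hv.2.1 hv.2.2 hb'
        simp only [F, e] at hp
        rcases hp with ⟨-, h1 | ⟨i, hi, hib, hsi, hri⟩⟩ | ⟨-, h1, -⟩
        · exact h1
        · rcases hri.eq_or_lt with he | hl
          · obtain rfl := h.rk_inj _ _ hi.2.1 hv.2.1 he
            exact absurd hsel hsi
          · exact absurd hb' (h.order hi hv hib hl).1
        · exact h1
      · rw [hPF _ (h.par_ch hv hb')]
        simp only [F, h.bot_par hv hb'] at hp ⊢
        rcases hp with ⟨h1, h2 | ⟨i, hi, hib, hsi, hri⟩⟩ | ⟨h1, h2, h3⟩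
        · exact Or.inl ⟨h1, Or.inl h2⟩
        · refine Or.inl ⟨h1, Or.inr ⟨i, hi, hib, hsi, ?_⟩⟩
          rcases hri.eq_or_lt with he | hl
          · obtain rfl := h.rk_inj _ _ hi.2.1 hv.2.1 he
            exact absurd hsel hsi
          · exact (h.order hi hv hib hl).2
        · exact Or.inr ⟨h1, h2, fun j hj hjb hsj => hr.trans (h3 j hj hjb hsj)⟩
    · intro v hv hsel hp
      rw [hPF v hv]
      have hr := h.rk_par v hv.1 hv.2.1
      by_cases hb' : L.br (L.par v) = 1
      · simp only [P, if_pos hb'] at hp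
        have e := h.topv_eq v hv.1 hv.2.1 hv.2.2 hb'
        simp only [F, e]
        by_cases hz : Z (L.bot v)
        · exact Or.inl ⟨hz, Or.inl hp⟩
        · refine Or.inr ⟨hz, hp, fun j hj hjb hsj => ?_⟩
          by_contra hge
          rcases (not_lt.mp hge).eq_or_lt with he | hl
          · obtain rfl := h.rk_inj _ _ hj.2.1 hv.2.1 he
            exact absurd hsel hsj
          · exact absurd hb' (h.order hj hv hjb hl).1
      · rw [hPF _ (h.par_ch hv hb')] at hp
        simp only [F, h.bot_par hv hb'] at hp ⊢
        rcases hp with ⟨h1, h2 | ⟨i, hi, hib, hsi, hri⟩⟩ | ⟨h1, h2, h3⟩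
        · exact Or.inl ⟨h1, Or.inl h2⟩
        · exact Or.inl ⟨h1, Or.inr ⟨i, hi, hib, hsi, by omega⟩⟩
        · refine Or.inr ⟨h1, h2, fun j hj hjb hsj => ?_⟩
          have h3j := h3 j hj hjb hsj
          by_contra hge
          rcases (not_lt.mp hge).eq_or_lt with he | hl
          · obtain rfl := h.rk_inj _ _ hj.2.1 hv.2.1 he
            exact absurd hsel hsj
          · have := (h.order hj hv hjb hl).2
            omega
    · intro j hj hsel hp
      obtain ⟨-, h2, -, h4⟩ := h.arc_br j hj
      simp only [P, if_pos h2, if_pos h4] at hp ⊢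
      exact hp.tail (Or.inr (Or.inr ⟨j, hj, hsel, rfl, rfl⟩))
  exact fun v hv hb => ⟨key 0 v h.n_pos h.br_zero hv hb, key v 0 hv hb h.n_pos h.br_zero⟩

end Lay
end MinPAC

namespace MinPAC
namespace Lay
variable {L : Lay}

/-! #### Powers and costs -/

open Classical in
/-- The power that vertex `u` needs for the selected arcs. -/
noncomputable def pw (L : Lay) (SU SD SN : ℕ → Prop) (u : ℕ) : ℕ :=
  (if 0 < u ∧ SU u then L.wu u else 0) ⊔
    (((Finset.range L.n).sup fun v => if 0 < v ∧ L.par v = u ∧ SD v then L.wd v else 0) ⊔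
      (Finset.range L.na).sup fun j => if L.tt j = u ∧ SN j then L.ww j else 0)

/-- Powers are maxima and are handled through their upper bounds throughout; the loops that compute
them have invariants of this form. -/
theorem pw_le_iff {SU SD SN : ℕ → Prop} {u k : ℕ} : L.pw SU SD SN u ≤ k ↔
    (0 < u → SU u → L.wu u ≤ k) ∧ (∀ v, 0 < v → v < L.n → L.par v = u → SD v → L.wd v ≤ k) ∧
      ∀ j, j < L.na → L.tt j = u → SN j → L.ww j ≤ k := by
  unfold pw
  rw [sup_le_iff, sup_le_iff, Finset.sup_le_iff, Finset.sup_le_iff]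
  refine and_congr ?_ (and_congr ?_ ?_)
  · split_ifs with hc
    · exact ⟨fun h _ _ => h, fun h => h hc.1 hc.2⟩
    · exact ⟨fun _ h1 h2 => absurd ⟨h1, h2⟩ hc, fun _ => Nat.zero_le _⟩
  · simp only [Finset.mem_range]
    refine ⟨fun h v h0 hn hp hs => ?_, fun h v hn => ?_⟩
    · have := h v hn
      rwa [if_pos ⟨h0, hp, hs⟩] at this
    · split_ifs with hc
      · exact h v hc.1 hn hc.2.1 hc.2.2
      · exact Nat.zero_le _
  · simp only [Finset.mem_range]
    refine ⟨fun h v hn hp hs => ?_, fun h v hn => ?_⟩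
    · have := h v hn
      rwa [if_pos ⟨hp, hs⟩] at this
    · split_ifs with hc
      · exact h v hn hc.1 hc.2
      · exact Nat.zero_le _

theorem pw_le {SU SD SN SU' SD' SN' : ℕ → Prop} {u : ℕ} (hU : 0 < u → SU u → SU' u)
    (hD : ∀ v, 0 < v → v < L.n → L.par v = u → SD v → SD' v)
    (hN : ∀ j, j < L.na → L.tt j = u → SN j → SN' j) :
    L.pw SU SD SN u ≤ L.pw SU' SD' SN' u := by
  obtain ⟨h1, h2, h3⟩ := pw_le_iff.mp (le_refl (L.pw SU' SD' SN' u))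
  exact pw_le_iff.mpr ⟨fun h s => h1 h (hU h s), fun v h0 hn hp s => h2 v h0 hn hp (hD v h0 hn hp s),
    fun j hj ht s => h3 j hj ht (hN j hj ht s)⟩

theorem pw_congr {SU SD SN SU' SD' SN' : ℕ → Prop} {u : ℕ} (hU : 0 < u → (SU u ↔ SU' u))
    (hD : ∀ v, 0 < v → v < L.n → L.par v = u → (SD v ↔ SD' v))
    (hN : ∀ j, j < L.na → L.tt j = u → (SN j ↔ SN' j)) :
    L.pw SU SD SN u = L.pw SU' SD' SN' u :=
  le_antisymm (pw_le (fun h => (hU h).1) (fun v a b c => (hD v a b c).1) fun j a b => (hN j a b).1)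
    (pw_le (fun h => (hU h).2) (fun v a b c => (hD v a b c).2) fun j a b => (hN j a b).2)

/-- An inner vertex of a chain. -/
def Inner (L : Lay) (v : ℕ) : Prop := L.Ch v ∧ L.br v ≠ 1

theorem Good.not_inner_tt (h : L.Good) {j : ℕ} (hj : j < L.na) : ¬ L.Inner (L.tt j) :=
  fun hi => hi.2 (h.arc_br j hj).2.1

/-- Powers if all chains take option `o`. -/
noncomputable def powO (L : Lay) (mid : ℕ → ℕ) (o : ℕ) : ℕ → ℕ :=
  L.pw (L.selU mid fun _ => o) (L.selD mid fun _ => o) fun _ => False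

/-- The power of an inner vertex depends only on the option of its chain. -/
theorem Good.pw_inner (h : L.Good) (mid c : ℕ → ℕ) (SN : ℕ → Prop) {v : ℕ} (hv : L.Inner v) :
    L.pw (L.selU mid c) (L.selD mid c) SN v = L.powO mid (c (L.bot v)) v := by
  refine pw_congr (fun _ => Iff.rfl) (fun u h0 hn hp => ?_) fun j hj ht =>
    absurd (ht ▸ hv) (h.not_inner_tt hj)
  unfold selD
  by_cases ha : L.act u = 1
  · rw [← h.bot_par ⟨h0, hn, ha⟩ (hp ▸ hv.2), hp]
  · simp [ha]

open Classical in
/-- The cost of the inner vertices of the chain of `x` under option `o`. -/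
noncomputable def ic (L : Lay) (mid : ℕ → ℕ) (o x : ℕ) : ℕ :=
  ∑ v ∈ (Finset.range L.n).filter fun v => L.Inner v ∧ L.bot v = x, L.powO mid o v

/-- The branch vertices other than the root. -/
def Br (L : Lay) (x : ℕ) : Prop := 0 < x ∧ x < L.n ∧ L.br x = 1

theorem Good.bot_Br (h : L.Good) {v : ℕ} (hv : L.Ch v) : L.Br (L.bot v) :=
  ⟨(h.bot_spec v hv).1.1, (h.bot_spec v hv).1.2.1, (h.bot_spec v hv).2.1⟩

open Classical in
/-- The cost of a choice of options, up to a constant. -/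
noncomputable def val (L : Lay) (mid c : ℕ → ℕ) (SN : ℕ → Prop) : ℕ :=
  ∑ v ∈ (Finset.range L.n).filter (fun v => L.br v = 1), L.pw (L.selU mid c) (L.selD mid c) SN v +
    ∑ x ∈ (Finset.range L.n).filter L.Br, L.ic mid (c x) x

open Classical in
theorem Good.sum_inner (h : L.Good) (f : ℕ → ℕ) :
    ∑ v ∈ (Finset.range L.n).filter L.Inner, f v = ∑ x ∈ (Finset.range L.n).filter L.Br,
      ∑ v ∈ (Finset.range L.n).filter (fun v => L.Inner v ∧ L.bot v = x), f v := by
  rw [← Finset.sum_fiberwise_of_maps_to (s := (Finset.range L.n).filter L.Inner)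
    (t := (Finset.range L.n).filter L.Br) (g := L.bot)]
  · refine Finset.sum_congr rfl fun x _ => ?_
    rw [Finset.filter_filter]
  · intro v hv
    simp only [Finset.mem_filter, Finset.mem_range] at hv ⊢
    exact ⟨(h.bot_Br hv.2.1).2.1, h.bot_Br hv.2.1⟩

open Classical in
theorem Good.sum_split (h : L.Good) (f : ℕ → ℕ) : ∑ v ∈ Finset.range L.n, f v =
    ∑ v ∈ (Finset.range L.n).filter (fun v => L.br v = 1), f v +
      ∑ v ∈ (Finset.range L.n).filter L.Inner, f v +
      ∑ v ∈ (Finset.range L.n).filter (fun v => L.act v ≠ 1), f v := by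
  rw [← Finset.sum_filter_add_sum_filter_not (Finset.range L.n) fun v => L.act v ≠ 1,
    ← Finset.sum_filter_add_sum_filter_not ((Finset.range L.n).filter fun v => ¬ L.act v ≠ 1)
      fun v => L.br v = 1, Finset.filter_filter, Finset.filter_filter, add_comm]
  congr 2
  · refine Finset.sum_congr (Finset.filter_congr fun v hv => ?_) fun _ _ => rfl
    have := h.br_act v (Finset.mem_range.mp hv)
    tauto
  · refine Finset.sum_congr (Finset.filter_congr fun v hv => ?_) fun _ _ => rfl
    have hv' := Finset.mem_range.mp hv
    unfold Inner Ch
    have : v = 0 → L.br v = 1 := fun h0 => h0 ▸ h.br_zero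
    rcases Nat.eq_zero_or_pos v with h0 | h0
    · have := this h0
      tauto
    · tauto

open Classical in
/-- The total power is the cost of the options plus a constant. -/
theorem Good.sum_pw (h : L.Good) (mid c : ℕ → ℕ) (SN : ℕ → Prop) :
    ∑ v ∈ Finset.range L.n, L.pw (L.selU mid c) (L.selD mid c) SN v = L.val mid c SN +
      ∑ v ∈ (Finset.range L.n).filter (fun v => L.act v ≠ 1),
        L.pw (fun _ => True) (fun _ => True) (fun _ => False) v := by
  rw [h.sum_split, h.sum_inner, val]
  congr 1
  · congr 1
    refine Finset.sum_congr rfl fun x _ => Finset.sum_congr rfl fun v hv => ?_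
    rw [Finset.mem_filter] at hv
    rw [h.pw_inner mid c SN hv.2.1, hv.2.2]
  · refine Finset.sum_congr rfl fun v hv => ?_
    rw [Finset.mem_filter] at hv
    refine pw_congr (fun _ => ?_) (fun u h0 hn hp => ?_) fun j hj ht => ?_
    · simp [selU, hv.2]
    · have : L.act u ≠ 1 := fun ha => hv.2 (hp ▸ h.act_par u h0 hn ha)
      simp [selD, this]
    · exact absurd (h.br_act _ (h.arc_br j hj).1 (h.arc_br j hj).2.1) (ht ▸ hv.2)

/-! #### The best inner break -/

/-- `k` and its parent are inner vertices of the same chain. -/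
def Cand (L : Lay) (k : ℕ) : Prop := L.Inner k ∧ L.br (L.par k) ≠ 1

/-- What breaking the edge above `k` saves at the two ends. -/
noncomputable def sav (L : Lay) (mid : ℕ → ℕ) (k : ℕ) : ℕ :=
  (L.powO mid 2 k - L.powO mid 1 k) + (L.powO mid 2 (L.par k) - L.powO mid 0 (L.par k))

/-- A chain without candidates puts no condition on `mid`. As `sav` involves only options `0`, `1`
and `2`, it does not itself depend on `mid`. -/
def MidOpt (L : Lay) (mid : ℕ → ℕ) : Prop :=
  ∀ k, L.Cand k → L.Cand (mid (L.bot k)) ∧ L.bot (mid (L.bot k)) = L.bot k ∧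
    L.sav mid k ≤ L.sav mid (mid (L.bot k))

/-- Only option `5` consults `mid`, so the tables of the other options survive a change of `mid`. -/
theorem bk_congr_mid (mid mid' : ℕ → ℕ) {o : ℕ} (ho : o ≠ 5) (x : ℕ) :
    L.bk mid o x = L.bk mid' o x := by
  unfold bk
  simp [ho]

theorem powO_congr_mid (mid mid' : ℕ → ℕ) {o : ℕ} (ho : o ≠ 5) :
    L.powO mid o = L.powO mid' o := by
  unfold powO selU selD
  simp only [bk_congr_mid mid mid' ho]

open Classical in
/-- Breaking a chain above a candidate saves exactly `sav`. -/
theorem Good.ic_add_sav (h : L.Good) {mid : ℕ → ℕ} {k x : ℕ} (hk : L.Cand k) (hx : L.bot k = x)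
    (hm : mid x = k) : L.ic mid 5 x + L.sav mid k = L.ic mid 2 x := by
  have hp := h.par_ch hk.1.1 hk.2
  have hpb : L.bot (L.par k) = x := (h.bot_par hk.1.1 hk.2).trans hx
  have hne : L.par k ≠ k := fun e => by
    have := h.rk_par k hk.1.1.1 hk.1.1.2.1
    rw [e] at this
    omega
  set S := (Finset.range L.n).filter fun v => L.Inner v ∧ L.bot v = x with hS
  have hbk : L.bk mid 5 x = k := hm
  have mono : ∀ o, o < 3 → ∀ v, L.powO mid o v ≤ L.powO mid 2 v := fun o ho v => by
    refine pw_le (fun h0 hs => ?_) (fun u h0 hn hp hs => ?_) fun _ _ _ => id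
    · exact hs.imp id fun hs => ⟨by simp, by interval_cases o <;> exact hs.2⟩
    · exact hs.imp id fun hs => ⟨by simp, by interval_cases o <;> exact hs.2⟩
  -- With the edge above `k` broken, `k` loses its upward arc as under option `1`, while its parent
  -- loses the downward arc as under option `0`. All other inner vertices keep the power of option
  -- `2`.
  have hself : L.powO mid 5 k = L.powO mid 1 k := by
    refine pw_congr (fun _ => ?_) (fun u h0 hn hp' => ?_) fun _ _ _ => Iff.rfl
    · simp [selU, hk.1.1.2.2, hx, hbk]
    · by_cases ha : L.act u = 1
      · have hb : L.bot u = x := by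
          rw [← hx, ← hp', h.bot_par ⟨h0, hn, ha⟩ (hp' ▸ hk.1.2)]
        have h1 : L.bk mid 1 x ≠ u := bk_ne (by omega) ⟨h0, hn, ha⟩
        have h2 : k ≠ u := fun e => hne (by rw [← e] at hp'; exact hp')
        simp [selD, ha, hb, hbk, h1, h2]
      · simp [selD, ha]
  have hpar : L.powO mid 5 (L.par k) = L.powO mid 0 (L.par k) := by
    refine pw_congr (fun _ => ?_) (fun u h0 hn hp' => ?_) fun _ _ _ => Iff.rfl
    · have h1 : L.bk mid 0 x ≠ L.par k := bk_ne (by omega) hp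
      simp [selU, hp.2.2, hpb, hbk, h1, hne.symm]
    · by_cases ha : L.act u = 1
      · obtain ⟨c, hc, hcp, -, -, hu⟩ := h.child_ch hp hk.2
        obtain rfl : u = k := (hu u ⟨h0, hn, ha⟩ hp').trans (hu k hk.1.1 rfl).symm
        simp [selD, ha, hx, hbk]
      · simp [selD, ha]
  have hother : ∀ v ∈ S, v ≠ k → v ≠ L.par k → L.powO mid 5 v = L.powO mid 2 v := by
    intro v hv hvk hvp
    obtain ⟨-, ⟨hv1, hv2⟩, hvx⟩ := by simpa [hS] using hv
    refine pw_congr (fun _ => ?_) (fun u h0 hn hp' => ?_) fun _ _ _ => Iff.rfl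
    · have h1 : L.bk mid 2 x ≠ v := bk_ne (by omega) hv1
      simp [selU, hv1.2.2, hvx, hbk, h1, hvk.symm]
    · by_cases ha : L.act u = 1
      · have hb : L.bot u = x := by
          rw [← hvx, ← hp', h.bot_par ⟨h0, hn, ha⟩ (hp' ▸ hv2)]
        have h1 : L.bk mid 2 x ≠ u := bk_ne (by omega) ⟨h0, hn, ha⟩
        have h2 : k ≠ u := fun e => hvp (by rw [e, hp'])
        simp [selD, ha, hb, hbk, h1, h2]
      · simp [selD, ha]
  have hkS : k ∈ S := by
    simp only [hS, Finset.mem_filter, Finset.mem_range]; exact ⟨hk.1.1.2.1, hk.1, hx⟩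
  have hpS : L.par k ∈ S.erase k := by
    simp only [hS, Finset.mem_erase, Finset.mem_filter, Finset.mem_range]
    exact ⟨hne, hp.2.1, ⟨hp, hk.2⟩, hpb⟩
  unfold ic sav
  rw [← hS, ← Finset.add_sum_erase S _ hkS, ← Finset.add_sum_erase S _ hkS,
    ← Finset.add_sum_erase _ _ hpS, ← Finset.add_sum_erase _ _ hpS]
  have hsum : ((S.erase k).erase (L.par k)).sum (L.powO mid 5) =
      ((S.erase k).erase (L.par k)).sum (L.powO mid 2) := Finset.sum_congr rfl fun v hv =>
    hother v (Finset.mem_of_mem_erase (Finset.mem_of_mem_erase hv))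
      (Finset.ne_of_mem_erase (Finset.mem_of_mem_erase hv)) (Finset.ne_of_mem_erase hv)
  change L.powO mid 5 k + (L.powO mid 5 (L.par k) +
    ((S.erase k).erase (L.par k)).sum (L.powO mid 5)) + _ = L.powO mid 2 k + (L.powO mid 2 (L.par k) +
    ((S.erase k).erase (L.par k)).sum (L.powO mid 2))
  rw [hself, hpar, hsum]
  have := mono 1 (by omega) k
  have := mono 0 (by omega) (L.par k)
  omega

open Classical in
/-- Some choice of options is at least as good as a given strongly connected selection. -/
theorem Good.exists_options (h : L.Good) {mid : ℕ → ℕ} (hmid : L.MidOpt mid)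
    {SU SD SN : ℕ → Prop} (hs : L.Strong SU SD SN) :
    ∃ c : ℕ → ℕ, (∀ x, c x < 6) ∧ L.BStrong c SN ∧
      ∑ v ∈ Finset.range L.n, L.pw (L.selU mid c) (L.selD mid c) SN v ≤
        ∑ v ∈ Finset.range L.n, L.pw SU SD SN v := by
  let MU : ℕ → Prop := fun x => ∃ v, L.Ch v ∧ L.bot v = x ∧ ¬ SU v
  let MD : ℕ → Prop := fun x => ∃ v, L.Ch v ∧ L.bot v = x ∧ ¬ SD v
  let i : ℕ → ℕ := fun x => if hx : MU x then hx.choose else 0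
  have hi : ∀ x, MU x → L.Ch (i x) ∧ L.bot (i x) = x ∧ ¬ SU (i x) := fun x hx => by
    simp only [i, dif_pos hx]; exact hx.choose_spec
  -- `MU` and `MD` say that the chain lacks some upward or some downward arc. A direction that is
  -- incomplete on its own is dropped entirely; if both are incomplete, the option records where the
  -- one missing edge `i x` lies.
  let c : ℕ → ℕ := fun x => if MU x then (if MD x then (if i x = x then 3 else
    if i x = L.topv x then 4 else 5) else 1) else if MD x then 0 else 2
  -- With `m'` an inner break stays where the given selection has it, so the options select only
  -- arcs of that selection. The passage from `m'` to `mid` comes afterwards.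
  let m' : ℕ → ℕ := fun x => if c x = 5 then i x else mid x
  have c0 : ∀ x, c x = 0 → ¬ MU x ∧ MD x := fun x hx => by
    simp only [c] at hx; split_ifs at hx <;> first | (exfalso; omega) | (constructorm* _ ∧ _ <;> assumption)
  have c1 : ∀ x, c x = 1 → MU x ∧ ¬ MD x := fun x hx => by
    simp only [c] at hx; split_ifs at hx <;> first | (exfalso; omega) | (constructorm* _ ∧ _ <;> assumption)
  have c2 : ∀ x, c x = 2 → ¬ MU x ∧ ¬ MD x := fun x hx => by
    simp only [c] at hx; split_ifs at hx <;> first | (exfalso; omega) | (constructorm* _ ∧ _ <;> assumption)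
  have c3 : ∀ x, c x = 3 → MU x ∧ MD x ∧ i x = x := fun x hx => by
    simp only [c] at hx; split_ifs at hx <;> first | (exfalso; omega) | (constructorm* _ ∧ _ <;> assumption)
  have c4 : ∀ x, c x = 4 → MU x ∧ MD x ∧ i x = L.topv x := fun x hx => by
    simp only [c] at hx; split_ifs at hx <;> first | (exfalso; omega) | (constructorm* _ ∧ _ <;> assumption)
  have c5 : ∀ x, c x = 5 → MU x ∧ MD x ∧ i x ≠ x ∧ i x ≠ L.topv x := fun x hx => by
    simp only [c] at hx; split_ifs at hx <;> first | (exfalso; omega) | (constructorm* _ ∧ _ <;> assumption)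
  have c6 : ∀ x, c x < 6 := fun x => by simp only [c]; split_ifs <;> omega
  -- the broken edge is the missing one
  have hbk : ∀ x, 3 ≤ c x → MU x ∧ MD x ∧ L.bk m' (c x) x = i x := fun x hx => by
    have := c6 x
    obtain hc | hc | hc : c x = 3 ∨ c x = 4 ∨ c x = 5 := by omega
    · obtain ⟨h1, h2, h3⟩ := c3 x hc
      exact ⟨h1, h2, by rw [hc, h3]; rfl⟩
    · obtain ⟨h1, h2, h3⟩ := c4 x hc
      exact ⟨h1, h2, by rw [hc, h3]; rfl⟩
    · obtain ⟨h1, h2, -⟩ := c5 x hc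
      exact ⟨h1, h2, by rw [hc]; simp [bk, m', hc]⟩
  have hmiss : ∀ x, MU x → MD x → (∀ v, L.Ch v → L.bot v = x → ¬ SU v → v = i x) ∧
      ∀ v, L.Ch v → L.bot v = x → ¬ SD v → v = i x := by
    rintro x hu ⟨d, hd1, hd2, hd3⟩
    obtain ⟨hi1, hi2, hi3⟩ := hi x hu
    have e := h.missing_eq hs hi1 hd1 (hi2.trans hd2.symm) hi3 hd3
    refine ⟨fun v hv hb hsel => ?_, fun v hv hb hsel => ?_⟩
    · exact (h.missing_eq hs hv hd1 (hb.trans hd2.symm) hsel hd3).trans e.symm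
    · exact (h.missing_eq hs hi1 hv (hi2.trans hb.symm) hi3 hsel).symm
  have subU : ∀ v, 0 < v → v < L.n → L.selU m' c v → SU v := by
    rintro v h0 hn (ha | ⟨h1, h2⟩)
    · exact (h.inactive hs h0 hn ha).1
    · by_contra hsel
      by_cases ha : L.act v = 1
      · have hv : L.Ch v := ⟨h0, hn, ha⟩
        have hmu : MU (L.bot v) := ⟨v, hv, rfl, hsel⟩
        have h3 : 3 ≤ c (L.bot v) := by
          by_contra hlt
          obtain hc | hc : c (L.bot v) = 0 ∨ c (L.bot v) = 2 := by omega
          exacts [(c0 _ hc).1 hmu, (c2 _ hc).1 hmu]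
        obtain ⟨-, hmd, he⟩ := hbk _ h3
        exact h2 (he.trans ((hmiss _ hmu hmd).1 v hv rfl hsel).symm)
      · exact hsel (h.inactive hs h0 hn ha).1
  have subD : ∀ v, 0 < v → v < L.n → L.selD m' c v → SD v := by
    rintro v h0 hn (ha | ⟨h1, h2⟩)
    · exact (h.inactive hs h0 hn ha).2
    · by_contra hsel
      by_cases ha : L.act v = 1
      · have hv : L.Ch v := ⟨h0, hn, ha⟩
        have hmd : MD (L.bot v) := ⟨v, hv, rfl, hsel⟩
        have h3 : 3 ≤ c (L.bot v) := by
          by_contra hlt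
          obtain hc | hc : c (L.bot v) = 1 ∨ c (L.bot v) = 2 := by omega
          exacts [(c1 _ hc).2 hmd, (c2 _ hc).2 hmd]
        obtain ⟨hmu, -, he⟩ := hbk _ h3
        exact h2 (he.trans ((hmiss _ hmu hmd).2 v hv rfl hsel).symm)
      · exact hsel (h.inactive hs h0 hn ha).2
  refine ⟨c, c6, h.bstrong hs (fun x h0 hn hb hall => ?_) (fun x h0 hn hb hall => ?_), ?_⟩
  · have hmu : ¬ MU x := fun ⟨v, h1, h2, h3⟩ => h3 (hall v h1 h2)
    simp only [c, if_neg hmu]; split_ifs <;> tauto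
  · have hmd : ¬ MD x := fun ⟨v, h1, h2, h3⟩ => h3 (hall v h1 h2)
    simp only [c, if_neg hmd]; split_ifs <;> tauto
  refine le_trans ?_ (Finset.sum_le_sum fun v _ => pw_le (SU := L.selU m' c) (SD := L.selD m' c)
    (SN := SN) (fun h0 hsel => ?_) (fun u h0 hn _ hsel => subD u h0 hn hsel) fun _ _ _ => id)
  swap
  · exact subU v h0 (Finset.mem_range.mp ‹_›) hsel
  rw [h.sum_pw, h.sum_pw]
  -- Moving the inner breaks from `m'` to `mid` does not raise the power of any branch vertex, since
  -- both ends of the edge that `m'` breaks are inner, and on each chain it saves at least as much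
  -- by `MidOpt`.
  refine Nat.add_le_add_right (Nat.add_le_add (Finset.sum_le_sum fun v hv => ?_)
    (Finset.sum_le_sum fun x hx => ?_)) _
  · rw [Finset.mem_filter] at hv
    have cand_bk : ∀ x, c x = 5 → L.Cand (L.bk m' (c x) x) := fun x hc => by
      rw [(hbk x (by omega)).2.2]
      obtain ⟨h1, -, h3, h4⟩ := c5 _ hc
      obtain ⟨hi1, hi2, -⟩ := hi _ h1
      exact ⟨⟨hi1, fun hb => h3 (by rw [← h.bot_br _ hi1.1 hi1.2.1 hb, hi2])⟩, fun hb => h4 (by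
        rw [← h.topv_eq _ hi1.1 hi1.2.1 hi1.2.2 hb, hi2])⟩
    refine pw_le (fun h0 => Or.imp id fun hsel => ⟨hsel.1, fun e => ?_⟩)
      (fun u h0 hn hp => Or.imp id fun hsel => ⟨hsel.1, fun e => ?_⟩) fun _ _ _ => id
    · by_cases hc : c (L.bot v) = 5
      · have hcd := cand_bk _ hc
        rw [e] at hcd
        exact hcd.1.2 hv.2
      · exact hsel.2 (by rw [← bk_congr_mid m' mid hc, e])
    · by_cases hc : c (L.bot u) = 5
      · have hcd := cand_bk _ hc
        rw [e] at hcd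
        exact hcd.2 (hp ▸ hv.2)
      · exact hsel.2 (by rw [← bk_congr_mid m' mid hc, e])
  · by_cases hc : c x = 5
    · obtain ⟨h1, -, h3, h4⟩ := c5 _ hc
      obtain ⟨hi1, hi2, -⟩ := hi _ h1
      have hcd : L.Cand (i x) := ⟨⟨hi1, fun hb => h3 (by
        rw [← h.bot_br _ hi1.1 hi1.2.1 hb, hi2])⟩, fun hb => h4 (by
        rw [← h.topv_eq _ hi1.1 hi1.2.1 hi1.2.2 hb, hi2])⟩
      obtain ⟨m1, m2, m3⟩ := hmid _ hcd
      rw [hi2] at m1 m2 m3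
      have e1 := h.ic_add_sav m1 m2 rfl
      have e2 := h.ic_add_sav (mid := m') hcd hi2 (by simp [m', hc])
      have e3 : L.ic m' 2 x = L.ic mid 2 x := by
        unfold ic; rw [powO_congr_mid m' mid (by omega)]
      have e4 : L.sav m' (i x) = L.sav mid (i x) := by
        unfold sav; rw [powO_congr_mid m' mid (o := 2) (by omega),
          powO_congr_mid m' mid (o := 1) (by omega), powO_congr_mid m' mid (o := 0) (by omega)]
      rw [hc]
      omega
    · have := c6 x
      unfold ic
      rw [powO_congr_mid mid m' hc]

end Lay
end MinPAC

namespace MinPAC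
namespace Lay
variable {L : Lay}

/-! ### Branch vertices: their powers and their number -/

theorem Good.bk_bot (h : L.Good) {x : ℕ} (hx : L.Br x) : L.Ch x ∧ L.bot x = x :=
  ⟨⟨hx.1, hx.2.1, h.br_act x hx.2.1 hx.2.2⟩, h.bot_br x hx.1 hx.2.1 hx.2.2⟩

/-- The power of a branch vertex. -/
theorem Good.pw_branch_le_iff (h : L.Good) (mid c : ℕ → ℕ) (SN : ℕ → Prop) {v : ℕ} (hn : v < L.n)
    (hv : L.br v = 1) (k : ℕ) : L.pw (L.selU mid c) (L.selD mid c) SN v ≤ k ↔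
      (∀ u, 0 < u → u < L.n → L.par u = v → L.act u ≠ 1 → L.wd u ≤ k) ∧
      (∀ x, L.Br x → (x = v → c x ≠ 1 → L.bk mid (c x) x ≠ x → L.wu x ≤ k) ∧
        (L.par (L.topv x) = v → c x ≠ 0 → L.bk mid (c x) x ≠ L.topv x → L.wd (L.topv x) ≤ k)) ∧
      ∀ j, j < L.na → L.tt j = v → SN j → L.ww j ≤ k := by
  rw [pw_le_iff]
  constructor
  · rintro ⟨h1, h2, h3⟩
    refine ⟨fun u h0 hu hp ha => h2 u h0 hu hp (Or.inl ha), fun x hx => ⟨?_, fun hp h4 h5 => ?_⟩, h3⟩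
    · rintro rfl h4 h5
      exact h1 hx.1 (Or.inr (by rw [(h.bk_bot hx).2]; exact ⟨h4, h5⟩))
    · obtain ⟨hxc, hxb⟩ := h.bk_bot hx
      obtain ⟨t1, t2, t3⟩ := h.topv_spec x hxc
      rw [hxb] at t1 t2 t3
      exact h2 _ t1.1 t1.2.1 hp (Or.inr (by rw [t3]; exact ⟨h4, h5⟩))
  · rintro ⟨h1, h2, h3⟩
    refine ⟨fun h0 hs => ?_, fun u h0 hu hp hs => ?_, h3⟩
    · have hb : L.Br v := ⟨h0, hn, hv⟩
      have hs' := hs.resolve_left (not_not.mpr (h.br_act v hn hv))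
      rw [(h.bk_bot hb).2] at hs'
      exact (h2 v hb).1 rfl hs'.1 hs'.2
    · by_cases ha : L.act u = 1
      · have hc : L.Ch u := ⟨h0, hu, ha⟩
        have hs' := hs.resolve_left (not_not.mpr ha)
        have ht := h.topv_eq u h0 hu ha (hp ▸ hv)
        have := (h2 _ (h.bot_Br hc)).2
        rw [ht] at this
        exact this hp hs'.1 hs'.2
      · exact h1 u h0 hu hp ha

/-- The set of further arcs that the assignment `A` selects. -/
def arcs (L : Lay) (A : ℕ → ℕ) (j : ℕ) : Prop := A (L.n + j) = 0

/-- The assignments agree where it matters. -/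
def Agree (L : Lay) (A A' : ℕ → ℕ) : Prop :=
  (∀ x, L.Br x → A x = A' x) ∧ ∀ j, j < L.na → A (L.n + j) = A' (L.n + j)

theorem Good.pw_sel_congr (h : L.Good) {mid c c' : ℕ → ℕ} {SN SN' : ℕ → Prop} (hc : ∀ x, L.Br x → c x = c' x)
    (hN : ∀ j, j < L.na → (SN j ↔ SN' j)) {v : ℕ} (hn : v < L.n) :
    L.pw (L.selU mid c) (L.selD mid c) SN v = L.pw (L.selU mid c') (L.selD mid c') SN' v := by
  refine pw_congr (fun h0 => ?_) (fun u h0 hu hp => ?_) fun j hj _ => hN j hj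
  · unfold selU
    by_cases ha : L.act v = 1
    · rw [hc _ (h.bot_Br ⟨h0, hn, ha⟩)]
    · simp [ha]
  · unfold selD
    by_cases ha : L.act u = 1
    · rw [hc _ (h.bot_Br ⟨h0, hu, ha⟩)]
    · simp [ha]

theorem Agree.arcs_iff {A A' : ℕ → ℕ} (hA : L.Agree A A') (j : ℕ) (hj : j < L.na) :
    L.arcs A j ↔ L.arcs A' j := by
  unfold arcs; rw [hA.2 j hj]

theorem Good.pw_agree (h : L.Good) {mid A A' : ℕ → ℕ} (hA : L.Agree A A') {v : ℕ} (hn : v < L.n) :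
    L.pw (L.selU mid A) (L.selD mid A) (L.arcs A) v =
      L.pw (L.selU mid A') (L.selD mid A') (L.arcs A') v :=
  h.pw_sel_congr hA.1 hA.arcs_iff hn

open Classical in
theorem Good.val_agree (h : L.Good) {mid A A' : ℕ → ℕ} (hA : L.Agree A A') :
    L.val mid A (L.arcs A) = L.val mid A' (L.arcs A') := by
  unfold val
  congr 1
  · refine Finset.sum_congr rfl fun v hv => ?_
    exact h.pw_agree hA (Finset.mem_range.mp (Finset.mem_filter.mp hv).1)
  · refine Finset.sum_congr rfl fun x hx => ?_
    rw [hA.1 x (Finset.mem_filter.mp hx).2]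

theorem BStrong.congr {c c' : ℕ → ℕ} {SN SN' : ℕ → Prop} (hc : ∀ x, L.Br x → c x = c' x)
    (hN : ∀ j, j < L.na → (SN j ↔ SN' j)) (hs : L.BStrong c SN) : L.BStrong c' SN' := by
  have : ∀ x y, L.BArc c SN x y → L.BArc c' SN' x y := by
    rintro x y (⟨h1, h2, h3, h4, h5⟩ | ⟨h1, h2, h3, h4, h5⟩ | ⟨j, h1, h2, h3⟩)
    · exact Or.inl ⟨h1, h2, h3, by rwa [← hc x ⟨h1, h2, h3⟩], h5⟩
    · exact Or.inr (Or.inl ⟨h1, h2, h3, by rwa [← hc y ⟨h1, h2, h3⟩], h5⟩)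
    · exact Or.inr (Or.inr ⟨j, h1, (hN j h1).mp h2, h3⟩)
  exact fun v hv hb => ⟨Relation.ReflTransGen.mono this _ _ (hs v hv hb).1,
    Relation.ReflTransGen.mono this _ _ (hs v hv hb).2⟩

theorem BStrong.agree {A A' : ℕ → ℕ} (hA : L.Agree A A') (hs : L.BStrong A (L.arcs A)) :
    L.BStrong A' (L.arcs A') :=
  hs.congr hA.1 hA.arcs_iff

open Classical in
/-- There are few branch vertices. -/
theorem Pre.card_br_le (h : L.Pre) : ((Finset.range L.n).filter L.Br).card ≤ 4 * L.na := by
  set R := Finset.range L.n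
  let Tm : ℕ → Prop := fun v => ∃ j, j < L.na ∧ (L.tt j = v ∨ L.hh j = v)
  have hT : (R.filter fun v => L.Br v ∧ Tm v).card ≤ 2 * L.na := by
    calc _ ≤ ((Finset.range L.na).image L.tt ∪ (Finset.range L.na).image L.hh).card := by
          refine Finset.card_le_card fun v hv => ?_
          obtain ⟨-, -, j, hj, hjv⟩ := by simpa using hv
          simp only [Finset.mem_union, Finset.mem_image, Finset.mem_range]
          exact hjv.imp (fun e => ⟨j, hj, e⟩) fun e => ⟨j, hj, e⟩
      _ ≤ _ := (Finset.card_union_le _ _).trans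
          (Nat.add_le_add Finset.card_image_le Finset.card_image_le)
      _ = _ := by rw [Finset.card_range]; omega
  let S := R.filter L.Ch
  -- Active vertices other than the root are counted by their parents. Inner vertices have at least
  -- one active child, and branch vertices that are no end of a further arc have at least two. So
  -- the latter are at most as many as the branch vertices that are ends, of which there are at most
  -- `2 * L.na`.
  have h1 : ∑ v ∈ S, (S.filter fun c => L.par c = v).card ≤ S.card := by
    rw [Finset.card_eq_sum_card_fiberwise (f := L.par) (s := S) (t := R)]
    · exact Finset.sum_le_sum_of_subset (Finset.filter_subset _ _)
    · intro v hv
      have hv' : v < L.n ∧ L.Ch v := by simpa [S, R] using hv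
      simpa [R] using h.par_lt v hv'.2.1 hv'.1
  have split : ∀ f : ℕ → ℕ, ∑ v ∈ S, f v = ∑ v ∈ R.filter L.Inner, f v +
      (∑ v ∈ R.filter (fun v => L.Br v ∧ Tm v), f v + ∑ v ∈ R.filter (fun v => L.Br v ∧ ¬ Tm v), f v) := by
    intro f
    rw [← Finset.sum_filter_add_sum_filter_not S fun v => L.br v ≠ 1,
      ← Finset.sum_filter_add_sum_filter_not (S.filter fun v => ¬ L.br v ≠ 1) Tm]
    simp only [S, Finset.filter_filter]
    have hbr : ∀ v ∈ R, (L.Ch v ∧ ¬ L.br v ≠ 1 ↔ L.Br v) := fun v hv => by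
      have := h.br_act v (Finset.mem_range.mp hv)
      unfold Ch Br; tauto
    refine congrArg₂ _ (Finset.sum_congr (by ext; simp [Inner]) fun _ _ => rfl) (congrArg₂ _ ?_ ?_)
    · refine Finset.sum_congr (Finset.filter_congr fun v hv => ?_) fun _ _ => rfl
      rw [hbr v hv]
    · refine Finset.sum_congr (Finset.filter_congr fun v hv => ?_) fun _ _ => rfl
      rw [hbr v hv]
  have h2 : (R.filter L.Inner).card ≤ ∑ v ∈ R.filter L.Inner, (S.filter fun c => L.par c = v).card := by
    rw [Finset.card_eq_sum_ones]
    refine Finset.sum_le_sum fun v hv => ?_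
    have hv' : v < L.n ∧ L.Inner v := by simpa [R] using hv
    obtain ⟨c, hc, hp, -⟩ := h.child_ch hv'.2.1 hv'.2.2
    exact Finset.card_pos.mpr ⟨c, by simp [S, R, hc, hp, hc.2.1]⟩
  have h3 : 2 * (R.filter fun v => L.Br v ∧ ¬ Tm v).card ≤
      ∑ v ∈ R.filter (fun v => L.Br v ∧ ¬ Tm v), (S.filter fun c => L.par c = v).card := by
    rw [Finset.card_eq_sum_ones, Finset.mul_sum]
    refine Finset.sum_le_sum fun v hv => ?_
    have hv' : v < L.n ∧ L.Br v ∧ ¬ Tm v := by simpa [R] using hv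
    obtain ⟨c, c', hne, ⟨a1, a2, a3, a4⟩, b1, b2, b3, b4⟩ :=
      (h.br_cause v hv'.2.1.1 hv'.1 hv'.2.1.2.2).resolve_left hv'.2.2
    exact Finset.one_lt_card.mpr ⟨c, by simp [S, R, Ch, a1, a2, a3, a4], c',
      by simp [S, R, Ch, b1, b2, b3, b4], hne⟩
  have h4 := split fun _ => 1
  have h5 := split fun v => (S.filter fun c => L.par c = v).card
  simp only [← Finset.card_eq_sum_ones] at h4
  have h6 : (R.filter L.Br).card = (R.filter fun v => L.Br v ∧ Tm v).card +
      (R.filter fun v => L.Br v ∧ ¬ Tm v).card := by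
    rw [← Finset.card_filter_add_card_filter_not (s := R.filter L.Br) Tm, Finset.filter_filter,
      Finset.filter_filter]
  omega

end Lay

/-! ### The feedback edge number -/

/-- A forest extends to a spanning tree of the complete graph. -/
theorem card_edgeSet_lt_of_isAcyclic {V : Type*} [Finite V] [Nonempty V] {H : SimpleGraph V}
    (h : H.IsAcyclic) : H.edgeSet.ncard < Nat.card V := by
  obtain ⟨F, hF, -, hT⟩ :=
    (SimpleGraph.connected_top (V := V)).exists_isTree_le_of_le_of_isAcyclic le_top h
  have h1 := (SimpleGraph.isTree_iff_connected_and_card.mp hT).2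
  have h2 : H.edgeSet.ncard ≤ F.edgeSet.ncard :=
    Set.ncard_le_ncard (SimpleGraph.edgeSet_mono hF) (Set.toFinite _)
  rw [Nat.card_coe_set_eq] at h1
  omega

/-- At most `2 g` arcs of a connected digraph are neither loops nor parallel to an arc of a given
spanning tree. -/
theorem card_nontree_le {n : ℕ} (hn : 0 < n) (G : Digraph (Fin n)) (par : Fin n → Fin n)
    (rk : Fin n → ℕ) (root : Fin n) (hrk : ∀ v, v ≠ root → rk (par v) < rk v)
    (htree : ∀ v, v ≠ root → G.Adj (par v) v) (S : Finset (Fin n × Fin n))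
    (hS : ∀ a ∈ S, G.Adj a.1 a.2 ∧ a.1 ≠ a.2 ∧ (a.1 ≠ root → par a.1 ≠ a.2) ∧
      (a.2 ≠ root → par a.2 ≠ a.1)) : S.card ≤ 2 * feedbackEdgeNumber G := by
  classical
  have : Nonempty (Fin n) := ⟨root⟩
  set U := G.toSimpleGraphInclusive with hU
  have adj : ∀ u v, G.Adj u v → u ≠ v → U.Adj u v := fun u v h hne => ⟨hne, Or.inl h⟩
  obtain ⟨F, hF1, hF2, hF3⟩ : feedbackEdgeNumber G ∈ {k | ∃ F : Finset (Sym2 (Fin n)),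
      (F : Set (Sym2 (Fin n))) ⊆ U.edgeSet ∧ F.card = k ∧
      (U.deleteEdges (F : Set (Sym2 (Fin n)))).IsAcyclic} := by
    refine Nat.sInf_mem ⟨_, U.edgeFinset, by simp, rfl, ?_⟩
    have : U.deleteEdges (U.edgeFinset : Set (Sym2 (Fin n))) = ⊥ := by simp
    rw [this]
    exact SimpleGraph.isAcyclic_bot
  have h1 := card_edgeSet_lt_of_isAcyclic hF3
  rw [SimpleGraph.edgeSet_deleteEdges, Nat.card_eq_fintype_card, Fintype.card_fin] at h1
  have h2 : U.edgeSet.ncard = (U.edgeSet \ F).ncard + F.card := by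
    rw [← Set.ncard_coe_finset F, Set.ncard_sdiff_add_ncard_of_subset hF1]
  -- The `n - 1` tree edges and the edges under `S` are disjoint, while all but `F.card` edges form
  -- a forest. So at most `F.card` edges lie under `S`, and each carries at most two arcs, one in
  -- each direction.
  let TE : Finset (Sym2 (Fin n)) := (Finset.univ.erase root).image fun v => s(par v, v)
  have hTE : TE.card = n - 1 := by
    rw [Finset.card_image_of_injOn, Finset.card_erase_of_mem (Finset.mem_univ _),
      Finset.card_univ, Fintype.card_fin]
    intro u hu v hv huv
    have hu' : u ≠ root := by simpa using hu
    have hv' : v ≠ root := by simpa using hv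
    have r1 := hrk u hu'
    have r2 := hrk v hv'
    rcases Sym2.eq_iff.mp huv with ⟨-, e⟩ | ⟨e1, e2⟩
    · exact e
    · change par u = v at e1
      change u = par v at e2
      rw [e1] at r1
      rw [← e2] at r2
      omega
  let NE : Finset (Sym2 (Fin n)) := S.image fun a => s(a.1, a.2)
  have hdisj : Disjoint NE TE := by
    rw [Finset.disjoint_left]
    intro e he ht
    obtain ⟨a, ha, rfl⟩ := Finset.mem_image.mp he
    obtain ⟨v, hv, hve⟩ := Finset.mem_image.mp ht
    have hv' : v ≠ root := by simpa using hv
    obtain ⟨-, -, s3, s4⟩ := hS a ha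
    rcases Sym2.eq_iff.mp hve with ⟨e1, e2⟩ | ⟨e1, e2⟩
    · exact s4 (e2 ▸ hv') (e2 ▸ e1)
    · exact s3 (e2 ▸ hv') (e2 ▸ e1)
  have hsub : ((NE ∪ TE : Finset (Sym2 (Fin n))) : Set (Sym2 (Fin n))) ⊆ U.edgeSet := by
    intro e he
    rcases Finset.mem_union.mp (Finset.mem_coe.mp he) with he | he
    · obtain ⟨a, ha, rfl⟩ := Finset.mem_image.mp he
      exact adj _ _ (hS a ha).1 (hS a ha).2.1
    · obtain ⟨v, hv, rfl⟩ := Finset.mem_image.mp he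
      have hv' : v ≠ root := by simpa using hv
      exact adj _ _ (htree v hv') fun e => by
        have := hrk v hv'
        rw [show par v = v from e] at this
        omega
  have h3 := Set.ncard_le_ncard hsub (Set.toFinite _)
  rw [Set.ncard_coe_finset, Finset.card_union_of_disjoint hdisj, hTE] at h3
  have h4 : S.card ≤ 2 * NE.card := by
    refine Finset.card_le_mul_card_image (f := fun a : Fin n × Fin n => s(a.1, a.2)) S 2 fun e he => ?_
    obtain ⟨a, ha, rfl⟩ := Finset.mem_image.mp he
    refine (Finset.card_le_card (t := {a, a.swap}) fun c hc => ?_).trans Finset.card_le_two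
    have := (Finset.mem_filter.mp hc).2
    rcases Sym2.eq_iff.mp this with ⟨e1, e2⟩ | ⟨e1, e2⟩
    · simp [Prod.ext_iff, e1, e2]
    · simp [Prod.ext_iff, e1, e2]
  omega

/-! ### The program -/

notation "v_n" => (0 : ℕ)
notation "v_m" => (1 : ℕ)
notation "v_inf" => (2 : ℕ)
notation "v_i" => (3 : ℕ)
notation "v_k" => (4 : ℕ)
notation "v_p" => (5 : ℕ)
notation "v_q" => (6 : ℕ)
notation "v_a" => (7 : ℕ)
notation "v_t" => (8 : ℕ)
notation "v_h" => (9 : ℕ)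
notation "v_na" => (10 : ℕ)
notation "v_nb" => (11 : ℕ)
notation "v_x" => (12 : ℕ)
notation "v_o" => (13 : ℕ)
notation "v_z" => (15 : ℕ)
notation "v_bk" => (16 : ℕ)
notation "v_u" => (17 : ℕ)
notation "v_d" => (18 : ℕ)
notation "v_ch" => (19 : ℕ)
notation "v_ok" => (20 : ℕ)
notation "v_tot" => (21 : ℕ)
notation "v_best" => (22 : ℕ)
notation "v_fnd" => (23 : ℕ)
notation "v_done" => (24 : ℕ)
notation "v_K" => (25 : ℕ)
notation "v_c" => (26 : ℕ)
notation "v_ra" => (27 : ℕ)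

notation "a_in" => (0 : ℕ)
notation "a_T" => (1 : ℕ)
notation "a_H" => (2 : ℕ)
notation "a_W" => (3 : ℕ)
notation "a_nx" => (4 : ℕ)
notation "a_hd" => (5 : ℕ)
notation "a_Q" => (6 : ℕ)
notation "a_vis" => (7 : ℕ)
notation "a_par" => (8 : ℕ)
notation "a_rk" => (9 : ℕ)
notation "a_wd" => (10 : ℕ)
notation "a_wu" => (11 : ℕ)
notation "a_nt" => (12 : ℕ)
notation "a_tt" => (13 : ℕ)
notation "a_hh" => (14 : ℕ)
notation "a_ww" => (15 : ℕ)
notation "a_term" => (16 : ℕ)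
notation "a_cnt" => (17 : ℕ)
notation "a_cb" => (18 : ℕ)
notation "a_bot" => (19 : ℕ)
notation "a_act" => (20 : ℕ)
notation "a_br" => (21 : ℕ)
notation "a_BL" => (22 : ℕ)
notation "a_topv" => (23 : ℕ)
notation "a_dg" => (24 : ℕ)
notation "a_mid" => (25 : ℕ)
notation "a_bs" => (26 : ℕ)
notation "a_b" => (27 : ℕ)
notation "a_ep" => (28 : ℕ)
notation "a_fw" => (29 : ℕ)
notation "a_bw" => (30 : ℕ)
notation "a_RF" => (31 : ℕ)
notation "a_RT" => (32 : ℕ)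
notation "a_bd" => (33 : ℕ)
notation "a_IC" => (34 : ℕ)
notation "a_PF" => (35 : ℕ)
notation "a_P" => (40 : ℕ)

/-! ### Reading the arcs into lists by tail -/

open Ex Cm in
/-- Reads the arcs and links the arcs with the same tail. -/
def readArcs : Cm :=
  .for v_i 0 v_m
    (put a_T (var v_i) (get a_in (lit 2 +. (var v_i +. var v_i +. var v_i))) ;;
    put a_H (var v_i) (get a_in (lit 3 +. (var v_i +. var v_i +. var v_i))) ;;
    put a_W (var v_i) (get a_in (lit 4 +. (var v_i +. var v_i +. var v_i))) ;;
    -- In the end `v_inf` is one more than the total weight, which no solution costs; it stands in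
    -- for the weight of a missing upward tree arc.
    set v_inf (var v_inf +. get a_W (var v_i)) ;;
    put a_nx (var v_i) (get a_hd (get a_T (var v_i))) ;;
    put a_hd (get a_T (var v_i)) (var v_i +. lit 1)) ;;
  set v_inf (var v_inf +. lit 1)

/-- `p` is one more than the largest `j < k` with `T j = u`, or `0` if there is none. -/
def LastOcc (T : ℕ → ℕ) (u k p : ℕ) : Prop :=
  p ≤ k ∧ (0 < p → T (p - 1) = u) ∧ ∀ j, j < k → T j = u → j < p

/-- `a_hd` points to the last arc with a given tail and `a_nx` from an arc to the previous one with
the same tail. Pointers are shifted by one, so that `0` ends a list. This makes the search below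
linear without sorting the input. -/
theorem readArcs_spec {B b m : ℕ} {s : St} (hm : s.v v_m = m) (hi : s.v v_inf = 0)
    (hz : ∀ u, s.a a_hd u = 0) (hb : 3 * m + 4 < b) (hbB : b ≤ B)
    (hB : ∑ i ∈ Finset.range m, s.a a_in (4 + 3 * i) + 1 ≤ B) :
    Tr B b readArcs s (10 * m + 10) fun s' =>
      (∀ i, i < m → s'.a a_T i = s.a a_in (2 + 3 * i) ∧ s'.a a_H i = s.a a_in (3 + 3 * i) ∧
        s'.a a_W i = s.a a_in (4 + 3 * i)) ∧
      s'.v v_inf = ∑ i ∈ Finset.range m, s.a a_in (4 + 3 * i) + 1 ∧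
      (∀ u, LastOcc (s'.a a_T) u m (s'.a a_hd u)) ∧
      ∀ i, i < m → LastOcc (s'.a a_T) (s'.a a_T i) i (s'.a a_nx i) := by
  refine Tr.seq_wp (Q := fun s' => (∀ i, i < m → s'.a a_T i = s.a a_in (2 + 3 * i) ∧
      s'.a a_H i = s.a a_in (3 + 3 * i) ∧ s'.a a_W i = s.a a_in (4 + 3 * i)) ∧
      s'.v v_inf = ∑ i ∈ Finset.range m, s.a a_in (4 + 3 * i) ∧
      (∀ u, LastOcc (s'.a a_T) u m (s'.a a_hd u)) ∧
      ∀ i, i < m → LastOcc (s'.a a_T) (s'.a a_T i) i (s'.a a_nx i))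
    (Tr.for_wp (I := fun k s' => (∀ i, i < k → s'.a a_T i = s.a a_in (2 + 3 * i) ∧
      s'.a a_H i = s.a a_in (3 + 3 * i) ∧ s'.a a_W i = s.a a_in (4 + 3 * i)) ∧
      s'.v v_inf = ∑ i ∈ Finset.range k, s.a a_in (4 + 3 * i) ∧
      (∀ u, LastOcc (s'.a a_T) u k (s'.a a_hd u)) ∧
      ∀ i, i < k → LastOcc (s'.a a_T) (s'.a a_T i) i (s'.a a_nx i)) m rfl rfl rfl hm
      (by omega) (Nat.zero_le _) (by omega) ?_ ?_ fun s' _ h => h) ?_ (by simp [Cm.sz]; omega)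
  rotate_left 2
  · rintro s' - ⟨h1, h2, h3, h4⟩
    simp only [wp, Ex.ok, Ex.eval, St.set_v, St.set_a, h2]
    exact ⟨⟨trivial, by omega, hB⟩, h1, rfl, h3, h4⟩
  · exact ⟨fun i hi => absurd hi (by omega), by simpa using hi,
      fun u => ⟨by simp [hz], by simp [hz], by simp⟩, fun i hi => absurd hi (by omega)⟩
  · rintro k s' - hk hf hik ⟨h1, h2, h3, h4⟩
    have hin : s'.a a_in = s.a a_in := hf.2 a_in rfl
    have e3 : k + k + k = 3 * k := by omega
    have hsum : ∑ i ∈ Finset.range (k + 1), s.a a_in (4 + 3 * i) ≤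
        ∑ i ∈ Finset.range m, s.a a_in (4 + 3 * i) :=
      Finset.sum_le_sum_of_subset (Finset.range_mono (by omega))
    rw [Finset.sum_range_succ] at hsum
    simp [hik, hin, h2, e3]
    refine ⟨by omega, by omega, by omega, by omega, by omega, fun i hi => ?_, ?_, ?_, ?_⟩
    · rcases hi.lt_or_eq with h | rfl
      · have hne : i ≠ k := by omega
        simpa [hne] using h1 i h
      · simp
    · rw [Finset.sum_range_succ]
    · intro u
      obtain ⟨g1, g2, g3⟩ := h3 u
      by_cases hu : u = s.a a_in (2 + 3 * k)
      · subst hu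
        refine ⟨by simp, by simp, fun j hj _ => by simpa using hj⟩
      · refine ⟨by simp [hu]; omega, ?_, ?_⟩
        · simp only [Function.update_apply, if_neg hu]
          intro hp
          rw [if_neg (by omega)]
          exact g2 hp
        · intro j hj hT
          simp only [Function.update_apply, if_neg hu] at hT ⊢
          split_ifs at hT with hjk
          · exact absurd hT.symm hu
          · exact g3 j (by omega) hT
    · intro i hi
      rcases hi.lt_or_eq with h | rfl
      · have hne : i ≠ k := by omega
        obtain ⟨g1, g2, g3⟩ := h4 i h
        refine ⟨by simpa [hne] using g1, ?_, ?_⟩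
        · simp only [Function.update_apply, if_neg hne]
          intro hp
          rw [if_neg (by omega)]
          exact g2 hp
        · intro j hj
          simp only [Function.update_apply, if_neg hne]
          rw [if_neg (by omega)]
          exact g3 j hj
      · obtain ⟨g1, g2, g3⟩ := h3 (s.a a_in (2 + 3 * i))
        simp only [Function.update_self]
        refine ⟨g1, fun hp => ?_, fun j hj => ?_⟩
        · rw [Function.update_of_ne (by omega)]
          exact g2 hp
        · rw [Function.update_of_ne (by omega)]
          exact g3 j hj

/-! ### Breadth-first search for the spanning tree -/

open Ex Cm in
def bfsBody : Cm :=
  ite (lit 0) (var v_p)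
    (set v_a (var v_p -. lit 1) ;;
      set v_h (get a_H (var v_a)) ;;
      set v_p (get a_nx (var v_a)) ;;
      ite (get a_vis (var v_h)) (lit 1)
        (put a_vis (var v_h) (lit 1) ;;
          put a_par (var v_h) (get a_Q (var v_k)) ;;
          put a_rk (var v_h) (var v_q) ;;
          put a_Q (var v_q) (var v_h) ;;
          set v_q (var v_q +. lit 1))
        skip)
    (set v_k (var v_k +. lit 1) ;; set v_p (get a_hd (get a_Q (var v_k))))

open Ex Cm in
/-- Breadth-first search from vertex `0`. -/
def bfs : Cm :=
  (put a_par (lit 0) (var v_n) ;; put a_vis (lit 0) (lit 1) ;; put a_Q (lit 0) (lit 0) ;;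
    put a_rk (lit 0) (lit 0) ;; set v_q (lit 1) ;; set v_k (lit 0) ;;
    set v_p (get a_hd (lit 0))) ;;
  .while (var v_k) (var v_q) bfsBody

/-- The queue `Q` holds `q` visited vertices, the first `k` of which are scanned completely; `p`,
shifted by one, points to the next arc to scan at `Q k`. The rank of a vertex is its position in the
queue. -/
structure Bfs (n m : ℕ) (T H : ℕ → ℕ) (k q p : ℕ) (Q vis par rk : ℕ → ℕ) : Prop where
  q_pos : 0 < q
  k_le : k ≤ q
  Q_zero : Q 0 = 0
  par_zero : par 0 = n
  visQ : ∀ i, i < q → Q i < n ∧ vis (Q i) = 1 ∧ rk (Q i) = i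
  vis_rk : ∀ v, vis v = 0 ∨ (vis v = 1 ∧ rk v < q ∧ Q (rk v) = v)
  tree : ∀ i, i < q → 0 < i → ∃ i', i' < i ∧ par (Q i) = Q i' ∧ ∃ a, a < m ∧ T a = Q i' ∧ H a = Q i
  scan : ∀ i, i < k → ∀ a, a < m → T a = Q i → vis (H a) = 1
  cur : k < q → p ≤ m ∧ (0 < p → T (p - 1) = Q k) ∧
    ∀ a, a < m → T a = Q k → a < p ∨ vis (H a) = 1

/-- A spanning tree with root `0`, parents `par` and the vertices listed in `Q`. -/
structure Tree (n m : ℕ) (T H Q par rk : ℕ → ℕ) : Prop where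
  par_zero : par 0 = n
  Qlt : ∀ i, i < n → Q i < n ∧ rk (Q i) = i
  rk_lt : ∀ v, v < n → rk v < n ∧ Q (rk v) = v
  rk_zero : rk 0 = 0
  par_lt : ∀ v, 0 < v → v < n → par v < n ∧ rk (par v) < rk v ∧ ∃ a, a < m ∧ T a = par v ∧ H a = v

/-- The relation given by the arcs. -/
def ArcRel (m : ℕ) (T H : ℕ → ℕ) (u v : ℕ) : Prop := ∃ a, a < m ∧ T a = u ∧ H a = v

section
variable {n m k q p : ℕ} {T H Q vis par rk : ℕ → ℕ}

theorem Bfs.q_le (h : Bfs n m T H k q p Q vis par rk) : q ≤ n := by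
  have := Finset.card_le_card_of_injOn (s := Finset.range q) (t := Finset.range n) Q
    (fun i hi => by simpa using (h.visQ i (by simpa using hi)).1)
    (fun i hi j hj hij => by
      rw [← (h.visQ i (by simpa using hi)).2.2, ← (h.visQ j (by simpa using hj)).2.2, hij])
  simpa using this

/-- When the queue is exhausted, the visited vertices are closed under arcs and hence all of them
are visited; a parent precedes its children in the queue, so ranks fall towards the root. -/
theorem Bfs.tree_of_done (h : Bfs n m T H k q p Q vis par rk) (hk : ¬ k < q)
    (hs : ∀ v, v < n → Relation.ReflTransGen (ArcRel m T H) 0 v) : Tree n m T H Q par rk := by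
  have hkq : k = q := le_antisymm h.k_le (not_lt.mp hk)
  have hv0 : vis 0 = 1 := by have := (h.visQ 0 h.q_pos).2.1; rwa [h.Q_zero] at this
  have hall : ∀ v, v < n → vis v = 1 := fun v hv => by
    have := hs v hv
    clear hv
    induction this with
    | refl => exact hv0
    | tail _ hbc ih =>
      obtain ⟨a, ha, rfl, rfl⟩ := hbc
      rcases h.vis_rk (T a) with h0 | ⟨-, h1, h2⟩
      · omega
      · exact h.scan _ (hkq ▸ h1) a ha h2.symm
  have hrk : ∀ v, v < n → rk v < q ∧ Q (rk v) = v := fun v hv => by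
    rcases h.vis_rk v with h0 | ⟨-, h1⟩
    · have := hall v hv; omega
    · exact h1
  have hqn : q = n := by
    refine le_antisymm h.q_le ?_
    have := Finset.card_le_card_of_injOn (s := Finset.range n) (t := Finset.range q) rk
      (fun i hi => by simpa using (hrk i (by simpa using hi)).1)
      (fun i hi j hj hij => by
        rw [← (hrk i (by simpa using hi)).2, ← (hrk j (by simpa using hj)).2, hij])
    simpa using this
  subst hqn
  have hr0 : rk 0 = 0 := by have := (h.visQ 0 h.q_pos).2.2; rwa [h.Q_zero] at this
  refine ⟨h.par_zero, fun i hi => ⟨(h.visQ i hi).1, (h.visQ i hi).2.2⟩, hrk, hr0, fun v h0 hv => ?_⟩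
  obtain ⟨r1, r2⟩ := hrk v hv
  obtain ⟨i', hi', e, a, ha, e1, e2⟩ := h.tree (rk v) r1 (Nat.pos_of_ne_zero fun hz => by
    rw [hz, h.Q_zero] at r2; omega)
  rw [r2] at e e2
  rw [← e] at e1
  refine ⟨?_, ?_, a, ha, e1, e2⟩
  · rw [e]; exact (h.visQ i' (by omega)).1
  · rw [e, (h.visQ i' (by omega)).2.2]; exact hi'

/-- The arcs that the search has not scanned yet. -/
def unscanned (m : ℕ) (T : ℕ → ℕ) (k p : ℕ) (Q : ℕ → ℕ) : Finset ℕ :=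
  (Finset.range m).filter fun a => (∀ i, i < k → T a ≠ Q i) ∧ ¬ (T a = Q k ∧ p ≤ a)

theorem Bfs.Q_ne (h : Bfs n m T H k q p Q vis par rk) {i j : ℕ} (hij : i < j) (hj : j < q) :
    Q j ≠ Q i := fun e => by
  have h1 := (h.visQ j hj).2.2
  have h2 := (h.visQ i (hij.trans hj)).2.2
  rw [e] at h1
  omega

theorem Bfs.advance (h : Bfs n m T H k q 0 Q vis par rk) (hk : k < q) {p' : ℕ}
    (hp : LastOcc T (Q (k + 1)) m p') : Bfs n m T H (k + 1) q p' Q vis par rk := by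
  refine ⟨h.q_pos, hk, h.Q_zero, h.par_zero, h.visQ, h.vis_rk, h.tree, fun i hi a ha hT => ?_,
    fun _ => ⟨hp.1, hp.2.1, fun a ha hT => .inl (hp.2.2 a ha hT)⟩⟩
  rcases (Nat.lt_succ_iff.mp hi).lt_or_eq with hlt | rfl
  · exact h.scan i hlt a ha hT
  · exact ((h.cur hk).2.2 a ha hT).resolve_left (by omega)

theorem Bfs.skip (h : Bfs n m T H k q p Q vis par rk) (hk : k < q) (hp0 : 0 < p) {p' : ℕ}
    (hp : LastOcc T (T (p - 1)) (p - 1) p') (hv : vis (H (p - 1)) = 1) :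
    Bfs n m T H k q p' Q vis par rk := by
  obtain ⟨c1, c2, c3⟩ := h.cur hk
  refine ⟨h.q_pos, h.k_le, h.Q_zero, h.par_zero, h.visQ, h.vis_rk, h.tree, h.scan, fun _ =>
    ⟨by have := hp.1; omega, fun h1 => (hp.2.1 h1).trans (c2 hp0), fun a ha hT => ?_⟩⟩
  rcases c3 a ha hT with h1 | h1
  · rcases (Nat.le_sub_one_of_lt h1).lt_or_eq with h2 | rfl
    · exact .inl (hp.2.2 a h2 (hT.trans (c2 hp0).symm))
    · exact .inr hv
  · exact .inr h1

/-- The head is enqueued while the arc pointer stays; `Bfs.skip` then moves the pointer past the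
arc, whose head is visited by now. -/
theorem Bfs.new (h : Bfs n m T H k q p Q vis par rk) (hk : k < q) (hp0 : 0 < p)
    (hH : H (p - 1) < n) (hv : vis (H (p - 1)) = 0) :
    Bfs n m T H k (q + 1) p (Function.update Q q (H (p - 1)))
      (Function.update vis (H (p - 1)) 1) (Function.update par (H (p - 1)) (Q k))
      (Function.update rk (H (p - 1)) q) := by
  obtain ⟨c1, c2, c3⟩ := h.cur hk
  set x := H (p - 1) with hx
  have hne : ∀ i, i < q → Q i ≠ x := fun i hi e => by
    have := (h.visQ i hi).2.1; rw [e] at this; omega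
  have hQ : ∀ i, i < q → Function.update Q q x i = Q i := fun i hi =>
    Function.update_of_ne (by omega) _ _
  have hvis : ∀ v, vis v = 1 → Function.update vis x 1 v = 1 := fun v hv => by
    rw [Function.update_apply]; split_ifs <;> simp [hv]
  refine ⟨by omega, by omega, (hQ 0 h.q_pos).trans h.Q_zero, ?_, fun i hi => ?_, fun v => ?_,
    fun i hi hi0 => ?_, fun i hi a ha hT => ?_, fun _ => ⟨c1, ?_, fun a ha hT => ?_⟩⟩
  · rw [Function.update_of_ne, h.par_zero]
    exact fun e => hne 0 h.q_pos (h.Q_zero.trans e)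
  · rcases (Nat.lt_succ_iff.mp hi).lt_or_eq with hlt | rfl
    · rw [hQ i hlt, Function.update_of_ne (hne i hlt), Function.update_of_ne (hne i hlt)]
      exact h.visQ i hlt
    · simp [hH]
  · by_cases e : v = x
    · subst e; simp
    · rw [Function.update_of_ne e, Function.update_of_ne e]
      rcases h.vis_rk v with h1 | ⟨h1, h2, h3⟩
      · exact .inl h1
      · exact .inr ⟨h1, by omega, by rw [hQ _ h2, h3]⟩
  · rcases (Nat.lt_succ_iff.mp hi).lt_or_eq with hlt | rfl
    · obtain ⟨i', hi', e⟩ := h.tree i hlt hi0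
      refine ⟨i', hi', ?_⟩
      rwa [hQ i hlt, hQ i' (by omega), Function.update_of_ne (hne i hlt)]
    · refine ⟨k, hk, by rw [hQ k hk]; simp, p - 1, by omega, by rw [hQ k hk]; exact c2 hp0, by simp [hx]⟩
  · rw [hQ i (by omega)] at hT
    exact hvis _ (h.scan i hi a ha hT)
  · rwa [hQ k hk]
  · rw [hQ k hk] at hT
    exact (c3 a ha hT).imp_right (hvis _)

theorem Bfs.card_skip (h : Bfs n m T H k q p Q vis par rk) (hk : k < q) (hp0 : 0 < p) {p' : ℕ}
    (hp : LastOcc T (T (p - 1)) (p - 1) p') {Q' : ℕ → ℕ} (hQ : ∀ i, i < q → Q' i = Q i) :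
    (unscanned m T k p' Q').card < (unscanned m T k p Q).card := by
  obtain ⟨c1, c2, c3⟩ := h.cur hk
  have := hp.1
  have hT := c2 hp0
  refine Finset.card_lt_card ((Finset.ssubset_iff_of_subset fun a ha => ?_).2 ⟨p - 1, ?_, ?_⟩)
  · simp only [unscanned, Finset.mem_filter, Finset.mem_range] at ha ⊢
    refine ⟨ha.1, fun i hi => by rw [← hQ i (by omega)]; exact ha.2.1 i hi, fun hc => ha.2.2 ?_⟩
    rw [hQ k hk]
    exact ⟨hc.1, by omega⟩
  · simp only [unscanned, Finset.mem_filter, Finset.mem_range]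
    exact ⟨by omega, fun i hi => by rw [hT]; exact h.Q_ne hi hk, by omega⟩
  · simp only [unscanned, Finset.mem_filter, not_and]
    exact fun _ _ hc => hc (by rw [hQ k hk, hT]) (by omega)

theorem card_unscanned_advance (p' : ℕ) :
    (unscanned m T (k + 1) p' Q).card ≤ (unscanned m T k 0 Q).card := by
  refine Finset.card_le_card fun a ha => ?_
  simp only [unscanned, Finset.mem_filter] at ha ⊢
  exact ⟨ha.1, fun i hi => ha.2.1 i (by omega), fun hc => ha.2.1 k (by omega) hc.1⟩

theorem Bfs.init (h0 : 0 < n) {p' : ℕ} (hvis : ∀ v, vis v = 0) (hp : LastOcc T 0 m p') :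
    Bfs n m T H 0 1 p' (Function.update Q 0 0) (Function.update vis 0 1) (Function.update par 0 n)
      (Function.update rk 0 0) := by
  refine ⟨by omega, by omega, by simp, by simp, fun i hi => ?_, fun v => ?_, by omega, by omega, fun _ => ?_⟩
  · obtain rfl : i = 0 := by omega
    simp [h0]
  · by_cases e : v = 0
    · subst e; simp
    · simp [e, hvis]
  · exact ⟨hp.1, by simpa using hp.2.1, fun a ha hT => .inl (hp.2.2 a ha (by simpa using hT))⟩

end

theorem bfs_spec {B b n m : ℕ} {T H : ℕ → ℕ} {s : St} (h0 : 0 < n) (hn : s.v v_n = n)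
    (hvis : ∀ v, s.a a_vis v = 0) (hT : s.a a_T = T) (hH : s.a a_H = H)
    (hHn : ∀ i, i < m → H i < n) (hhd : ∀ u, LastOcc T u m (s.a a_hd u))
    (hnx : ∀ i, i < m → LastOcc T (T i) i (s.a a_nx i)) (hB : n + m + 2 ≤ B)
    (hs : ∀ v, v < n → Relation.ReflTransGen (ArcRel m T H) 0 v) :
    Tr B b bfs s (14 * (n + m) + 8) fun s' => Tree n m T H (s'.a a_Q) (s'.a a_par) (s'.a a_rk) := by
  let I : St → Prop := fun s' => s'.a a_T = T ∧ s'.a a_H = H ∧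
    s'.a a_hd = s.a a_hd ∧ s'.a a_nx = s.a a_nx ∧ Bfs n m T H (s'.v v_k) (s'.v v_q) (s'.v v_p)
      (s'.a a_Q) (s'.a a_vis) (s'.a a_par) (s'.a a_rk)
  -- Each round either moves on in the queue or scans one more arc.
  let Φ : St → ℕ := fun s' => (n - s'.v v_k) + (unscanned m T (s'.v v_k) (s'.v v_p) (s'.a a_Q)).card
  have loop : ∀ s1, I s1 → s1.v v_k = 0 → Tr B b (.while (.var v_k) (.var v_q) bfsBody) s1
      ((n + m) * 14 + 1) fun s' => Tree n m T H (s'.a a_Q) (s'.a a_par) (s'.a a_rk) := by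
    intro s1 hI hk0
    refine (Tr.while (T := bfsBody.sz) I Φ hI ?_ ?_ ?_).mono ?_ fun _ _ => id
    · exact fun _ _ _ => ⟨trivial, trivial⟩
    · rintro s' - ⟨i2, i3, i4, i5, i6⟩ hlt
      refine Tr.wp ?_
      have hq := i6.q_le
      simp only [Ex.eval] at hlt
      simp only [bfsBody, wp, Ex.ok, Ex.eval, true_and, and_true, St.set_v, St.set_a, St.put_v, St.put_a,
        I, Φ, i2, i3, i4, i5]
      set k := s'.v v_k with hk
      set q := s'.v v_q with hqq
      set p := s'.v v_p with hp
      have hkn : k < n := by omega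
      obtain ⟨c1, c2, c3⟩ := i6.cur hlt
      refine ⟨by omega, fun hp0 => ?_, fun hp0 => ?_⟩
      · have hnx' := hnx (p - 1) (by omega)
        have hH' := hHn (p - 1) (by omega)
        have h1 := hnx'.1
        simp
        refine ⟨by omega, fun hv => ⟨by omega, ⟨by omega, by omega⟩, ?_, ?_⟩, fun hv => ⟨?_, ?_⟩⟩
        · exact (i6.new hlt hp0 hH' hv).skip (by omega) hp0 hnx' (by simp)
        · exact i6.card_skip hlt hp0 hnx' fun i hi => Function.update_of_ne (by omega) _ _
        · refine i6.skip hlt hp0 hnx' ?_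
          rcases i6.vis_rk (H (p - 1)) with h | h
          exacts [absurd h hv, h.1]
        · exact i6.card_skip hlt hp0 hnx' fun _ _ => rfl
      · have hp' : p = 0 := by omega
        have hu := card_unscanned_advance (m := m) (T := T) (k := k) (Q := s'.a a_Q)
          (s.a a_hd (s'.a a_Q (k + 1)))
        rw [hp'] at i6 ⊢
        simp
        exact ⟨by omega, i6.advance hlt (hhd _), by omega⟩
    · rintro s' - ⟨i2, i3, i4, i5, i6⟩ hlt
      exact i6.tree_of_done hlt hs
    · have h1 : (unscanned m T (s1.v v_k) (s1.v v_p) (s1.a a_Q)).card ≤ m := by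
        unfold unscanned
        exact (Finset.card_filter_le _ _).trans (by simp)
      have := Nat.mul_le_mul_right 14 (show Φ s1 ≤ n + m by simp only [Φ]; omega)
      have e : bfsBody.sz + 1 = 14 := rfl
      rw [e]
      omega
  refine Tr.wp_seq (T := (n + m) * 14 + 1) ?_ (by simp [Cm.sz]; omega)
  simp only [wp, Ex.ok, Ex.eval, true_and, and_true, St.set_v, St.set_a, St.put_v, St.put_a]
  simp
  refine ⟨by omega, loop _ ?_ (by simp)⟩
  simp only [I, St.set_v, St.set_a, St.put_v, St.put_a]
  simpa [hn, hT, hH] using Bfs.init h0 hvis (hhd 0)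

/-! ### Sorting the arcs into tree arcs and further arcs -/

open Ex Cm in
def classifyBody : Cm :=
  set v_t (get a_T (var v_i)) ;; set v_h (get a_H (var v_i)) ;; set v_a (get a_W (var v_i)) ;;
  -- The root has parent `n`, which is no vertex, so it matches neither test.
  ifEq (get a_par (var v_h)) (var v_t) (put a_wd (var v_h) (var v_a))
    (ifEq (get a_par (var v_t)) (var v_h) (put a_wu (var v_t) (var v_a))
      (ifEq (var v_t) (var v_h) skip
        (put a_nt (var v_na) (var v_i) ;; put a_tt (var v_na) (var v_t) ;;
          put a_hh (var v_na) (var v_h) ;; put a_ww (var v_na) (var v_a) ;;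
          put a_term (var v_t) (lit 1) ;; put a_term (var v_h) (lit 1) ;;
          set v_na (var v_na +. lit 1))))

open Ex Cm in
/-- Sorts the arcs into tree arcs and further arcs. -/
def classify : Cm :=
  .for v_i 0 v_n (put a_wu (var v_i) (var v_inf)) ;; .for v_i 0 v_m classifyBody

/-- The arc `a` is neither a loop nor runs along an edge of the tree. -/
def NonTree (T H par : ℕ → ℕ) (a : ℕ) : Prop := par (H a) ≠ T a ∧ par (T a) ≠ H a ∧ T a ≠ H a

/-- The result of sorting the first `k` arcs. -/
structure Cls (n inf k : ℕ) (T H W par : ℕ → ℕ) (na : ℕ) (wd wu nt tt hh ww term : ℕ → ℕ) :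
    Prop where
  wd_eq : ∀ a, a < k → par (H a) = T a → wd (H a) = W a
  wu_eq : ∀ a, a < k → par (H a) ≠ T a → par (T a) = H a → wu (T a) = W a
  wu_inf : ∀ v, v < n → (∀ a, a < k → T a = v → par v ≠ H a) → wu v = inf
  na_le : na ≤ k
  nt_spec : ∀ j, j < na → nt j < k ∧ NonTree T H par (nt j) ∧ tt j = T (nt j) ∧ hh j = H (nt j) ∧
    ww j = W (nt j)
  nt_surj : ∀ a, a < k → NonTree T H par a → ∃ j, j < na ∧ nt j = a
  nt_mono : ∀ i j, i < j → j < na → nt i < nt j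
  term_le : ∀ v, term v ≤ 1
  term_iff : ∀ v, term v = 1 ↔ ∃ j, j < na ∧ (tt j = v ∨ hh j = v)

section
variable {n inf k na : ℕ} {T H W par wd wu nt tt hh ww term : ℕ → ℕ}

/-- There are no parallel arcs, so the entry that is written now has not been filled by an earlier
arc. -/
theorem Cls.tree_down (h : Cls n inf k T H W par na wd wu nt tt hh ww term)
    (hu : ∀ a, a < k → T a = T k → H a ≠ H k) (hk : par (H k) = T k) (hk' : par (T k) ≠ H k) :
    Cls n inf (k + 1) T H W par na (Function.update wd (H k) (W k)) wu nt tt hh ww term := by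
  refine ⟨fun a ha hp => ?_, fun a ha hp hp' => ?_, fun v hv hv' => ?_, by have := h.na_le; omega,
    fun j hj => ?_, fun a ha hn => ?_, h.nt_mono, h.term_le, h.term_iff⟩
  · rcases (Nat.lt_succ_iff.mp ha).lt_or_eq with hlt | rfl
    · rw [Function.update_of_ne, h.wd_eq a hlt hp]
      intro e
      exact hu a hlt (by rw [← hp, e, hk]) e
    · simp
  · rcases (Nat.lt_succ_iff.mp ha).lt_or_eq with hlt | rfl
    · exact h.wu_eq a hlt hp hp'
    · exact absurd hk hp
  · exact h.wu_inf v hv fun a ha => hv' a (by omega)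
  · have := h.nt_spec j hj
    exact ⟨by omega, this.2⟩
  · rcases (Nat.lt_succ_iff.mp ha).lt_or_eq with hlt | rfl
    · exact h.nt_surj a hlt hn
    · exact absurd hk hn.1

theorem Cls.tree_up (h : Cls n inf k T H W par na wd wu nt tt hh ww term)
    (hu : ∀ a, a < k → T a = T k → H a ≠ H k) (hk : par (H k) ≠ T k) (hk' : par (T k) = H k) :
    Cls n inf (k + 1) T H W par na wd (Function.update wu (T k) (W k)) nt tt hh ww term := by
  refine ⟨fun a ha hp => ?_, fun a ha hp hp' => ?_, fun v hv hv' => ?_, by have := h.na_le; omega,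
    fun j hj => ?_, fun a ha hn => ?_, h.nt_mono, h.term_le, h.term_iff⟩
  · rcases (Nat.lt_succ_iff.mp ha).lt_or_eq with hlt | rfl
    · exact h.wd_eq a hlt hp
    · exact absurd hp hk
  · rcases (Nat.lt_succ_iff.mp ha).lt_or_eq with hlt | rfl
    · rw [Function.update_of_ne, h.wu_eq a hlt hp hp']
      intro e
      exact hu a hlt e (by rw [← hp', e, hk'])
    · simp
  · rw [Function.update_of_ne]
    · exact h.wu_inf v hv fun a ha => hv' a (by omega)
    · rintro rfl
      exact hv' k (by omega) rfl hk'
  · have := h.nt_spec j hj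
    exact ⟨by omega, this.2⟩
  · rcases (Nat.lt_succ_iff.mp ha).lt_or_eq with hlt | rfl
    · exact h.nt_surj a hlt hn
    · exact absurd hk' hn.2.1

theorem Cls.loop (h : Cls n inf k T H W par na wd wu nt tt hh ww term)
    (hk : par (H k) ≠ T k) (hk' : par (T k) ≠ H k) (hl : T k = H k) :
    Cls n inf (k + 1) T H W par na wd wu nt tt hh ww term := by
  refine ⟨fun a ha hp => ?_, fun a ha hp hp' => ?_, fun v hv hv' => ?_, by have := h.na_le; omega,
    fun j hj => ?_, fun a ha hn => ?_, h.nt_mono, h.term_le, h.term_iff⟩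
  · rcases (Nat.lt_succ_iff.mp ha).lt_or_eq with hlt | rfl
    · exact h.wd_eq a hlt hp
    · exact absurd hp hk
  · rcases (Nat.lt_succ_iff.mp ha).lt_or_eq with hlt | rfl
    · exact h.wu_eq a hlt hp hp'
    · exact absurd hp' hk'
  · exact h.wu_inf v hv fun a ha => hv' a (by omega)
  · have := h.nt_spec j hj
    exact ⟨by omega, this.2⟩
  · rcases (Nat.lt_succ_iff.mp ha).lt_or_eq with hlt | rfl
    · exact h.nt_surj a hlt hn
    · exact absurd hl hn.2.2

theorem Cls.nontree (h : Cls n inf k T H W par na wd wu nt tt hh ww term)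
    (hk : NonTree T H par k) :
    Cls n inf (k + 1) T H W par (na + 1) wd wu (Function.update nt na k)
      (Function.update tt na (T k)) (Function.update hh na (H k)) (Function.update ww na (W k))
      (Function.update (Function.update term (T k) 1) (H k) 1) := by
  have hn := h.na_le
  refine ⟨fun a ha hp => ?_, fun a ha hp hp' => ?_, fun v hv hv' => ?_, by omega,
    fun j hj => ?_, fun a ha hn => ?_, fun i j hij hj => ?_, fun v => ?_, fun v => ?_⟩
  · rcases (Nat.lt_succ_iff.mp ha).lt_or_eq with hlt | rfl
    · exact h.wd_eq a hlt hp
    · exact absurd hp hk.1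
  · rcases (Nat.lt_succ_iff.mp ha).lt_or_eq with hlt | rfl
    · exact h.wu_eq a hlt hp hp'
    · exact absurd hp' hk.2.1
  · exact h.wu_inf v hv fun a ha => hv' a (by omega)
  · rcases (Nat.lt_succ_iff.mp hj).lt_or_eq with hlt | rfl
    · have := h.nt_spec j hlt
      simp only [Function.update_of_ne hlt.ne]
      exact ⟨by omega, this.2⟩
    · simp [hk]
  · rcases (Nat.lt_succ_iff.mp ha).lt_or_eq with hlt | rfl
    · obtain ⟨j, hj, e⟩ := h.nt_surj a hlt hn
      exact ⟨j, by omega, by rwa [Function.update_of_ne hj.ne]⟩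
    · exact ⟨na, by omega, by simp⟩
  · rcases (Nat.lt_succ_iff.mp hj).lt_or_eq with hlt | rfl
    · rw [Function.update_of_ne hlt.ne, Function.update_of_ne (by omega)]
      exact h.nt_mono i j hij hlt
    · rw [Function.update_self, Function.update_of_ne (by omega)]
      exact (h.nt_spec i hij).1
  · have := h.term_le v
    simp only [Function.update_apply]
    split_ifs <;> omega
  · have ht := h.term_iff v
    constructor
    · intro hv
      by_cases e1 : v = H k
      · exact ⟨na, by omega, by simp [e1]⟩
      · by_cases e2 : v = T k
        · exact ⟨na, by omega, by simp [e2]⟩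
        · rw [Function.update_of_ne e1, Function.update_of_ne e2] at hv
          obtain ⟨j, hj, e⟩ := ht.1 hv
          exact ⟨j, by omega, by rwa [Function.update_of_ne hj.ne, Function.update_of_ne hj.ne]⟩
    · rintro ⟨j, hj, e⟩
      rcases (Nat.lt_succ_iff.mp hj).lt_or_eq with hlt | rfl
      · rw [Function.update_of_ne hlt.ne, Function.update_of_ne hlt.ne] at e
        have := ht.2 ⟨j, hlt, e⟩
        simp [Function.update_apply, this]
      · simp only [Function.update_self] at e
        rcases e with rfl | rfl <;> simp [Function.update_apply]

end

theorem classify_spec {B b n m : ℕ} {s : St} (hn : s.v v_n = n) (hm : s.v v_m = m)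
    (hna : s.v v_na = 0) (hterm : ∀ v, s.a a_term v = 0)
    (hTH : ∀ i, i < m → s.a a_T i < n ∧ s.a a_H i < n)
    (hW : ∀ i, i < m → s.a a_W i ≤ B) (hB : n + m + 2 ≤ B) (hinf : s.v v_inf ≤ B)
    (hpar : ∀ v, v < n → s.a a_par v ≤ n)
    (hanti : ∀ i, i < m → s.a a_par (s.a a_H i) = s.a a_T i → s.a a_par (s.a a_T i) ≠ s.a a_H i)
    (hu : ∀ i j, i < j → j < m → s.a a_T i = s.a a_T j → s.a a_H i ≠ s.a a_H j) :
    Tr B b classify s (18 * (n + m) + 4) fun s' =>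
      Cls n (s.v v_inf) m (s.a a_T) (s.a a_H) (s.a a_W) (s.a a_par) (s'.v v_na) (s'.a a_wd)
        (s'.a a_wu) (s'.a a_nt) (s'.a a_tt) (s'.a a_hh) (s'.a a_ww) (s'.a a_term) := by
  refine ((Tr.for_wp (fun k s' => ∀ v, v < k → s'.a a_wu v = s.v v_inf) n rfl rfl rfl hn (by omega)
    (Nat.zero_le _) (by omega) ?_ ?_ fun s' _ h => h).seq (T' := m * (16 + 2) + 2) ?_).mono
    (by simp [Cm.sz]; omega) fun _ _ => id
  · exact fun v hv => absurd hv (by omega)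
  · rintro k s' - hk hf hik h
    have h2 : s'.v v_inf = s.v v_inf := hf.1 _ rfl
    simp [hik, h2, Function.update_apply]
    exact fun v hv e => h v (by omega)
  · rintro s1 hf1 hI
    have e1 : s1.a a_T = s.a a_T := hf1.2 _ rfl
    have e2 : s1.a a_H = s.a a_H := hf1.2 _ rfl
    have e3 : s1.a a_W = s.a a_W := hf1.2 _ rfl
    have e4 : s1.a a_par = s.a a_par := hf1.2 _ rfl
    have e5 : s1.a a_term = s.a a_term := hf1.2 _ rfl
    have e6 : s1.v v_na = s.v v_na := hf1.1 _ rfl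
    have e7 : s1.v v_m = s.v v_m := hf1.1 _ rfl
    have e8 : s1.v v_inf = s.v v_inf := hf1.1 _ rfl
    rw [← e1, ← e2, ← e3, ← e4, ← e8]
    simp only [← e1, ← e2, ← e3, ← e4, ← e5, ← e6, ← e7, ← e8] at *
    refine (Tr.for_wp (c := classifyBody) (fun k s' => Cls n (s1.v v_inf) k (s1.a a_T) (s1.a a_H) (s1.a a_W)
      (s1.a a_par) (s'.v v_na) (s'.a a_wd) (s'.a a_wu) (s'.a a_nt) (s'.a a_tt) (s'.a a_hh)
      (s'.a a_ww) (s'.a a_term)) m rfl rfl rfl hm (by omega) (Nat.zero_le _) (by omega) ?_ ?_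
      fun s' _ h => h).mono (by simp [Cm.sz, classifyBody, Cm.ifEq]) fun _ _ => id
    · simp [hna]
      exact ⟨by omega, by omega, fun v hv _ => hI v hv, by omega, by omega, by omega, by omega,
        by simp [hterm], by simp [hterm]⟩
    · rintro k s' - hk hf hik h
      have f1 : s'.a a_T = s1.a a_T := hf.2 _ rfl
      have f2 : s'.a a_H = s1.a a_H := hf.2 _ rfl
      have f3 : s'.a a_W = s1.a a_W := hf.2 _ rfl
      have f4 : s'.a a_par = s1.a a_par := hf.2 _ rfl
      obtain ⟨hT, hH⟩ := hTH k hk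
      have hu' := fun a ha => hu a k ha hk
      have hna' := h.na_le
      have p1 := hpar _ hT
      have p2 := hpar _ hH
      have hW' := hW k hk
      simp only [classifyBody, wp, Ex.ok, Ex.eval]
      simp [f1, f2, f3, hik]
      rw [wp_ifEq (by omega) (by simp [Ex.ok]) (by simp [Ex.ok, Ex.eval])
        (by simp [Ex.eval, f4]; omega) (by simp [Ex.eval]; omega)]
      rw [wp_ifEq (by omega) (by simp [Ex.ok]) (by simp [Ex.ok, Ex.eval])
        (by simp [Ex.eval, f4]; omega) (by simp [Ex.eval]; omega)]
      rw [wp_ifEq (by omega) (by simp [Ex.ok]) (by simp [Ex.ok, Ex.eval])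
        (by simp [Ex.eval]; omega) (by simp [Ex.eval]; omega)]
      simp [f4, hik]
      refine ⟨fun c => h.tree_down hu' c (hanti k hk c), fun c1 => ⟨fun c2 => h.tree_up hu' c1 c2,
        fun c2 => ⟨fun c3 => h.loop c1 c2 c3, fun c3 => ⟨by omega, by omega, h.nontree ⟨c1, c2, c3⟩⟩⟩⟩⟩

/-! ### Active vertices, branch vertices and the lower ends of chains -/

open Ex Cm in
def bottomUpBody : Cm :=
  set v_h (get a_Q (var v_n -. var v_i)) ;; set v_t (get a_par (var v_h)) ;;
  -- Vertices come in reverse queue order, children before parents. An end of a further arc is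
  -- counted twice, so that it becomes a branch vertex without any active child: a positive count
  -- means active, a count above one means branch vertex.
  set v_x (get a_term (var v_h) +. get a_term (var v_h) +. get a_cnt (var v_h)) ;;
  ite (lit 0) (var v_x)
    (set v_a (get a_cb (var v_h)) ;;
      ite (lit 1) (var v_x)
        (put a_br (var v_h) (lit 1) ;; put a_BL (var v_nb) (var v_h) ;;
          set v_nb (var v_nb +. lit 1) ;; set v_a (var v_h))
        skip ;;
      put a_bot (var v_h) (var v_a) ;; put a_act (var v_h) (lit 1) ;;
      put a_cnt (var v_t) (get a_cnt (var v_t) +. lit 1) ;; put a_cb (var v_t) (var v_a))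
    skip

open Ex Cm in
/-- Finds the active vertices and the branch vertices. -/
def bottomUp : Cm :=
  .for v_i 1 v_n bottomUpBody ;; put a_br (lit 0) (lit 1) ;; put a_act (lit 0) (lit 1)

/-- The vertices `v` with `rk v > n - k` are done. -/
structure Act (n k : ℕ) (par rk term : ℕ → ℕ) (nb : ℕ) (cnt cb bot act br BL : ℕ → ℕ) : Prop where
  fresh : ∀ v, ¬ (v < n ∧ n < rk v + k) → act v = 0 ∧ br v = 0
  le_one : ∀ v, act v ≤ 1 ∧ br v ≤ 1
  cnt_le : ∀ v, cnt v + 1 ≤ k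
  cnt_zero : ∀ v, cnt v = 0 → ∀ c, c < n → n < rk c + k → par c = v → act c = 0
  cnt_one : ∀ v, cnt v = 1 → ∃ c, c < n ∧ n < rk c + k ∧ par c = v ∧ act c = 1 ∧ cb v = bot c ∧
    ∀ c', c' < n → n < rk c' + k → par c' = v → act c' = 1 → c' = c
  cnt_two : ∀ v, 2 ≤ cnt v → ∃ c c', c ≠ c' ∧ (c < n ∧ n < rk c + k ∧ par c = v ∧ act c = 1) ∧
    (c' < n ∧ n < rk c' + k ∧ par c' = v ∧ act c' = 1)
  act_iff : ∀ v, v < n → n < rk v + k → (act v = 1 ↔ 0 < term v + term v + cnt v)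
  br_iff : ∀ v, v < n → n < rk v + k → (br v = 1 ↔ 1 < term v + term v + cnt v)
  bot_eq : ∀ v, v < n → n < rk v + k → act v = 1 → bot v = if br v = 1 then v else cb v
  nb_le : nb + 1 ≤ k
  BL_spec : ∀ i, i < nb → BL i < n ∧ n < rk (BL i) + k ∧ br (BL i) = 1
  BL_inj : ∀ i j, i < j → j < nb → rk (BL j) < rk (BL i)
  BL_surj : ∀ v, v < n → n < rk v + k → br v = 1 → ∃ i, i < nb ∧ BL i = v

section
variable {n k m nb : ℕ} {T H Q par rk term cnt cb bot act br BL : ℕ → ℕ}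

theorem Tree.done_succ (ht : Tree n m T H Q par rk) {v w : ℕ} (hw : w < n) (hk : rk v + k = n)
    (hv : v < n) : n < rk w + (k + 1) ↔ n < rk w + k ∨ w = v := by
  constructor
  · intro h
    by_cases e : rk w = rk v
    · right; rw [← (ht.rk_lt w hw).2, ← (ht.rk_lt v hv).2, e]
    · left; omega
  · rintro (h | rfl) <;> omega

theorem Tree.pos (ht : Tree n m T H Q par rk) (h0 : 0 < n) {v : ℕ} (hv : v < n) (hr : 0 < rk v) :
    0 < v := Nat.pos_of_ne_zero fun e => by rw [e, ht.rk_zero] at hr; omega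

theorem Act.skip (h : Act n k par rk term nb cnt cb bot act br BL) (ht : Tree n m T H Q par rk)
    {v : ℕ} (hv : v < n) (hk : rk v + k = n) (hx : ¬ 0 < term v + term v + cnt v) :
    Act n (k + 1) par rk term nb cnt cb bot act br BL := by
  have hd := fun w hw => ht.done_succ (w := w) hw hk hv
  have hv0 := h.fresh v (by omega)
  have ha : ∀ c, c < n → n < rk c + (k + 1) → act c = 1 → n < rk c + k := fun c hc hc' hca => by
    rcases (hd c hc).1 hc' with h1 | rfl
    · exact h1
    · omega
  refine ⟨fun w hw => h.fresh w fun hc => hw ⟨hc.1, by omega⟩, h.le_one, fun w => ?_,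
    fun w hw c hc hc' hp => ?_, fun w hw => ?_, fun w hw => ?_, fun w hw hw' => ?_, fun w hw hw' => ?_,
    fun w hw hw' hwa => h.bot_eq w hw (ha w hw hw' hwa) hwa, ?_, fun i hi => ?_, h.BL_inj,
    fun w hw hw' hwb => ?_⟩
  · have := h.cnt_le w; omega
  · rcases (hd c hc).1 hc' with h1 | rfl
    · exact h.cnt_zero w hw c hc h1 hp
    · exact hv0.1
  · obtain ⟨c, h1, h2, h3, h4, h5, h6⟩ := h.cnt_one w hw
    exact ⟨c, h1, by omega, h3, h4, h5, fun c' g1 g2 g3 g4 => h6 c' g1 (ha c' g1 g2 g4) g3 g4⟩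
  · obtain ⟨c, c', h0, h1, h2⟩ := h.cnt_two w hw
    exact ⟨c, c', h0, ⟨h1.1, by omega, h1.2.2⟩, ⟨h2.1, by omega, h2.2.2⟩⟩
  · rcases (hd w hw).1 hw' with h1 | rfl
    · exact h.act_iff w hw h1
    · omega
  · rcases (hd w hw).1 hw' with h1 | rfl
    · exact h.br_iff w hw h1
    · omega
  · have := h.nb_le; omega
  · have := h.BL_spec i hi; exact ⟨this.1, by omega, this.2.2⟩
  · rcases (hd w hw).1 hw' with h1 | rfl
    · exact h.BL_surj w hw h1 hwb
    · omega

/-- The value `a` is the lower end of the chain through `v`, namely `v` itself if it is a branch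
vertex and otherwise the lower end inherited from its only active child. It is handed on to the
parent in `cb`. -/
theorem Act.active (h : Act n k par rk term nb cnt cb bot act br BL) (ht : Tree n m T H Q par rk)
    {v : ℕ} (hv : v < n) (hv0 : 0 < v) (hk : rk v + k = n)
    (hx : 0 < term v + term v + cnt v) {a nb' : ℕ} {br' BL' : ℕ → ℕ}
    (hbr : (1 < term v + term v + cnt v ∧ br' = Function.update br v 1 ∧
      BL' = Function.update BL nb v ∧ nb' = nb + 1 ∧ a = v) ∨
      (¬ 1 < term v + term v + cnt v ∧ br' = br ∧ BL' = BL ∧ nb' = nb ∧ a = cb v)) :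
    Act n (k + 1) par rk term nb' (Function.update cnt (par v) (cnt (par v) + 1))
      (Function.update cb (par v) a) (Function.update bot v a) (Function.update act v 1) br' BL' := by
  have hd := fun w hw => ht.done_succ (w := w) hw hk hv
  have hvf := h.fresh v (by omega)
  obtain ⟨hp1, hp2, -⟩ := ht.par_lt v hv0 hv
  have hne : ∀ w, n < rk w + k → w ≠ v := by rintro w hw rfl; omega
  have hnp : ∀ w, n < rk w + (k + 1) → w ≠ par v := by rintro w hw rfl; omega
  have hact : ∀ w, n < rk w + k → Function.update act v 1 w = act w := fun w hw =>
    Function.update_of_ne (hne w hw) _ _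
  have hbot : ∀ w, n < rk w + k → Function.update bot v a w = bot w := fun w hw =>
    Function.update_of_ne (hne w hw) _ _
  have hbr1 : ∀ w, w ≠ v → br' w = br w := fun w hw => by
    rcases hbr with ⟨-, rfl, -⟩ | ⟨-, rfl, -⟩
    · exact Function.update_of_ne hw _ _
    · rfl
  have hbrv : br' v = if 1 < term v + term v + cnt v then 1 else 0 := by
    rcases hbr with ⟨h1, rfl, -⟩ | ⟨h1, rfl, -⟩
    · simp [h1]
    · simp [h1, hvf.2]
  have hvd : n < rk v + (k + 1) := by omega
  refine ⟨fun w hw => ?_, fun w => ?_, fun w => ?_,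
    fun w hw c hc hc' hp => ?_, fun w hw => ?_, fun w hw => ?_, fun w hw hw' => ?_, fun w hw hw' => ?_,
    fun w hw hw' hwa => ?_, ?_, fun i hi => ?_, fun i j hij hj => ?_,
    fun w hw hw' hwb => ?_⟩
  · have hwv : w ≠ v := by rintro rfl; exact hw ⟨hv, hvd⟩
    rw [hbr1 w hwv, Function.update_of_ne hwv]
    exact h.fresh w fun hc => hw ⟨hc.1, by omega⟩
  · by_cases e : w = v
    · subst e; rw [hbrv]; simp; split_ifs <;> omega
    · rw [hbr1 w e, Function.update_of_ne e]; exact h.le_one w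
  · have := h.cnt_le w
    have := h.cnt_le (par v)
    rw [Function.update_apply]; split_ifs <;> omega
  · rw [Function.update_apply] at hw
    split_ifs at hw with e
    · rcases (hd c hc).1 hc' with h1 | rfl
      · rw [hact c h1]; exact h.cnt_zero w hw c hc h1 hp
      · exact absurd hp.symm e
  · rw [Function.update_apply] at hw
    split_ifs at hw with e
    · subst e
      have h0 := h.cnt_zero (par v) (by omega)
      refine ⟨v, hv, hvd, rfl, by simp, by simp, fun c' g1 g2 g3 g4 => ?_⟩
      rcases (hd c' g1).1 g2 with h1 | h1
      · rw [hact c' h1, h0 c' g1 h1 g3] at g4; omega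
      · exact h1
    · obtain ⟨c, h1, h2, h3, h4, h5, h6⟩ := h.cnt_one w hw
      refine ⟨c, h1, by omega, h3, by rwa [hact c h2], by rw [hbot c h2, Function.update_of_ne e, h5],
        fun c' g1 g2 g3 g4 => ?_⟩
      rcases (hd c' g1).1 g2 with h1 | rfl
      · rw [hact c' h1] at g4; exact h6 c' g1 h1 g3 g4
      · exact absurd g3.symm e
  · rw [Function.update_apply] at hw
    split_ifs at hw with e
    · subst e
      obtain ⟨c, h1, h2, h3, h4⟩ : ∃ c, c < n ∧ n < rk c + k ∧ par c = par v ∧ act c = 1 := by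
        rcases (show cnt (par v) = 1 ∨ 2 ≤ cnt (par v) by omega) with h1 | h1
        · obtain ⟨c, h1, h2, h3, h4, -⟩ := h.cnt_one _ h1
          exact ⟨c, h1, h2, h3, h4⟩
        · obtain ⟨c, -, -, h1, -⟩ := h.cnt_two _ h1
          exact ⟨c, h1⟩
      exact ⟨c, v, hne c h2, ⟨h1, by omega, h3, by rwa [hact c h2]⟩, hv, hvd, rfl, by simp⟩
    · obtain ⟨c, c', h0, h1, h2⟩ := h.cnt_two w hw
      exact ⟨c, c', h0, ⟨h1.1, by omega, h1.2.2.1, by rw [hact c h1.2.1]; exact h1.2.2.2⟩,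
        ⟨h2.1, by omega, h2.2.2.1, by rw [hact c' h2.2.1]; exact h2.2.2.2⟩⟩
  · rw [Function.update_of_ne (hnp w hw')]
    rcases (hd w hw).1 hw' with h1 | rfl
    · rw [hact w h1]; exact h.act_iff w hw h1
    · simpa using hx
  · rw [Function.update_of_ne (hnp w hw')]
    rcases (hd w hw).1 hw' with h1 | rfl
    · rw [hbr1 w (hne w h1)]; exact h.br_iff w hw h1
    · rw [hbrv]; simp
  · rw [Function.update_of_ne (hnp w hw')]
    rcases (hd w hw).1 hw' with h1 | rfl
    · rw [hact w h1] at hwa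
      rw [hbot w h1, hbr1 w (hne w h1)]; exact h.bot_eq w hw h1 hwa
    · rw [hbrv]
      rcases hbr with ⟨h1, -, -, -, rfl⟩ | ⟨h1, -, -, -, rfl⟩ <;> simp [h1]
  · have := h.nb_le
    rcases hbr with ⟨-, -, -, rfl, -⟩ | ⟨-, -, -, rfl, -⟩ <;> omega
  · have key : ∀ i, i < nb → BL i < n ∧ n < rk (BL i) + (k + 1) ∧ br' (BL i) = 1 := fun i hi => by
      obtain ⟨h1, h2, h3⟩ := h.BL_spec i hi
      exact ⟨h1, by omega, by rwa [hbr1 _ (hne _ h2)]⟩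
    rcases hbr with ⟨h1, -, rfl, rfl, -⟩ | ⟨-, -, rfl, rfl, -⟩
    · rcases (Nat.lt_succ_iff.mp hi).lt_or_eq with hlt | rfl
      · rw [Function.update_of_ne hlt.ne]; exact key i hlt
      · rw [Function.update_self, hbrv, if_pos h1]; exact ⟨hv, hvd, rfl⟩
    · exact key i hi
  · rcases hbr with ⟨h1, -, rfl, rfl, -⟩ | ⟨-, -, rfl, rfl, -⟩
    · rw [Function.update_of_ne (show i ≠ nb by omega)]
      rcases (Nat.lt_succ_iff.mp hj).lt_or_eq with hlt | rfl
      · rw [Function.update_of_ne hlt.ne]; exact h.BL_inj i j hij hlt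
      · rw [Function.update_self]
        have := (h.BL_spec i hij).2.1
        omega
    · exact h.BL_inj i j hij hj
  · rcases (hd w hw).1 hw' with h1 | rfl
    · rw [hbr1 w (hne w h1)] at hwb
      obtain ⟨i, hi, e⟩ := h.BL_surj w hw h1 hwb
      rcases hbr with ⟨-, -, rfl, rfl, -⟩ | ⟨-, -, rfl, rfl, -⟩
      · exact ⟨i, by omega, by rwa [Function.update_of_ne hi.ne]⟩
      · exact ⟨i, hi, e⟩
    · rcases hbr with ⟨-, -, rfl, rfl, -⟩ | ⟨h1, -⟩
      · exact ⟨nb, by omega, by simp⟩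
      · rw [hbrv, if_neg h1] at hwb; omega

/-- The loop stops before the root, which is declared active and a branch vertex in any case, even
when there are no further arcs. -/
theorem Act.pre (h : Act n n par rk term nb cnt cb bot act br BL) (ht : Tree n m T H Q par rk)
    (h0 : 0 < n) {na : ℕ} {tt hh : ℕ → ℕ} (hlt : ∀ j, j < na → tt j < n ∧ hh j < n)
    (hterm : ∀ v, term v ≤ 1) (hti : ∀ v, term v = 1 ↔ ∃ j, j < na ∧ (tt j = v ∨ hh j = v))
    (topv wd wu ww : ℕ → ℕ) : (Lay.mk n par rk (Function.update act 0 1) (Function.update br 0 1)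
      bot topv wd wu na tt hh ww).Pre := by
  have hpos : ∀ v, 0 < v → v < n → n < rk v + n := fun v h1 h2 => by
    have : rk v ≠ 0 := fun e => by
      have h3 := (ht.rk_lt v h2).2
      have h4 := (ht.rk_lt 0 h0).2
      rw [ht.rk_zero] at h4
      rw [e] at h3
      omega
    omega
  have hc : ∀ c v, c < n → n < rk c + n → par c = v → act c = 1 → 0 < c ∧ c < n ∧
      Function.update act 0 1 c = 1 ∧ par c = v := fun c v h1 h2 h3 h4 => by
    have := ht.pos h0 h1 (by omega)
    exact ⟨this, h1, by rwa [Function.update_of_ne (by omega)], h3⟩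
  have hb : ∀ v, term v = 1 → v < n → Function.update br 0 1 v = 1 := fun v hv hn => by
    rw [Function.update_apply]
    split_ifs with e
    · rfl
    · exact (h.br_iff v hn (hpos v (by omega) hn)).2 (by omega)
  refine ⟨h0, fun v h1 h2 => (ht.par_lt v h1 h2).1, fun v h1 h2 => (ht.par_lt v h1 h2).2.1,
    fun v h1 => (ht.rk_lt v h1).1, fun u v h1 h2 e => ?_, fun v h1 h2 ha => ?_, by simp,
    fun v h1 hv => ?_, fun v h1 ha hv => ?_, fun v h1 h2 hv => ?_, fun j hj => ?_, fun v h1 h2 hv => ?_⟩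
  · rw [← (ht.rk_lt u h1).2, ← (ht.rk_lt v h2).2]; exact congrArg Q e
  · have hp := (ht.par_lt v h1 h2).1
    simp only [Function.update_apply] at ha ⊢
    split_ifs with e
    · rfl
    · rw [if_neg (by omega)] at ha
      rw [h.act_iff _ hp (hpos _ (by omega) hp)]
      have := fun hz => h.cnt_zero _ hz v h2 (hpos v h1 h2) rfl
      omega
  · simp only [Function.update_apply] at hv ⊢
    split_ifs with e
    · rfl
    · rw [if_neg e, h.br_iff v h1 (hpos v (by omega) h1)] at hv
      rw [h.act_iff v h1 (hpos v (by omega) h1)]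
      omega
  · have hv0 : v ≠ 0 := by rintro rfl; simp at hv
    have hd := hpos v (by omega) h1
    simp only [Function.update_of_ne hv0] at ha hv
    have ha' := (h.act_iff v h1 hd).1 ha
    have hv' := mt (h.br_iff v h1 hd).2 hv
    obtain ⟨c, g1, g2, g3, g4, g5, g6⟩ := h.cnt_one v (by omega)
    obtain ⟨q1, q2, q3, q4⟩ := hc c v g1 g2 g3 g4
    refine ⟨c, q1, q2, q4, q3, ?_, fun c' r1 r2 r3 r4 => ?_⟩
    · simp only []
      rw [h.bot_eq v h1 hd ha, if_neg hv, g5]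
    · simp only [Function.update_of_ne r1.ne'] at r4
      exact g6 c' r2 (hpos c' r1 r2) r3 r4
  · have hd := hpos v h1 h2
    simp only [Function.update_of_ne h1.ne'] at hv ⊢
    rw [h.bot_eq v h2 hd, if_pos hv]
    have := (h.br_iff v h2 hd).1 hv
    exact (h.act_iff v h2 hd).2 (by omega)
  · obtain ⟨q1, q2⟩ := hlt j hj
    exact ⟨q1, hb _ ((hti _).2 ⟨j, hj, .inl rfl⟩) q1, q2, hb _ ((hti _).2 ⟨j, hj, .inr rfl⟩) q2⟩
  · have hd := hpos v h1 h2
    simp only [Function.update_of_ne h1.ne'] at hv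
    have hv' := (h.br_iff v h2 hd).1 hv
    have := hterm v
    rcases (show term v = 1 ∨ 2 ≤ cnt v by omega) with ht' | ht'
    · exact .inl ((hti v).1 ht')
    · obtain ⟨c, c', e, ⟨g1, g2, g3, g4⟩, q1, q2, q3, q4⟩ := h.cnt_two v ht'
      exact .inr ⟨c, c', e, hc c v g1 g2 g3 g4, hc c' v q1 q2 q3 q4⟩

end

/-- The layout stored in a state. -/
def St.lay (s : St) : Lay where
  n := s.v v_n
  par := s.a a_par
  rk := s.a a_rk
  act := s.a a_act
  br := s.a a_br
  bot := s.a a_bot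
  topv := s.a a_topv
  wd := s.a a_wd
  wu := s.a a_wu
  na := s.v v_na
  tt := s.a a_tt
  hh := s.a a_hh
  ww := s.a a_ww

theorem Frame.lay {B : ℕ} {c : Cm} {s s' : St} (hf : Frame B c s s')
    (hv : (c.wv v_n || c.wv v_na) = false)
    (ha : (c.wa a_par || (c.wa a_rk || (c.wa a_act || (c.wa a_br || (c.wa a_bot || (c.wa a_topv ||
      (c.wa a_wd || (c.wa a_wu || (c.wa a_tt || (c.wa a_hh || c.wa a_ww)))))))))) = false) :
    s'.lay = s.lay := by
  simp only [Bool.or_eq_false_iff] at hv ha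
  obtain ⟨h1, h2, h3, h4, h5, h6, h7, h8, h9, h10, h11⟩ := ha
  simp only [St.lay, hf.1 _ hv.1, hf.1 _ hv.2, hf.2 _ h1, hf.2 _ h2, hf.2 _ h3, hf.2 _ h4, hf.2 _ h5,
    hf.2 _ h6, hf.2 _ h7, hf.2 _ h8, hf.2 _ h9, hf.2 _ h10, hf.2 _ h11]
/-- `BL` lists the branch vertices other than the root. -/
structure Listed (L : Lay) (nb : ℕ) (BL : ℕ → ℕ) : Prop where
  spec : ∀ i, i < nb → L.Br (BL i)
  inj : ∀ i j, i < j → j < nb → BL i ≠ BL j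
  surj : ∀ x, L.Br x → ∃ i, i < nb ∧ BL i = x

theorem bottomUp_spec {B b n m : ℕ} {T H : ℕ → ℕ} {s : St} (h0 : 0 < n) (hn : s.v v_n = n)
    (ht : Tree n m T H (s.a a_Q) (s.a a_par) (s.a a_rk)) (hnb : s.v v_nb = 0)
    (hz : ∀ v, s.a a_cnt v = 0 ∧ s.a a_act v = 0 ∧ s.a a_br v = 0)
    (hterm : ∀ v, s.a a_term v ≤ 1) (hB : n + n + 2 ≤ B)
    (hlt : ∀ j, j < s.v v_na → s.a a_tt j < n ∧ s.a a_hh j < n)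
    (hti : ∀ v, s.a a_term v = 1 ↔ ∃ j, j < s.v v_na ∧ (s.a a_tt j = v ∨ s.a a_hh j = v)) :
    Tr B b bottomUp s (19 * n + 4) fun s' => s'.lay.Pre ∧ Listed s'.lay (s'.v v_nb) (s'.a a_BL) ∧
      (∀ v, s'.a a_act v ≤ 1 ∧ s'.a a_br v ≤ 1) := by
  refine (Tr.for_wp (c := bottomUpBody) (fun k s' => Act n k (s.a a_par) (s.a a_rk) (s.a a_term) (s'.v v_nb)
    (s'.a a_cnt) (s'.a a_cb) (s'.a a_bot) (s'.a a_act) (s'.a a_br) (s'.a a_BL)) n rfl rfl rfl hn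
    (by omega) (by omega) (by omega) ?_ ?_ fun s' _ h => h).seq_wp ?_ (by
      simp [Cm.sz, bottomUpBody]; omega)
  · simp [hnb]
    have hr : ∀ v, v < n → ¬ n < s.a a_rk v + 1 := fun v hv => by have := (ht.rk_lt v hv).1; omega
    refine ⟨fun v _ => (hz v).2, fun v => ?_, fun v => ?_, fun v _ c h1 h2 => absurd h2 (hr c h1),
      fun v hv => ?_, fun v hv => ?_, fun v h1 h2 => absurd h2 (hr v h1), fun v h1 h2 => absurd h2 (hr v h1),
      fun v h1 h2 => absurd h2 (hr v h1), by omega, by omega, by omega,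
      fun v h1 h2 => absurd h2 (hr v h1)⟩
    · have := hz v; omega
    · have := hz v; omega
    · have := hz v; omega
    · have := hz v; omega
  · rintro k s' hk1 hk hf hik h
    have f1 : s'.a a_Q = s.a a_Q := hf.2 _ rfl
    have f2 : s'.a a_par = s.a a_par := hf.2 _ rfl
    have f3 : s'.a a_term = s.a a_term := hf.2 _ rfl
    have f4 : s'.v v_n = s.v v_n := hf.1 _ rfl
    obtain ⟨q1, q2⟩ := ht.Qlt (n - k) (by omega)
    simp [bottomUpBody, f1, f2, f3, f4, hik, hn]
    generalize hv : s.a a_Q (n - k) = v at *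
    have hv0 : 0 < v := ht.pos h0 q1 (by omega)
    have hc := h.cnt_le v
    have hc' := h.cnt_le (s.a a_par v)
    have htv := hterm v
    have hnb' := h.nb_le
    have hk' : s.a a_rk v + k = n := by omega
    refine ⟨⟨by omega, by omega⟩, fun hx => ⟨by omega, fun h1 => ?_, fun h1 => ?_⟩, fun h1 h2 => ?_⟩
    · exact ⟨by omega, by omega, by omega, by omega,
        h.active ht q1 hv0 hk' (by omega) (.inl ⟨h1, rfl, rfl, rfl, rfl⟩)⟩
    · exact ⟨by omega, by omega,
        h.active ht q1 hv0 hk' (by omega) (.inr ⟨by omega, rfl, rfl, rfl, rfl⟩)⟩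
    · exact h.skip ht q1 hk' (by omega)
  · rintro s' hf h
    have f2 : s'.a a_par = s.a a_par := hf.2 _ rfl
    have f3 : s'.a a_rk = s.a a_rk := hf.2 _ rfl
    have f4 : s'.v v_n = s.v v_n := hf.1 _ rfl
    have f5 : s'.v v_na = s.v v_na := hf.1 _ rfl
    have f6 : s'.a a_tt = s.a a_tt := hf.2 _ rfl
    have f7 : s'.a a_hh = s.a a_hh := hf.2 _ rfl
    have hpre := fun topv wd wu ww => h.pre ht h0 hlt hterm hti topv wd wu ww
    have hpos : ∀ v, v < n → n < s.a a_rk v + n → 0 < v := fun v h1 h2 => ht.pos h0 h1 (by omega)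
    have hrk : ∀ v, 0 < v → v < n → n < s.a a_rk v + n := fun v h1 h2 => by
      have := (ht.par_lt v h1 h2).2.1; omega
    simp [St.lay, f2, f3, f4, f5, f6, f7, hn]
    refine ⟨by omega, hpre _ _ _ _, ⟨fun i hi => ?_, fun i j hij hj e => ?_, fun x hx => ?_⟩, fun v => ?_⟩
    · obtain ⟨h1, h2, h3⟩ := h.BL_spec i hi
      have := hpos _ h1 h2
      refine ⟨this, h1, ?_⟩
      show Function.update _ _ _ _ = _
      rwa [Function.update_of_ne (by omega)]
    · have := h.BL_inj i j hij hj
      rw [e] at this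
      omega
    · obtain ⟨h1, h2, h3⟩ := hx
      replace h3 : Function.update _ _ _ _ = _ := h3
      rw [Function.update_of_ne (by omega)] at h3
      exact h.BL_surj x h2 (hrk x h1 h2) h3
    · have := h.le_one v
      simp only [Function.update_apply]
      split_ifs <;> omega

/-! ### Upper ends of chains, and slots for the further arcs -/

open Ex Cm in
def chainTops : Cm :=
  .for v_i 1 v_n (ite (lit 0) (get a_act (var v_i))
    (ite (lit 0) (get a_br (get a_par (var v_i)))
      (put a_topv (get a_bot (var v_i)) (var v_i)) skip) skip)

theorem Lay.Pre.congr_topv {L : Lay} (h : L.Pre) (f : ℕ → ℕ) : Lay.Pre { L with topv := f } :=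
  ⟨h.n_pos, h.par_lt, h.rk_par, h.rk_lt, h.rk_inj, h.act_par, h.br_zero, h.br_act, h.child, h.bot_br,
    h.arc_br, h.br_cause⟩

theorem chainTops_spec {B b n : ℕ} {s : St} (hn : s.v v_n = n) (h0 : 0 < n) (hB : n + 2 ≤ B)
    (h : s.lay.Pre) (hle : ∀ v, s.a a_act v ≤ 1 ∧ s.a a_br v ≤ 1) :
    Tr B b chainTops s (8 * n + 2) fun s' => s'.lay.Good := by
  refine (Tr.for_wp (fun k s' => ∀ v, 0 < v → v < k → s.a a_act v = 1 →
    s.a a_br (s.a a_par v) = 1 → s'.a a_topv (s.a a_bot v) = v) n rfl rfl rfl hn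
    (by omega) (by omega) (by omega) ?_ ?_ ?_).mono (by simp [Cm.sz]; omega) fun _ _ => id
  · exact fun v h1 h2 => absurd h2 (by omega)
  · rintro k s' hk1 hk hf hik hI
    have f1 : s'.a a_act = s.a a_act := hf.2 _ rfl
    have f2 : s'.a a_par = s.a a_par := hf.2 _ rfl
    have f3 : s'.a a_br = s.a a_br := hf.2 _ rfl
    have f4 : s'.a a_bot = s.a a_bot := hf.2 _ rfl
    simp [f1, f2, f3, f4, hik]
    refine ⟨fun ha => ⟨fun hb => ?_, fun hb => ?_⟩, fun ha => ?_⟩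
    · intro v h1 h2 h3 h4
      by_cases e : s.a a_bot v = s.a a_bot k
      · rw [e, Function.update_self]
        have := hle k
        have := hle (s.a a_par k)
        exact h.top_unique (u := k) (v := v) ⟨hk1, hk.trans_eq hn.symm, by show s.a a_act k = 1; omega⟩
          ⟨h1, by show v < s.v v_n; omega, h3⟩ e.symm (by show s.a a_br (s.a a_par k) = 1; omega) h4
      · rw [Function.update_of_ne e]
        refine hI v h1 (lt_of_le_of_ne (by omega) fun hvk => e (by rw [hvk])) h3 h4
    · intro v h1 h2 h3 h4
      exact hI v h1 (lt_of_le_of_ne (by omega) fun hvk => by rw [hvk] at h4; omega) h3 h4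
    · intro v h1 h2 h3 h4
      exact hI v h1 (lt_of_le_of_ne (by omega) fun hvk => by rw [hvk] at h3; omega) h3 h4
  · rintro s' hf hI
    have f1 : s'.a a_act = s.a a_act := hf.2 _ rfl
    have f2 : s'.a a_par = s.a a_par := hf.2 _ rfl
    have f3 : s'.a a_br = s.a a_br := hf.2 _ rfl
    have f4 : s'.a a_bot = s.a a_bot := hf.2 _ rfl
    have e : s'.lay = { s.lay with topv := s'.a a_topv } := by
      simp only [St.lay, f1, f2, f3, f4, hf.1 v_n rfl, hf.1 v_na rfl, hf.2 a_rk rfl, hf.2 a_wd rfl,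
        hf.2 a_wu rfl, hf.2 a_tt rfl, hf.2 a_hh rfl, hf.2 a_ww rfl]
    rw [e]
    exact ⟨h.congr_topv _, fun v h1 h2 h3 h4 => hI v h1 (h2.trans_eq hn) h3 h4⟩

open Ex Cm in
/-- Appends the slots of the further arcs. -/
def arcSlots : Cm :=
  -- The digit of further arc `j` is stored at index `n + j`, beyond the vertices, so that one array
  -- of digits serves chains and further arcs alike.
  .for v_i 0 v_na (put a_BL (var v_nb +. var v_i) (var v_n +. var v_i)) ;;
  set v_K (var v_nb +. var v_na)

theorem arcSlots_spec {B b n na nb : ℕ} {s : St} (hn : s.v v_n = n) (hna : s.v v_na = na)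
    (hnb : s.v v_nb = nb) (hB : n + na + nb + 2 ≤ B) :
    Tr B b arcSlots s (3 * na + 3) fun s' => s'.v v_K = nb + na ∧
      (∀ i, i < nb → s'.a a_BL i = s.a a_BL i) ∧ ∀ j, j < na → s'.a a_BL (nb + j) = n + j := by
  refine Tr.seq_wp (Q := fun s' => (∀ i, i < nb → s'.a a_BL i = s.a a_BL i) ∧
    ∀ j, j < na → s'.a a_BL (nb + j) = n + j) (Tr.for_wp (fun k s' => (∀ i, i < nb → s'.a a_BL i = s.a a_BL i) ∧
    ∀ j, j < k → s'.a a_BL (nb + j) = n + j) na rfl rfl rfl hna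
    (by omega) (by omega) (by omega) ?_ ?_ fun s' hf h => h) ?_ (by simp [Cm.sz]; omega)
  · exact ⟨fun _ _ => rfl, fun _ h => absurd h (by omega)⟩
  · rintro k s' - hk hf hik ⟨h1, h2⟩
    have f1 : s'.v v_n = s.v v_n := hf.1 _ rfl
    have f2 : s'.v v_nb = s.v v_nb := hf.1 _ rfl
    simp [f1, f2, hik, hn, hnb]
    refine ⟨by omega, by omega, fun i hi => ?_, fun j hj => ?_⟩
    · rw [Function.update_of_ne (by omega), h1 i hi]
    · rw [Function.update_apply]
      split_ifs with e
      · omega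
      · exact h2 j (by omega)
  · rintro s' hf ⟨h1, h2⟩
    have f1 : s'.v v_na = s.v v_na := hf.1 _ rfl
    have f2 : s'.v v_nb = s.v v_nb := hf.1 _ rfl
    simp [f1, f2, hna, hnb]
    exact ⟨by omega, h1, h2⟩

/-! ### Computing the powers for given options -/

open Ex Cm in
/-- Sets `v_o` to the option of `v_x` and `v_bk` to the broken edge. -/
def bkCode : Cm :=
  set v_o (get a_dg (var v_x)) ;; set v_bk (var v_n) ;;
  ifEq (var v_o) (lit 3) (set v_bk (var v_x))
    (ifEq (var v_o) (lit 4) (set v_bk (get a_topv (var v_x)))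
      (ifEq (var v_o) (lit 5) (set v_bk (get a_mid (var v_x))) skip))

theorem bkCode_spec {B b x : ℕ} {s : St} (hx : s.v v_x = x) (hs : s.Fits B) (hB : 6 ≤ B) :
    wp B b bkCode (fun s' => s'.v v_o = s.a a_dg x ∧
      s'.v v_bk = s.lay.bk (s.a a_mid) (s.a a_dg x) x) s := by
  have h1 := fun j i => hs.2 j i
  simp only [bkCode, wp, Ex.ok, Ex.eval, true_and, Lay.bk, hx]
  rw [wp_ifEq (by omega) (by simp [Ex.ok]) (by simp [Ex.ok]; omega) (by simp [h1]) (by simp; omega),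
    wp_ifEq (by omega) (by simp [Ex.ok]) (by simp [Ex.ok]; omega) (by simp [h1]) (by simp; omega),
    wp_ifEq (by omega) (by simp [Ex.ok]) (by simp [Ex.ok]; omega) (by simp [h1]) (by simp; omega)]
  simp +contextual [St.lay, hx]

open Ex Cm in
/-- Sets `v_u` and `v_d` to the weights of the two arcs between the vertex `v_i` and its parent, or
to `0` if the options `a_dg` do not select them. -/
def selCode : Cm :=
  set v_x (get a_bot (var v_i)) ;; bkCode ;;
  set v_u (get a_wu (var v_i)) ;; set v_d (get a_wd (var v_i)) ;;
  ite (lit 0) (get a_act (var v_i))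
    (ifEq (var v_bk) (var v_i) (set v_u (lit 0) ;; set v_d (lit 0))
      (ifEq (var v_o) (lit 1) (set v_u (lit 0)) (ifEq (var v_o) (lit 0) (set v_d (lit 0)) skip)))
    skip

/-- Stated by upper bounds to match `Lay.pw_le_iff`: the value `0` of an unselected arc then becomes
a condition that holds trivially. -/
theorem selCode_spec {B b v : ℕ} {s : St} (hi : s.v v_i = v) (hs : s.Fits B) (hB : 6 ≤ B)
    (ha : s.a a_act v ≤ 1) : wp B b selCode (fun s' =>
      (∀ K, s'.v v_u ≤ K ↔ (s.lay.selU (s.a a_mid) (s.a a_dg) v → s.a a_wu v ≤ K)) ∧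
      ∀ K, s'.v v_d ≤ K ↔ (s.lay.selD (s.a a_mid) (s.a a_dg) v → s.a a_wd v ≤ K)) s := by
  have hv : v ≤ B := hi ▸ hs.1 _
  have h1 := fun j i => hs.2 j i
  have hs' : (s.set v_x (s.a a_bot v)).Fits B := hs.set _ _ (h1 _ _)
  refine ⟨⟨trivial, by simp⟩, wp_seq_of (bkCode_spec (x := s.a a_bot v) (by simp [hi]) (by simpa [hi] using hs') hB) ?_⟩
  rintro s' hf ⟨h2, h3⟩
  have e2 := hf.2 a_wu rfl
  have e3 := hf.2 a_wd rfl
  have e4 := hf.1 v_i rfl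
  have e5 := hf.2 a_act rfl
  have hbk : s'.v v_bk ≤ B := (hf.3 (by simpa [hi] using hs')).1 _
  have hlay : (s.set v_x (s.a a_bot v)).lay = s.lay := rfl
  simp [hi, hlay] at e2 e3 e4 e5 h2 h3
  simp only [wp, Ex.ok, Ex.eval, true_and, Nat.zero_le, e4]
  rw [wp_ifEq (by omega) (by simp [Ex.ok]) (by simp [Ex.ok]) (by simp [hbk]) (by simp [e4]; omega),
    wp_ifEq (by omega) (by simp [Ex.ok]) (by simp [Ex.ok]; omega) (by simp [h1, h2]) (by simp; omega),
    wp_ifEq (by omega) (by simp [Ex.ok]) (by simp [Ex.ok]) (by simp [h1, h2]) (by simp)]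
  have hact : s.lay.act v = s.a a_act v := rfl
  have hbot : s.lay.bot v = s.a a_bot v := rfl
  simp [e2, e3, e4, e5, h2, h3, Lay.selU, Lay.selD, hact, hbot]
  generalize s.lay.bk (s.a a_mid) (s.a a_dg (s.a a_bot v)) (s.a a_bot v) = z
  generalize s.a a_dg (s.a a_bot v) = o
  have hac : s.a a_act v = 0 ∨ s.a a_act v = 1 := by omega
  refine ⟨fun q => ⟨fun r => ?_, fun r => ⟨fun t => ?_, fun t => ⟨fun w => ?_, fun w => ?_⟩⟩⟩, fun q => ?_⟩
  all_goals
    rcases hac with hac | hac <;> simp_all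

theorem bumpAt_le_iff {f : ℕ → ℕ} {i k x K : ℕ} : bumpAt f i k x ≤ K ↔ f x ≤ K ∧ (x = i → k ≤ K) := by
  rw [bumpAt_apply]; split_ifs with h <;> simp [h]

open Ex Cm in
/-- Computes in `a_PF` the powers for the options `a_dg`. -/
def powerPass : Cm :=
  .for v_i 0 v_n (put a_PF (var v_i) (lit 0)) ;;
  .for v_i 1 v_n (selCode ;; bump a_PF (var v_i) (var v_u) ;;
    bump a_PF (get a_par (var v_i)) (var v_d)) ;;
  .for v_i 0 v_na (ite (get a_dg (var v_n +. var v_i)) (lit 1)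
    (bump a_PF (get a_tt (var v_i)) (get a_ww (var v_i))) skip)

theorem powerPass_aux {B b : ℕ} {s : St} (hs : s.Fits B) (hn : 0 < s.v v_n)
    (hB : s.v v_n + s.v v_na + 6 ≤ B) (ha : ∀ v, s.a a_act v ≤ 1) :
    Tr B b powerPass s (40 * (s.v v_n + s.v v_na) + 6) fun s' => ∀ u, u < s.v v_n →
      s'.a a_PF u = s.lay.pw (s.lay.selU (s.a a_mid) (s.a a_dg))
        (s.lay.selD (s.a a_mid) (s.a a_dg)) (s.lay.arcs (s.a a_dg)) u := by
  set L := s.lay with hL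
  set U := L.selU (s.a a_mid) (s.a a_dg) with hU
  set D := L.selD (s.a a_mid) (s.a a_dg) with hD
  refine ((Tr.for_wp (fun k s' => ∀ u, u < k → s'.a a_PF u = 0) _ rfl rfl rfl rfl (by omega) (by omega)
    (by omega) ?_ ?_ fun s' _ h => h).seq fun s1 hf1 hI1 => (Tr.for_wp (fun k s' =>
    ∀ u, u < s.v v_n → ∀ K, s'.a a_PF u ≤ K ↔ (0 < u → u < k → U u → L.wu u ≤ K) ∧
      ∀ v, 0 < v → v < k → L.par v = u → D v → L.wd v ≤ K) (s.v v_n) rfl rfl rfl (hf1.1 _ rfl) (by omega) hn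
    (by omega) ?_ ?_ fun s' _ h => h).seq fun s2 hf2 hI2 => (Tr.for_wp (fun k s' =>
    ∀ u, u < s.v v_n → ∀ K, s'.a a_PF u ≤ K ↔ (0 < u → U u → L.wu u ≤ K) ∧
      (∀ v, 0 < v → v < L.n → L.par v = u → D v → L.wd v ≤ K) ∧
        ∀ j, j < k → L.tt j = u → L.arcs (s.a a_dg) j → L.ww j ≤ K) (s.v v_na) rfl rfl rfl
    (by rw [hf2.1 _ rfl, hf1.1 _ rfl]) (by omega) (by omega)
    (by omega) ?_ ?_ ?_)).mono (by simp [Cm.sz, selCode, bkCode, Cm.bump, Cm.ifEq]; omega) fun _ _ => id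
  · exact fun u hu => absurd hu (by omega)
  · rintro k s' - hk hf hik h
    simp [hik]
    exact fun u hu => by
      rw [Function.update_apply]; split_ifs with e
      exacts [rfl, h u (by omega)]
  · intro u hu K
    simp [hI1 u hu]
    exact ⟨fun h1 h2 => by omega, fun v h1 h2 => by omega⟩
  · rintro k s' hk1 hk hf hik h
    have hs' := hf.3 (hf1.3 hs)
    have e1 : s'.lay = L := (hf.lay rfl rfl).trans (hf1.lay rfl rfl)
    have e2 : s'.a a_mid = s.a a_mid := (hf.2 _ rfl).trans (hf1.2 _ rfl)
    have e3 : s'.a a_dg = s.a a_dg := (hf.2 _ rfl).trans (hf1.2 _ rfl)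
    have e4 : s'.a a_act = s.a a_act := (hf.2 _ rfl).trans (hf1.2 _ rfl)
    have e5 : s'.a a_wu = L.wu := (hf.2 _ rfl).trans (hf1.2 _ rfl)
    have e6 : s'.a a_wd = L.wd := (hf.2 _ rfl).trans (hf1.2 _ rfl)
    have e7 : s'.a a_par = L.par := (hf.2 _ rfl).trans (hf1.2 _ rfl)
    have := selCode_spec (b := b) hik hs' (by omega) (by rw [e4]; exact ha k)
    rw [e1, e2, e3, e5, e6] at this
    refine wp_seq_of this fun s'' hf' ⟨h1, h2⟩ => ?_
    have g1 := (hf'.1 v_i rfl).trans hik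
    have g2 := (hf'.2 a_par rfl).trans e7
    have g3 := hf'.2 a_PF rfl
    simp [g1, g2, g3]
    intro u hu K
    simp only [bumpAt_le_iff, h u hu K, h1, h2]
    constructor
    · rintro ⟨⟨⟨q1, q2⟩, q3⟩, q4⟩
      refine ⟨fun r1 r2 => ?_, fun v r1 r2 r3 => ?_⟩
      · rcases r2.lt_or_eq with r | rfl
        · exact q1 r1 r
        · exact q3 rfl
      · rcases r2.lt_or_eq with r | rfl
        · exact q2 v r1 r r3
        · exact q4 r3.symm
    · rintro ⟨q1, q2⟩
      exact ⟨⟨⟨fun r1 r2 => q1 r1 r2.le, fun v r1 r2 => q2 v r1 r2.le⟩, fun e => e ▸ q1 (e ▸ hk1) e.le⟩,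
        fun e => q2 k hk1 le_rfl e.symm⟩
  · intro u hu K
    rw [show (s2.set v_i 0).a a_PF = s2.a a_PF from rfl, hI2 u hu]
    simp only [Nat.not_lt_zero, false_implies, implies_true, and_true]
    exact and_congr_left fun _ => ⟨fun h h1 => h h1 hu, fun h h1 _ => h h1⟩
  · rintro k s' - hk hf hik h
    have e1 : s'.v v_n = L.n := (hf.1 _ rfl).trans ((hf2.1 _ rfl).trans (hf1.1 _ rfl))
    have e3 : s'.a a_dg = s.a a_dg := (hf.2 _ rfl).trans ((hf2.2 _ rfl).trans (hf1.2 _ rfl))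
    have e4 : s'.a a_tt = L.tt := (hf.2 _ rfl).trans ((hf2.2 _ rfl).trans (hf1.2 _ rfl))
    have e5 : s'.a a_ww = L.ww := (hf.2 _ rfl).trans ((hf2.2 _ rfl).trans (hf1.2 _ rfl))
    have hLn : L.n = s.v v_n := rfl
    simp [hik, e1, e3, e4, e5]
    refine ⟨by omega, by omega, fun hd => ?_, fun hd => ?_⟩
    · intro u hu K
      simp only [bumpAt_le_iff, h u hu K, and_assoc]
      refine and_congr_right fun _ => and_congr_right fun _ => ⟨?_, ?_⟩
      · rintro ⟨q1, q2⟩ j r1 r2 r3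
        rcases r1.lt_or_eq with r | rfl
        · exact q1 j r r2 r3
        · exact q2 r2.symm
      · exact fun q => ⟨fun j r1 => q j r1.le, fun e => q k le_rfl e.symm hd⟩
    · intro u hu K
      rw [h u hu K]
      refine and_congr_right fun _ => and_congr_right fun _ => ⟨fun q j r1 r2 r3 => ?_, fun q j r1 => q j (by omega)⟩
      refine q j (lt_of_le_of_ne (by omega) ?_) r2 r3
      rintro rfl
      exact hd r3
  · intro s' _ h u hu
    refine eq_of_forall_ge_iff fun K => ?_
    rw [h u hu K, Lay.pw_le_iff]
    rfl

theorem powerPass_spec {B b : ℕ} {s : St} {L : Lay} {mid dg : ℕ → ℕ} (hs : s.Fits B)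
    (hL : s.lay = L) (hmid : s.a a_mid = mid) (hdg : s.a a_dg = dg) (hn : 0 < L.n)
    (hB : L.n + L.na + 6 ≤ B) (ha : ∀ v, L.act v ≤ 1) :
    Tr B b powerPass s (40 * (L.n + L.na) + 6) fun s' => ∀ u, u < L.n →
      s'.a a_PF u = L.pw (L.selU mid dg) (L.selD mid dg) (L.arcs dg) u := by
  subst hL hmid hdg
  exact powerPass_aux hs hn hB ha

/-! ### Tables of powers and chain costs for each option -/

/-- `6 * x + o` -/
def Ex.six (x : Ex) (o : ℕ) : Ex := x +. x +. x +. x +. x +. x +. .lit o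

@[simp] theorem Ex.six_eval (x : Ex) (o : ℕ) (s : St) : (x.six o).eval s = 6 * x.eval s + o := by
  simp only [Ex.six, Ex.eval]; ring

@[simp] theorem Ex.six_ok {B b : ℕ} {x : Ex} {o : ℕ} {s : St} :
    (x.six o).ok B b s ↔ x.ok B b s ∧ 6 * x.eval s + o ≤ B := by
  simp only [Ex.six, Ex.ok, Ex.eval]
  by_cases h : x.ok B b s <;> simp only [h, true_and, false_and]
  omega

-- All chains take option `o`. The further arcs get a nonzero digit, which leaves them unselected.
open Ex Cm in
def tableFill (o : ℕ) : Cm :=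
  .for v_i 0 v_n (put a_dg (var v_i) (lit o)) ;;
  .for v_i 0 v_na (put a_dg (var v_n +. var v_i) (lit 1))

open Ex Cm in
def tableSum (o : ℕ) : Cm :=
  .for v_i 0 v_n (put a_P ((var v_i).six o) (get a_PF (var v_i)) ;;
    ite (lit 0) (get a_act (var v_i)) (ite (get a_br (var v_i)) (lit 1)
      (set v_x (get a_bot (var v_i)) ;;
        put a_IC ((var v_x).six o) (get a_IC ((var v_x).six o) +. get a_PF (var v_i))) skip) skip)

/-- Tabulates the powers and the costs of the chains under option `o`. -/
def table (o : ℕ) : Cm := tableFill o ;; powerPass ;; tableSum o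

theorem tableFill_spec {B b o n na : ℕ} {s : St} (hn : s.v v_n = n) (hna : s.v v_na = na)
    (ho : o ≤ B) (hB : n + na + 2 ≤ B) :
    Tr B b (tableFill o) s (3 * (n + na) + 4) fun s' =>
      (∀ v, v < n → s'.a a_dg v = o) ∧ ∀ j, j < na → s'.a a_dg (n + j) = 1 := by
  subst hn hna
  refine ((Tr.for_wp (fun k s' => ∀ v, v < k → s'.a a_dg v = o) _ rfl rfl rfl rfl (by omega) (by omega)
    (by omega) ?_ ?_ fun s' _ h => h).seq fun s1 hf1 hI1 => Tr.for_wp (fun k s' =>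
      (∀ v, v < s.v v_n → s'.a a_dg v = o) ∧ ∀ j, j < k → s'.a a_dg (s.v v_n + j) = 1) (s.v v_na)
      rfl rfl rfl (hf1.1 _ rfl) (by omega) (by omega) (by omega) ?_ ?_ fun s' _ h => h).mono
      (by simp [Cm.sz]; omega) fun _ _ => id
  · exact fun u hu => absurd hu (by omega)
  · rintro k s' - hk hf hik h
    simp [hik, ho]
    intro u hu
    rw [Function.update_apply]; split_ifs with e
    exacts [rfl, h u (by omega)]
  · exact ⟨hI1, fun u hu => absurd hu (by omega)⟩
  · rintro k s' - hk hf hik ⟨h1, h2⟩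
    have e1 : s'.v v_n = s.v v_n := (hf.1 _ rfl).trans (hf1.1 _ rfl)
    simp [hik, e1]
    refine ⟨by omega, by omega, fun v hv => ?_, fun j hj => ?_⟩
    · rw [Function.update_of_ne (by omega), h1 v hv]
    · rw [Function.update_apply]; split_ifs with e
      exacts [rfl, h2 j (by omega)]

open Classical in
theorem tableSum_spec {B b o M : ℕ} {s : St} {L : Lay} {mid : ℕ → ℕ} (hL : s.lay = L) (hg : L.Good)
    (ho : o < 6) (hPF : ∀ u, u < L.n → s.a a_PF u = L.powO mid o u)
    (hM : ∀ u, u < L.n → L.powO mid o u ≤ M) (hB : 6 * L.n + 8 ≤ B) (hMB : L.n * M ≤ B)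
    (ha : ∀ v, s.a a_act v ≤ 1 ∧ s.a a_br v ≤ 1) (hz : ∀ x, s.a a_IC (6 * x + o) = 0) :
    Tr B b (tableSum o) s (9 * L.n + 2) fun s' =>
      (∀ u, u < L.n → s'.a a_P (6 * u + o) = L.powO mid o u) ∧
      (∀ x, s'.a a_IC (6 * x + o) = L.ic mid o x) ∧
      ∀ i, (∀ u, i ≠ 6 * u + o) → s'.a a_P i = s.a a_P i ∧ s'.a a_IC i = s.a a_IC i := by
  have hn : s.v v_n = L.n := by rw [← hL]; rfl
  refine (Tr.for_wp (fun k s' => (∀ u, u < k → s'.a a_P (6 * u + o) = L.powO mid o u) ∧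
      (∀ x, s'.a a_IC (6 * x + o) = ∑ v ∈ (Finset.range k).filter fun v => L.Inner v ∧ L.bot v = x,
        L.powO mid o v) ∧
      ∀ i, (∀ u, i ≠ 6 * u + o) → s'.a a_P i = s.a a_P i ∧ s'.a a_IC i = s.a a_IC i) L.n rfl rfl rfl
    hn (by omega) (by omega) (by omega) ?_ ?_ fun s' _ h => h).mono (by simp [Cm.sz]; omega) fun _ _ => id
  · exact ⟨fun u hu => absurd hu (by omega), by simpa using hz, fun _ _ => ⟨rfl, rfl⟩⟩
  · rintro k s' - hk hf hik ⟨h1, h2, h3⟩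
    have e1 : s'.a a_PF k = L.powO mid o k := by rw [hf.2 a_PF rfl]; exact hPF k hk
    have e2 : s'.a a_act = L.act := by rw [hf.2 a_act rfl, ← hL]; rfl
    have e3 : s'.a a_br = L.br := by rw [hf.2 a_br rfl, ← hL]; rfl
    have e4 : s'.a a_bot = L.bot := by rw [hf.2 a_bot rfl, ← hL]; rfl
    have ha' := ha k
    rw [← hf.2 a_act rfl, ← hf.2 a_br rfl, e2, e3] at ha'
    have hP : ∀ u, u < k + 1 → Function.update (s'.a a_P) (6 * k + o) (L.powO mid o k) (6 * u + o) =
        L.powO mid o u := fun u hu => by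
      rw [Function.update_apply]; split_ifs with e
      · rw [show u = k by omega]
      · exact h1 u (by omega)
    have hsum : ∀ x, ∑ v ∈ (Finset.range (k + 1)).filter fun v => L.Inner v ∧ L.bot v = x,
        L.powO mid o v = (if L.Inner k ∧ L.bot k = x then L.powO mid o k else 0) +
          s'.a a_IC (6 * x + o) := fun x => by
      rw [Finset.range_add_one, Finset.filter_insert, h2]
      split_ifs with e
      · rw [Finset.sum_insert (by simp)]
      · simp
    have hle : ∀ x, ∑ v ∈ (Finset.range (k + 1)).filter fun v => L.Inner v ∧ L.bot v = x,
        L.powO mid o v ≤ B := fun x => by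
      refine le_trans (Finset.sum_le_card_nsmul _ _ M fun v hv => hM v ?_) (le_trans ?_ hMB)
      · simp at hv; omega
      · refine Nat.mul_le_mul_right _ ((Finset.card_filter_le _ _).trans ?_)
        simp; omega
    simp [hik, e1, e2, e3, e4]
    refine ⟨by omega, fun q1 => ⟨by omega, fun q2 => ?_, fun q2 => ?_⟩, fun q1 => ?_⟩
    · have hin : L.Inner k := ⟨⟨Nat.pos_of_ne_zero fun e => ?_, hk, by omega⟩, by omega⟩
      · have hbn : L.bot k < L.n := (hg.bot_spec k hin.1).1.2.1
        have hs := hsum (L.bot k)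
        have hl := hle (L.bot k)
        rw [if_pos ⟨hin, rfl⟩] at hs
        refine ⟨by omega, by omega, fun u hu => hP u (by omega), fun x => ?_, fun i hi => ?_⟩
        · rw [hsum, Function.update_apply]
          by_cases e : x = L.bot k
          · subst e; rw [if_pos rfl, if_pos ⟨hin, rfl⟩, add_comm]
          · rw [if_neg (by omega), if_neg (fun c => e c.2.symm), zero_add]
        · rw [Function.update_of_ne (hi _), Function.update_of_ne (hi _)]
          exact h3 i hi
      · have := hg.br_zero
        rw [e] at q2
        omega
    · have hni : ¬ L.Inner k := fun c => q2 (by have := c.2; omega)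
      refine ⟨fun u hu => hP u (by omega), fun x => ?_, fun i hi => ?_⟩
      · rw [hsum, if_neg (fun c => hni c.1), zero_add]
      · rw [Function.update_of_ne (hi _)]
        exact h3 i hi
    · have hni : ¬ L.Inner k := fun c => by have := c.1.2.2; omega
      refine ⟨fun u hu => hP u (by omega), fun x => ?_, fun i hi => ?_⟩
      · rw [hsum, if_neg (fun c => hni c.1), zero_add]
      · rw [Function.update_of_ne (hi _)]
        exact h3 i hi

theorem Lay.Good.pw_eq_powO {L : Lay} (h : L.Good) {mid dg : ℕ → ℕ} {o u : ℕ} (hu : u < L.n)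
    (h1 : ∀ v, v < L.n → dg v = o) (h2 : ∀ j, j < L.na → dg (L.n + j) = 1) :
    L.pw (L.selU mid dg) (L.selD mid dg) (L.arcs dg) u = L.powO mid o u := by
  have hb : ∀ v, 0 < v → v < L.n → L.act v = 1 → dg (L.bot v) = o := fun v hv hn ha =>
    h1 _ (h.bot_spec v ⟨hv, hn, ha⟩).1.2.1
  refine Lay.pw_congr (fun h0 => ?_) (fun v h0 hv _ => ?_) fun j hj _ => ?_
  · simp only [Lay.selU]
    refine or_congr_right' fun ha => ?_
    rw [hb u h0 hu (not_not.mp ha)]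
  · simp only [Lay.selD]
    refine or_congr_right' fun ha => ?_
    rw [hb v h0 hv (not_not.mp ha)]
  · simp [Lay.arcs, h2 j hj]

theorem table_spec {B b o M : ℕ} {s : St} {L : Lay} {mid : ℕ → ℕ} (hs : s.Fits B) (hL : s.lay = L)
    (hmid : s.a a_mid = mid) (hg : L.Good)
    (ho : o < 6) (hM : ∀ u, u < L.n → L.powO mid o u ≤ M) (hB : 6 * L.n + L.na + 8 ≤ B)
    (hMB : L.n * M ≤ B) (ha : ∀ v, s.a a_act v ≤ 1 ∧ s.a a_br v ≤ 1)
    (hz : ∀ x, s.a a_IC (6 * x + o) = 0) :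
    Tr B b (table o) s (52 * (L.n + L.na) + 12) fun s' =>
      (∀ u, u < L.n → s'.a a_P (6 * u + o) = L.powO mid o u) ∧
      (∀ x, s'.a a_IC (6 * x + o) = L.ic mid o x) ∧
      ∀ i, (∀ u, i ≠ 6 * u + o) → s'.a a_P i = s.a a_P i ∧ s'.a a_IC i = s.a a_IC i := by
  have hn : s.v v_n = L.n := by rw [← hL]; rfl
  have hna : s.v v_na = L.na := by rw [← hL]; rfl
  refine ((tableFill_spec hn hna (by omega) (by omega)).seq fun s1 hf1 h12 =>
    (powerPass_spec (b := b) (hf1.3 hs) ((hf1.lay rfl rfl).trans hL) ((hf1.2 _ rfl).trans hmid) rfl hg.n_pos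
      (by omega) (fun v => by rw [← hL]; exact (ha v).1)).seq fun s2 hf2 h3 =>
    (tableSum_spec (b := b) (L := L) (mid := mid) ((hf2.lay rfl rfl).trans ((hf1.lay rfl rfl).trans hL)) hg ho
      (fun u hu => ?_) hM (by omega) hMB
      (fun v => by rw [hf2.2 _ rfl, hf1.2 _ rfl, hf2.2 _ rfl, hf1.2 _ rfl]; exact ha v)
      (fun x => by rw [hf2.2 _ rfl, hf1.2 _ rfl]; exact hz x)).mono le_rfl (Q' := fun s' =>
        (∀ u, u < L.n → s'.a a_P (6 * u + o) = L.powO mid o u) ∧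
        (∀ x, s'.a a_IC (6 * x + o) = L.ic mid o x) ∧
        ∀ i, (∀ u, i ≠ 6 * u + o) → s'.a a_P i = s.a a_P i ∧ s'.a a_IC i = s.a a_IC i)
        fun s3 _ ⟨g1, g2, g3⟩ => ⟨g1, g2, fun i hi => ?_⟩).mono (by omega) fun _ _ => id
  · rw [h3 u hu]
    exact hg.pw_eq_powO hu h12.1 h12.2
  · have := g3 i hi
    rwa [hf2.2 _ rfl, hf1.2 _ rfl, hf2.2 _ rfl, hf1.2 _ rfl] at this

/-! ### The best inner break of each chain -/

open Ex Cm in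
/-- Finds on each chain an inner edge whose removal saves most. -/
def mids : Cm :=
  .for v_i 1 v_n (ite (lit 0) (get a_act (var v_i)) (ite (get a_br (var v_i)) (lit 1)
    (set v_t (get a_par (var v_i)) ;; ite (get a_br (var v_t)) (lit 1)
      (set v_x (get a_bot (var v_i)) ;;
        -- The saving is increased by one, so that `0` in `a_bs` means that no candidate has been
        -- seen; a candidate that saves nothing is still recorded.
        set v_o ((get a_P ((var v_i).six 2) -. get a_P ((var v_i).six 1)) +.
          (get a_P ((var v_t).six 2) -. get a_P ((var v_t).six 0)) +. lit 1) ;;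
        ite (get a_bs (var v_x)) (var v_o)
          (put a_bs (var v_x) (var v_o) ;; put a_mid (var v_x) (var v_i)) skip)
      skip) skip) skip)

/-- The tables for the options below `k` are complete, and the others are empty. -/
structure Tabs (B k : ℕ) (L : Lay) (mid : ℕ → ℕ) (s : St) : Prop where
  fits : s.Fits B
  lay : s.lay = L
  mid_eq : s.a a_mid = mid
  ic_eq : ∀ o, o < k → ∀ x, s.a a_IC (6 * x + o) = L.ic mid o x
  ic_zero : ∀ o, k ≤ o → o < 6 → ∀ x, s.a a_IC (6 * x + o) = 0
  pw_eq : ∀ o, o < k → ∀ u, u < L.n → s.a a_P (6 * u + o) = L.powO mid o u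

variable {B b M : ℕ} {L : Lay} {mid : ℕ → ℕ} {s : St}

theorem Tabs.step {k : ℕ} (h : Tabs B k L mid s) (hk : k < 6) (hg : L.Good)
    (hM : ∀ mid o u, u < L.n → L.powO mid o u ≤ M) (hB : 6 * L.n + L.na + 8 ≤ B)
    (hMB : L.n * M ≤ B) (ha : ∀ v, L.act v ≤ 1 ∧ L.br v ≤ 1) :
    Tr B b (table k) s (52 * (L.n + L.na) + 12) (Tabs B (k + 1) L mid) := by
  refine (table_spec h.fits h.lay h.mid_eq hg hk (hM mid k) hB hMB (fun v => ?_)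
    fun x => h.ic_zero k le_rfl hk x).mono le_rfl fun s' hf ⟨h1, h2, h3⟩ =>
    ⟨hf.3 h.fits, (hf.lay rfl rfl).trans h.lay, (hf.2 _ rfl).trans h.mid_eq, fun o ho x => ?_,
      fun o ho ho' x => ?_, fun o ho u hu => ?_⟩
  · have := ha v; rw [← h.lay] at this; exact this
  · rcases (Nat.lt_succ_iff.mp ho).lt_or_eq with hlt | rfl
    · rw [(h3 (6 * x + o) fun u => by omega).2, h.ic_eq o hlt]
    · exact h2 x
  · rw [(h3 (6 * x + o) fun u => by omega).2, h.ic_zero o (by omega) ho']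
  · rcases (Nat.lt_succ_iff.mp ho).lt_or_eq with hlt | rfl
    · rw [(h3 (6 * u + o) fun u => by omega).1, h.pw_eq o hlt u hu]
    · exact h1 u hu

theorem Lay.ic_congr_mid (mid mid' : ℕ → ℕ) {o : ℕ} (ho : o ≠ 5) (x : ℕ) :
    L.ic mid o x = L.ic mid' o x := by
  rw [Lay.ic, Lay.ic, Lay.powO_congr_mid mid mid' ho]

theorem Lay.sav_congr_mid (mid mid' : ℕ → ℕ) (k : ℕ) : L.sav mid k = L.sav mid' k := by
  simp only [Lay.sav, Lay.powO_congr_mid mid mid' (show 2 ≠ 5 by omega),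
    Lay.powO_congr_mid mid mid' (show 1 ≠ 5 by omega), Lay.powO_congr_mid mid mid' (show 0 ≠ 5 by omega)]

/-- The savings need the tables of options `0`, `1` and `2` only, and these do not depend on `mid`.
So they are computed first and stay valid after `mid` has changed. -/
theorem Tabs.mids (h : Tabs B 3 L mid s) (hg : L.Good)
    (hM : ∀ mid o u, u < L.n → L.powO mid o u ≤ M) (hB : 6 * L.n + L.na + 8 ≤ B)
    (hMB : 2 * M + 1 ≤ B) (ha : ∀ v, L.act v ≤ 1 ∧ L.br v ≤ 1) (hz : ∀ x, s.a a_bs x = 0) :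
    Tr B b mids s (15 * L.n + 2) fun s' => ∃ mid', L.MidOpt mid' ∧ Tabs B 3 L mid' s' := by
  have hn : s.v v_n = L.n := by rw [← h.lay]; rfl
  refine (Tr.for_wp (fun k s' => ∀ x,
    (s'.a a_bs x = 0 ∨ (L.Cand (s'.a a_mid x) ∧ L.bot (s'.a a_mid x) = x ∧
      s'.a a_bs x = L.sav mid (s'.a a_mid x) + 1)) ∧
    ∀ v, v < k → L.Cand v → L.bot v = x → L.sav mid v + 1 ≤ s'.a a_bs x) L.n rfl rfl rfl hn (by omega)
    hg.n_pos (by omega) ?_ ?_ ?_).mono (by simp [Cm.sz]; omega) fun _ _ => id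
  · refine fun x => ⟨.inl (hz x), fun v hv hc => ?_⟩
    have := hc.1.1.1
    omega
  · rintro k s' hk1 hk hf hik hI
    have e2 : s'.a a_act = L.act := by rw [hf.2 a_act rfl, ← h.lay]; rfl
    have e3 : s'.a a_br = L.br := by rw [hf.2 a_br rfl, ← h.lay]; rfl
    have e4 : s'.a a_bot = L.bot := by rw [hf.2 a_bot rfl, ← h.lay]; rfl
    have e5 : s'.a a_par = L.par := by rw [hf.2 a_par rfl, ← h.lay]; rfl
    have e6 : ∀ o, o < 3 → ∀ u, u < L.n → s'.a a_P (6 * u + o) = L.powO mid o u := fun o ho u hu => by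
      rw [hf.2 a_P rfl]; exact h.pw_eq o ho u hu
    have hp := hg.par_lt k hk1 hk
    have hs : L.powO mid 2 k - L.powO mid 1 k + (L.powO mid 2 (L.par k) - L.powO mid 0 (L.par k)) =
      L.sav mid k := rfl
    have hsM : L.sav mid k ≤ 2 * M := by
      have := hM mid 2 k hk; have := hM mid 2 _ hp; omega
    have hna : ¬ L.Cand k → ∀ x,
      (s'.a a_bs x = 0 ∨ (L.Cand (s'.a a_mid x) ∧ L.bot (s'.a a_mid x) = x ∧
        s'.a a_bs x = L.sav mid (s'.a a_mid x) + 1)) ∧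
      ∀ v, v ≤ k → L.Cand v → L.bot v = x → L.sav mid v + 1 ≤ s'.a a_bs x := fun hc x =>
        ⟨(hI x).1, fun v hv hcv => (hI x).2 v (lt_of_le_of_ne hv fun e => hc (e ▸ hcv)) hcv⟩
    have hak := ha k
    have hap := ha (L.par k)
    have e60 : ∀ u, u < L.n → s'.a a_P (6 * u) = L.powO mid 0 u := e6 0 (by omega)
    simp [hik, e2, e3, e4, e5, e6, e60, hk, hp]
    rw [hs]
    refine ⟨fun q1 => ⟨by omega, fun q2 => ⟨by omega, fun q3 => ?_, fun q3 => hna ?_⟩, fun q2 => hna ?_⟩,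
      fun q1 => hna ?_⟩
    · have hc : L.Cand k := ⟨⟨⟨hk1, hk, by omega⟩, by omega⟩, by omega⟩
      refine ⟨by omega, fun q4 => fun x => ?_, fun q4 => fun x => ⟨(hI x).1, fun v hv hcv hbv => ?_⟩⟩
      · by_cases e : x = L.bot k
        · subst e
          simp only [Function.update_self]
          refine ⟨.inr ⟨hc, trivial, trivial⟩, fun v hv hcv hbv => ?_⟩
          rcases hv.lt_or_eq with r | rfl
          · exact ((hI _).2 v r hcv hbv).trans (by omega)
          · exact Nat.lt_succ_self _
        · simp only [Function.update_of_ne e]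
          refine ⟨(hI x).1, fun v hv hcv hbv => ?_⟩
          rcases hv.lt_or_eq with r | rfl
          · exact (hI _).2 v r hcv hbv
          · exact absurd hbv.symm e
      · rcases hv.lt_or_eq with r | rfl
        · exact (hI _).2 v r hcv hbv
        · subst hbv; omega
    · intro c; have := c.2; omega
    · intro c; have := c.1.2; omega
    · intro c; have := c.1.1.2.2; omega
  · intro s' hf hI
    refine ⟨s'.a a_mid, fun k hk => ?_, hf.3 h.fits, (hf.lay rfl rfl).trans h.lay, rfl, fun o ho x => ?_,
      fun o ho ho' x => ?_, fun o ho u hu => ?_⟩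
    · obtain ⟨h1, h2⟩ := hI (L.bot k)
      have h3 := h2 k hk.1.1.2.1 hk rfl
      rcases h1 with h1 | ⟨h4, h5, h6⟩
      · omega
      · refine ⟨h4, h5, ?_⟩
        rw [Lay.sav_congr_mid _ mid k, Lay.sav_congr_mid _ mid (s'.a a_mid _)]
        omega
    · rw [hf.2 _ rfl, h.ic_eq o ho, Lay.ic_congr_mid mid (s'.a a_mid) (by omega)]
    · rw [hf.2 _ rfl, h.ic_zero o ho ho']
    · rw [hf.2 _ rfl, h.pw_eq o ho u hu, Lay.powO_congr_mid mid _ (by omega)]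

def tables : Cm := table 0 ;; table 1 ;; table 2 ;; mids ;; table 3 ;; table 4 ;; table 5

theorem Tabs.all (h : Tabs B 0 L mid s) (hg : L.Good)
    (hM : ∀ mid o u, u < L.n → L.powO mid o u ≤ M) (hB : 6 * L.n + L.na + 8 ≤ B)
    (hMB : L.n * M ≤ B) (hMB' : 2 * M + 1 ≤ B) (ha : ∀ v, L.act v ≤ 1 ∧ L.br v ≤ 1) (hz : ∀ x, s.a a_bs x = 0) :
    Tr B b tables s (327 * (L.n + L.na) + 74) fun s' => ∃ mid', L.MidOpt mid' ∧ Tabs B 6 L mid' s' := by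
  refine ((h.step (by omega) hg hM hB hMB ha).seq fun s1 f1 h1 =>
    (h1.step (by omega) hg hM hB hMB ha).seq fun s2 f2 h2 =>
    (h2.step (by omega) hg hM hB hMB ha).seq fun s3 f3 h3 =>
    (h3.mids hg hM hB hMB' ha fun x => ?_).seq fun s4 f4 ⟨mid', hm, h4⟩ =>
    (h4.step (by omega) hg hM hB hMB ha).seq fun s5 f5 h5 =>
    (h5.step (by omega) hg hM hB hMB ha).seq fun s6 f6 h6 =>
    (h6.step (by omega) hg hM hB hMB ha).mono le_rfl fun s7 f7 h7 => ⟨mid', hm, h7⟩).mono (by omega)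
    fun _ _ => id
  rw [f3.2 _ rfl, f2.2 _ rfl, f1.2 _ rfl]
  exact hz x

variable {B b nb : ℕ} {L : Lay} {mid BL A : ℕ → ℕ} {s : St}

/-! ### Evaluating an assignment: its cost -/

open Ex Cm in
/-- The powers that branch vertices need for their inactive children. -/
def basePower : Cm :=
  .for v_i 1 v_n (ite (get a_act (var v_i)) (lit 1)
    (bump a_b (get a_par (var v_i)) (get a_wd (var v_i))) skip)

theorem basePower_spec (hL : s.lay = L) (hn : 0 < L.n) (hB : L.n + 2 ≤ B) (ha : ∀ v, L.act v ≤ 1)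
    (hz : ∀ v, s.a a_b v = 0) :
    Tr B b basePower s (7 * L.n + 2) fun s' => ∀ v K, s'.a a_b v ≤ K ↔
      ∀ u, 0 < u → u < L.n → L.par u = v → L.act u ≠ 1 → L.wd u ≤ K := by
  have hn' : s.v v_n = L.n := by rw [← hL]; rfl
  refine (Tr.for_wp (fun k s' => ∀ v K, s'.a a_b v ≤ K ↔
      ∀ u, 0 < u → u < k → L.par u = v → L.act u ≠ 1 → L.wd u ≤ K) L.n rfl rfl rfl hn' (by omega)
      hn (by omega) ?_ ?_ fun s' _ h => h).mono (by simp [Cm.sz, Cm.bump]; omega) fun _ _ => id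
  · intro v K
    simp [hz]
    omega
  · rintro k s' hk1 hk hf hik h
    have e2 : s'.a a_act = L.act := by rw [hf.2 a_act rfl, ← hL]; rfl
    have e3 : s'.a a_par = L.par := by rw [hf.2 a_par rfl, ← hL]; rfl
    have e4 : s'.a a_wd = L.wd := by rw [hf.2 a_wd rfl, ← hL]; rfl
    have hak := ha k
    simp [hik, e2, e3, e4]
    refine ⟨by omega, fun q => fun v K => ?_, fun q => fun v K => ?_⟩
    · rw [bumpAt_le_iff, h v K]
      constructor
      · rintro ⟨h1, h2⟩ u hu hu' hp hau
        rcases hu'.lt_or_eq with r | rfl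
        · exact h1 u hu r hp hau
        · exact h2 hp.symm
      · exact fun h1 => ⟨fun u hu hu' => h1 u hu hu'.le, fun e => h1 k hk1 le_rfl e.symm (by omega)⟩
    · rw [h v K]
      refine ⟨fun h1 u hu hu' hp hau => h1 u hu (lt_of_le_of_ne hu' ?_) hp hau, fun h1 u hu hu' => h1 u hu hu'.le⟩
      rintro rfl
      omega

/-- What the evaluation of an assignment relies on. -/
structure Env (B : ℕ) (L : Lay) (mid : ℕ → ℕ) (nb : ℕ) (BL : ℕ → ℕ) (s : St) : Prop where
  fits : s.Fits B
  lay : s.lay = L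
  mid_eq : s.a a_mid = mid
  nb_eq : s.v v_nb = nb
  BL_eq : s.a a_BL = BL
  ic_eq : ∀ o, o < 6 → ∀ x, s.a a_IC (6 * x + o) = L.ic mid o x
  base : ∀ v K, s.a a_b v ≤ K ↔ ∀ u, 0 < u → u < L.n → L.par u = v → L.act u ≠ 1 → L.wd u ≤ K

theorem Env.frame {c : Cm} {s' : St} (h : Env B L mid nb BL s) (hf : Frame B c s s')
    (hv : (c.wv v_n || (c.wv v_na || c.wv v_nb)) = false)
    (ha : ((c.wa a_par || (c.wa a_rk || (c.wa a_act || (c.wa a_br || (c.wa a_bot || (c.wa a_topv ||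
      (c.wa a_wd || (c.wa a_wu || (c.wa a_tt || (c.wa a_hh || c.wa a_ww)))))))))) ||
      (c.wa a_mid || (c.wa a_BL || (c.wa a_IC || c.wa a_b)))) = false) : Env B L mid nb BL s' := by
  rw [Bool.or_eq_false_iff] at ha
  obtain ⟨ha1, ha2⟩ := ha
  simp only [Bool.or_eq_false_iff] at ha2 hv
  obtain ⟨h1, h2, h3, h4⟩ := ha2
  refine ⟨hf.3 h.fits, (hf.lay (by simp [hv]) ha1).trans h.lay, (hf.2 _ h1).trans h.mid_eq,
    (hf.1 _ hv.2.2).trans h.nb_eq, (hf.2 _ h2).trans h.BL_eq, ?_, ?_⟩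
  · rw [hf.2 _ h3]; exact h.ic_eq
  · rw [hf.2 _ h4]; exact h.base

open Ex Cm in
def evalInit : Cm :=
  .for v_i 0 v_nb (set v_x (get a_BL (var v_i)) ;; put a_ep (var v_x) (get a_b (var v_x)) ;;
    put a_fw (var v_x) (lit 0) ;; put a_bw (var v_x) (lit 0)) ;;
  put a_ep (lit 0) (get a_b (lit 0)) ;; put a_fw (lit 0) (lit 1) ;; put a_bw (lit 0) (lit 1)

theorem evalInit_spec (h : Env B L mid nb BL s) (hl : Listed L nb BL) (hB : nb + 2 ≤ B) :
    Tr B b evalInit s (6 * nb + 5) fun s' => s'.a a_fw 0 = 1 ∧ s'.a a_bw 0 = 1 ∧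
      (∀ x, L.Br x → s'.a a_fw x = 0 ∧ s'.a a_bw x = 0) ∧
      ∀ v, v < L.n → L.br v = 1 → s'.a a_ep v = s.a a_b v := by
  refine Tr.seq_wp (Q := fun s' => (∀ i, i < nb → s'.a a_fw (BL i) = 0 ∧ s'.a a_bw (BL i) = 0 ∧
    s'.a a_ep (BL i) = s.a a_b (BL i))) (Tr.for_wp (fun k s' => (∀ i, i < k → s'.a a_fw (BL i) = 0 ∧
    s'.a a_bw (BL i) = 0 ∧ s'.a a_ep (BL i) = s.a a_b (BL i))) nb rfl rfl rfl h.nb_eq (by omega)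
    (by omega) (by omega) ?_ ?_ fun s' _ h => h) ?_ (by simp [Cm.sz]; omega)
  · exact fun i hi => absurd hi (by omega)
  · rintro k s' - hk hf hik hI
    have e1 := (hf.2 a_BL rfl).trans h.BL_eq
    have e2 := hf.2 a_b rfl
    simp [hik, e1, e2]
    intro i hi
    simp only [Function.update_apply]
    split_ifs with e
    · rw [e]; simp
    · refine hI i (lt_of_le_of_ne hi ?_)
      rintro rfl
      exact e rfl
  · rintro s' hf hI
    have e2 := hf.2 a_b rfl
    simp [e2]
    refine ⟨by omega, fun x hx => ?_, fun v hv hb => ?_⟩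
    · obtain ⟨i, hi, rfl⟩ := hl.surj x hx
      have := hx.1
      simp only [Function.update_of_ne this.ne']
      exact ⟨(hI i hi).1, (hI i hi).2.1⟩
    · rw [Function.update_apply]
      split_ifs with e
      · rw [e]
      · obtain ⟨i, hi, rfl⟩ := hl.surj v ⟨by omega, hv, hb⟩
        exact (hI i hi).2.2

theorem wp_ifEq_fits {x y : Ex} {c d : Cm} {Q : St → Prop} (hs : s.Fits B) (hB : 1 ≤ B)
    (hx : x.ok B b s) (hy : y.ok B b s) :
    wp B b (.ifEq x y c d) Q s ↔ (x.eval s = y.eval s → wp B b c Q s) ∧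
      (x.eval s ≠ y.eval s → wp B b d Q s) :=
  wp_ifEq hB hx hy (x.eval_le hs hx) (y.eval_le hs hy)

open Ex Cm in
/-- The weight of an arc of the edge `y`, or `0` if the edge is broken or has option `k`. -/
def guardCode (r w y k : ℕ) : Cm :=
  ifEq (var v_bk) (var y) (set r (lit 0))
    (ifEq (var v_o) (lit k) (set r (lit 0)) (set r (get w (var y))))

theorem guardCode_spec {r w y k : ℕ} (hw : w ≠ 0) (hs : s.Fits B) (hB : 1 ≤ B) (hk : k ≤ B) :
    wp B b (guardCode r w y k) (fun s' => ∀ K, s'.v r ≤ K ↔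
      (s.v v_o ≠ k → s.v v_bk ≠ s.v y → s.a w (s.v y) ≤ K)) s := by
  rw [guardCode, wp_ifEq_fits hs hB (by simp) (by simp), wp_ifEq_fits hs hB (by simp) (by simpa using hk)]
  simp +contextual [hw]

-- A chain affects the powers of branch vertices only through two arcs: the upward arc that leaves
-- its lower end, and the downward arc that enters its highest vertex. Looking at these alone makes
-- the evaluation independent of the lengths of the chains.
open Ex Cm in
def slotCode : Cm :=
  set v_x (get a_BL (var v_i)) ;; bkCode ;; guardCode v_u a_wu v_x 1 ;;
  set v_z (get a_topv (var v_x)) ;; guardCode v_d a_wd v_z 0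

theorem slotCode_spec {k : ℕ} (h : Env B L mid nb BL s) (hA : s.a a_dg = A) (hi : s.v v_i = k) (hB : 6 ≤ B) :
    wp B b slotCode (fun s' => s'.v v_x = BL k ∧ s'.v v_z = L.topv (BL k) ∧
      (∀ K, s'.v v_u ≤ K ↔ (A (BL k) ≠ 1 → L.bk mid (A (BL k)) (BL k) ≠ BL k → L.wu (BL k) ≤ K)) ∧
      ∀ K, s'.v v_d ≤ K ↔ (A (BL k) ≠ 0 → L.bk mid (A (BL k)) (BL k) ≠ L.topv (BL k) →
        L.wd (L.topv (BL k)) ≤ K)) s := by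
  have hfit : (s.set v_x (BL k)).Fits B := h.fits.set _ _ (by rw [← h.BL_eq]; exact h.fits.2 _ _)
  have e0 : s.a a_BL = BL := h.BL_eq
  refine ⟨⟨trivial, by simp⟩, ?_⟩
  simp only [Ex.eval, hi, e0]
  refine wp_seq_of (bkCode_spec (x := BL k) (by simp) hfit hB) fun s1 f1 ⟨h1, h2⟩ => ?_
  refine wp_seq_of (guardCode_spec (by omega) (f1.3 hfit) (by omega) (by omega)) fun s2 f2 h3 => ?_
  have x1 : s1.v v_x = BL k := by rw [f1.1 v_x rfl]; simp
  have x2 : s2.v v_x = BL k := by rw [f2.1 v_x rfl, x1]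
  have t2 : s2.a a_topv = L.topv := by
    rw [f2.2 _ rfl, f1.2 _ rfl, ← h.lay]; rfl
  refine ⟨⟨trivial, by simp⟩, ?_⟩
  simp only [Ex.eval, x2, t2]
  refine wp_mono (guardCode_spec (by omega) ((f2.3 (f1.3 hfit)).set _ _ ?_) (by omega) (by omega))
    fun s3 f3 h4 => ⟨?_, ?_, ?_, ?_⟩
  · rw [← t2]; exact (f2.3 (f1.3 hfit)).2 _ _
  · rw [f3.1 v_x rfl]; simpa using x2
  · rw [f3.1 v_z rfl]; simp
  · intro K
    rw [f3.1 v_u rfl]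
    have := h3 K
    rw [h1, h2, x1, f1.2 a_wu rfl] at this
    simp only [St.set_v, St.set_a, h.mid_eq, hA] at this ⊢
    rw [if_neg (by omega), this]
    rw [← h.lay]
    rfl
  · intro K
    have := h4 K
    simp only [St.set_v, St.set_a, if_true, f2.1 v_o rfl, f2.1 v_bk rfl, f2.2 a_wd rfl, f1.2 a_wd rfl] at this
    norm_num [f2.1 v_o rfl, f2.1 v_bk rfl, h1, h2, h.mid_eq, hA] at this
    rw [this, ← h.lay]
    rfl

open Ex Cm in
def evalPower : Cm :=
  .for v_i 0 v_nb (slotCode ;; bump a_ep (var v_x) (var v_u) ;;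
    bump a_ep (get a_par (var v_z)) (var v_d)) ;;
  .for v_i 0 v_na (ite (get a_dg (var v_n +. var v_i)) (lit 1)
    (bump a_ep (get a_tt (var v_i)) (get a_ww (var v_i))) skip)

theorem evalPower_spec (h : Env B L mid nb BL s) (hl : Listed L nb BL) (hg : L.Good)
    (hA : s.a a_dg = A) (hep : ∀ v, v < L.n → L.br v = 1 → s.a a_ep v = s.a a_b v)
    (hB : nb + L.n + L.na + 6 ≤ B) :
    Tr B b evalPower s (40 * (nb + L.na) + 4) fun s' => ∀ v, v < L.n → L.br v = 1 →
      s'.a a_ep v = L.pw (L.selU mid A) (L.selD mid A) (L.arcs A) v := by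
  let C : ℕ → ℕ → Prop := fun v K => ∀ u, 0 < u → u < L.n → L.par u = v → L.act u ≠ 1 → L.wd u ≤ K
  let D : ℕ → ℕ → ℕ → Prop := fun v K x => (x = v → A x ≠ 1 → L.bk mid (A x) x ≠ x → L.wu x ≤ K) ∧
    (L.par (L.topv x) = v → A x ≠ 0 → L.bk mid (A x) x ≠ L.topv x → L.wd (L.topv x) ≤ K)
  have hna : s.v v_na = L.na := by rw [← h.lay]; rfl
  refine ((Tr.for_wp (fun k s' => ∀ v, v < L.n → L.br v = 1 → ∀ K, s'.a a_ep v ≤ K ↔ C v K ∧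
    ∀ i, i < k → D v K (BL i)) nb rfl rfl rfl h.nb_eq (by omega) (by omega) (by omega) ?_ ?_
    fun s' _ h => h).seq fun s1 f1 h1 => Tr.for_wp (fun k s' => ∀ v, v < L.n → L.br v = 1 → ∀ K,
    s'.a a_ep v ≤ K ↔ C v K ∧ (∀ i, i < nb → D v K (BL i)) ∧
      ∀ j, j < k → L.tt j = v → L.arcs A j → L.ww j ≤ K) L.na rfl rfl rfl (by rw [f1.1 _ rfl, hna])
      (by omega) (by omega) (by omega) ?_ ?_ ?_).mono
      (by simp [Cm.sz, slotCode, bkCode, guardCode, Cm.bump, Cm.ifEq]; omega) fun _ _ => id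
  · intro v hv hb K
    rw [show (s.set v_i 0).a a_ep = s.a a_ep from rfl, hep v hv hb, h.base]
    simp [C]
  · rintro k s' - hk hf hik hI
    refine wp_seq_of (slotCode_spec (h.frame hf rfl rfl) ((hf.2 _ rfl).trans hA) hik (by omega))
      fun s2 f2 ⟨h1, h2, h3, h4⟩ => ?_
    have e1 : s2.a a_par = L.par := by rw [f2.2 _ rfl, hf.2 _ rfl, ← h.lay]; rfl
    have e2 := f2.2 a_ep rfl
    simp [e1, e2, h1, h2]
    intro v hv hb K
    simp only [bumpAt_le_iff, hI v hv hb K, h3, h4]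
    constructor
    · rintro ⟨⟨⟨q1, q2⟩, q3⟩, q4⟩
      refine ⟨q1, fun i hi => ?_⟩
      rcases hi.lt_or_eq with r | rfl
      · exact q2 i r
      · exact ⟨fun e => q3 e.symm, fun e => q4 e.symm⟩
    · rintro ⟨q1, q2⟩
      exact ⟨⟨⟨q1, fun i hi => q2 i hi.le⟩, fun e => (q2 k le_rfl).1 e.symm⟩, fun e => (q2 k le_rfl).2 e.symm⟩
  · intro v hv hb K
    rw [show (s1.set v_i 0).a a_ep = s1.a a_ep from rfl, h1 v hv hb]
    simp
  · rintro k s' - hk hf hik hI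
    have hf' := h.frame f1 rfl rfl
    have e1 : s'.v v_n = L.n := by rw [hf.1 _ rfl, ← hf'.lay]; rfl
    have e3 : s'.a a_dg = A := (hf.2 _ rfl).trans ((f1.2 _ rfl).trans hA)
    have e4 : s'.a a_tt = L.tt := by rw [hf.2 _ rfl, ← hf'.lay]; rfl
    have e5 : s'.a a_ww = L.ww := by rw [hf.2 _ rfl, ← hf'.lay]; rfl
    simp [hik, e1, e3, e4, e5]
    refine ⟨by omega, by omega, fun hd => ?_, fun hd => ?_⟩
    · intro u hu hb K
      simp only [bumpAt_le_iff, hI u hu hb K, and_assoc]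
      refine and_congr_right fun _ => and_congr_right fun _ => ⟨?_, ?_⟩
      · rintro ⟨q1, q2⟩ j r1 r2 r3
        rcases r1.lt_or_eq with r | rfl
        · exact q1 j r r2 r3
        · exact q2 r2.symm
      · exact fun q => ⟨fun j r1 => q j r1.le, fun e => q k le_rfl e.symm hd⟩
    · intro u hu hb K
      rw [hI u hu hb K]
      refine and_congr_right fun _ => and_congr_right fun _ => ⟨fun q j r1 r2 r3 => ?_, fun q j r1 => q j (by omega)⟩
      refine q j (lt_of_le_of_ne (by omega) ?_) r2 r3
      rintro rfl
      exact hd r3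
  · intro s' _ hI v hv hb
    refine eq_of_forall_ge_iff fun K => ?_
    rw [hI v hv hb K, hg.pw_branch_le_iff mid A _ hv hb]
    refine and_congr_right fun _ => and_congr_left fun _ => ⟨fun q x hx => ?_, fun q i hi => q _ (hl.spec i hi)⟩
    obtain ⟨i, hi, rfl⟩ := hl.surj x hx
    exact q i hi

open Ex Cm in
def evalSum : Cm :=
  set v_tot (get a_ep (lit 0)) ;;
  .for v_i 0 v_nb (set v_x (get a_BL (var v_i)) ;;
    set v_tot (var v_tot +. (get a_ep (var v_x) +. get a_IC ((var v_x +. var v_x +. var v_x +. var v_x +.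
      var v_x +. var v_x) +. get a_dg (var v_x)))))

open Classical in
theorem Listed.sum_eq (hl : Listed L nb BL) (f : ℕ → ℕ) :
    ∑ x ∈ (Finset.range L.n).filter L.Br, f x = ∑ i ∈ Finset.range nb, f (BL i) := by
  refine (Finset.sum_bij (fun i _ => BL i) (fun i hi => ?_) (fun i hi j hj e => ?_) (fun x hx => ?_)
    fun _ _ => rfl).symm
  · have := hl.spec i (by simpa using hi)
    simpa using ⟨this.2.1, this⟩
  · simp only [Finset.mem_range] at hi hj
    rcases lt_trichotomy i j with h | h | h
    · exact absurd e (hl.inj i j h hj)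
    · exact h
    · exact absurd e.symm (hl.inj j i h hi)
  · obtain ⟨i, hi, e⟩ := hl.surj x (by simp at hx; exact hx.2)
    exact ⟨i, by simpa using hi, e⟩

open Classical in
theorem Lay.Good.sum_br (h : L.Good) (f : ℕ → ℕ) :
    ∑ v ∈ (Finset.range L.n).filter (fun v => L.br v = 1), f v =
      f 0 + ∑ x ∈ (Finset.range L.n).filter L.Br, f x := by
  have : (Finset.range L.n).filter (fun v => L.br v = 1) = insert 0 ((Finset.range L.n).filter L.Br) := by
    ext v
    simp only [Finset.mem_filter, Finset.mem_range, Finset.mem_insert, Lay.Br]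
    constructor
    · rintro ⟨h1, h2⟩
      rcases Nat.eq_zero_or_pos v with r | r
      exacts [.inl r, .inr ⟨h1, r, h1, h2⟩]
    · rintro (rfl | ⟨h1, -, -, h2⟩)
      exacts [⟨h.n_pos, h.br_zero⟩, ⟨h1, h2⟩]
  rw [this, Finset.sum_insert (by simp [Lay.Br])]

theorem evalSum_spec (h : Env B L mid nb BL s) (hl : Listed L nb BL) (hg : L.Good)
    (hA : s.a a_dg = A) (hA6 : ∀ x, L.Br x → A x < 6)
    (hep : ∀ v, v < L.n → L.br v = 1 → s.a a_ep v = L.pw (L.selU mid A) (L.selD mid A) (L.arcs A) v)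
    (hB : nb + 6 * L.n + 8 ≤ B) (hv : L.val mid A (L.arcs A) ≤ B) :
    Tr B b evalSum s (4 * nb + 3) fun s' => s'.v v_tot = L.val mid A (L.arcs A) := by
  set P := L.pw (L.selU mid A) (L.selD mid A) (L.arcs A) with hP
  have hval : L.val mid A (L.arcs A) = P 0 + ∑ i ∈ Finset.range nb, (P (BL i) + L.ic mid (A (BL i)) (BL i)) := by
    rw [Lay.val, hg.sum_br, hl.sum_eq, hl.sum_eq (fun x => L.ic mid (A x) x), Finset.sum_add_distrib, add_assoc]
  refine Tr.wp_seq (T := nb * 4 + 2) ?_ (by simp [Cm.sz]; omega)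
  simp
  refine Tr.for_wp (fun k s' => s'.v v_tot = P 0 + ∑ i ∈ Finset.range k, (P (BL i) +
    L.ic mid (A (BL i)) (BL i))) nb rfl rfl rfl h.nb_eq (by omega) (by omega) (by omega) ?_ ?_
    fun s' _ hI => by rw [hI, hval]
  · simpa using hep 0 hg.n_pos hg.br_zero
  · rintro k s' - hk hf hik hI
    have hbr := hl.spec k hk
    have h6 := hA6 _ hbr
    have e1 : s'.a a_BL = BL := (hf.2 _ rfl).trans (by simpa using h.BL_eq)
    have e2 : s'.a a_ep (BL k) = P (BL k) := by rw [hf.2 _ rfl]; simpa using hep _ hbr.2.1 hbr.2.2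
    have e3 : s'.a a_dg = A := (hf.2 _ rfl).trans (by simpa using hA)
    have e4 : s'.a a_IC (BL k + BL k + BL k + BL k + BL k + BL k + A (BL k)) = L.ic mid (A (BL k)) (BL k) := by
      rw [hf.2 _ rfl, show BL k + BL k + BL k + BL k + BL k + BL k + A (BL k) = 6 * BL k + A (BL k) by omega]
      simpa using h.ic_eq _ h6 _
    have hn := hbr.2.1
    -- Partial sums are bounded by the total, so no intermediate number is too large.
    have hle : ∑ i ∈ Finset.range (k + 1), (P (BL i) + L.ic mid (A (BL i)) (BL i)) ≤
      ∑ i ∈ Finset.range nb, (P (BL i) + L.ic mid (A (BL i)) (BL i)) :=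
      Finset.sum_le_sum_of_subset (Finset.range_mono (by omega))
    rw [Finset.sum_range_succ] at hle ⊢
    simp [hik, e1, e2, e3, e4, hI]
    omega

variable {B b nb : ℕ} {L : Lay} {mid BL A : ℕ → ℕ} {s : St}

/-! ### Evaluating an assignment: strong connectivity of the branch vertices -/

/-- The arrays `RF` and `RT` list the pairs that satisfy `R`. -/
def Pairs (ra : ℕ) (RF RT : ℕ → ℕ) (R : ℕ → ℕ → Prop) : Prop :=
  ∀ x y, R x y ↔ ∃ i, i < ra ∧ RF i = x ∧ RT i = y

theorem Pairs.append {ra : ℕ} {RF RT : ℕ → ℕ} {R R' : ℕ → ℕ → Prop} (h : Pairs ra RF RT R) {p q : ℕ}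
    (h' : ∀ x y, R' x y ↔ R x y ∨ (p = x ∧ q = y)) :
    Pairs (ra + 1) (Function.update RF ra p) (Function.update RT ra q) R' := by
  intro x y
  rw [h', h x y]
  constructor
  · rintro (⟨i, hi, e1, e2⟩ | ⟨rfl, rfl⟩)
    · exact ⟨i, by omega, by rwa [Function.update_of_ne hi.ne], by rwa [Function.update_of_ne hi.ne]⟩
    · exact ⟨ra, by omega, by simp, by simp⟩
  · rintro ⟨i, hi, e1, e2⟩
    rcases (Nat.lt_succ_iff.mp hi).lt_or_eq with r | rfl
    · rw [Function.update_of_ne r.ne] at e1 e2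
      exact .inl ⟨i, r, e1, e2⟩
    · simp only [Function.update_self] at e1 e2
      exact .inr ⟨e1, e2⟩

theorem Pairs.congr {ra : ℕ} {RF RT : ℕ → ℕ} {R R' : ℕ → ℕ → Prop} (h : Pairs ra RF RT R)
    (h' : ∀ x y, R' x y ↔ R x y) : Pairs ra RF RT R' := fun x y => (h' x y).trans (h x y)

theorem Pairs.swap {ra : ℕ} {RF RT : ℕ → ℕ} {R : ℕ → ℕ → Prop} (h : Pairs ra RF RT R) :
    Pairs ra RT RF (Function.swap R) := fun x y => (h y x).trans
  (exists_congr fun _ => and_congr_right fun _ => and_comm)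

open Ex Cm in
def appendPair (x y : ℕ) : Cm :=
  put a_RF (var v_ra) (var x) ;; put a_RT (var v_ra) (var y) ;; set v_ra (var v_ra +. lit 1)

open Ex Cm in
/-- Lists the arcs between branch vertices that the options `a_dg` provide. -/
def evalArcs : Cm :=
  set v_ra (lit 0) ;;
  .for v_i 0 v_nb (set v_x (get a_BL (var v_i)) ;; set v_t (get a_par (get a_topv (var v_x))) ;;
    set v_o (get a_dg (var v_x)) ;;
    -- The tests separate options `0`, `1` and `2`, which give the arc up, the arc down, and both; a
    -- broken chain gives none.
    ite (var v_o) (lit 1) (appendPair v_x v_t)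
      (ite (var v_o) (lit 2) (appendPair v_t v_x)
        (ite (var v_o) (lit 3) (appendPair v_x v_t ;; appendPair v_t v_x) skip))) ;;
  .for v_i 0 v_na (ite (get a_dg (var v_n +. var v_i)) (lit 1)
    (set v_x (get a_tt (var v_i)) ;; set v_t (get a_hh (var v_i)) ;; appendPair v_x v_t) skip)

theorem evalArcs_spec (h : Env B L mid nb BL s) (hl : Listed L nb BL) (hA : s.a a_dg = A)
    (hB : 2 * nb + L.n + L.na + 6 ≤ B) :
    Tr B b evalArcs s (30 * (nb + L.na) + 6) fun s' =>
      s'.v v_ra ≤ 2 * nb + L.na ∧ Pairs (s'.v v_ra) (s'.a a_RF) (s'.a a_RT) (L.BArc A (L.arcs A)) := by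
  let E : ℕ → ℕ → ℕ → Prop := fun x y z =>
    ((A x = 0 ∨ A x = 2) ∧ y = x ∧ z = L.par (L.topv x)) ∨
      ((A x = 1 ∨ A x = 2) ∧ y = L.par (L.topv x) ∧ z = x)
  let F : ℕ → ℕ → ℕ → Prop := fun j y z => L.arcs A j ∧ y = L.tt j ∧ z = L.hh j
  have hna : s.v v_na = L.na := by rw [← h.lay]; rfl
  have hn : s.v v_n = L.n := by rw [← h.lay]; rfl
  have hBL := h.BL_eq
  have hsucc : ∀ {P : ℕ → Prop} {k : ℕ}, (∃ i, i ≤ k ∧ P i) ↔ (∃ i, i < k ∧ P i) ∨ P k := by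
    intro P k
    constructor
    · rintro ⟨i, hi, hp⟩
      rcases hi.lt_or_eq with r | rfl
      exacts [.inl ⟨i, r, hp⟩, .inr hp]
    · rintro (⟨i, hi, hp⟩ | hp)
      exacts [⟨i, by omega, hp⟩, ⟨k, by omega, hp⟩]
  refine Tr.wp_seq (T := 30 * (nb + L.na) + 5) ⟨Nat.zero_le _, ?_⟩ (by simp [Cm.sz]; omega)
  refine ((Tr.for_wp (fun k s' => s'.v v_ra ≤ 2 * k ∧ Pairs (s'.v v_ra) (s'.a a_RF) (s'.a a_RT)
    fun y z => ∃ i, i < k ∧ E (BL i) y z) nb rfl rfl rfl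
    (by simpa using h.nb_eq) (by omega) (by omega) (by omega) ?_ ?_
    fun s' _ h => h).seq fun s1 f1 h1 => Tr.for_wp (fun k s' => s'.v v_ra ≤ 2 * nb + k ∧
      Pairs (s'.v v_ra) (s'.a a_RF) (s'.a a_RT)
    fun y z => (∃ i, i < nb ∧ E (BL i) y z) ∨ ∃ j, j < k ∧ F j y z) L.na rfl rfl rfl
      (by rw [f1.1 _ rfl]; simpa using hna)
      (by omega) (by omega) (by omega) ?_ ?_ ?_).mono
      (by simp [Cm.sz, appendPair]; omega) fun _ _ => id
  · simp [Pairs]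
  · rintro k s' - hk hf hik ⟨hr, hI⟩
    have e1 : s'.a a_BL = BL := (hf.2 _ rfl).trans hBL
    have e2 : s'.a a_par = L.par := by rw [hf.2 _ rfl, ← h.lay]; rfl
    have e3 : s'.a a_topv = L.topv := by rw [hf.2 _ rfl, ← h.lay]; rfl
    have e4 : s'.a a_dg = A := (hf.2 _ rfl).trans hA
    simp [appendPair, hik, e1, e2, e3, e4]
    refine ⟨by omega, fun q => ?_, fun q => ⟨by omega, fun q' => ?_, fun q' => ⟨by omega, fun q'' => ?_, fun q'' => ?_⟩⟩⟩
    · refine ⟨by omega, by omega, hI.append fun y z => ?_⟩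
      simp only [hsucc]
      refine or_congr_right ?_
      simp [E, q, eq_comm]
    · have : A (BL k) = 1 := by omega
      refine ⟨by omega, by omega, hI.append fun y z => ?_⟩
      simp only [hsucc]
      refine or_congr_right ?_
      simp [E, this, eq_comm]
    · have : A (BL k) = 2 := by omega
      refine ⟨by omega, by omega, by omega, (hI.append (p := BL k) (q := L.par (L.topv (BL k))) fun y z => Iff.rfl).append fun y z => ?_⟩
      simp only [hsucc]
      rw [or_assoc]
      refine or_congr_right ?_
      simp [E, this, eq_comm]
    · refine ⟨by omega, hI.congr fun y z => ?_⟩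
      simp only [hsucc]
      refine or_iff_left ?_
      simp only [E]
      omega
  · refine ⟨h1.1, h1.2.congr fun y z => ?_⟩
    simp
  · rintro k s' - hk hf hik ⟨hr, hI⟩
    have e1 : s'.a a_tt = L.tt := by rw [hf.2 _ rfl, f1.2 _ rfl, ← h.lay]; rfl
    have e2 : s'.a a_hh = L.hh := by rw [hf.2 _ rfl, f1.2 _ rfl, ← h.lay]; rfl
    have e4 : s'.a a_dg = A := (hf.2 _ rfl).trans ((f1.2 _ rfl).trans hA)
    have e5 : s'.v v_n = L.n := by rw [hf.1 _ rfl, f1.1 _ rfl]; exact hn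
    simp [appendPair, hik, e1, e2, e4, e5]
    refine ⟨by omega, by omega, fun q => ?_, fun q => ⟨by omega, hI.congr fun y z => ?_⟩⟩
    · refine ⟨by omega, by omega, hI.append fun y z => ?_⟩
      simp only [hsucc]
      rw [← or_assoc]
      refine or_congr_right ?_
      have : L.arcs A k := q
      simp [F, this, eq_comm]
    · simp only [hsucc]
      rw [← or_assoc]
      refine or_iff_left ?_
      exact fun c => q c.1
  · rintro s' - ⟨hr, hI⟩
    refine ⟨hr, hI.congr fun y z => ?_⟩
    rw [Lay.BArc]
    constructor
    · rintro (⟨q1, q2, q3, q4, rfl⟩ | ⟨q1, q2, q3, q4, rfl⟩ | ⟨j, hj, q⟩)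
      · obtain ⟨i, hi, rfl⟩ := hl.surj y ⟨q1, q2, q3⟩
        exact .inl ⟨i, hi, .inl ⟨q4, rfl, rfl⟩⟩
      · obtain ⟨i, hi, rfl⟩ := hl.surj z ⟨q1, q2, q3⟩
        exact .inl ⟨i, hi, .inr ⟨q4, rfl, rfl⟩⟩
      · exact .inr ⟨j, hj, q⟩
    · rintro (⟨i, hi, ⟨q4, rfl, rfl⟩ | ⟨q4, rfl, rfl⟩⟩ | ⟨j, hj, q⟩)
      · obtain ⟨q1, q2, q3⟩ := hl.spec i hi
        exact .inl ⟨q1, q2, q3, q4, rfl⟩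
      · obtain ⟨q1, q2, q3⟩ := hl.spec i hi
        exact .inr (.inl ⟨q1, q2, q3, q4, rfl⟩)
      · exact .inr (.inr ⟨j, hj, q⟩)

open Ex Cm in
def reachBody (src tgt f : ℕ) : Cm :=
  set v_ch (lit 0) ;;
  .for v_i 0 v_ra (ite (lit 0) (get f (get src (var v_i))) (ite (get f (get tgt (var v_i))) (lit 1)
    (put f (get tgt (var v_i)) (lit 1) ;; set v_ch (lit 1)) skip) skip)

open Ex Cm in
/-- Marks in `f` everything that can be reached from marked vertices along the listed pairs. -/
def reach (src tgt f : ℕ) : Cm :=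
  set v_ch (lit 1) ;; .while (lit 0) (var v_ch) (reachBody src tgt f)

/-- Marks are always sound, and a sweep that changes nothing shows that they are closed under the
pairs. The potential is the number of unmarked elements of `V` plus the flag `v_ch`: a changing
sweep marks a new element, and the final one lowers the flag. So there are at most `V.card + 1`
sweeps. -/
theorem reach_spec {src tgt f ra : ℕ} {R : ℕ → ℕ → Prop} (V : Finset ℕ)
    (hsf : Nat.beq src f = false) (htf : Nat.beq tgt f = false) (hf0 : f ≠ 0) (hs0 : src ≠ 0) (ht0 : tgt ≠ 0)
    (hra : s.v v_ra = ra) (hB : ra + 2 ≤ B) (hR : Pairs ra (s.a src) (s.a tgt) R)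
    (h0 : s.a f 0 = 1) (hz : ∀ v ∈ V, s.a f v = 0) (hV : ∀ x y, R x y → (x = 0 ∨ x ∈ V) ∧ (y = 0 ∨ y ∈ V)) :
    Tr B b (reach src tgt f) s ((V.card + 1) * (8 * ra + 4) + 2) fun s' =>
      ∀ v, v = 0 ∨ v ∈ V → (0 < s'.a f v ↔ Relation.ReflTransGen R 0 v) := by
  have hsf' : src ≠ f := by rintro rfl; simp at hsf
  have htf' : tgt ≠ f := by rintro rfl; simp at htf
  let un : (ℕ → ℕ) → ℕ := fun g => (V.filter fun v => g v = 0).card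
  let J : St → Prop := fun s' => s'.a f 0 = 1 ∧ s'.v v_ch ≤ 1 ∧
    ∀ v, v = 0 ∨ v ∈ V → 0 < s'.a f v → Relation.ReflTransGen R 0 v
  let N : ℕ → St → Prop := fun k s' => s'.v v_ch = 0 →
    ∀ i, i < k → 0 < s'.a f (s.a src i) → 0 < s'.a f (s.a tgt i)
  have hfa : ∀ j, (reachBody src tgt f).wa j = Nat.beq j f := fun j => by
    simp [reachBody, Cm.for, Cm.wa]
  have hun : ∀ (g : ℕ → ℕ) t, t ∈ V → g t = 0 → un (Function.update g t 1) + 1 ≤ un g := by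
    intro g t ht hg
    refine Finset.card_lt_card ((Finset.ssubset_iff_of_subset fun v hv => ?_).2 ⟨t, ?_, ?_⟩)
    · simp only [Finset.mem_filter, Function.update_apply] at hv ⊢
      split_ifs at hv with e
      · simp at hv
      · exact hv
    · simp [ht, hg]
    · simp
  refine Tr.wp_seq (T := (V.card + 1) * (8 * ra + 4) + 1) ⟨by show 1 ≤ B; omega, ?_⟩ (by simp [Cm.sz]; omega)
  refine (Tr.while (T := 8 * ra + 3) (fun s' => J s' ∧ N ra s') (fun s' => un (s'.a f) + s'.v v_ch)
    ?_ ?_ ?_ ?_).mono ?_ fun _ _ => id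
  · refine ⟨⟨by simpa using h0, by simp, fun v hv h1 => ?_⟩, fun h1 => by simp at h1⟩
    rcases hv with rfl | hv
    · exact .refl
    · simp [hz v hv] at h1
  · exact fun _ _ _ => ⟨Nat.zero_le _, trivial⟩
  · rintro s1 hf ⟨⟨j1, j2, j3⟩, -⟩ hch
    replace hch : 0 < s1.v v_ch := hch
    have hsrc1 : s1.a src = s.a src := by rw [hf.2 _ ((hfa _).trans hsf)]; rfl
    have htgt1 : s1.a tgt = s.a tgt := by rw [hf.2 _ ((hfa _).trans htf)]; rfl
    have hra1 : s1.v v_ra = ra := by rw [hf.1 _ rfl]; exact hra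
    refine Tr.wp_seq (T := 8 * ra + 2) ⟨Nat.zero_le _, ?_⟩ (by simp [Cm.sz]; omega)
    refine (Tr.for_wp (fun k s' => (J s' ∧ N k s') ∧ un (s'.a f) + s'.v v_ch ≤ un (s1.a f)) ra rfl rfl rfl
      (by simpa using hra1) (by omega) (by omega) (by omega) ?_ ?_ ?_).mono (by simp [Cm.sz]; omega) fun _ _ => id
    · refine ⟨⟨⟨by simpa using j1, by simp, fun v hv => by simpa using j3 v hv⟩, fun _ i hi => by omega⟩, by simp⟩
    · rintro k s' - hk hf' hik ⟨⟨⟨i1, i2, i3⟩, i4⟩, i5⟩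
      have hsrc' : s'.a src = s.a src := by
        rw [hf'.2 src (by simpa [Cm.for, Cm.wa] using hsf)]; exact hsrc1
      have htgt' : s'.a tgt = s.a tgt := by
        rw [hf'.2 tgt (by simpa [Cm.for, Cm.wa] using htf)]; exact htgt1
      have hRk : R (s.a src k) (s.a tgt k) := (hR _ _).2 ⟨k, hk, rfl, rfl⟩
      have hVk := hV _ _ hRk
      simp [hik, hsrc', htgt', hf0, hs0, ht0]
      refine ⟨fun q1 => ⟨by omega, fun q2 => ⟨by omega, ⟨⟨?_, ?_, ?_⟩, ?_⟩, ?_⟩, fun q2 => ?_⟩, fun q1 => ?_⟩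
      · simp [Function.update_apply, i1]
      · simp
      · intro v hv h1
        by_cases e : v = s.a tgt k
        · subst e; exact (i3 _ hVk.1 q1).tail hRk
        · simp [e] at h1
          exact i3 v hv h1
      · intro h1; simp at h1
      · have : s.a tgt k ∈ V := hVk.2.resolve_left fun e => by rw [e] at q2; omega
        have := hun (s'.a f) _ this q2
        omega
      · refine ⟨⟨⟨by simpa using i1, by simpa using i2, by simpa using i3⟩, fun h1 i hi => ?_⟩, i5⟩
        rcases (Nat.lt_succ_iff.mp hi).lt_or_eq with r | rfl
        · simpa using i4 (by simpa using h1) i r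
        · simp; omega
      · refine ⟨⟨⟨by simpa using i1, by simpa using i2, by simpa using i3⟩, fun h1 i hi => ?_⟩, i5⟩
        rcases (Nat.lt_succ_iff.mp hi).lt_or_eq with r | rfl
        · simpa using i4 (by simpa using h1) i r
        · simp; omega
    · rintro s' - ⟨hJ, hle⟩
      exact ⟨hJ, by show un _ + _ < un _ + _; omega⟩
  · rintro s' - ⟨⟨j1, j2, j3⟩, j4⟩ hch v hv
    have hc : s'.v v_ch = 0 := by simpa [Ex.eval] using hch
    refine ⟨j3 v hv, fun hr => ?_⟩
    clear hv
    induction hr with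
    | refl => omega
    | tail _ hbc ih =>
      obtain ⟨i, hi, rfl, rfl⟩ := (hR _ _).1 hbc
      exact j4 hc i hi ih
  · have : un ((s.set v_ch 1).a f) ≤ V.card := Finset.card_filter_le _ _
    have := Nat.mul_le_mul_right (8 * ra + 4) (show un ((s.set v_ch 1).a f) + (s.set v_ch 1).v v_ch ≤ V.card + 1 by
      simp at this ⊢; omega)
    show (un ((s.set v_ch 1).a f) + (s.set v_ch 1).v v_ch) * (8 * ra + 4) + 1 ≤ _
    omega

variable {B b nb : ℕ} {L : Lay} {mid BL A : ℕ → ℕ} {s : St}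

open Ex Cm in
def evalOk : Cm :=
  set v_ok (lit 1) ;;
  .for v_i 0 v_nb (set v_x (get a_BL (var v_i)) ;; ite (lit 0) (get a_fw (var v_x))
    (ite (lit 0) (get a_bw (var v_x)) skip (set v_ok (lit 0))) (set v_ok (lit 0)))

theorem evalOk_spec (h : Env B L mid nb BL s) (hB : nb + 2 ≤ B) :
    Tr B b evalOk s (9 * nb + 3) fun s' => 0 < s'.v v_ok ↔
      ∀ i, i < nb → 0 < s.a a_fw (BL i) ∧ 0 < s.a a_bw (BL i) := by
  refine Tr.wp_seq (T := 9 * nb + 2) ⟨by show 1 ≤ B; omega, ?_⟩ (by simp [Cm.sz]; omega)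
  refine (Tr.for_wp (fun k s' => 0 < s'.v v_ok ↔
      ∀ i, i < k → 0 < s.a a_fw (BL i) ∧ 0 < s.a a_bw (BL i)) nb rfl rfl rfl
    (by simpa using h.nb_eq) (by omega) (by omega) (by omega) ?_ ?_ fun s' _ h => h).mono
    (by simp [Cm.sz]; omega) fun _ _ => id
  · simp
  · rintro k s' - hk hf hik hI
    have e1 : s'.a a_BL = BL := by rw [hf.2 _ rfl]; simpa using h.BL_eq
    have e2 : s'.a a_fw = s.a a_fw := by rw [hf.2 _ rfl]; simp
    have e3 : s'.a a_bw = s.a a_bw := by rw [hf.2 _ rfl]; simp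
    have hs : (∀ i, i ≤ k → 0 < s.a a_fw (BL i) ∧ 0 < s.a a_bw (BL i)) ↔
        (∀ i, i < k → 0 < s.a a_fw (BL i) ∧ 0 < s.a a_bw (BL i)) ∧ 0 < s.a a_fw (BL k) ∧ 0 < s.a a_bw (BL k) := by
      refine ⟨fun q => ⟨fun i hi => q i hi.le, q k le_rfl⟩, fun q i hi => ?_⟩
      rcases hi.lt_or_eq with r | rfl
      exacts [q.1 i r, q.2]
    simp [hik, e1, e2, e3]
    rw [hs]
    refine ⟨fun q1 => ⟨fun q2 => ?_, fun q2 => ?_⟩, fun q1 => ?_⟩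
    · rw [hI]; exact ⟨fun q => ⟨q, q1, q2⟩, fun q => q.1⟩
    · exact ⟨k, le_rfl, fun _ => q2⟩
    · exact ⟨k, le_rfl, fun c => by omega⟩

/-- Computes the cost of the assignment `a_dg` and decides whether it is strongly connected. -/
def evaluate : Cm :=
  evalInit ;; evalPower ;; evalSum ;; evalArcs ;; reach a_RF a_RT a_fw ;; reach a_RT a_RF a_bw ;; evalOk

open Classical in
theorem evaluate_spec (h : Env B L mid nb BL s) (hl : Listed L nb BL) (hg : L.Good)
    (hA : s.a a_dg = A) (hA6 : ∀ x, L.Br x → A x < 6) (hB : 2 * nb + 6 * L.n + L.na + 8 ≤ B)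
    (hv : L.val mid A (L.arcs A) ≤ B) :
    Tr B b evaluate s (200 * ((nb + L.na + 1) * (nb + L.na + 1))) fun s' =>
      s'.v v_tot = L.val mid A (L.arcs A) ∧ (0 < s'.v v_ok ↔ L.BStrong A (L.arcs A)) := by
  set V := (Finset.range L.n).filter L.Br with hVd
  have hVc : V.card = nb := by
    have := hl.sum_eq fun _ => 1
    simpa using this
  have hVm : ∀ v, v ∈ V ↔ L.Br v := fun v => by
    simp only [hVd, Finset.mem_filter, Finset.mem_range]
    exact ⟨fun q => q.2, fun q => ⟨q.2.1, q⟩⟩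
  have hbr : ∀ v, v < L.n → L.br v = 1 → v = 0 ∨ v ∈ V := fun v h1 h2 => by
    rcases Nat.eq_zero_or_pos v with r | r
    exacts [.inl r, .inr ((hVm v).2 ⟨r, h1, h2⟩)]
  have htop : ∀ x, L.Br x → L.par (L.topv x) = 0 ∨ L.par (L.topv x) ∈ V := fun x hx => by
    obtain ⟨g1, g2⟩ := hg.bk_bot hx
    have := hg.topv_spec x g1
    rw [g2] at this
    exact hbr _ (hg.par_lt _ this.1.1 this.1.2.1) this.2.1
  have hBA : ∀ x y, L.BArc A (L.arcs A) x y → (x = 0 ∨ x ∈ V) ∧ (y = 0 ∨ y ∈ V) := by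
    rintro x y (⟨q1, q2, q3, -, rfl⟩ | ⟨q1, q2, q3, -, rfl⟩ | ⟨j, hj, -, rfl, rfl⟩)
    · exact ⟨.inr ((hVm _).2 ⟨q1, q2, q3⟩), htop _ ⟨q1, q2, q3⟩⟩
    · exact ⟨htop _ ⟨q1, q2, q3⟩, .inr ((hVm _).2 ⟨q1, q2, q3⟩)⟩
    · obtain ⟨q1, q2, q3, q4⟩ := hg.arc_br j hj
      exact ⟨hbr _ q1 q2, hbr _ q3 q4⟩
  have ht : ∀ ra, ra ≤ 2 * nb + L.na → (nb + 1) * (8 * ra + 4) ≤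
      16 * ((nb + L.na + 1) * (nb + L.na + 1)) := fun ra hr => by
    have := Nat.mul_le_mul (show nb + 1 ≤ nb + L.na + 1 by omega) (show 8 * ra + 4 ≤ 16 * (nb + L.na + 1) by omega)
    linarith
  have hq : nb + L.na + 1 ≤ (nb + L.na + 1) * (nb + L.na + 1) := Nat.le_mul_self _
  refine ((evalInit_spec h hl (by omega)).seq fun s1 f1 ⟨p1, p2, p3, p4⟩ =>
    (evalPower_spec (b := b) (h.frame f1 rfl rfl) hl hg ((f1.2 _ rfl).trans hA)
      (fun v hv hb => (p4 v hv hb).trans (by rw [f1.2 _ rfl])) (by omega)).seq fun s2 f2 h2 =>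
    (evalSum_spec (b := b) ((h.frame f1 rfl rfl).frame f2 rfl rfl) hl hg
      ((f2.2 _ rfl).trans ((f1.2 _ rfl).trans hA)) hA6 h2 (by omega) hv).seq fun s3 f3 h3 =>
    (evalArcs_spec (b := b) (((h.frame f1 rfl rfl).frame f2 rfl rfl).frame f3 rfl rfl) hl
      ((f3.2 _ rfl).trans ((f2.2 _ rfl).trans ((f1.2 _ rfl).trans hA))) (by omega)).seq fun s4 f4 ⟨h4, h4'⟩ =>
    (((reach_spec (b := b) V rfl rfl (by omega) (by omega) (by omega) rfl (by omega) h4' ?_ ?_ hBA).mono (T' := 16 * ((nb + L.na + 1) * (nb + L.na + 1)) + 2) ?_ fun _ _ => id).seq fun s5 f5 h5 =>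
    ((reach_spec (b := b) (ra := s4.v v_ra) (R := Function.swap (L.BArc A (L.arcs A))) V rfl rfl (by omega) (by omega) (by omega) (f5.1 _ rfl) (by omega)
      (by rw [f5.2 a_RF rfl, f5.2 a_RT rfl]; exact h4'.swap) ?_ ?_ fun x y hxy => (hBA _ _ hxy).symm).mono (T' := 16 * ((nb + L.na + 1) * (nb + L.na + 1)) + 2) ?_ fun _ _ => id).seq fun s6 f6 h6 =>
    (evalOk_spec (b := b) ((((((h.frame f1 rfl rfl).frame f2 rfl rfl).frame f3 rfl rfl).frame f4 rfl rfl).frame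
      f5 rfl rfl).frame f6 rfl rfl) (by omega)).mono le_rfl fun s7 f7 h7 => ⟨?_, ?_⟩)).mono (by omega) fun _ _ => id
  · rw [f4.2 _ rfl, f3.2 _ rfl, f2.2 _ rfl]; exact p1
  · intro v hv
    rw [f4.2 _ rfl, f3.2 _ rfl, f2.2 _ rfl]; exact (p3 v ((hVm v).1 hv)).1
  · rw [hVc]; have := ht _ h4; omega
  · rw [f5.2 _ rfl, f4.2 _ rfl, f3.2 _ rfl, f2.2 _ rfl]; exact p2
  · intro v hv
    rw [f5.2 _ rfl, f4.2 _ rfl, f3.2 _ rfl, f2.2 _ rfl]; exact (p3 v ((hVm v).1 hv)).2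
  · rw [hVc]; have := ht _ h4; omega
  · rw [f7.1 _ rfl, f6.1 _ rfl, f5.1 _ rfl, f4.1 _ rfl, h3]
  · rw [h7, f6.2 a_fw rfl]
    constructor
    · intro q v hv hb
      rcases Nat.eq_zero_or_pos v with rfl | r
      · exact ⟨.refl, .refl⟩
      · obtain ⟨i, hi, rfl⟩ := hl.surj v ⟨r, hv, hb⟩
        have hm := hbr _ hv hb
        refine ⟨(h5 _ hm).1 (q i hi).1, ?_⟩
        have := (h6 _ hm).1 (q i hi).2
        rwa [Relation.reflTransGen_swap] at this
    · intro q i hi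
      have hb := hl.spec i hi
      have hm := hbr _ hb.2.1 hb.2.2
      refine ⟨(h5 _ hm).2 (q _ hb.2.1 hb.2.2).1, (h6 _ hm).2 ?_⟩
      rw [Relation.reflTransGen_swap]
      exact (q _ hb.2.1 hb.2.2).2

variable {B b nb K : ℕ} {L : Lay} {mid BL A : ℕ → ℕ} {s : St}

/-! ### Counting through the assignments in base six -/

/-- The number with the base `6` digits `f`. -/
def num (K : ℕ) (f : ℕ → ℕ) : ℕ := ∑ i ∈ Finset.range K, f i * 6 ^ i

theorem num_lt {f : ℕ → ℕ} (h : ∀ i, i < K → f i < 6) : num K f < 6 ^ K := by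
  induction K with
  | zero => simp [num]
  | succ K ih =>
    have h1 := ih fun i hi => h i (by omega)
    have h2 := h K (by omega)
    rw [num, Finset.sum_range_succ, pow_succ]
    change num K f + _ < _
    have := Nat.mul_le_mul_right (6 ^ K) (Nat.le_of_lt_succ h2)
    omega

theorem num_inj {f g : ℕ → ℕ} (hf : ∀ i, i < K → f i < 6) (hg : ∀ i, i < K → g i < 6)
    (h : num K f = num K g) : ∀ i, i < K → f i = g i := by
  induction K with
  | zero => omega
  | succ K ih =>
    have h1 := num_lt (K := K) fun i hi => hf i (by omega)
    have h2 := num_lt (K := K) fun i hi => hg i (by omega)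
    have e : ∀ f, num (K + 1) f = num K f + f K * 6 ^ K := fun f => Finset.sum_range_succ _ _
    rw [e, e] at h
    have hK : f K = g K := by
      have := congrArg (· / 6 ^ K) h
      simpa [Nat.add_mul_div_right, Nat.div_eq_of_lt, h1, h2] using this
    rw [hK] at h
    intro i hi
    rcases (Nat.lt_succ_iff.mp hi).lt_or_eq with r | rfl
    · exact ih (fun i hi => hf i (by omega)) (fun i hi => hg i (by omega)) (by omega) i r
    · exact hK

theorem num_update {f : ℕ → ℕ} {p d : ℕ} (hp : p < K) :
    num K (Function.update f p d) + f p * 6 ^ p = num K f + d * 6 ^ p := by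
  have hm : p ∈ Finset.range K := Finset.mem_range.2 hp
  simp only [num]
  rw [← Finset.add_sum_erase _ _ hm, ← Finset.add_sum_erase (a := p) (f := fun i => f i * 6 ^ i) _ hm,
    Finset.sum_congr rfl fun i hi => by rw [Function.update_of_ne (Finset.ne_of_mem_erase hi)]]
  simp only [Function.update_self]
  omega

open Ex Cm in
def nextBody : Cm :=
  ite (var v_p) (var v_K)
    (set v_x (get a_BL (var v_p)) ;; ite (get a_dg (var v_x)) (lit 5)
      (put a_dg (var v_x) (get a_dg (var v_x) +. lit 1) ;; set v_c (lit 0))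
      (put a_dg (var v_x) (lit 0) ;; set v_p (var v_p +. lit 1)))
    (set v_done (lit 1) ;; set v_c (lit 0))

open Ex Cm in
/-- Moves on to the next assignment. -/
def next : Cm :=
  set v_p (lit 0) ;; set v_c (lit 1) ;; .while (lit 0) (var v_c) nextBody

/-- Addition of one with a carry `v_c` at position `v_p`: the number plus `6 ^ v_p * v_c` stays
equal to the old number plus one. A carry that arrives at position `K` shows that all digits were
`5`. -/
theorem next_spec (hBL : s.a a_BL = BL) (hK : s.v v_K = K) (hinj : ∀ i j, i < j → j < K → BL i ≠ BL j)
    (hd : ∀ i, i < K → s.a a_dg (BL i) < 6) (h0 : s.v v_done = 0) (hB : K + 6 ≤ B) :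
    Tr B b next s (11 * K + 15) fun s' => (∀ i, i < K → s'.a a_dg (BL i) < 6) ∧
      ((s'.v v_done = 0 ∧ num K (fun i => s'.a a_dg (BL i)) = num K (fun i => s.a a_dg (BL i)) + 1) ∨
        (s'.v v_done = 1 ∧ 6 ^ K ≤ num K (fun i => s.a a_dg (BL i)) + 1)) := by
  set N := num K (fun i => s.a a_dg (BL i)) with hN
  have hinj' : ∀ i j, i < K → j < K → BL i = BL j → i = j := fun i j hi hj e => by
    rcases lt_trichotomy i j with h | h | h
    · exact absurd e (hinj i j h hj)
    · exact h
    · exact absurd e.symm (hinj j i h hi)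
  have hupd : ∀ (f : ℕ → ℕ) p d, p < K → ∀ i, i < K → Function.update f (BL p) d (BL i) =
      Function.update (fun i => f (BL i)) p d i := fun f p d hp i hi => by
    simp only [Function.update_apply]
    by_cases e : i = p
    · simp [e]
    · rw [if_neg e, if_neg fun c => e (hinj' i p hi hp c)]
  have hnum : ∀ (f : ℕ → ℕ) p d, p < K → num K (fun i => Function.update f (BL p) d (BL i)) + f (BL p) * 6 ^ p =
      num K (fun i => f (BL i)) + d * 6 ^ p := fun f p d hp => by
    rw [← num_update (f := fun i => f (BL i)) (d := d) hp]
    congr 1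
    exact Finset.sum_congr rfl fun i hi => by
      beta_reduce; rw [hupd f p d hp i (by simpa using hi)]
  refine Tr.wp_seq (T := 11 * K + 14) ⟨Nat.zero_le _, ?_⟩ (by simp [Cm.sz]; omega)
  refine Tr.wp_seq (T := 11 * K + 13) ⟨by show 1 ≤ B; omega, ?_⟩ (by simp [Cm.sz]; omega)
  simp only [Ex.eval]
  refine (Tr.while (T := nextBody.sz) (fun s' => s'.v v_p ≤ K ∧ s'.v v_c ≤ 1 ∧
    (∀ i, i < K → s'.a a_dg (BL i) < 6) ∧
    ((s'.v v_done = 0 ∧ num K (fun i => s'.a a_dg (BL i)) + 6 ^ s'.v v_p * s'.v v_c = N + 1) ∨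
      (s'.v v_done = 1 ∧ s'.v v_c = 0 ∧ 6 ^ K ≤ N + 1)))
    (fun s' => K - s'.v v_p + s'.v v_c) ?_ ?_ ?_ ?_).mono ?_ fun _ _ => id
  · simp [h0, hN]
    exact hd
  · exact fun _ _ _ => ⟨Nat.zero_le _, trivial⟩
  · rintro s1 hf ⟨i1, i2, i3, i4⟩ hc
    have e1 : s1.a a_BL = BL := by rw [hf.2 _ rfl]; simpa using hBL
    have e2 : s1.v v_K = K := by rw [hf.1 _ rfl]; simpa using hK
    have hc1 : s1.v v_c = 1 := by
      have : 0 < s1.v v_c := hc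
      omega
    have i5 : s1.v v_done = 0 ∧ num K (fun i => s1.a a_dg (BL i)) + 6 ^ s1.v v_p * 1 = N + 1 := by
      rw [hc1] at i4; simpa using i4
    obtain ⟨i5, i6⟩ := i5
    refine Tr.wp ?_
    simp [nextBody, e1, e2, hc1, i5]
    have hdg : ∀ d, d < 6 → s1.v v_p < K → ∀ i, i < K →
        Function.update (s1.a a_dg) (BL (s1.v v_p)) d (BL i) < 6 := fun d hd' _ i hi => by
      rw [Function.update_apply]; split_ifs
      exacts [hd', i3 i hi]
    refine ⟨fun q => ⟨by omega, fun q1 => ?_, fun q1 => ?_⟩, fun q => ?_⟩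
    · have := hnum (s1.a a_dg) (s1.v v_p) (s1.a a_dg (BL (s1.v v_p)) + 1) q
      rw [Nat.add_mul] at this
      refine ⟨⟨by omega, by omega⟩, i1, hdg _ (by omega) q, by omega⟩
    · have := hnum (s1.a a_dg) (s1.v v_p) 0 q
      have h5 : s1.a a_dg (BL (s1.v v_p)) = 5 := by have := i3 _ q; omega
      rw [h5] at this
      refine ⟨by omega, ⟨q, hdg _ (by omega) q, ?_⟩, by omega⟩
      rw [pow_succ]
      omega
    · have : s1.v v_p = K := by omega
      rw [this] at i6
      exact ⟨by omega, i1, i3, by omega⟩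
  · rintro s1 - ⟨i1, i2, i3, i4⟩ hc
    have hc0 : s1.v v_c = 0 := by
      have : ¬ 0 < s1.v v_c := hc
      omega
    refine ⟨i3, ?_⟩
    rcases i4 with ⟨g1, g2⟩ | ⟨g1, g2, g3⟩
    · exact .inl ⟨g1, by simpa [hc0] using g2⟩
    · exact .inr ⟨g1, g3⟩
  · have : nextBody.sz = 9 := rfl
    rw [this]
    simp
    omega

/-! ### Searching for the best assignment -/

/-- The assignment `D` is feasible and costs `c`. -/
structure Feas (L : Lay) (mid BL : ℕ → ℕ) (K : ℕ) (D : ℕ → ℕ) (c : ℕ) : Prop where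
  digit : ∀ i, i < K → D (BL i) < 6
  strong : L.BStrong D (L.arcs D)
  cost : c = L.val mid D (L.arcs D)

theorem Listed.agree (hl : Listed L nb BL) (hs : ∀ j, j < L.na → BL (nb + j) = L.n + j) {D D' : ℕ → ℕ}
    (h : ∀ i, i < nb + L.na → D (BL i) = D' (BL i)) : L.Agree D D' := by
  refine ⟨fun x hx => ?_, fun j hj => ?_⟩
  · obtain ⟨i, hi, rfl⟩ := hl.surj x hx
    exact h i (by omega)
  · have := h (nb + j) (by omega)
    rwa [hs j hj] at this

open Ex Cm in
def copyBest : Cm :=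
  set v_fnd (lit 1) ;; set v_best (var v_tot) ;;
  .for v_i 0 v_K (set v_x (get a_BL (var v_i)) ;; put a_bd (var v_x) (get a_dg (var v_x)))

open Ex Cm in
/-- Stores the current assignment if it is feasible and better than the stored one. -/
def record : Cm :=
  ite (lit 0) (var v_ok) (ite (var v_fnd) (lit 1) copyBest
    (ite (var v_tot) (var v_best) copyBest skip)) skip

theorem copyBest_spec (hBL : s.a a_BL = BL) (hK : s.v v_K = K) (hB : K + 6 ≤ B) :
    Tr B b copyBest s (4 * K + 4) fun s' => s'.v v_fnd = 1 ∧ s'.v v_best = s.v v_tot ∧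
      ∀ i, i < K → s'.a a_bd (BL i) = s.a a_dg (BL i) := by
  refine Tr.wp_seq (T := 4 * K + 3) ⟨by show 1 ≤ B; omega, ?_⟩ (by simp [Cm.sz]; omega)
  refine Tr.wp_seq (T := 4 * K + 2) ⟨trivial, ?_⟩ (by simp [Cm.sz]; omega)
  refine (Tr.for_wp (fun k s' => ∀ i, i < k → s'.a a_bd (BL i) = s.a a_dg (BL i)) K rfl rfl rfl
    (by simpa using hK) (by omega) (by omega) (by omega) ?_ ?_ fun s' hf h => ⟨?_, ?_, h⟩).mono
    (by simp [Cm.sz]; omega) fun _ _ => id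
  · exact fun i hi => absurd hi (by omega)
  · rintro k s' - hk hf hik hI
    have e1 : s'.a a_BL = BL := by rw [hf.2 _ rfl]; simpa using hBL
    have e2 : s'.a a_dg = s.a a_dg := by rw [hf.2 _ rfl]; simp
    simp [hik, e1, e2]
    intro i hi
    rw [Function.update_apply]
    split_ifs with e
    · rw [e]
    · refine hI i (lt_of_le_of_ne hi ?_)
      rintro rfl
      exact e rfl
  · rw [hf.1 _ rfl]; simp [Ex.eval]
  · rw [hf.1 _ rfl]; simp [Ex.eval]

theorem record_spec (hg : L.Good) (hl : Listed L nb BL) (hs : ∀ j, j < L.na → BL (nb + j) = L.n + j)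
    (hBL : s.a a_BL = BL) (hK : s.v v_K = nb + L.na) (hA : s.a a_dg = A) (hB : nb + L.na + 6 ≤ B)
    (hd : ∀ i, i < nb + L.na → A (BL i) < 6) (htot : s.v v_tot = L.val mid A (L.arcs A))
    (hok : 0 < s.v v_ok ↔ L.BStrong A (L.arcs A)) (hf1 : s.v v_fnd ≤ 1)
    (hf : s.v v_fnd = 1 → Feas L mid BL (nb + L.na) (s.a a_bd) (s.v v_best)) :
    Tr B b record s (4 * (nb + L.na) + 8) fun s' => s'.v v_fnd ≤ 1 ∧
      (s'.v v_fnd = 1 → Feas L mid BL (nb + L.na) (s'.a a_bd) (s'.v v_best)) ∧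
      (L.BStrong A (L.arcs A) → s'.v v_fnd = 1 ∧ s'.v v_best ≤ L.val mid A (L.arcs A)) ∧
      (s.v v_fnd = 1 → s'.v v_fnd = 1 ∧ s'.v v_best ≤ s.v v_best) := by
  have hcopy : L.BStrong A (L.arcs A) → (s.v v_fnd = 1 → s.v v_tot ≤ s.v v_best) →
      Tr B b copyBest s (4 * (nb + L.na) + 4) fun s' => s'.v v_fnd ≤ 1 ∧
      (s'.v v_fnd = 1 → Feas L mid BL (nb + L.na) (s'.a a_bd) (s'.v v_best)) ∧
      (L.BStrong A (L.arcs A) → s'.v v_fnd = 1 ∧ s'.v v_best ≤ L.val mid A (L.arcs A)) ∧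
      (s.v v_fnd = 1 → s'.v v_fnd = 1 ∧ s'.v v_best ≤ s.v v_best) := fun hS hle => by
    refine (copyBest_spec hBL hK hB).mono le_rfl fun s' _ ⟨h1, h2, h3⟩ => ⟨by omega, fun _ => ?_, fun _ => ⟨h1, by omega⟩,
      fun q => ⟨h1, by have := hle q; omega⟩⟩
    rw [hA] at h3
    have ha := hl.agree hs fun i hi => (h3 i hi).symm
    exact ⟨fun i hi => by rw [h3 i hi]; exact hd i hi, hS.agree ha, by rw [h2, htot]; exact hg.val_agree ha⟩
  have hskip : (L.BStrong A (L.arcs A) → s.v v_fnd = 1 ∧ s.v v_best ≤ s.v v_tot) →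
      Tr B b .skip s (4 * (nb + L.na) + 5) fun s' => s'.v v_fnd ≤ 1 ∧
      (s'.v v_fnd = 1 → Feas L mid BL (nb + L.na) (s'.a a_bd) (s'.v v_best)) ∧
      (L.BStrong A (L.arcs A) → s'.v v_fnd = 1 ∧ s'.v v_best ≤ L.val mid A (L.arcs A)) ∧
      (s.v v_fnd = 1 → s'.v v_fnd = 1 ∧ s'.v v_best ≤ s.v v_best) := fun h =>
    (Tr.wp (by exact ⟨hf1, hf, fun q => htot ▸ h q, fun q => ⟨q, le_rfl⟩⟩)).mono (by simp [Cm.sz]) fun _ _ => id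
  refine Tr.ite (T := 4 * (nb + L.na) + 7) (Nat.zero_le _) trivial (fun h1 => ?_) fun h1 => ?_
  · have hS := hok.1 h1
    refine Tr.ite (T := 4 * (nb + L.na) + 6) trivial (by show 1 ≤ B; omega) (fun h2 => ?_) fun h2 => ?_
    · replace h2 : s.v v_fnd < 1 := h2
      exact (hcopy hS (by omega)).mono (by omega) fun _ _ => id
    · replace h2 : ¬ s.v v_fnd < 1 := h2
      refine Tr.ite (T := 4 * (nb + L.na) + 5) trivial trivial (fun h3 => ?_) fun h3 => ?_
      · replace h3 : s.v v_tot < s.v v_best := h3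
        exact (hcopy hS (by omega)).mono (by omega) fun _ _ => id
      · replace h3 : ¬ s.v v_tot < s.v v_best := h3
        exact hskip fun _ => by omega
  · exact (hskip fun q => absurd (hok.2 q) h1).mono (by omega) fun _ _ => id

variable {B b nb K : ℕ} {L : Lay} {mid BL A : ℕ → ℕ} {s : St}

open Ex Cm in
/-- Finds an optimal assignment by trying all of them. -/
def search : Cm :=
  .for v_i 0 v_K (set v_x (get a_BL (var v_i)) ;; put a_dg (var v_x) (lit 0)) ;;
  .while (var v_done) (lit 1) (evaluate ;; record ;; next)

theorem Listed.slot_ne (hl : Listed L nb BL) (hs : ∀ j, j < L.na → BL (nb + j) = L.n + j) (i j : ℕ)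
    (hij : i < j) (hj : j < nb + L.na) : BL i ≠ BL j := by
  by_cases h1 : j < nb
  · exact hl.inj i j hij h1
  · obtain ⟨j', rfl⟩ := Nat.exists_eq_add_of_le (not_lt.mp h1)
    rw [hs j' (by omega)]
    by_cases h2 : i < nb
    · have := (hl.spec i h2).2.1
      omega
    · obtain ⟨i', rfl⟩ := Nat.exists_eq_add_of_le (not_lt.mp h2)
      rw [hs i' (by omega)]
      omega

/-- The invariant says that the stored assignment is at least as good as every feasible one with a
number below the counter. Further arcs have six digit values too, although only zero or nonzero
matters; this is harmless for the bound and keeps the counter uniform. -/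
theorem search_spec (h : Env B L mid nb BL s) (hg : L.Good) (hl : Listed L nb BL)
    (hs : ∀ j, j < L.na → BL (nb + j) = L.n + j) (hK : s.v v_K = nb + L.na)
    (hdone : s.v v_done = 0) (hfnd : s.v v_fnd = 0) (hB : 2 * nb + 6 * L.n + L.na + 8 ≤ B)
    (hv : ∀ A, L.val mid A (L.arcs A) ≤ B) :
    Tr B b search s (6 ^ (nb + L.na) * (300 * ((nb + L.na + 1) * (nb + L.na + 1)))) fun s' =>
      (s'.v v_fnd = 1 → Feas L mid BL (nb + L.na) (s'.a a_bd) (s'.v v_best)) ∧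
      ∀ A, (∀ i, i < nb + L.na → A (BL i) < 6) → L.BStrong A (L.arcs A) →
        s'.v v_fnd = 1 ∧ s'.v v_best ≤ L.val mid A (L.arcs A) := by
  set K := nb + L.na with hKd
  let D : St → ℕ → ℕ := fun s' i => s'.a a_dg (BL i)
  let Opt : ℕ → St → Prop := fun N s' => ∀ A, (∀ i, i < K → A (BL i) < 6) → num K (fun i => A (BL i)) < N →
    L.BStrong A (L.arcs A) → s'.v v_fnd = 1 ∧ s'.v v_best ≤ L.val mid A (L.arcs A)
  refine ((Tr.for_wp (fun k s' => ∀ i, i < k → s'.a a_dg (BL i) = 0) K rfl rfl rfl hK (by omega) (by omega)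
    (by omega) ?_ ?_ fun s' _ h => h).seq fun s1 f1 h1 =>
    (Tr.while (T := 200 * ((K + 1) * (K + 1)) + (15 * K + 23)) (fun s' => s'.v v_done ≤ 1 ∧ s'.v v_fnd ≤ 1 ∧ (∀ i, i < K → D s' i < 6) ∧
      (s'.v v_fnd = 1 → Feas L mid BL K (s'.a a_bd) (s'.v v_best)) ∧
      (s'.v v_done = 0 → Opt (num K (D s')) s') ∧ (s'.v v_done = 1 → Opt (6 ^ K) s'))
      (fun s' => if s'.v v_done = 0 then 6 ^ K - num K (D s') else 0) ?_ ?_ ?_ ?_).mono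
      (T' := 6 ^ K * (200 * ((K + 1) * (K + 1)) + (15 * K + 23) + 1) + 1) ?_ fun _ _ => id).mono ?_ fun _ _ => id
  · exact fun i hi => absurd hi (by omega)
  · rintro k s' - hk hf hik hI
    have e1 : s'.a a_BL = BL := by rw [hf.2 _ rfl]; exact h.BL_eq
    simp [hik, e1]
    intro i hi
    rw [Function.update_apply]
    split_ifs with e
    · rfl
    · refine hI i (lt_of_le_of_ne hi ?_)
      rintro rfl
      exact e rfl
  · have e1 : s1.v v_done = 0 := (f1.1 _ rfl).trans hdone
    have e2 : s1.v v_fnd = 0 := (f1.1 _ rfl).trans hfnd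
    refine ⟨by omega, by omega, fun i hi => by simp [D, h1 i hi], by omega, fun _ A _ hlt => ?_, by omega⟩
    have : num K (D s1) = 0 := Finset.sum_eq_zero fun i hi => by simp [D, h1 i (by simpa using hi)]
    omega
  · exact fun _ _ _ => ⟨trivial, by show 1 ≤ B; omega⟩
  · rintro s2 f2 ⟨i1, i2, i3, i4, i5, i6⟩ hlt
    replace hlt : s2.v v_done < 1 := hlt
    have hd0 : s2.v v_done = 0 := by omega
    have hE := (h.frame f1 rfl rfl).frame f2 rfl rfl
    have hK2 : s2.v v_K = K := by rw [f2.1 _ rfl, f1.1 _ rfl, hK]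
    have hbr : ∀ x, L.Br x → s2.a a_dg x < 6 := fun x hx => by
      obtain ⟨i, hi, rfl⟩ := hl.surj x hx
      exact i3 i (by omega)
    refine ((evaluate_spec (b := b) hE hl hg rfl hbr hB (hv _)).seq fun s3 f3 ⟨h3, h3'⟩ =>
      (record_spec (mid := mid) (b := b) hg hl hs (hE.frame f3 rfl rfl).BL_eq ((f3.1 _ rfl).trans hK2) (f3.2 _ rfl) (by omega)
        i3 h3 h3' (by rw [f3.1 _ rfl]; exact i2) (by rw [f3.1 v_fnd rfl, f3.1 v_best rfl, f3.2 _ rfl]; exact i4)).seq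
        fun s4 f4 ⟨g1, g2, g3, g4⟩ =>
      (next_spec (b := b) (K := K) ((hE.frame f3 rfl rfl).frame f4 rfl rfl).BL_eq (by rw [f4.1 _ rfl, f3.1 _ rfl, hK2])
        (hl.slot_ne hs) (fun i hi => by rw [f4.2 _ rfl, f3.2 _ rfl]; exact i3 i hi)
        (by rw [f4.1 _ rfl, f3.1 _ rfl, hd0]) (by omega)).mono le_rfl fun s5 f5 ⟨q1, q2⟩ => ?_).mono
      (by rw [hKd]; omega) fun _ _ => id
    rw [f4.2 a_dg rfl, f3.2 a_dg rfl] at q2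
    rw [f3.1 v_fnd rfl, f3.1 v_best rfl] at g4
    have hN : Opt (num K (D s2) + 1) s5 := fun A hA hlt hS => by
      simp only [f5.1 v_fnd rfl, f5.1 v_best rfl]
      rcases (Nat.lt_succ_iff.mp hlt).lt_or_eq with r | r
      · obtain ⟨r1, r2⟩ := i5 hd0 A hA r hS
        obtain ⟨r3, r4⟩ := g4 r1
        exact ⟨r3, r4.trans r2⟩
      · have ha := hl.agree hs (num_inj hA i3 r)
        obtain ⟨r3, r4⟩ := g3 (hS.agree ha)
        exact ⟨r3, r4.trans (hg.val_agree ha).ge⟩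
    have hlt6 := num_lt (K := K) i3
    refine ⟨⟨by omega, by rw [f5.1 _ rfl]; exact g1, q1, ?_, fun q => ?_, fun q => ?_⟩, ?_⟩
    · rw [f5.1 v_fnd rfl, f5.1 v_best rfl, f5.2 _ rfl]; exact g2
    · rcases q2 with ⟨q3, q4⟩ | ⟨q3, q4⟩
      · have : num K (D s5) = num K (D s2) + 1 := q4
        rw [this]; exact hN
      · omega
    · rcases q2 with ⟨q3, q4⟩ | ⟨q3, q4⟩
      · omega
      · exact fun A hA hlt hS => hN A hA (hlt.trans_le q4) hS
    · rw [if_pos hd0]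
      rcases q2 with ⟨q3, q4⟩ | ⟨q3, q4⟩
      · have : num K (D s5) = num K (D s2) + 1 := q4
        rw [if_pos q3, this]
        omega
      · rw [if_neg (by omega)]
        omega
  · rintro s2 f2 ⟨i1, i2, i3, i4, i5, i6⟩ hlt
    replace hlt : ¬ s2.v v_done < 1 := hlt
    exact ⟨i4, fun A hA hS => i6 (by omega) A hA (num_lt hA) hS⟩
  · have hle : (if s1.v v_done = 0 then 6 ^ K - num K (D s1) else 0) ≤ 6 ^ K := by
      split_ifs
      exacts [Nat.sub_le _ _, Nat.zero_le _]
    exact Nat.add_le_add_right (Nat.mul_le_mul_right _ hle) 1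
  · have h3 : K + 1 ≤ (K + 1) * (K + 1) := Nat.le_mul_self _
    have h4 : 1 ≤ 6 ^ K := Nat.one_le_pow _ _ (by omega)
    have h5 := Nat.mul_le_mul_left (6 ^ K) (show 200 * ((K + 1) * (K + 1)) + (15 * K + 23) + 1 + (4 * K + 3) ≤
      300 * ((K + 1) * (K + 1)) by omega)
    rw [Nat.mul_add] at h5
    have h6 := Nat.mul_le_mul_right (4 * K + 3) h4
    simp [Cm.sz]
    omega

variable {B b nb K : ℕ} {L : Lay} {mid BL A : ℕ → ℕ} {s : St}

/-! ### Writing the output -/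

open Ex Cm in
/-- Selects the arcs that the powers of the best assignment pay for. -/
def finish : Cm :=
  .for v_i 0 v_K (set v_x (get a_BL (var v_i)) ;; put a_dg (var v_x) (get a_bd (var v_x))) ;;
  powerPass ;;
  .for v_i 0 v_m (ite (get a_PF (get a_T (var v_i))) (get a_W (var v_i))
    (put a_in (var v_i) (lit 0)) (put a_in (var v_i) (lit 1)))

/-- The marks overwrite the input cells, but the tails and weights have been copied to other arrays
before. -/
theorem finish_spec {m : ℕ} (h : Env B L mid nb BL s) (hg : L.Good) (hl : Listed L nb BL)
    (hs : ∀ j, j < L.na → BL (nb + j) = L.n + j) (hK : s.v v_K = nb + L.na) (hm : s.v v_m = m)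
    (hT : ∀ i, i < m → s.a a_T i < L.n) (hb : m < b) (hB : nb + L.n + L.na + m + 6 ≤ B)
    (ha : ∀ v, L.act v ≤ 1) :
    Tr B b finish s (5 * m + 40 * (L.n + L.na) + 4 * (nb + L.na) + 10) fun s' => ∀ i, i < m →
      (s'.a a_in i = 1 ↔ s.a a_W i ≤ L.pw (L.selU mid (s.a a_bd)) (L.selD mid (s.a a_bd))
        (L.arcs (s.a a_bd)) (s.a a_T i)) := by
  refine ((Tr.for_wp (fun k s' => ∀ i, i < k → s'.a a_dg (BL i) = s.a a_bd (BL i)) (nb + L.na) rfl rfl rfl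
    hK (by omega) (by omega) (by omega) ?_ ?_ fun s' _ h => h).seq fun s1 f1 h1 =>
    (powerPass_spec (b := b) (f1.3 h.fits) ((f1.lay rfl rfl).trans h.lay) ((f1.2 _ rfl).trans h.mid_eq) rfl
      hg.n_pos (by omega) ha).seq fun s2 f2 h2 => Tr.for_wp (fun k s' => ∀ i, i < k →
      (s'.a a_in i = 1 ↔ s.a a_W i ≤ L.pw (L.selU mid (s.a a_bd)) (L.selD mid (s.a a_bd))
        (L.arcs (s.a a_bd)) (s.a a_T i))) m rfl rfl rfl ((f2.1 _ rfl).trans ((f1.1 _ rfl).trans hm)) (by omega)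
      (by omega) (by omega) ?_ ?_ fun s' _ h => h).mono (by simp [Cm.sz]; omega) fun _ _ => id
  · exact fun i hi => absurd hi (by omega)
  · rintro k s' - hk hf hik hI
    have e1 : s'.a a_BL = BL := by rw [hf.2 _ rfl]; exact h.BL_eq
    have e2 : s'.a a_bd = s.a a_bd := hf.2 _ rfl
    simp [hik, e1, e2]
    intro i hi
    rw [Function.update_apply]
    split_ifs with e
    · rw [e]
    · refine hI i (lt_of_le_of_ne hi ?_)
      rintro rfl
      exact e rfl
  · exact fun i hi => absurd hi (by omega)
  · rintro k s' - hk hf hik hI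
    have e1 : s'.a a_T k = s.a a_T k := by rw [hf.2 _ rfl, f2.2 _ rfl, f1.2 _ rfl]
    have e2 : s'.a a_W k = s.a a_W k := by rw [hf.2 _ rfl, f2.2 _ rfl, f1.2 _ rfl]
    have hTk := hT k hk
    have e3 : s'.a a_PF (s.a a_T k) = L.pw (L.selU mid (s.a a_bd)) (L.selD mid (s.a a_bd))
        (L.arcs (s.a a_bd)) (s.a a_T k) := by
      rw [hf.2 _ rfl, h2 _ hTk]
      exact hg.pw_agree (hl.agree hs fun i hi => h1 i hi) hTk
    simp [hik, e1, e2, e3]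
    refine ⟨fun q => ⟨by omega, fun i hi => ?_⟩, fun q => ⟨by omega, by omega, fun i hi => ?_⟩⟩
    · rw [Function.update_apply]
      split_ifs with e
      · subst e; simpa using q
      · exact hI i (lt_of_le_of_ne hi e)
    · rw [Function.update_apply]
      split_ifs with e
      · subst e; simpa using q
      · exact hI i (lt_of_le_of_ne hi e)

/-! ### Assembling the preprocessing -/

/-- The state after the preprocessing of a graph with arcs from `T i` to `H i` of weight `W i`. -/
structure Front (n m inf : ℕ) (T H W : ℕ → ℕ) (s : St) : Prop where
  n_eq : s.v v_n = n
  tree : ∃ Q, Tree n m T H Q (s.a a_par) (s.a a_rk)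
  cls : ∃ nt term, Cls n inf m T H W (s.a a_par) (s.v v_na) (s.a a_wd) (s.a a_wu) nt (s.a a_tt)
    (s.a a_hh) (s.a a_ww) term
  good : s.lay.Good
  listed : Listed s.lay (s.v v_nb) (s.a a_BL)
  slots : ∀ j, j < s.v v_na → s.a a_BL (s.v v_nb + j) = n + j
  K_eq : s.v v_K = s.v v_nb + s.v v_na
  le_one : ∀ v, s.lay.act v ≤ 1 ∧ s.lay.br v ≤ 1

def front : Cm := bfs ;; classify ;; bottomUp ;; chainTops ;; arcSlots

theorem Listed.congr {BL' : ℕ → ℕ} (hl : Listed L nb BL) (h : ∀ i, i < nb → BL' i = BL i) :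
    Listed L nb BL' :=
  ⟨fun i hi => by rw [h i hi]; exact hl.spec i hi, fun i j hij hj => by
    rw [h i (by omega), h j hj]; exact hl.inj i j hij hj, fun x hx => by
    obtain ⟨i, hi, e⟩ := hl.surj x hx
    exact ⟨i, hi, by rw [h i hi, e]⟩⟩

open Classical in
theorem Listed.card_eq (hl : Listed L nb BL) : ((Finset.range L.n).filter L.Br).card = nb := by
  have := hl.sum_eq fun _ => 1
  simpa using this

theorem Listed.le_n (hl : Listed L nb BL) : nb ≤ L.n := by
  classical
  rw [← hl.card_eq]
  exact (Finset.card_filter_le _ _).trans (by simp)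

theorem front_spec {n m : ℕ} {T H W : ℕ → ℕ} (h0 : 0 < n) (hn : s.v v_n = n) (hm : s.v v_m = m)
    (hv : ∀ x, 4 ≤ x → s.v x = 0) (ha : ∀ j, 7 ≤ j → ∀ i, s.a j i = 0)
    (hT : s.a a_T = T) (hH : s.a a_H = H) (hW : s.a a_W = W)
    (hTH : ∀ i, i < m → T i < n ∧ H i < n) (hWB : ∀ i, i < m → W i ≤ B) (hinf : s.v v_inf ≤ B)
    (hhd : ∀ u, LastOcc T u m (s.a a_hd u))
    (hnx : ∀ i, i < m → LastOcc T (T i) i (s.a a_nx i)) (hB : 2 * n + 2 * m + 6 ≤ B)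
    (hs : ∀ v, v < n → Relation.ReflTransGen (ArcRel m T H) 0 v)
    (hu : ∀ i j, i < j → j < m → T i = T j → H i ≠ H j) :
    Tr B b front s (62 * (n + m) + 30) (Front n m (s.v v_inf) T H W) := by
  subst hT hH hW
  have key : ∀ s2 : St, Tree n m (s.a a_T) (s.a a_H) (s2.a a_Q) (s2.a a_par) (s2.a a_rk) → Frame B bfs s s2 →
      Tr B b (classify ;; bottomUp ;; chainTops ;; arcSlots) s2 (48 * (n + m) + 20)
        (Front n m (s.v v_inf) (s.a a_T) (s.a a_H) (s.a a_W)) := by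
    intro s2 ht f2
    have hanti : ∀ i, i < m → s2.a a_par (s.a a_H i) = s.a a_T i → s2.a a_par (s.a a_T i) ≠ s.a a_H i := by
      intro i hi h1 h2
      obtain ⟨g1, g2⟩ := hTH i hi
      rcases Nat.eq_zero_or_pos (s.a a_H i) with r | r
      · rw [r, ht.par_zero] at h1; omega
      rcases Nat.eq_zero_or_pos (s.a a_T i) with r' | r'
      · rw [r', ht.par_zero] at h2; omega
      · have h3 := (ht.par_lt _ r g2).2.1
        have h4 := (ht.par_lt _ r' g1).2.1
        rw [h1] at h3
        rw [h2] at h4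
        omega
    refine ((classify_spec (b := b) (n := n) (m := m) ((f2.1 _ rfl).trans hn) ((f2.1 _ rfl).trans hm)
      ((f2.1 _ rfl).trans (hv _ (by omega))) (fun v => by rw [f2.2 _ rfl]; exact ha _ (by omega) v)
      (by rw [f2.2 a_T rfl, f2.2 a_H rfl]; exact hTH) (by rw [f2.2 a_W rfl]; exact hWB) (by omega)
      (by rw [f2.1 v_inf rfl]; exact hinf) (fun v hv => ?_) (by rw [f2.2 a_T rfl, f2.2 a_H rfl]; exact hanti)
      (by rw [f2.2 a_T rfl, f2.2 a_H rfl]; exact hu)).seq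
      (T' := 30 * (n + m) + 16) fun s3 f3 hc => ?_).mono (by omega) fun _ _ => id
    · rcases Nat.eq_zero_or_pos v with rfl | r
      · exact ht.par_zero.le
      · exact (ht.par_lt v r hv).1.le
    rw [f2.1 v_inf rfl, f2.2 a_T rfl, f2.2 a_H rfl, f2.2 a_W rfl] at hc
    have hna := hc.na_le
    refine ((bottomUp_spec (b := b) (m := m) (T := s.a a_T) (H := s.a a_H) h0 ((f3.1 _ rfl).trans ((f2.1 _ rfl).trans hn)) (by
      rw [f3.2 a_Q rfl, f3.2 a_par rfl, f3.2 a_rk rfl]; exact ht) ((f3.1 _ rfl).trans ((f2.1 _ rfl).trans (hv _ (by omega))))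
      (fun v => by
        rw [f3.2 a_cnt rfl, f3.2 a_act rfl, f3.2 a_br rfl, f2.2 a_cnt rfl, f2.2 a_act rfl, f2.2 a_br rfl]
        exact ⟨ha _ (by omega) v, ha _ (by omega) v, ha _ (by omega) v⟩) hc.term_le (by omega)
      (fun j hj => by
        obtain ⟨q1, -, q2, q3, -⟩ := hc.nt_spec j hj
        rw [q2, q3]
        exact hTH _ q1) hc.term_iff).seq (T' := 11 * (n + m) + 12) fun s4 f4 ⟨g1, g2, g3⟩ => ?_).mono (by omega) fun _ _ => id
    have hn4 : s4.v v_n = n := (f4.1 _ rfl).trans ((f3.1 _ rfl).trans ((f2.1 _ rfl).trans hn))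
    have hna4 : s4.v v_na = s3.v v_na := f4.1 _ rfl
    have hnb4 := g2.le_n
    replace hnb4 : s4.v v_nb ≤ n := by rw [← hn4]; exact hnb4
    refine ((chainTops_spec (b := b) hn4 h0 (by omega) g1 g3).seq (T' := 3 * m + 3) fun s5 f5 h5 => ?_).mono
      (by omega) fun _ _ => id
    refine (arcSlots_spec (b := b) (n := n) (na := s3.v v_na) (nb := s4.v v_nb) ((f5.1 _ rfl).trans hn4)
      ((f5.1 _ rfl).trans hna4) (f5.1 _ rfl) (by omega)).mono (by omega) fun s6 f6 ⟨r1, r2, r3⟩ => ?_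
    have hlay : s6.lay = s5.lay := f6.lay rfl rfl
    have hna6 : s6.v v_na = s3.v v_na := (f6.1 _ rfl).trans ((f5.1 _ rfl).trans hna4)
    have hnb6 : s6.v v_nb = s4.v v_nb := (f6.1 _ rfl).trans (f5.1 _ rfl)
    have hpar6 : s6.a a_par = s2.a a_par :=
      (f6.2 _ rfl).trans ((f5.2 _ rfl).trans ((f4.2 _ rfl).trans (f3.2 _ rfl)))
    have hl5 : s5.lay = { s4.lay with topv := s5.a a_topv } := by
      simp only [St.lay, f5.1 v_n rfl, f5.1 v_na rfl, f5.2 a_rk rfl, f5.2 a_wd rfl, f5.2 a_par rfl,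
        f5.2 a_wu rfl, f5.2 a_tt rfl, f5.2 a_hh rfl, f5.2 a_ww rfl, f5.2 a_act rfl, f5.2 a_br rfl, f5.2 a_bot rfl]
    refine ⟨(f6.1 _ rfl).trans ((f5.1 _ rfl).trans hn4), ⟨s2.a a_Q, ?_⟩, ⟨s3.a a_nt, s3.a a_term, ?_⟩,
      hlay ▸ h5, ?_, ?_, ?_, ?_⟩
    · rw [hpar6, f6.2 a_rk rfl, f5.2 a_rk rfl, f4.2 a_rk rfl, f3.2 a_rk rfl]; exact ht
    · rw [hpar6, hna6, f6.2 a_wd rfl, f6.2 a_wu rfl, f6.2 a_tt rfl, f6.2 a_hh rfl, f6.2 a_ww rfl,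
        f5.2 a_wd rfl, f5.2 a_wu rfl, f5.2 a_tt rfl, f5.2 a_hh rfl, f5.2 a_ww rfl,
        f4.2 a_wd rfl, f4.2 a_wu rfl, f4.2 a_tt rfl, f4.2 a_hh rfl, f4.2 a_ww rfl, ← f3.2 a_par rfl]
      rw [← f3.2 a_par rfl] at hc
      exact hc
    · rw [hlay, hl5, hnb6]
      have : Listed { s4.lay with topv := s5.a a_topv } (s4.v v_nb) (s4.a a_BL) := ⟨g2.spec, g2.inj, g2.surj⟩
      exact this.congr fun i hi => by rw [r2 i hi, f5.2 _ rfl]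
    · rw [hna6, hnb6]; exact r3
    · rw [r1, hna6, hnb6]
    · intro v
      rw [hlay, hl5]
      exact g3 v
  refine ((bfs_spec (b := b) (n := n) (m := m) h0 hn (fun v => ha _ (by omega) v) rfl rfl (fun i hi => (hTH i hi).2) hhd hnx
    (by omega) hs).seq fun s2 f2 ht => key s2 ht f2).mono (by omega) fun _ _ => id

variable {B b nb M : ℕ} {L : Lay} {s : St}

/-! ### Assembling tables, search and output -/

def back : Cm := basePower ;; tables ;; search ;; finish

theorem Lay.Good.sum_pw_le (hg : L.Good) (hM : ∀ SU SD SN u, u < L.n → L.pw SU SD SN u ≤ M)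
    (mid c : ℕ → ℕ) (SN : ℕ → Prop) : L.val mid c SN ≤ L.n * M := by
  have h1 := hg.sum_pw mid c SN
  have h2 : ∑ v ∈ Finset.range L.n, L.pw (L.selU mid c) (L.selD mid c) SN v ≤ L.n * M := by
    refine (Finset.sum_le_card_nsmul _ _ M fun v hv => hM _ _ _ v (Finset.mem_range.mp hv)).trans ?_
    simp
  omega

/-- An assignment for every selection of arcs. -/
theorem Lay.Good.exists_assignment (hg : L.Good) {mid : ℕ → ℕ} (hm : L.MidOpt mid) {SU SD SN : ℕ → Prop}
    (hs : L.Strong SU SD SN) : ∃ A : ℕ → ℕ, (∀ x, A x < 6) ∧ L.BStrong A (L.arcs A) ∧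
      ∑ v ∈ Finset.range L.n, L.pw (L.selU mid A) (L.selD mid A) (L.arcs A) v ≤
        ∑ v ∈ Finset.range L.n, L.pw SU SD SN v := by
  classical
  obtain ⟨c, hc, hS, hle⟩ := hg.exists_options hm hs
  -- Indices below `L.n` carry the options of the chains, the others the selection of the further
  -- arcs, encoded as `0` for selected.
  let A : ℕ → ℕ := fun x => if x < L.n then c x else if SN (x - L.n) then 0 else 1
  have hA : ∀ x, L.Br x → c x = A x := fun x hx => by simp [A, hx.2.1]
  have hN : ∀ j, j < L.na → (SN j ↔ L.arcs A j) := fun j _ => by simp [A, Lay.arcs]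
  refine ⟨A, fun x => ?_, hS.congr hA hN, hle.trans' (Finset.sum_le_sum fun v hv => ?_)⟩
  · simp only [A]
    have := hc x
    split_ifs <;> omega
  · exact (hg.pw_sel_congr hA hN (Finset.mem_range.mp hv)).ge

theorem back_spec {m q : ℕ} (hf : s.Fits B) (hL : s.lay = L) (hg : L.Good) (hl : Listed L (s.v v_nb) (s.a a_BL))
    (hs : ∀ j, j < L.na → s.a a_BL (s.v v_nb + j) = L.n + j) (hK : s.v v_K = s.v v_nb + L.na) (hm : s.v v_m = m)
    (h1 : ∀ v, L.act v ≤ 1 ∧ L.br v ≤ 1) (hd : s.v v_done = 0) (hfd : s.v v_fnd = 0)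
    (hz : ∀ j, j = a_b ∨ j = a_IC ∨ j = a_bs → ∀ x, s.a j x = 0)
    (hT : ∀ i, i < m → s.a a_T i < L.n) (hb : m < b) (hB : 8 * L.n + L.na + m + 8 ≤ B)
    (hM : ∀ SU SD SN u, u < L.n → L.pw SU SD SN u ≤ M) (hMB : L.n * M ≤ B) (hMB' : 2 * M + 1 ≤ B)
    (hna : L.na ≤ m) (hq : L.na ≤ q) (hex : ∃ SU SD SN, L.Strong SU SD SN) :
    Tr B b back s (383 * (L.n + m) + 86 + 6 ^ (5 * q) * (300 * ((5 * q + 1) * (5 * q + 1)))) fun s' =>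
      ∃ mid D, L.BStrong D (L.arcs D) ∧
        (∀ SU SD SN, L.Strong SU SD SN →
          ∑ v ∈ Finset.range L.n, L.pw (L.selU mid D) (L.selD mid D) (L.arcs D) v ≤
            ∑ v ∈ Finset.range L.n, L.pw SU SD SN v) ∧
        ∀ i, i < m → (s'.a a_in i = 1 ↔
          s.a a_W i ≤ L.pw (L.selU mid D) (L.selD mid D) (L.arcs D) (s.a a_T i)) := by
  have hnb : s.v v_nb ≤ L.n := hl.le_n
  have hnb4 : s.v v_nb ≤ 4 * L.na := by
    classical
    rw [← hl.card_eq]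
    exact hg.card_br_le
  have hn := hg.n_pos
  set nb := s.v v_nb with hnbd
  set BL := s.a a_BL with hBLd
  -- There are at most `4 * L.na` chains, so there are at most `5 * L.na ≤ 5 * q` digits.
  have hpow : 6 ^ (nb + L.na) * (300 * ((nb + L.na + 1) * (nb + L.na + 1))) ≤
      6 ^ (5 * q) * (300 * ((5 * q + 1) * (5 * q + 1))) := by
    have e : nb + L.na ≤ 5 * q := by omega
    gcongr
    norm_num
  refine ((basePower_spec (b := b) (B := B) hL hn (by omega) (fun v => (h1 v).1) (hz _ (Or.inl rfl))).seq
    (T' := 376 * (L.n + m) + 84 + 6 ^ (5 * q) * (300 * ((5 * q + 1) * (5 * q + 1)))) fun s1 f1 hb1 => ?_).mono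
    (by omega) fun _ _ => id
  have t0 : Tabs B 0 L (s.a a_mid) s1 := ⟨f1.3 hf, (f1.lay rfl rfl).trans hL, f1.2 _ rfl,
    fun o ho => absurd ho (by omega), fun o _ _ x => by
    rw [f1.2 a_IC rfl]; exact hz _ (Or.inr (Or.inl rfl)) _,
    fun o ho => absurd ho (by omega)⟩
  refine ((t0.all (b := b) (M := M) hg (fun mid o u hu => hM _ _ _ u hu) (by omega) hMB hMB' h1 (fun x => by
    rw [f1.2 a_bs rfl]; exact hz _ (Or.inr (Or.inr rfl)) _)).seq
    (T' := 49 * (L.n + m) + 10 + 6 ^ (5 * q) * (300 * ((5 * q + 1) * (5 * q + 1))))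
    fun s2 f2 ⟨mid, hmid, ht⟩ => ?_).mono (by omega) fun _ _ => id
  have e2 : Env B L mid nb BL s2 := ⟨ht.fits, ht.lay, ht.mid_eq, (f2.1 v_nb rfl).trans (f1.1 v_nb rfl),
    (f2.2 a_BL rfl).trans (f1.2 a_BL rfl), ht.ic_eq, by rw [f2.2 a_b rfl]; exact hb1⟩
  refine ((search_spec (b := b) e2 hg hl hs ((f2.1 _ rfl).trans ((f1.1 _ rfl).trans hK))
    ((f2.1 _ rfl).trans ((f1.1 _ rfl).trans hd)) ((f2.1 _ rfl).trans ((f1.1 _ rfl).trans hfd)) (by omega)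
    fun A => (hg.sum_pw_le hM _ _ _).trans hMB).seq
    (T' := 44 * (L.n + m) + 10 + 5 * m) fun s3 f3 ⟨g1, g2⟩ => ?_).mono
    (by linarith) fun _ _ => id
  have e3 : Env B L mid nb BL s3 := e2.frame f3 rfl rfl
  have aT : s3.a a_T = s.a a_T := (f3.2 _ rfl).trans ((f2.2 _ rfl).trans (f1.2 _ rfl))
  have aW : s3.a a_W = s.a a_W := (f3.2 _ rfl).trans ((f2.2 _ rfl).trans (f1.2 _ rfl))
  refine (finish_spec (b := b) e3 hg hl hs ((f3.1 _ rfl).trans ((f2.1 _ rfl).trans ((f1.1 _ rfl).trans hK)))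
    ((f3.1 _ rfl).trans ((f2.1 _ rfl).trans ((f1.1 _ rfl).trans hm))) (by rw [aT]; exact hT) hb (by omega)
    fun v => (h1 v).1).mono (by omega) fun s4 f4 h4 => ?_
  have key : ∀ SU SD SN, L.Strong SU SD SN → s3.v v_fnd = 1 ∧
      (∃ A, s3.v v_best ≤ L.val mid A (L.arcs A) ∧
        ∑ v ∈ Finset.range L.n, L.pw (L.selU mid A) (L.selD mid A) (L.arcs A) v ≤
        ∑ v ∈ Finset.range L.n, L.pw SU SD SN v) := by
    intro SU SD SN hS
    obtain ⟨A, a1, a2, a3⟩ := hg.exists_assignment hmid hS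
    obtain ⟨b1, b2⟩ := g2 A (fun i _ => a1 _) a2
    exact ⟨b1, A, b2, a3⟩
  -- As some strong selection exists, the search has found a feasible assignment.
  obtain ⟨SU, SD, SN, hS⟩ := hex
  have hF := g1 (key SU SD SN hS).1
  refine ⟨mid, s3.a a_bd, hF.strong, fun SU SD SN hS => ?_, fun i hi => ?_⟩
  · obtain ⟨-, A, c1, c2⟩ := key SU SD SN hS
    refine le_trans ?_ c2
    rw [hg.sum_pw, hg.sum_pw, ← hF.cost]
    omega
  · rw [h4 i hi, aT, aW]

/-! ### From solutions of the graph problem to selections, and back -/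

/-- `G` has the `m` arcs from `T i` to `H i`, of weight `W i`. -/
structure Inst {n : ℕ} (G : Digraph (Fin n)) (w : Fin n → Fin n → ℕ) (m : ℕ) (T H W : ℕ → ℕ) : Prop where
  lt : ∀ i, i < m → T i < n ∧ H i < n
  adj : ∀ i, i < m → ∀ u v : Fin n, T i = u → H i = v → G.Adj u v ∧ W i = w u v
  surj : ∀ u v : Fin n, G.Adj u v → ∃ i, i < m ∧ T i = u ∧ H i = v
  inj : ∀ i j, i < m → j < m → T i = T j → H i = H j → i = j

section
variable {n m inf : ℕ} {G : Digraph (Fin n)} {w : Fin n → Fin n → ℕ} {T H W Q nt term : ℕ → ℕ} {L : Lay}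

theorem Tree.par_ne (h : Tree n m T H Q L.par L.rk) {u v : ℕ} (hu : u < n) (hv : v < n) (he : L.par u = v) :
    L.par v ≠ u := by
  intro e
  rcases Nat.eq_zero_or_pos u with rfl | h1
  · rw [h.par_zero] at he; omega
  rcases Nat.eq_zero_or_pos v with rfl | h2
  · rw [h.par_zero] at e; omega
  have r1 := (h.par_lt u h1 hu).2.1
  have r2 := (h.par_lt v h2 hv).2.1
  rw [he] at r1
  rw [e] at r2
  omega

theorem Tree.pos_of_par (h : Tree n m T H Q L.par L.rk) {u : ℕ} (hp : L.par u < n) : 0 < u := by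
  rcases Nat.eq_zero_or_pos u with rfl | h1
  · rw [h.par_zero] at hp; omega
  · exact h1

/-- The layout `L` describes the instance. -/
structure Desc (G : Digraph (Fin n)) (w : Fin n → Fin n → ℕ) (inf m : ℕ) (T H W Q nt term : ℕ → ℕ) (L : Lay) :
    Prop where
  inst : Inst G w m T H W
  n_eq : L.n = n
  tree : Tree n m T H Q L.par L.rk
  cls : Cls n inf m T H W L.par L.na L.wd L.wu nt L.tt L.hh L.ww term
  good : L.Good

/-- Adjacency, with natural numbers for the vertices. -/
def NAdj (H' : Digraph (Fin n)) (u v : ℕ) : Prop := ∃ x y : Fin n, H'.Adj x y ∧ u = x ∧ v = y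

theorem NAdj.arc (h : Desc G w inf m T H W Q nt term L) {H' : Digraph (Fin n)} (hH : H' ≤ G) {u v : ℕ}
    (ha : NAdj H' u v) : ∃ a, a < m ∧ T a = u ∧ H a = v := by
  obtain ⟨x, y, hxy, rfl, rfl⟩ := ha
  exact h.inst.surj x y (hH hxy)

/-- An arc of the solution is a loop, runs along a tree edge or is a further arc; loops can be
dropped from any walk. -/
theorem Desc.strong (h : Desc G w inf m T H W Q nt term L) {H' : Digraph (Fin n)} (hH : IsSolution G H') :
    L.Strong (fun v => NAdj H' v (L.par v)) (fun v => NAdj H' (L.par v) v)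
      (fun j => NAdj H' (L.tt j) (L.hh j)) := by
  have hn := h.good.n_pos
  have hne := h.n_eq
  have key : ∀ x y : Fin n, H'.Adj x y → Relation.ReflTransGen (L.Arc (fun v => NAdj H' v (L.par v))
      (fun v => NAdj H' (L.par v) v) (fun j => NAdj H' (L.tt j) (L.hh j))) x y := by
    intro x y hxy
    obtain ⟨a, ha, h1, h2⟩ := h.inst.surj x y (hH.1 hxy)
    have hN : NAdj H' x y := ⟨x, y, hxy, rfl, rfl⟩
    by_cases e : (x : ℕ) = y
    · rw [e]
    by_cases e1 : L.par y = x
    · exact .single (Or.inr (Or.inl ⟨h.tree.pos_of_par (by omega), by omega, by simpa [e1] using hN, e1.symm⟩))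
    by_cases e2 : L.par x = y
    · exact .single (Or.inl ⟨h.tree.pos_of_par (by omega), by omega, by simpa [e2] using hN, e2.symm⟩)
    obtain ⟨j, hj, rfl⟩ := h.cls.nt_surj a ha ⟨by rwa [h1, h2], by rwa [h1, h2], by rwa [h1, h2]⟩
    obtain ⟨-, -, g1, g2, -⟩ := h.cls.nt_spec j hj
    exact .single (Or.inr (Or.inr ⟨j, hj, by simpa [g1, g2, h1, h2] using hN, by omega, by omega⟩))
  intro v hv
  exact ⟨(hH.2 ⟨0, by omega⟩ ⟨v, by omega⟩).lift' _ key, (hH.2 ⟨v, by omega⟩ ⟨0, by omega⟩).lift' _ key⟩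

/-- A selection read off from a solution consists of real arcs, so the substitute weight `inf` does
not enter. -/
theorem Desc.sum_pw_le_cost (h : Desc G w inf m T H W Q nt term L) {H' : Digraph (Fin n)} (hH : H' ≤ G) :
    ∑ v ∈ Finset.range L.n, L.pw (fun v => NAdj H' v (L.par v)) (fun v => NAdj H' (L.par v) v)
      (fun j => NAdj H' (L.tt j) (L.hh j)) v ≤ cost H' w := by
  classical
  rw [h.n_eq, Finset.sum_range, cost]
  refine Finset.sum_le_sum fun u _ => ?_
  have key : ∀ a v, a < m → T a = u → H a = v → NAdj H' u v →
      W a ≤ (Finset.univ.filter fun y => H'.Adj u y).sup fun y => w u y := by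
    rintro a v ha h1 h2 ⟨x, y, hxy, e1, rfl⟩
    obtain rfl : u = x := Fin.ext e1
    rw [(h.inst.adj a ha u y h1 h2).2]
    exact Finset.le_sup (f := fun y => w u y) (by simpa using hxy)
  refine Lay.pw_le_iff.mpr ⟨fun h0 hS => ?_, fun v h0 hv hp hS => ?_, fun j hj ht hS => ?_⟩
  · obtain ⟨a, ha, h1, h2⟩ := hS.arc h hH
    have hlt := h.inst.lt a ha
    have := h.tree.par_ne u.2 (by omega : H a < n) h2.symm
    rw [← h1, h.cls.wu_eq a ha (by omega) (by rw [h1, h2])]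
    exact key a _ ha h1 h2 hS
  · rw [hp] at hS
    obtain ⟨a, ha, h1, h2⟩ := hS.arc h hH
    rw [← h2, h.cls.wd_eq a ha (by rw [h1, h2, hp])]
    exact key a _ ha h1 h2 hS
  · obtain ⟨g, -, g1, g2, g3⟩ := h.cls.nt_spec j hj
    rw [g3]
    exact key _ _ g (by omega) (by omega) (ht ▸ hS)

theorem Inst.cost_le (h : Inst G w m T H W) : cost G w ≤ ∑ i ∈ Finset.range m, W i := by
  classical
  have h1 : ∀ v : Fin n, ((Finset.univ.filter fun u => G.Adj v u).sup fun u => w v u) ≤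
      ∑ i ∈ (Finset.range m).filter (fun i => T i = v), W i := by
    refine fun v => Finset.sup_le fun u hu => ?_
    obtain ⟨i, hi, e1, e2⟩ := h.surj v u (by simpa using hu)
    rw [← (h.adj i hi v u e1 e2).2]
    exact Finset.single_le_sum (fun _ _ => Nat.zero_le _) (by simp [hi, e1])
  refine (Finset.sum_le_sum fun v _ => h1 v).trans ?_
  rw [← Finset.sum_range (fun v => ∑ i ∈ (Finset.range m).filter (fun i => T i = v), W i)]
  rw [Finset.sum_fiberwise_of_maps_to fun i hi => Finset.mem_range.mpr (h.lt i (Finset.mem_range.mp hi)).1]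

/-- Serves to bound the numbers that the program handles, also for selections with missing arcs. -/
theorem Desc.pw_le (h : Desc G w inf m T H W Q nt term L) (hW : ∀ i, i < m → W i ≤ inf) (SU SD SN : ℕ → Prop)
    {u : ℕ} (hu : u < L.n) : L.pw SU SD SN u ≤ inf := by
  have hne := h.n_eq
  refine Lay.pw_le_iff.mpr ⟨fun h0 _ => ?_, fun v h0 hv hp _ => ?_, fun j hj ht _ => ?_⟩
  · by_cases hex : ∀ a, a < m → T a = u → L.par u ≠ H a
    · exact (h.cls.wu_inf u (by omega) hex).le
    · push Not at hex
      obtain ⟨a, ha, h1, h2⟩ := hex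
      have := h.tree.par_ne (by omega) (h.inst.lt a ha).2 h2
      rw [← h1, h.cls.wu_eq a ha (by omega) (by rw [h1, h2])]
      exact hW a ha
  · obtain ⟨-, -, a, ha, h1, h2⟩ := h.tree.par_lt v h0 (by omega)
    rw [← h2, h.cls.wd_eq a ha (by rw [h1, h2])]
    exact hW a ha
  · obtain ⟨g, -, g1, g2, g3⟩ := h.cls.nt_spec j hj
    rw [g3]
    exact hW _ g

/-- The arcs that the powers of a strong selection pay for form an optimal solution if the selection
is optimal. -/
theorem Desc.isOptimal (h : Desc G w inf m T H W Q nt term L) (hG : StronglyConnected G)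
    (hinf : inf = (∑ i ∈ Finset.range m, W i) + 1) {SU SD SN : ℕ → Prop} (hS : L.Strong SU SD SN)
    (hopt : ∀ SU' SD' SN', L.Strong SU' SD' SN' →
      ∑ v ∈ Finset.range L.n, L.pw SU SD SN v ≤ ∑ v ∈ Finset.range L.n, L.pw SU' SD' SN' v)
    {O : Digraph (Fin n)} (hO : ∀ u v, O.Adj u v ↔ G.Adj u v ∧ w u v ≤ L.pw SU SD SN u) :
    IsOptimalSolution G w O := by
  classical
  have hn := h.good.n_pos
  have hne := h.n_eq
  have hle : ∀ H', IsSolution G H' → ∑ v ∈ Finset.range L.n, L.pw SU SD SN v ≤ cost H' w := fun H' hH =>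
    (hopt _ _ _ (h.strong hH)).trans (h.sum_pw_le_cost hH.1)
  -- `G` itself is a solution of cost below `inf`, so an optimal selection contains no missing
  -- upward arc.
  have hlt : ∑ v ∈ Finset.range L.n, L.pw SU SD SN v < inf := by
    have h1 := hle G ⟨le_rfl, hG⟩
    have h2 := h.inst.cost_le
    omega
  have hlt' : ∀ u, u < L.n → L.pw SU SD SN u < inf := fun u hu => lt_of_le_of_lt
    (Finset.single_le_sum (f := L.pw SU SD SN) (fun _ _ => Nat.zero_le _) (Finset.mem_range.mpr hu)) hlt
  let f : ℕ → Fin n := fun x => ⟨x % n, Nat.mod_lt _ (by omega)⟩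
  have hf : ∀ x, x < n → ((f x : Fin n) : ℕ) = x := fun x hx => Nat.mod_eq_of_lt hx
  have key : ∀ a, a < m → W a ≤ L.pw SU SD SN (T a) → O.Adj (f (T a)) (f (H a)) := by
    intro a ha hw
    obtain ⟨h1, h2⟩ := h.inst.lt a ha
    obtain ⟨g1, g2⟩ := h.inst.adj a ha (f (T a)) (f (H a)) (hf _ h1).symm (hf _ h2).symm
    exact (hO _ _).mpr ⟨g1, by rw [← g2, hf _ h1]; exact hw⟩
  have harc : ∀ u v, L.Arc SU SD SN u v → O.Adj (f u) (f v) := by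
    rintro u v (⟨h0, hu, hs, rfl⟩ | ⟨h0, hv, hs, rfl⟩ | ⟨j, hj, hs, rfl, rfl⟩)
    · have hw := (Lay.pw_le_iff.mp (le_refl (L.pw SU SD SN u))).1 h0 hs
      have hex : ¬ ∀ a, a < m → T a = u → L.par u ≠ H a := by
        intro hex
        have := h.cls.wu_inf u (by omega) hex
        have := hlt' u hu
        omega
      push Not at hex
      obtain ⟨a, ha, rfl, h2⟩ := hex
      have := h.tree.par_ne (by omega) (h.inst.lt a ha).2 h2
      rw [h2]
      exact key a ha (by rwa [h.cls.wu_eq a ha this h2] at hw)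
    · obtain ⟨h3, -, a, ha, h1, rfl⟩ := h.tree.par_lt v h0 (by omega)
      have hw := (Lay.pw_le_iff.mp (le_refl (L.pw SU SD SN (L.par (H a))))).2.1 _ h0 hv rfl hs
      rw [h.cls.wd_eq a ha h1.symm] at hw
      rw [← h1] at hw ⊢
      exact key a ha hw
    · obtain ⟨g, -, g1, g2, g3⟩ := h.cls.nt_spec j hj
      have hw := (Lay.pw_le_iff.mp (le_refl (L.pw SU SD SN (L.tt j)))).2.2 j hj rfl hs
      rw [g3, g1] at hw
      rw [g1, g2]
      exact key _ g hw
  have hOG : O ≤ G := fun u v huv => ((hO u v).mp huv).1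
  have hff : ∀ x : Fin n, f x = x := fun x => Fin.ext (hf x x.2)
  refine ⟨⟨hOG, fun u v => ?_⟩, fun H' hH => le_trans ?_ (hle H' hH)⟩
  · have h1 : Relation.ReflTransGen O.Adj (f u) (f 0) := (hS u (by omega)).2.lift f harc
    have h2 : Relation.ReflTransGen O.Adj (f 0) (f v) := (hS v (by omega)).1.lift f harc
    rw [hff] at h1 h2
    exact h1.trans h2
  -- `O` may contain more than the selected arcs, but each of its arcs is paid for by the power of
  -- its tail.
  · rw [cost, h.n_eq, Finset.sum_range]
    exact Finset.sum_le_sum fun u _ => Finset.sup_le fun v hv => ((hO u v).mp (by simpa using hv)).2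

theorem Desc.na_le (h : Desc G w inf m T H W Q nt term L) : L.na ≤ 2 * feedbackEdgeNumber G := by
  classical
  have hn := h.good.n_pos
  have hne := h.n_eq
  let f : ℕ → Fin n := fun x => ⟨x % n, Nat.mod_lt _ (by omega)⟩
  have hf : ∀ x, x < n → ((f x : Fin n) : ℕ) = x := fun x hx => Nat.mod_eq_of_lt hx
  have hpos : ∀ v : Fin n, v ≠ f 0 → 0 < (v : ℕ) := fun v hv => by
    refine Nat.pos_of_ne_zero fun e => hv (Fin.ext ?_)
    rw [hf 0 (by omega), e]
  have hpar : ∀ v : Fin n, v ≠ f 0 → ((f (L.par v) : Fin n) : ℕ) = L.par v := fun v hv =>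
    hf _ (h.tree.par_lt v (hpos v hv) v.2).1
  have := card_nontree_le (by omega) G (fun v => f (L.par v)) (fun v => L.rk v) (f 0) (fun v hv => ?_)
    (fun v hv => ?_) ((Finset.range L.na).image fun j => (f (T (nt j)), f (H (nt j)))) ?_
  · rwa [Finset.card_image_of_injOn, Finset.card_range] at this
    intro i hi j hj hij
    simp only [Finset.coe_range, Set.mem_Iio] at hi hj
    have gi := (h.cls.nt_spec i hi).1
    have gj := (h.cls.nt_spec j hj).1
    have li := h.inst.lt _ gi
    have lj := h.inst.lt _ gj
    have e1 := congrArg (fun p => (p.1 : ℕ)) hij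
    have e2 := congrArg (fun p => (p.2 : ℕ)) hij
    simp only [hf _ li.1, hf _ li.2, hf _ lj.1, hf _ lj.2] at e1 e2
    have e := h.inst.inj _ _ gi gj e1 e2
    rcases lt_trichotomy i j with r | r | r
    · exact absurd e (h.cls.nt_mono i j r hj).ne
    · exact r
    · exact absurd e (h.cls.nt_mono j i r hi).ne'
  · simp only [hpar v hv]
    exact (h.tree.par_lt v (hpos v hv) v.2).2.1
  · obtain ⟨-, -, a, ha, h1, h2⟩ := h.tree.par_lt v (hpos v hv) v.2
    exact (h.inst.adj a ha _ _ (h1.trans (hpar v hv).symm) h2).1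
  · intro p hp
    obtain ⟨j, hj, rfl⟩ := Finset.mem_image.mp hp
    obtain ⟨g, ⟨g1, g2, g3⟩, -⟩ := h.cls.nt_spec j (Finset.mem_range.mp hj)
    obtain ⟨l1, l2⟩ := h.inst.lt _ g
    refine ⟨(h.inst.adj _ g _ _ (hf _ l1).symm (hf _ l2).symm).1, fun e => g3 ?_, fun hr e => g2 ?_, fun hr e => g1 ?_⟩
    · have := congrArg Fin.val e
      simpa only [hf _ l1, hf _ l2] using this
    · have := congrArg Fin.val e
      have h3 := hpar _ hr
      simp only [hf _ l1, hf _ l2] at this h3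
      omega
    · have := congrArg Fin.val e
      have h3 := hpar _ hr
      simp only [hf _ l1, hf _ l2] at this h3
      omega

end

/-! ### The whole program -/

open Ex Cm in
/-- Solves the instance in the low part of the memory. -/
def solve : Cm :=
  set v_n (get a_in (lit 0)) ;; set v_m (get a_in (lit 1)) ;;
  -- Without vertices there is no root to start from, and nothing has to be done.
  ite (lit 0) (var v_n) (readArcs ;; front ;; back) skip

section
variable {B b n m : ℕ} {G : Digraph (Fin n)} {w : Fin n → Fin n → ℕ} {T H W T' H' W' : ℕ → ℕ} {s : St}

theorem Inst.congr (h : Inst G w m T H W) (e : ∀ i, i < m → T' i = T i ∧ H' i = H i ∧ W' i = W i) :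
    Inst G w m T' H' W' :=
  ⟨fun i hi => by rw [(e i hi).1, (e i hi).2.1]; exact h.lt i hi,
    fun i hi u v => by rw [(e i hi).1, (e i hi).2.1, (e i hi).2.2]; exact h.adj i hi u v,
    fun u v huv => by
      obtain ⟨i, hi, h1⟩ := h.surj u v huv
      exact ⟨i, hi, by rwa [(e i hi).1, (e i hi).2.1]⟩,
    fun i j hi hj => by
      rw [(e i hi).1, (e i hi).2.1, (e j hj).1, (e j hj).2.1]
      exact h.inj i j hi hj⟩

theorem Inst.reach (h : Inst G w m T H W) (hG : StronglyConnected G) (v : ℕ) (hv : v < n) :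
    Relation.ReflTransGen (ArcRel m T H) 0 v :=
  (hG ⟨0, by omega⟩ ⟨v, hv⟩).lift Fin.val h.surj

/-- The main part of the program. -/
theorem solveCore_spec {inf : ℕ} (hI : Inst G w m T H W) (hG : StronglyConnected G) (hn0 : 0 < n)
    (hf : s.Fits B) (hn : s.v v_n = n) (hm : s.v v_m = m) (hv : ∀ x, 2 ≤ x → s.v x = 0)
    (ha : ∀ j, 1 ≤ j → ∀ i, s.a j i = 0)
    (hT : ∀ i, T i = s.a a_in (2 + 3 * i)) (hH : ∀ i, H i = s.a a_in (3 + 3 * i))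
    (hW : ∀ i, W i = s.a a_in (4 + 3 * i)) (hinf : inf = (∑ i ∈ Finset.range m, W i) + 1)
    (hb : 3 * m + 4 < b) (hbB : b ≤ B) (hB : 8 * n + 2 * m + 8 ≤ B) (hB' : n * inf ≤ B)
    (hB2 : 2 * inf + 1 ≤ B) :
    Tr B b (readArcs ;; front ;; back) s (455 * (n + m) + 126 +
      6 ^ (10 * feedbackEdgeNumber G) *
        (300 * ((10 * feedbackEdgeNumber G + 1) * (10 * feedbackEdgeNumber G + 1)))) fun s' =>
      ∀ O : Digraph (Fin n), (∀ u v : Fin n, O.Adj u v ↔ ∃ i, i < m ∧ T i = u ∧ H i = v ∧ s'.a a_in i = 1) →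
        IsOptimalSolution G w O := by
  have hsW : ∑ i ∈ Finset.range m, s.a a_in (4 + 3 * i) + 1 = inf := by
    rw [hinf]; congr 1; exact Finset.sum_congr rfl fun i _ => (hW i).symm
  refine ((readArcs_spec (b := b) (B := B) hm (hv _ (by omega)) (ha _ (by omega)) hb hbB (by omega)).seq
    (T' := 445 * (n + m) + 116 + 6 ^ (10 * feedbackEdgeNumber G) *
        (300 * ((10 * feedbackEdgeNumber G + 1) * (10 * feedbackEdgeNumber G + 1)))) fun s1 f1 ⟨g1, g2, g3, g4⟩ =>
    ?_).mono (by linarith) fun _ _ => id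
  rw [hsW] at g2
  have hI1 : Inst G w m (s1.a a_T) (s1.a a_H) (s1.a a_W) := hI.congr fun i hi => by
    rw [hT, hH, hW]; exact g1 i hi
  have hWinf : ∀ i, i < m → s1.a a_W i ≤ inf := fun i hi => by
    rw [(g1 i hi).2.2, ← hW, hinf]
    exact (Finset.single_le_sum (f := W) (fun _ _ => Nat.zero_le _) (Finset.mem_range.mpr hi)).trans (Nat.le_succ _)
  have hv1 : ∀ x, 4 ≤ x → s1.v x = 0 := fun x hx => by
    obtain ⟨y, rfl⟩ := Nat.exists_eq_add_of_le' hx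
    rw [f1.1 (y + 4) rfl]
    exact hv _ (by omega)
  have ha1 : ∀ j, 7 ≤ j → ∀ i, s1.a j i = 0 := fun j hj i => by
    obtain ⟨l, rfl⟩ := Nat.exists_eq_add_of_le' hj
    rw [f1.2 (l + 7) rfl]
    exact ha _ (by omega) i
  refine ((front_spec (b := b) (B := B) hn0 ((f1.1 _ rfl).trans hn) ((f1.1 _ rfl).trans hm) hv1 ha1 rfl rfl rfl
    hI1.lt (fun i hi => (hWinf i hi).trans (by omega)) (by omega) g3 g4 (by omega) (hI1.reach hG)
    fun i j hij hj e1 e2 => hij.ne (hI1.inj i j (hij.trans hj) hj e1 e2)).seq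
    (T' := 383 * (n + m) + 86 + 6 ^ (10 * feedbackEdgeNumber G) *
        (300 * ((10 * feedbackEdgeNumber G + 1) * (10 * feedbackEdgeNumber G + 1)))) fun s2 f2 h2 =>
    ?_).mono (by linarith) fun _ _ => id
  obtain ⟨Q, hQ⟩ := h2.tree
  obtain ⟨nt, term, hc⟩ := h2.cls
  rw [g2] at hc
  have hD : Desc G w inf m (s1.a a_T) (s1.a a_H) (s1.a a_W) Q nt term s2.lay :=
    ⟨hI1, h2.n_eq, hQ, hc, h2.good⟩
  have hne : s2.lay.n = n := h2.n_eq
  have hinf1 : inf = (∑ i ∈ Finset.range m, s1.a a_W i) + 1 := by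
    rw [← hsW]; congr 1
    exact Finset.sum_congr rfl fun i hi => (g1 i (Finset.mem_range.mp hi)).2.2.symm
  have hT2 : s2.a a_T = s1.a a_T := f2.2 _ rfl
  have hW2 : s2.a a_W = s1.a a_W := f2.2 _ rfl
  have hna : s2.lay.na ≤ m := hc.na_le
  refine (back_spec (b := b) (B := B) (m := m) (q := 2 * feedbackEdgeNumber G) (M := inf) (f2.3 (f1.3 hf)) rfl h2.good
    h2.listed (fun j hj => by rw [hne]; exact h2.slots j hj) h2.K_eq ((f2.1 _ rfl).trans ((f1.1 _ rfl).trans hm))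
    h2.le_one ((f2.1 _ rfl).trans (hv1 _ (by omega))) ((f2.1 _ rfl).trans (hv1 _ (by omega))) ?_ ?_ (by omega)
    (by omega) (fun SU SD SN u hu => hD.pw_le hWinf SU SD SN hu) (by rwa [hne]) hB2 hna hD.na_le
    ⟨_, _, _, hD.strong ⟨le_rfl, hG⟩⟩).mono ?_ ?_
  · rintro j (rfl | rfl | rfl) x
    · rw [f2.2 _ rfl]; exact ha1 _ (by omega) x
    · rw [f2.2 _ rfl]; exact ha1 _ (by omega) x
    · rw [f2.2 _ rfl]; exact ha1 _ (by omega) x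
  · rw [hT2, hne]
    exact fun i hi => (hI1.lt i hi).1
  · rw [hne, show 5 * (2 * feedbackEdgeNumber G) = 10 * feedbackEdgeNumber G by ring]
  · rintro s3 - ⟨mid, D, q1, q2, q3⟩ O hO
    refine hD.isOptimal hG hinf1 (h2.good.strong_of_bstrong q1) q2 fun u v => (hO u v).trans ?_
    constructor
    · rintro ⟨i, hi, e1, e2, e3⟩
      obtain ⟨r1, r2⟩ := hI.adj i hi u v e1 e2
      rw [q3 i hi, hT2, hW2, (g1 i hi).1, (g1 i hi).2.2, ← hT, ← hW, r2, e1] at e3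
      exact ⟨r1, e3⟩
    · rintro ⟨huv, hle⟩
      obtain ⟨i, hi, e1, e2⟩ := hI.surj u v huv
      obtain ⟨r1, r2⟩ := hI.adj i hi u v e1 e2
      refine ⟨i, hi, e1, e2, ?_⟩
      rwa [q3 i hi, hT2, hW2, (g1 i hi).1, (g1 i hi).2.2, ← hT, ← hW, r2, e1]

end

/-! ### The input -/

theorem flatMap_triple_getD {α : Type*} (f g h : α → ℕ) (l : List α) (i : ℕ) (hi : i < l.length) :
    (l.flatMap fun e => [f e, g e, h e]).getD (3 * i) 0 = f l[i] ∧
    (l.flatMap fun e => [f e, g e, h e]).getD (3 * i + 1) 0 = g l[i] ∧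
    (l.flatMap fun e => [f e, g e, h e]).getD (3 * i + 2) 0 = h l[i] := by
  induction l generalizing i with
  | nil => simp at hi
  | cons e l ih =>
    cases i with
    | zero => simp
    | succ i =>
      have := ih i (by simpa using hi)
      simpa [Nat.mul_succ] using this

theorem flatMap_triple_length {α : Type*} (f g h : α → ℕ) (l : List α) :
    (l.flatMap fun e => [f e, g e, h e]).length = 3 * l.length := by
  induction l with
  | nil => rfl
  | cons e l ih => simp [ih]; omega

theorem getD_le {l : List ℕ} {N : ℕ} (h : ∀ x ∈ l, x ≤ N) (a : ℕ) : l.getD a 0 ≤ N := by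
  rw [List.getD_eq_getElem?_getD]
  rcases hx : l[a]? with _ | x
  · simp
  · exact h x (List.mem_of_getElem? hx)

section
variable {n : ℕ} {w : Fin n → Fin n → ℕ} {L : List (Fin n × Fin n)}

theorem inputState_arc (i : ℕ) (hi : i < L.length) : (inputState w L).mem (2 + 3 * i) = L[i].1 ∧
    (inputState w L).mem (3 + 3 * i) = L[i].2 ∧ (inputState w L).mem (4 + 3 * i) = w L[i].1 L[i].2 := by
  have := flatMap_triple_getD (fun e : Fin n × Fin n => (e.1 : ℕ)) (fun e => (e.2 : ℕ)) (fun e => w e.1 e.2) L i hi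
  have e1 : 2 + 3 * i = 3 * i + 1 + 1 := by omega
  have e2 : 3 + 3 * i = 3 * i + 1 + 1 + 1 := by omega
  have e3 : 4 + 3 * i = 3 * i + 2 + 1 + 1 := by omega
  rw [e1, e2, e3]
  simpa only [inputState, List.getD_cons_succ] using this

theorem inputState_mem_eq_zero {a : ℕ} (ha : 3 * L.length + 2 ≤ a) : (inputState w L).mem a = 0 := by
  refine List.getD_eq_default _ _ ?_
  simp only [List.length_cons, flatMap_triple_length]
  omega

theorem le_maxWeight {e : Fin n × Fin n} (he : e ∈ L) : w e.1 e.2 ≤ maxWeight w L :=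
  Finset.le_sup (f := fun e : Fin n × Fin n => w e.1 e.2) (List.mem_toFinset.mpr he)

theorem inputState_mem_le (a : ℕ) : (inputState w L).mem a ≤ n + L.length + maxWeight w L := by
  refine getD_le (fun x hx => ?_) a
  simp only [List.mem_cons, List.mem_flatMap, List.not_mem_nil, or_false] at hx
  rcases hx with rfl | rfl | ⟨e, he, rfl | rfl | rfl⟩
  · omega
  · omega
  · have := e.1.2; omega
  · have := e.2.2; omega
  · have := le_maxWeight (w := w) he; omega

theorem IsArcList.inst {G : Digraph (Fin n)} (h : IsArcList G L) : Inst G w L.length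
    (fun i => (inputState w L).mem (2 + 3 * i)) (fun i => (inputState w L).mem (3 + 3 * i))
    (fun i => (inputState w L).mem (4 + 3 * i)) := by
  refine ⟨fun i hi => ?_, fun i hi u v e1 e2 => ?_, fun u v huv => ?_, fun i j hi hj e1 e2 => ?_⟩
  · obtain ⟨h1, h2, -⟩ := inputState_arc (w := w) i hi
    simp only [h1, h2]
    exact ⟨L[i].1.2, L[i].2.2⟩
  · obtain ⟨h1, h2, h3⟩ := inputState_arc (w := w) i hi
    obtain rfl : L[i].1 = u := Fin.ext (h1.symm.trans e1)
    obtain rfl : L[i].2 = v := Fin.ext (h2.symm.trans e2)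
    exact ⟨(h.2 _).mp (List.getElem_mem hi), h3⟩
  · obtain ⟨i, hi, e⟩ := List.mem_iff_getElem.mp ((h.2 (u, v)).mpr huv)
    obtain ⟨h1, h2, -⟩ := inputState_arc (w := w) i hi
    refine ⟨i, hi, ?_, ?_⟩
    · simp only [h1, e]
    · simp only [h2, e]
  · obtain ⟨h1, h2, -⟩ := inputState_arc (w := w) i hi
    obtain ⟨h3, h4, -⟩ := inputState_arc (w := w) j hj
    simp only [h1, h2, h3, h4] at e1 e2
    exact (h.1.getElem_inj_iff).mp (Prod.ext (Fin.ext e1) (Fin.ext e2))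

/-- The initial state of the language with arrays. -/
def inputSt (w : Fin n → Fin n → ℕ) (L : List (Fin n × Fin n)) : St where
  v := fun _ => 0
  a := fun j i => if j = 0 then (inputState w L).mem i else 0

/-- Computes the base address of the arrays. -/
def prelude : Prog :=
  .seq (.instr (.const 2 1)) <| .seq (.instr (.load 2 2)) <| .seq (.instr (.add 4 2 2)) <|
  .seq (.instr (.add 4 4 2)) <| .seq (.instr (.const 2 5)) <| .instr (.add 0 4 2)

theorem fits_run {N : ℕ} {σ : State} (h : σ.Fits N) (x k : ℕ) (hk : k ≤ N) (i : Instr)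
    (hi : i.run σ = { σ with reg := Function.update σ.reg x k }) :
    Exec N (.instr i) σ 1 { σ with reg := Function.update σ.reg x k } := by
  have := Exec.instr (B := N) i σ (by rw [hi]; exact fits_update_reg h x k hk)
  rwa [hi] at this

/-- The input ends before cell `3 * L.length + 2`, so the memory from the base address on is zero,
as the initial values of all other arrays require. -/
theorem prelude_spec {B b : ℕ} (hb : b = 3 * L.length + 5) (hB : b ≤ B)
    (hB' : n + L.length + maxWeight w L ≤ B) :
    ∃ σ, Exec (b + stride * B + stride) prelude (inputState w L) 6 σ ∧ Rep B b (inputSt w L) σ := by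
  set N := b + stride * B + stride with hN
  have hNB : b + B ≤ N := by unfold stride at hN; omega
  set m := L.length with hm
  set σ0 := inputState w L with hσ0
  have f0 : σ0.Fits N := ⟨fun x => Nat.zero_le _, fun a => (inputState_mem_le a).trans (by omega)⟩
  have hm1 : σ0.mem 1 = m := rfl
  have hr : ∀ x, σ0.reg x = 0 := fun x => rfl
  have e1 := fits_run f0 2 1 (by omega) (.const 2 1) rfl
  have f1 := fits_update_reg f0 2 1 (by omega)
  have e2 := fits_run f1 2 m (by omega) (.load 2 2) (by simp [Instr.run, hm1])
  have f2 := fits_update_reg f1 2 m (by omega)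
  have e3 := fits_run f2 4 (m + m) (by omega) (.add 4 2 2) (by simp [Instr.run])
  have f3 := fits_update_reg f2 4 (m + m) (by omega)
  have e4 := fits_run f3 4 (m + m + m) (by omega) (.add 4 4 2) (by simp [Instr.run])
  have f4 := fits_update_reg f3 4 (m + m + m) (by omega)
  have e5 := fits_run f4 2 5 (by omega) (.const 2 5) (by simp [Instr.run])
  have f5 := fits_update_reg f4 2 5 (by omega)
  have e6 := fits_run f5 0 (m + m + m + 5) (by omega) (.add 0 4 2) (by simp [Instr.run])
  have f6 := fits_update_reg f5 0 (m + m + m + 5) (by omega)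
  refine ⟨_, .seq e1 (.seq e2 (.seq e3 (.seq e4 (.seq e5 e6)))), ?_, fun x => ?_, fun j i hj hi => ?_, f6⟩
  · simp; omega
  · have h0 : 2 * x + 1 ≠ 0 := by omega
    have h2 : 2 * x + 1 ≠ 2 := by omega
    have h4 : 2 * x + 1 ≠ 4 := by omega
    simp [h2, h4, hr, inputSt]
  · simp only [inputSt, addr]
    split_ifs
    · rfl
    · exact inputState_mem_eq_zero (by omega)

end

/-! ### The run on the machine, its time and its word size -/

theorem solve_exec {n : ℕ} {G : Digraph (Fin n)} {w : Fin n → Fin n → ℕ} {L : List (Fin n × Fin n)}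
    (hG : StronglyConnected G) (hL : IsArcList G L) {B b : ℕ} (hb : b = 3 * L.length + 5) (hbB : b ≤ B)
    (hB : 8 * (n + L.length + maxWeight w L + 1) ^ 3 ≤ B) : ∃ t s,
      Exec (b + stride * B + stride) (.seq prelude solve.comp) (inputState w L) t s ∧
      t ≤ 6 + solve.wt * (455 * (n + L.length) + 129 + 6 ^ (10 * feedbackEdgeNumber G) *
        (300 * ((10 * feedbackEdgeNumber G + 1) * (10 * feedbackEdgeNumber G + 1)))) ∧
      IsOptimalSolution G w (outputGraph L s) := by
  set N := n + L.length + maxWeight w L + 1 with hN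
  have hN3 : N ≤ N ^ 3 := Nat.le_self_pow (by omega) _
  have hN2 : N * N ≤ N ^ 3 := by
    rw [← sq]; exact Nat.pow_le_pow_right (by omega) (by omega)
  have hfit : (inputSt w L).Fits B := ⟨fun _ => Nat.zero_le _, fun j i => by
    simp only [inputSt]
    split_ifs
    · have := inputState_mem_le (w := w) (L := L) i
      omega
    · exact Nat.zero_le _⟩
  obtain ⟨σ, hσ, hrep⟩ := prelude_spec (w := w) hb hbB (by omega)
  obtain ⟨t, s, hr, ht, hq⟩ : Tr B b solve (inputSt w L) (455 * (n + L.length) + 129 +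
      6 ^ (10 * feedbackEdgeNumber G) *
        (300 * ((10 * feedbackEdgeNumber G + 1) * (10 * feedbackEdgeNumber G + 1))))
      fun s' => 0 < n → ∀ O : Digraph (Fin n), (∀ u v : Fin n, O.Adj u v ↔ ∃ i, i < L.length ∧
        (inputState w L).mem (2 + 3 * i) = u ∧ (inputState w L).mem (3 + 3 * i) = v ∧ s'.a a_in i = 1) →
        IsOptimalSolution G w O := by
    set S := 6 ^ (10 * feedbackEdgeNumber G) *
        (300 * ((10 * feedbackEdgeNumber G + 1) * (10 * feedbackEdgeNumber G + 1))) with hS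
    refine Tr.wp_seq (T := 455 * (n + L.length) + 128 + S) ?_ (by simp [Cm.sz]; omega)
    refine ⟨?_, ?_⟩
    · simp; omega
    refine Tr.wp_seq (T := 455 * (n + L.length) + 127 + S) ?_ (by simp [Cm.sz]; omega)
    refine ⟨?_, ?_⟩
    · simp; omega
    have hn' : (inputState w L).mem 0 = n := rfl
    have hm' : (inputState w L).mem 1 = L.length := rfl
    refine (Tr.ite (T := 455 * (n + L.length) + 126 + S) (by simp) (by simp) (fun h0 => ?_) (fun h0 => ?_)).mono
      (by omega) fun _ _ => id
    · have hn0 : 0 < n := by simpa [inputSt, hn'] using h0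
      have hsum : ∑ i ∈ Finset.range L.length, (inputState w L).mem (4 + 3 * i) ≤ L.length * maxWeight w L := by
        refine (Finset.sum_le_card_nsmul _ _ (maxWeight w L) fun i hi => ?_).trans (by simp)
        have hi' := Finset.mem_range.mp hi
        rw [(inputState_arc i hi').2.2]
        exact le_maxWeight (List.getElem_mem hi')
      have hinf : (∑ i ∈ Finset.range L.length, (inputState w L).mem (4 + 3 * i)) + 1 ≤ N * N := by
        have : L.length * maxWeight w L + 1 ≤ N * N := by
          rw [hN]; nlinarith
        omega
      refine (solveCore_spec (b := b) (B := B) (hL.inst (w := w)) hG hn0 ?_ ?_ ?_ ?_ ?_ ?_ ?_ ?_ rfl (by omega) hbB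
        (by omega) ?_ (by omega)).mono le_rfl fun s' _ h _ => h
      · exact (hfit.set _ _ (by simp [inputSt, hn']; omega)).set _ _ (by simp [inputSt, hm']; omega)
      · simp [inputSt, hn']
      · simp [inputSt, hm']
      · intro x hx
        have h1 : x ≠ 0 := by omega
        have h2 : x ≠ 1 := by omega
        simp [inputSt, h1, h2]
      · intro j hj i
        have h1 : j ≠ 0 := by omega
        simp [inputSt, h1]
      · intro i; simp [inputSt]
      · intro i; simp [inputSt]
      · intro i; simp [inputSt]
      -- The substitute weight is at most `N * N`, and a total cost adds up `n` such numbers; this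
      -- is why the bound on the words is cubic.
      · calc n * _ ≤ N * (N * N) := Nat.mul_le_mul (by omega) hinf
          _ = N ^ 3 := by ring
          _ ≤ B := by omega
    · have hn0 : n = 0 := by simpa [inputSt, hn'] using h0
      exact ⟨_, _, .skip _, by omega, fun h => absurd h (by omega)⟩
  obtain ⟨t', σ', hE, ht', hrep'⟩ := hr.comp hfit rfl σ hrep
  refine ⟨_, σ', .seq hσ hE, ?_, ?_⟩
  · have := Nat.mul_le_mul_left solve.wt ht
    omega
  · rcases Nat.eq_zero_or_pos n with rfl | hn0
    · refine ⟨⟨fun u => u.elim0, fun u => u.elim0⟩, fun H' _ => ?_⟩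
      simp [cost]
    · refine hq hn0 _ fun u v => ?_
      simp only [outputGraph]
      constructor
      · rintro ⟨i, h1, h2⟩
        obtain ⟨hi, he⟩ := List.getElem?_eq_some_iff.mp h1
        obtain ⟨g1, g2, -⟩ := inputState_arc (w := w) i hi
        refine ⟨i, hi, by rw [g1, he], by rw [g2, he], ?_⟩
        rw [← hrep'.arr 0 i (by norm_num) (by omega)]
        exact h2
      · rintro ⟨i, hi, h1, h2, h3⟩
        obtain ⟨g1, g2, -⟩ := inputState_arc (w := w) i hi
        refine ⟨i, List.getElem?_eq_some_iff.mpr ⟨hi, Prod.ext (Fin.ext (g1.symm.trans h1))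
          (Fin.ext (g2.symm.trans h2))⟩, ?_⟩
        rw [← hrep'.arr 0 i (by norm_num) (by omega)] at h3
        exact h3

theorem Exec.mono {B B' : ℕ} (h : B ≤ B') {p : Prog} {s s' : State} {t : ℕ} (he : Exec B p s t s') :
    Exec B' p s t s' := by
  induction he with
  | instr i s hf => exact .instr i s ⟨fun x => (hf.1 x).trans h, fun a => (hf.2 a).trans h⟩
  | seq _ _ ih ih' => exact .seq ih ih'
  | ite_true hlt _ ih => exact .ite_true hlt ih
  | ite_false hlt _ ih => exact .ite_false hlt ih
  | while_true hlt _ _ ih ih' => exact .while_true hlt ih ih'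
  | while_false hlt => exact .while_false hlt

/-- From `6 ≤ 2 ^ 3`; each linear factor is absorbed by a further `2 ^ (10 * g)`. -/
theorem search_time_le (g : ℕ) : 6 ^ (10 * g) * (300 * ((10 * g + 1) * (10 * g + 1))) ≤ 300 * 2 ^ (50 * g) := by
  have h1 : 6 ^ (10 * g) ≤ 2 ^ (30 * g) := by
    rw [show 30 * g = 3 * (10 * g) by ring, pow_mul 2 3]
    exact Nat.pow_le_pow_left (by omega) _
  have h2 : 10 * g + 1 ≤ 2 ^ (10 * g) := Nat.lt_two_pow_self
  calc 6 ^ (10 * g) * (300 * ((10 * g + 1) * (10 * g + 1)))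
    _ ≤ 2 ^ (30 * g) * (300 * (2 ^ (10 * g) * 2 ^ (10 * g))) := by gcongr
    _ = 300 * 2 ^ (50 * g) := by
      rw [mul_left_comm, ← pow_add, ← pow_add, show 30 * g + (10 * g + 10 * g) = 50 * g by ring]

end MinPAC

theorem mainTheorem8 :
    ∃ (p : MinPAC.Prog) (c : ℕ),
      ∀ (n : ℕ) (G : Digraph (Fin n)) (w : Fin n → Fin n → ℕ) (L : List (Fin n × Fin n)),
        MinPAC.StronglyConnected G → MinPAC.IsArcList G L →
          ∃ (t : ℕ) (s : MinPAC.State),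
            MinPAC.Exec (c * (n + L.length + MinPAC.maxWeight w L + 1) ^ c) p
              (MinPAC.inputState w L) t s ∧
            t ≤ c * (2 ^ (c * MinPAC.feedbackEdgeNumber G) + n + L.length) ∧
            MinPAC.IsOptimalSolution G w (MinPAC.outputGraph L s) := by
  -- The factor `455` covers the linear part of the time as well as `129 + 300` times the power of
  -- two. The summand `700` covers the word bound `b + 64 * B + 64` with `b = 3 * L.length + 5` and
  -- `B = 8 * N ^ 3`, and makes the exponent `c` larger than `50`.
  refine ⟨.seq MinPAC.prelude MinPAC.solve.comp, 455 * MinPAC.solve.wt + 700, fun n G w L hG hL => ?_⟩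
  set c := 455 * MinPAC.solve.wt + 700 with hc
  set N := n + L.length + MinPAC.maxWeight w L + 1 with hN
  set g := MinPAC.feedbackEdgeNumber G with hg
  have hN3 : N ≤ N ^ 3 := Nat.le_self_pow (by omega) _
  obtain ⟨t, s, h1, h2, h3⟩ := MinPAC.solve_exec (w := w) hG hL (B := 8 * N ^ 3) rfl (by omega) le_rfl
  refine ⟨t, s, MinPAC.Exec.mono ?_ h1, h2.trans ?_, h3⟩
  · have : N ^ 3 ≤ N ^ c := Nat.pow_le_pow_right (by omega) (by omega)
    calc _ ≤ 700 * N ^ 3 := by unfold MinPAC.stride; omega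
      _ ≤ c * N ^ c := Nat.mul_le_mul (by omega) this
  · have e1 := MinPAC.search_time_le g
    have e2 : 2 ^ (50 * g) ≤ 2 ^ (c * g) :=
      Nat.pow_le_pow_right (by norm_num) (Nat.mul_le_mul_right _ (by omega))
    have e3 : 1 ≤ 2 ^ (c * g) := Nat.one_le_two_pow
    set X := 2 ^ (c * g)
    have e4 : 455 * (n + L.length) + 129 + 6 ^ (10 * g) * (300 * ((10 * g + 1) * (10 * g + 1))) ≤
        455 * (X + n + L.length) := by linarith
    calc _ ≤ 6 + MinPAC.solve.wt * (455 * (X + n + L.length)) := by gcongr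
      _ ≤ c * (X + n + L.length) := by rw [hc]; nlinarith
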